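/- Let $\mathbb F$ be a field of characteristic $0$, let $A$ be a Lie conformal algebra over $\mathbb F$ with $\lambda$-bracket $[a_\lambda b]$, and let $M$ be an $A$-module with $\lambda$-action $a_\lambda m$, endowed with a commutative associative product such that $\partial=\partial^M$ and all $a_\lambda$ ($a\in A$) are derivations of the product. Write $\int m$ for the class of $m$ in $M/\partial M$. **$\mathfrak g$-complexes.** For a Lie algebra $\mathfrak g$ let $\hat{\mathfrak g}=\eta\mathfrak g\oplus\mathfrak g\oplus\mathbb F\partial_\eta$ be the associated $\mathbb Z$-graded Lie superalgebra ($\eta$ odd, $\eta^2=0$; degrees $-1,0,1$). A $\mathfrak g$-complex is a graded space $B^\bullet=\bigoplus_{k\ge0}B^k$ with a differential $d$ and a grading preserving Lie superalgebra homomorphism $\varphi:\hat{\mathfrak g}\to\operatorname{End}B^\bullet$ with $\varphi(\partial_\eta)=d$; put $\iota_X=\varphi(\eta X)$ and $L_X=\varphi(X)=[d,\iota_X]$. A morphism from a $\mathfrak g$-complex $B^\bullet$ to an $\mathfrak h$-complex $B'^\bullet$ is a Lie algebra homomorphism $\pi:\mathfrak g\to\mathfrak h$ and a grading preserving linear map $\rho:B^\bullet\to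 B'^\bullet$ with $\rho(\varphi(g)b)=\varphi'(\pi(g))\rho(b)$ for $g\in\hat{\mathfrak g}$; it is an isomorphism if $\pi$ and $\rho$ are bijective. **Cochains.** $\tilde\Gamma^k$ is the space of linear maps $\tilde\gamma:A^{\otimes k}\to\mathbb F[\lambda_1,\dots,\lambda_k]\otimes M$ such that $\tilde\gamma_{\lambda_1,\dots,\lambda_k}(\dots,\partial a_i,\dots)=-\lambda_i\tilde\gamma_{\lambda_1,\dots,\lambda_k}(a_1,\dots,a_k)$ and $\tilde\gamma$ is skew-symmetric under simultaneous permutations of the $a_i$ and the $\lambda_i$; so $\tilde\Gamma^0=M$. Its differential is $$(\delta\tilde\gamma)_{\lambda_1,\dots,\lambda_{k+1}}(a_1,\dots,a_{k+1})=\sum_i(-1)^{i+1}{a_i}_{\lambda_i}\tilde\gamma_{\dots\hat{\lambda}_i\dots}(\dots\hat a_i\dots)+\sum_{i<j}(-1)^{k+i+j+1}\tilde\gamma_{\dots\hat{\lambda}_i\dots\hat{\lambda}_j\dots,\lambda_i+\lambda_j}(\dots\hat a_i\dots\hat a_j\dots,[{a_i}_{\lambda_i}a_j]).$$ Put $\Gamma^k=\tilde\Gamma^k/\partial\tilde\Gamma^k$,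 where $\partial\tilde\gamma=(\partial^M+\lambda_1+\dots+\lambda_k)\tilde\gamma$, with the induced differential. Put $C^0=M/\partial M$, and for $k\ge1$ let $C^k$ be the space of linear maps $c:A^{\otimes k}\to\mathbb F[\lambda_1,\dots,\lambda_{k-1}]\otimes M$, written $\{{a_1}_{\lambda_1}\cdots{a_{k-1}}_{\lambda_{k-1}}a_k\}_c$, on which replacing $a_i$ by $\partial a_i$ amounts to multiplication by $-\lambda_i$ if $i<k$ and by $\lambda_1+\dots+\lambda_{k-1}+\partial^M$ if $i=k$, and with $\{{a_1}_{\lambda_1}\cdots a_k\}_c=\operatorname{sign}(\sigma)\{{a_{\sigma(1)}}_{\lambda_{\sigma(1)}}\cdots a_{\sigma(k)}\}_c\big|_{\lambda_k\mapsto\lambda_k^\dagger}$ for all $\sigma\in S_k$, where $\lambda_k^\dagger=-\lambda_1-\dots-\lambda_{k-1}-\partial^M$ and $\partial^M$ is moved to the left. The differential of $C^\bullet$ is $(d\int m)(a)=a_{-\partial^M}m$ and, for $c\in C^k$, $k\ge1$, $$\{{a_1}_{\lambda_1}\cdots{a_k}_{\lambda_k}a_{k+1}\}_{dc}=\Big(\sum_{i=1}^{k+1}(-1)^{i+1}{a_i}_{\lambda_i}\{{a_1}_{\lambda_1}\cdots\hat{a}_i\cdots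 a_{k+1}\}_c+\sum_{1\le i<j\le k+1}(-1)^{k+i+j+1}\{{a_1}_{\lambda_1}\cdots\hat{a}_i\cdots\hat{a}_j\cdots{a_{k+1}}_{\lambda_{k+1}}[{a_i}_{\lambda_i}a_j]\}_c\Big)\Big|_{\lambda_{k+1}\mapsto\lambda_{k+1}^\dagger}.$$ $\bar C^0=C^0$, and $\bar C^k\subset C^k$ ($k\ge1$) consists of the $c$ that vanish if some $a_i$ is a torsion element of the $\mathbb F[\partial]$-module $A$. **$1$-chains.** $\tilde\Gamma_1$ is the quotient of $A\otimes\operatorname{Hom}(\mathbb F[\lambda],M)$ by the span of the elements $\partial a\otimes\phi+a\otimes\lambda^*\phi$, where $(\lambda^*\phi)(f)=\phi(\lambda f)$; $\partial$ acts on $\tilde\Gamma_1$ by $\partial\otimes1+1\otimes\partial$, and $\Gamma_1=\ker\partial\subset\tilde\Gamma_1$. Put $C_1=(A\otimes M)/\partial(A\otimes M)$ and $\bar C_1=(\bar A\otimes M)/\partial(\bar A\otimes M)$, where $\bar A=A/\operatorname{Tor}A$. For $\phi\in\operatorname{Hom}(\mathbb F[\lambda],M)$ let $\langle\phi,f\otimes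 m\rangle=\phi(f)m$, for $m\in M$ let $e_m(f)=f(\partial)m$, and let $(\phi\cdot\psi)(\lambda^N)=\sum_j\binom Nj\phi(\lambda^j)\psi(\lambda^{N-j})$. The brackets are, with $[a_\lambda b]=\sum_j\lambda^jc_j$, $$[a\otimes\phi,b\otimes\psi]=\sum_jc_j\otimes(({\lambda^*}^j\phi)\cdot\psi)-a\otimes\langle\psi,b_\lambda\phi(\cdot)\rangle+b\otimes\langle\phi,a_\lambda\psi(\cdot)\rangle\ \text{ on }\tilde\Gamma_1,$$ $$[a\otimes m,b\otimes n]=\sum_jc_j\otimes(\partial^jm)n+b\otimes\langle e_m,a_\lambda n\rangle-a\otimes\langle e_n,b_\lambda m\rangle\ \text{ on }C_1.$$ The contraction of $\tilde\gamma\in\tilde\Gamma^k$, $k\ge1$, by the class of $a_1\otimes\phi$ is $(\iota\tilde\gamma)_{\lambda_2,\dots,\lambda_k}(a_2,\dots,a_k)=\langle\phi,\tilde\gamma_{\lambda_1,\dots,\lambda_k}(a_1,\dots,a_k)\rangle$ (pairing in $\lambda_1$). The contraction of $c\in C^k$ by the class of $a_1\otimes m$ is $\int m\,c(a_1)$ if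 $k=1$, and $\{{a_2}_{\lambda_2}\cdots a_k\}_{\iota c}=\langle e_m,\{{a_1}_{\lambda_1}\cdots a_k\}_c\rangle$ (pairing in $\lambda_1$) if $k\ge2$. Contractions are $0$ in degree $0$. The map $\psi^\bullet:\Gamma^\bullet\to\bar C^\bullet$ is the identity of $M/\partial M$ in degree $0$ and, for $k\ge1$, maps the class of $\tilde\gamma$ to $\{{a_1}_{\lambda_1}\cdots a_k\}_{\psi^k(\tilde\gamma)}=\tilde\gamma_{\lambda_1,\dots,\lambda_{k-1},\lambda_k^\dagger}(a_1,\dots,a_k)$ ($\partial^M$ moved to the left). The map $\chi_1:C_1\to\Gamma_1$ maps the class of $a\otimes m$ to the class of $a\otimes e_m$. **Theorem.** All the above brackets, differentials, contractions and maps are well defined. The brackets make $\Pi\tilde\Gamma_1$ and $\Pi C_1$ Lie algebras, $\Pi\Gamma_1\subset\Pi\tilde\Gamma_1$ is a subalgebra, and the bracket of $\Pi C_1$ descends to $\Pi\bar C_1$ ($\Pi$ denotes reversal of parity). The differentials and contractions make $\tilde\Gamma^\bullet$ a $\Pi\tilde\Gamma_1$-complex, $\Gamma^\bullet$ the induced $\Pi\Gamma_1$-complex,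 and $C^\bullet$ a $\Pi C_1$-complex, with subcomplex $\bar C^\bullet$ on which $\Pi C_1$ acts through $\Pi\bar C_1$. (1) $\chi_1:\Pi C_1\to\Pi\Gamma_1$ is a Lie algebra homomorphism, which factors through a map $\bar\chi_1:\bar C_1\to\Gamma_1$, and $\psi^\bullet:\Gamma^\bullet\to\bar C^\bullet\subset C^\bullet$ is a morphism of $\Pi C_1$-complexes (over the identity of $\Pi C_1$), where $\Pi C_1$ acts on $\Gamma^\bullet$ through $\chi_1$. (2) If $A$ is, as an $\mathbb F[\partial]$-module, the direct sum of its torsion and a free submodule, then $\bar\chi_1$ and $\psi^\bullet$ are bijective, and $(\bar\chi_1^{-1},\psi^\bullet)$ is an isomorphism from the $\Pi\Gamma_1$-complex $\Gamma^\bullet$ to the $\Pi\bar C_1$-complex $\bar C^\bullet$. -/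

import Mathlib

open scoped TensorProduct DirectSum Polynomial

noncomputable section

namespace LieConf

universe u v w

/-! ### Polynomials in `λ₁, …, λₖ` with coefficients in a module over `F[∂]`

An `F[∂]`-module is a `Module F[X]`, and `∂` is the action of `X`. -/

section Poly

variable (F : Type u) [Field F]

/-- The space `F[λ₁, …, λₖ] ⊗ N`. -/
abbrev P (k : ℕ) (N : Type v) [AddCommGroup N] [Module F N] : Type (max u v) :=
  MvPolynomial (Fin k) F ⊗[F] N

instance (k : ℕ) (N : Type v) [AddCommGroup N] [Module F N] : AddCommGroup (P F k N) :=
  TensorProduct.addCommGroup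

/-- The commutative algebra `F[λ₁, …, λₖ] ⊗ F[∂] = F[λ₁, …, λₖ, ∂]`. -/
abbrev DPoly (k : ℕ) : Type u := MvPolynomial (Fin k) F ⊗[F] F[X]

/-- `λᵢ` as an element of `F[λ₁, …, λₖ, ∂]`. -/
def lam {k : ℕ} (i : Fin k) : DPoly F k := MvPolynomial.X i ⊗ₜ[F] 1

/-- `∂` as an element of `F[λ₁, …, λₖ, ∂]`. -/
def del (k : ℕ) : DPoly F k := 1 ⊗ₜ[F] Polynomial.X

/-- `λ† = -λ₁ - ⋯ - λₖ - ∂` in `F[λ₁, …, λₖ, ∂]`. -/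
def dag (k : ℕ) : DPoly F k := -(∑ i, lam F i) - del F k

/-- The values `λ₁, …, λₖ, λ†` to be given to `k + 1` variables. -/
def lamDag (k : ℕ) : Fin (k + 1) → DPoly F k :=
  Fin.snoc (α := fun _ => DPoly F k) (fun i => lam F i) (dag F k)

variable (N : Type v) [AddCommGroup N] [Module F N] [Module F[X] N] [IsScalarTower F F[X] N]

/-- The action of `∂` on an `F[∂]`-module, as an `F`-linear map. -/
def D : N →ₗ[F] N := ((LinearMap.lsmul F[X] N) Polynomial.X).restrictScalars F

variable {N}

/-- The action of `∂` on `F[λ₁, …, λₖ] ⊗ N` through the second factor. -/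
def DP (k : ℕ) : P F k N →ₗ[F] P F k N := (D F N).lTensor (MvPolynomial (Fin k) F)

/-- The substitution `λᵢ ↦ T i`, with `T i` in `F[λ₁, …, λₖ, ∂]`: it maps `f ⊗ n` to
`f(T₁, …, Tₗ) n`, where `∂` acts on the coefficient `n` (that is, `∂` is moved to the left). -/
def subst {l k : ℕ} (T : Fin l → DPoly F k) : P F l N →ₗ[F] P F k N :=
  TensorProduct.lift <| LinearMap.mk₂ F
    (fun (f : MvPolynomial (Fin l) F) (n : N) =>
      ((LinearMap.toSpanSingleton F[X] N n).restrictScalars F).lTensor (MvPolynomial (Fin k) F)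
        (MvPolynomial.aeval T f))
    (fun f f' n => by simp)
    (fun c f n => by simp)
    (fun f n n' => by
      rw [← LinearMap.add_apply, ← LinearMap.lTensor_add]
      congr 2
      ext; simp)
    (fun c f n => by
      rw [← LinearMap.smul_apply, ← LinearMap.lTensor_smul]
      congr 2
      ext; simp [smul_comm c])

/-- Renaming of the variables, `λᵢ ↦ λ_{f i}`. -/
def ren {l k : ℕ} (f : Fin l → Fin k) : P F l N →ₗ[F] P F k N := subst F fun i => lam F (f i)

variable {F}

/-- For `p = ∑ⱼ λʲ ⊗ eⱼ` in `F[λ] ⊗ E` and a linear map `g : E → F[λ₁, …, λₖ] ⊗ N`, the element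
`∑ⱼ qʲ g(eⱼ)`. -/
def bind {E : Type w} [AddCommGroup E] [Module F E] {k : ℕ}
    (q : MvPolynomial (Fin k) F) (g : E →ₗ[F] P F k N) : P F 1 E →ₗ[F] P F k N :=
  TensorProduct.lift <| LinearMap.mk₂ F
    (fun (f : MvPolynomial (Fin 1) F) (e : E) => MvPolynomial.aeval (fun _ => q) f • g e)
    (fun f f' e => by simp [add_smul])
    (fun c f e => by simp)
    (fun f e e' => by simp)
    (fun c f e => by rw [map_smul, smul_comm])

/-- For a linear map `g : N → F[λ] ⊗ N`, written `n ↦ g_λ(n)`, the map `g_{λᵢ}` on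
`F[λ₁, …, λₖ] ⊗ N`, commuting with all the variables. -/
def actAt {k : ℕ} (g : N →ₗ[F] P F 1 N) (i : Fin k) : P F k N →ₗ[F] P F k N :=
  TensorProduct.lift <| LinearMap.mk₂ F
    (fun (f : MvPolynomial (Fin k) F) (n : N) => f • ren F (fun _ => i) (g n))
    (fun f f' n => add_smul _ _ _)
    (fun c f n => smul_assoc _ _ _)
    (fun f n n' => by simp)
    (fun c f n => by rw [map_smul, map_smul, smul_comm])

/-- The identification of `F[λ₁, …, λₖ] ⊗ N` with `N` for `k = 0`. -/
def val0 : P F 0 N →ₗ[F] N :=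
  (TensorProduct.lid F N).toLinearMap ∘ₗ
    (MvPolynomial.isEmptyAlgEquiv F (Fin 0)).toLinearMap.rTensor N

end Poly

/-! ### Lie conformal algebras and their modules -/

/-- A Lie conformal algebra structure on the `F[∂]`-module `A`; `bracket a b` is `[a_λ b]`. In the
Jacobi identity `λ` and `μ` are the variables number `0` and `1`. -/
structure LieConformalAlgebra (F : Type u) [Field F] (A : Type v) [AddCommGroup A] [Module F A]
    [Module F[X] A] [IsScalarTower F F[X] A] where
  bracket : A →ₗ[F] A →ₗ[F] P F 1 A
  sesq_left : ∀ a b, bracket (D F A a) b = -((MvPolynomial.X 0 : MvPolynomial (Fin 1) F) • bracket a b)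
  sesq_right : ∀ a b, bracket a (D F A b) =
    DP F 1 (bracket a b) + (MvPolynomial.X 0 : MvPolynomial (Fin 1) F) • bracket a b
  skew : ∀ a b, bracket a b = -subst F (fun _ => -lam F (0 : Fin 1) - del F 1) (bracket b a)
  jacobi : ∀ a b c,
    actAt (bracket a) (0 : Fin 2) (ren F (fun _ => 1) (bracket b c)) -
        actAt (bracket b) (1 : Fin 2) (ren F (fun _ => 0) (bracket a c)) =
      bind (MvPolynomial.X 0 : MvPolynomial (Fin 2) F)
        (subst F (fun _ => lam F (0 : Fin 2) + lam F 1) ∘ₗ bracket.flip c) (bracket a b)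

/-- A module `M` over the Lie conformal algebra `A`; `act a m` is `a_λ m`. -/
structure LieConformalModule {F : Type u} [Field F] {A : Type v} [AddCommGroup A] [Module F A]
    [Module F[X] A] [IsScalarTower F F[X] A] (L : LieConformalAlgebra F A)
    (M : Type w) [AddCommGroup M] [Module F M] [Module F[X] M] [IsScalarTower F F[X] M] where
  act : A →ₗ[F] M →ₗ[F] P F 1 M
  sesq_left : ∀ a m, act (D F A a) m = -((MvPolynomial.X 0 : MvPolynomial (Fin 1) F) • act a m)
  sesq_right : ∀ a m, act a (D F M m) =
    DP F 1 (act a m) + (MvPolynomial.X 0 : MvPolynomial (Fin 1) F) • act a m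
  jacobi : ∀ a b m,
    actAt (act a) (0 : Fin 2) (ren F (fun _ => 1) (act b m)) -
        actAt (act b) (1 : Fin 2) (ren F (fun _ => 0) (act a m)) =
      bind (MvPolynomial.X 0 : MvPolynomial (Fin 2) F)
        (subst F (fun _ => lam F (0 : Fin 2) + lam F 1) ∘ₗ act.flip m) (L.bracket a b)

/-! ### `𝔤`-complexes -/

section GComplex

/-- A Lie algebra structure on the vector space `g`. -/
structure LieStr (F : Type u) [Field F] (g : Type v) [AddCommGroup g] [Module F g] where
  br : g →ₗ[F] g →ₗ[F] g
  br_self : ∀ x, br x x = 0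
  jacobi : ∀ x y z, br x (br y z) = br (br x y) z + br y (br x z)

variable {F : Type u} [Field F]

/-- The subspace `Bᵏ` of `B^• = ⨁ₖ Bᵏ`. -/
abbrev homog (F : Type u) [Field F] (B : ℕ → Type v) [∀ k, AddCommGroup (B k)]
    [∀ k, Module F (B k)] (k : ℕ) : Submodule F (⨁ k, B k) :=
  LinearMap.range (DirectSum.lof F ℕ B k)

/-- A `𝔤`-complex structure on the graded space `B^•`: a differential `d` together with a
grading preserving homomorphism of Lie superalgebras `φ` from `η𝔤 ⊕ 𝔤 ⊕ F∂_η` (where `η𝔤`, `𝔤`,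
`∂_η` have degrees `-1`, `0`, `1`) to `End B^•` with `φ(∂_η) = d`. Here `ι X = φ(ηX)` and
`L X = φ(X)`, and all the brackets of the superalgebra `η𝔤 ⊕ 𝔤 ⊕ F∂_η` are listed. -/
structure GStructure {g : Type v} [AddCommGroup g] [Module F g] (lie : LieStr F g)
    (B : ℕ → Type w) [∀ k, AddCommGroup (B k)] [∀ k, Module F (B k)] where
  d : Module.End F (⨁ k, B k)
  ι : g →ₗ[F] Module.End F (⨁ k, B k)
  L : g →ₗ[F] Module.End F (⨁ k, B k)
  d_deg : ∀ k, ∀ b ∈ homog F B k, d b ∈ homog F B (k + 1)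
  ι_deg_zero : ∀ X, ∀ b ∈ homog F B 0, ι X b = 0
  ι_deg : ∀ X k, ∀ b ∈ homog F B (k + 1), ι X b ∈ homog F B k
  L_deg : ∀ X k, ∀ b ∈ homog F B k, L X b ∈ homog F B k
  d_d : d * d = 0
  d_ι : ∀ X, d * ι X + ι X * d = L X
  d_L : ∀ X, d * L X - L X * d = 0
  ι_ι : ∀ X Y, ι X * ι Y + ι Y * ι X = 0
  L_ι : ∀ X Y, L X * ι Y - ι Y * L X = ι (lie.br X Y)
  L_L : ∀ X Y, L X * L Y - L Y * L X = L (lie.br X Y)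

/-- The `𝔤'`-complex obtained from a `𝔤`-complex through a Lie algebra homomorphism `𝔤' → 𝔤`. -/
def GStructure.pullback {g g' : Type*} [AddCommGroup g] [Module F g] [AddCommGroup g'] [Module F g']
    {lie : LieStr F g} {lie' : LieStr F g'}
    {B : ℕ → Type w} [∀ k, AddCommGroup (B k)] [∀ k, Module F (B k)]
    (S : GStructure lie B) (f : g' →ₗ[F] g) (hf : ∀ x y, f (lie'.br x y) = lie.br (f x) (f y)) :
    GStructure lie' B where
  d := S.d
  ι := S.ι ∘ₗ f
  L := S.L ∘ₗ f
  d_deg := S.d_deg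
  ι_deg_zero X := S.ι_deg_zero (f X)
  ι_deg X := S.ι_deg (f X)
  L_deg X := S.L_deg (f X)
  d_d := S.d_d
  d_ι X := S.d_ι (f X)
  d_L X := S.d_L (f X)
  ι_ι X Y := S.ι_ι (f X) (f Y)
  L_ι X Y := by simpa [hf] using S.L_ι (f X) (f Y)
  L_L X Y := by simpa [hf] using S.L_L (f X) (f Y)

/-- `(π, ρ)` is a morphism from the `𝔤`-complex `(B^•, S)` to the `𝔥`-complex `(B'^•, S')`. -/
structure IsGMorphism {g h : Type*} [AddCommGroup g] [Module F g] [AddCommGroup h] [Module F h]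
    {lie : LieStr F g} {lie' : LieStr F h}
    {B B' : ℕ → Type*} [∀ k, AddCommGroup (B k)] [∀ k, Module F (B k)]
    [∀ k, AddCommGroup (B' k)] [∀ k, Module F (B' k)]
    (S : GStructure lie B) (S' : GStructure lie' B')
    (π : g →ₗ[F] h) (ρ : (⨁ k, B k) →ₗ[F] (⨁ k, B' k)) : Prop where
  map_br : ∀ x y, π (lie.br x y) = lie'.br (π x) (π y)
  map_deg : ∀ k, ∀ b ∈ homog F B k, ρ b ∈ homog F B' k
  map_d : ∀ b, ρ (S.d b) = S'.d (ρ b)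
  map_ι : ∀ X b, ρ (S.ι X b) = S'.ι (π X) (ρ b)
  map_L : ∀ X b, ρ (S.L X b) = S'.L (π X) (ρ b)

end GComplex

/-! ### Spaces of cochains -/

section Cochains

variable (F : Type u) [Field F]
  (A : Type v) [AddCommGroup A] [Module F A] [Module F[X] A] [IsScalarTower F F[X] A]
  (M : Type w) [AddCommGroup M] [Module F M] [Module F[X] M] [IsScalarTower F F[X] M]

/-- The space `Γ̃ᵏ` of basic `k`-cochains: `γ a` is `γ_{λ₁,…,λₖ}(a₁, …, aₖ)`. -/
def Gt (k : ℕ) : Submodule F (MultilinearMap F (fun _ : Fin k => A) (P F k M)) where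
  carrier := {γ |
    (∀ a i, γ (Function.update a i (D F A (a i))) =
      -((MvPolynomial.X i : MvPolynomial (Fin k) F) • γ a)) ∧
    (∀ (σ : Equiv.Perm (Fin k)) a, ren F σ (γ (a ∘ σ)) = (Equiv.Perm.sign σ : ℤ) • γ a)}
  add_mem' := by
    rintro γ γ' ⟨h1, h2⟩ ⟨h1', h2'⟩
    refine ⟨fun a i => ?_, fun σ a => ?_⟩
    · simp only [add_apply, h1, h1', smul_add, neg_add]
    · simp only [add_apply, map_add, h2, h2', smul_add]
  zero_mem' := by constructor <;> simp
  smul_mem' := by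
    rintro c γ ⟨h1, h2⟩
    refine ⟨fun a i => ?_, fun σ a => ?_⟩
    · rw [smul_apply, smul_apply, h1, smul_neg, smul_comm]
    · rw [smul_apply, smul_apply, map_smul, h2, smul_comm]

instance (k : ℕ) : AddCommGroup (Gt F A M k) := Submodule.addCommGroup _

/-- The subspace `∂Γ̃ᵏ` of `Γ̃ᵏ`, where `∂γ = (∂ + λ₁ + ⋯ + λₖ)γ`. -/
def delGt (k : ℕ) : Submodule F (Gt F A M k) where
  carrier := {γ | ∃ θ : Gt F A M k, ∀ a, γ.1 a =
    DP F k (θ.1 a) + (∑ i, MvPolynomial.X i : MvPolynomial (Fin k) F) • θ.1 a}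
  add_mem' := by
    rintro γ γ' ⟨θ, h⟩ ⟨θ', h'⟩
    refine ⟨θ + θ', fun a => ?_⟩
    simp only [Submodule.coe_add, add_apply, map_add, smul_add, h, h']
    abel
  zero_mem' := ⟨0, fun a => by simp⟩
  smul_mem' := by
    rintro c γ ⟨θ, h⟩
    refine ⟨c • θ, fun a => ?_⟩
    simp only [Submodule.coe_smul, smul_apply, map_smul, smul_add, h]
    rw [smul_comm c (∑ i, MvPolynomial.X i : MvPolynomial (Fin k) F)]

/-- The space `Γᵏ = Γ̃ᵏ / ∂Γ̃ᵏ` of reduced `k`-cochains. -/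
abbrev Gam (k : ℕ) : Type (max u v w) := Gt F A M k ⧸ delGt F A M k

/-- The space of `(k + 1)`-`λ`-brackets on `A` with coefficients in `M`: `c a` is
`{a₁ _{λ₁} ⋯ aₖ _{λₖ} aₖ₊₁}_c`. -/
def LamBr (k : ℕ) : Submodule F (MultilinearMap F (fun _ : Fin (k + 1) => A) (P F k M)) where
  carrier := {c |
    (∀ a (i : Fin k), c (Function.update a i.castSucc (D F A (a i.castSucc))) =
      -((MvPolynomial.X i : MvPolynomial (Fin k) F) • c a)) ∧
    (∀ a, c (Function.update a (Fin.last k) (D F A (a (Fin.last k)))) =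
      (∑ i, MvPolynomial.X i : MvPolynomial (Fin k) F) • c a + DP F k (c a)) ∧
    (∀ (σ : Equiv.Perm (Fin (k + 1))) a, c a = (Equiv.Perm.sign σ : ℤ) •
      subst F (fun j : Fin k => lamDag F k (σ j.castSucc)) (c (a ∘ σ)))}
  add_mem' := by
    rintro c c' ⟨h1, h2, h3⟩ ⟨h1', h2', h3'⟩
    refine ⟨fun a i => ?_, fun a => ?_, fun σ a => ?_⟩
    · simp only [add_apply, h1, h1', smul_add, neg_add]
    · simp only [add_apply, h2, h2', smul_add, map_add]
      abel
    · rw [add_apply, add_apply, map_add, smul_add, ← h3, ← h3']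
  zero_mem' := by refine ⟨?_, ?_, ?_⟩ <;> simp
  smul_mem' := by
    rintro r c ⟨h1, h2, h3⟩
    refine ⟨fun a i => ?_, fun a => ?_, fun σ a => ?_⟩
    · rw [smul_apply, smul_apply, h1, smul_neg, smul_comm]
    · rw [smul_apply, smul_apply, h2, smul_add, smul_comm, map_smul]
    · rw [smul_apply, smul_apply, map_smul, smul_comm, ← h3]

/-- The space `Cᵏ`: `C⁰ = M/∂M`, and `Cᵏ` is the space of `k`-`λ`-brackets for `k ≥ 1`. -/
def C : ℕ → Type (max u v w)
  | 0 => ULift.{max u v} (M ⧸ LinearMap.range (D F M))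
  | k + 1 => LamBr F A M k

instance : ∀ k, AddCommGroup (C F A M k)
  | 0 => inferInstanceAs (AddCommGroup (ULift.{max u v} (M ⧸ LinearMap.range (D F M))))
  | k + 1 => inferInstanceAs (AddCommGroup (LamBr F A M k))

instance : ∀ k, Module F (C F A M k)
  | 0 => inferInstanceAs (Module F (ULift.{max u v} (M ⧸ LinearMap.range (D F M))))
  | k + 1 => inferInstanceAs (Module F (LamBr F A M k))

variable {M} in
/-- The class `∫ m` in `C⁰ = M/∂M`. -/
def tint (m : M) : C F A M 0 := ULift.up (Submodule.Quotient.mk m)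

variable {F A M} in
/-- A `(k + 1)`-`λ`-bracket as an element of `Cᵏ⁺¹`. -/
def ofBr {k : ℕ} (c : LamBr F A M k) : C F A M (k + 1) := c

/-- The subspace `C̄ᵏ` of `Cᵏ`: `C̄⁰ = C⁰`, and for `k ≥ 1` it consists of the `k`-`λ`-brackets
that vanish if one of the arguments is a torsion element of the `F[∂]`-module `A`. -/
def Cbar : ∀ k, Submodule F (C F A M k)
  | 0 => ⊤
  | k + 1 =>
    { carrier := {c : LamBr F A M k | ∀ a i, a i ∈ Submodule.torsion F[X] A → c.1 a = 0}
      add_mem' := fun {c c'} h h' a i hi => by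
        change c.1 a + c'.1 a = 0
        rw [h a i hi, h' a i hi, add_zero]
      zero_mem' := fun _ _ _ => rfl
      smul_mem' := fun r c h a i hi => by
        change r • c.1 a = 0
        rw [h a i hi, smul_zero] }

/-- The inclusion of `C̄^•` in `C^•`. -/
def incl : (⨁ k, Cbar F A M k) →ₗ[F] (⨁ k, C F A M k) :=
  DirectSum.lmap fun k => (Cbar F A M k).subtype

/-- The quotient map `Γ̃^• → Γ^•`. -/
def toGam : (⨁ k, Gt F A M k) →ₗ[F] (⨁ k, Gam F A M k) :=
  DirectSum.lmap fun k => (delGt F A M k).mkQ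

end Cochains

/-! ### Spaces of `1`-chains -/

section Chains

variable (F : Type u) [Field F]
  (A : Type v) [AddCommGroup A] [Module F A] [Module F[X] A] [IsScalarTower F F[X] A]
  (M : Type w) [AddCommGroup M] [Module F M] [Module F[X] M] [IsScalarTower F F[X] M]

/-- The space `Hom(F[λ], M)`. -/
abbrev HomL : Type (max u w) := MvPolynomial (Fin 1) F →ₗ[F] M

/-- The operator `λ*` on `Hom(F[λ], M)`, `(λ*φ)(f) = φ(λf)`. -/
def lamStar : HomL F M →ₗ[F] HomL F M :=
  LinearMap.lcomp F M (LinearMap.mulLeft F (MvPolynomial.X 0 : MvPolynomial (Fin 1) F))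

/-- The operator `∂` on `Hom(F[λ], M)`, `(∂φ)(f) = ∂(φ(f))`. -/
def delHom : HomL F M →ₗ[F] HomL F M := LinearMap.llcomp F _ _ _ (D F M)

/-- The subspace of `A ⊗ Hom(F[λ], M)` spanned by the elements `∂a ⊗ φ + a ⊗ λ*φ`. -/
def relGt1 : Submodule F (A ⊗[F] HomL F M) :=
  LinearMap.range ((D F A).rTensor (HomL F M) + (lamStar F M).lTensor A)

/-- The space `Γ̃₁` of basic `1`-chains. -/
abbrev Gt1 : Type (max u v w) := (A ⊗[F] HomL F M) ⧸ relGt1 F A M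

/-- The action of `∂` on `Γ̃₁`, induced by `∂ ⊗ 1 + 1 ⊗ ∂`. -/
def delGt1 : Gt1 F A M →ₗ[F] Gt1 F A M :=
  (relGt1 F A M).mapQ (relGt1 F A M) ((D F A).rTensor (HomL F M) + (delHom F M).lTensor A) (by
    rintro _ ⟨x, rfl⟩
    refine ⟨((D F A).rTensor (HomL F M) + (delHom F M).lTensor A) x, ?_⟩
    have hc : lamStar F M ∘ₗ delHom F M = delHom F M ∘ₗ lamStar F M := rfl
    have h := DFunLike.congr_fun hc
    simp only [LinearMap.comp_apply] at h
    induction x using TensorProduct.induction_on with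
    | zero => simp
    | add x y hx hy => simp only [map_add] at hx hy ⊢; rw [hx, hy]
    | tmul a φ =>
      simp only [LinearMap.add_apply, LinearMap.rTensor_tmul, LinearMap.lTensor_tmul, map_add, h]
      abel)

/-- The space `Γ₁` of reduced `1`-chains. -/
def G1 : Submodule F (Gt1 F A M) := LinearMap.ker (delGt1 F A M)

/-- The subspace `∂(A ⊗ M)` of `A ⊗ M`. -/
def relC1 : Submodule F (A ⊗[F] M) := LinearMap.range ((D F A).rTensor M + (D F M).lTensor A)

/-- The space `C₁ = (A ⊗ M)/∂(A ⊗ M)`. -/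
abbrev C1 : Type (max v w) := (A ⊗[F] M) ⧸ relC1 F A M

/-- The quotient `Ā` of `A` by its torsion. -/
abbrev Abar : Type v := A ⧸ Submodule.torsion F[X] A

/-- The space `C̄₁ = (Ā ⊗ M)/∂(Ā ⊗ M)`. -/
abbrev C1bar : Type (max v w) := C1 F (Abar F A) M

/-- The natural surjection `C₁ → C̄₁`. -/
def toC1bar : C1 F A M →ₗ[F] C1bar F A M :=
  (relC1 F A M).mapQ (relC1 F (Abar F A) M)
    (((Submodule.torsion F[X] A).mkQ.restrictScalars F).rTensor M) (by
    rintro _ ⟨x, rfl⟩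
    refine ⟨((Submodule.torsion F[X] A).mkQ.restrictScalars F).rTensor M x, ?_⟩
    induction x using TensorProduct.induction_on with
    | zero => simp
    | add x y hx hy => simp only [map_add] at hx hy ⊢; rw [hx, hy]
    | tmul a m => simp [D])

variable {M} in
/-- The element of `Hom(F[λ], M)` given by `f ↦ f(∂)m`. -/
def expD : M →ₗ[F] HomL F M where
  toFun m := (LinearMap.toSpanSingleton F[X] M m).restrictScalars F ∘ₗ
    (MvPolynomial.aeval fun _ => Polynomial.X).toLinearMap
  map_add' m m' := by ext; simp
  map_smul' c m := by
    apply LinearMap.ext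
    intro x
    simp [smul_comm c]

lemma lamStar_expD (m : M) : lamStar F M (expD F m) = expD F (D F M m) := by
  apply LinearMap.ext
  intro f
  simp only [lamStar, expD, D, LinearMap.lcomp_apply, LinearMap.mulLeft_apply,
    LinearMap.coe_mk, AddHom.coe_mk, LinearMap.comp_apply, AlgHom.toLinearMap_apply, map_mul,
    MvPolynomial.aeval_X, LinearMap.coe_restrictScalars, LinearMap.toSpanSingleton_apply,
    LinearMap.lsmul_apply]
  rw [mul_comm, mul_smul]

lemma delHom_expD (m : M) : delHom F M (expD F m) = expD F (D F M m) := by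
  apply LinearMap.ext
  intro f
  simp only [delHom, expD, D, LinearMap.llcomp_apply,
    LinearMap.coe_mk, AddHom.coe_mk, LinearMap.comp_apply, AlgHom.toLinearMap_apply,
    LinearMap.coe_restrictScalars, LinearMap.toSpanSingleton_apply, LinearMap.lsmul_apply]
  rw [smul_comm]

/-- The map `a ⊗ m ↦ a ⊗ (f ↦ f(∂)m)` from `C₁` to `Γ̃₁`. -/
def chi1' : C1 F A M →ₗ[F] Gt1 F A M :=
  (relC1 F A M).mapQ (relGt1 F A M) ((expD F).lTensor A) (by
    rintro _ ⟨x, rfl⟩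
    refine ⟨(expD F).lTensor A x, ?_⟩
    induction x using TensorProduct.induction_on with
    | zero => simp
    | add x y hx hy => simp only [map_add] at hx hy ⊢; rw [hx, hy]
    | tmul a m => simp [lamStar_expD])

lemma delGt1_chi1' (x : C1 F A M) : delGt1 F A M (chi1' F A M x) = 0 := by
  obtain ⟨x, rfl⟩ := Submodule.Quotient.mk_surjective _ x
  refine (Submodule.Quotient.mk_eq_zero _).2 ⟨(expD F).lTensor A x, ?_⟩
  induction x using TensorProduct.induction_on with
  | zero => simp
  | add x y hx hy => simp only [map_add] at hx hy ⊢; rw [hx, hy]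
  | tmul a m => simp [lamStar_expD, delHom_expD]

/-- The map `χ₁ : C₁ → Γ₁`. -/
def chi1 : C1 F A M →ₗ[F] G1 F A M := (chi1' F A M).codRestrict _ (delGt1_chi1' F A M)

variable {A M} in
/-- The class of `a ⊗ φ` in `Γ̃₁`. -/
def gt1 (a : A) (φ : HomL F M) : Gt1 F A M := Submodule.Quotient.mk (a ⊗ₜ φ)

variable {A M} in
/-- The class of `a ⊗ m` in `C₁`. -/
def c1 (a : A) (m : M) : C1 F A M := Submodule.Quotient.mk (a ⊗ₜ m)

end Chains

/-! ### Differentials -/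

section Differentials

variable {F : Type u} [Field F]
  {A : Type v} [AddCommGroup A] [Module F A] [Module F[X] A] [IsScalarTower F F[X] A]
  {M : Type w} [AddCommGroup M] [Module F M] [Module F[X] M] [IsScalarTower F F[X] M]
  {L : LieConformalAlgebra F A} (V : LieConformalModule L M)

/-- For `i < j`, the increasing enumeration of the `k` indices different from `i` and `j`. -/
def skip {k : ℕ} (i : Fin (k + 1)) (j : Fin (k + 2)) (r : Fin k) : Fin (k + 2) :=
  j.succAbove (i.succAbove r)

/-- For `f = f(b)` multilinear with values in polynomials in the variables `λ`, the sum
`∑_{i<j} (-1)^{k+i+j} f(a₁, …, aₖ₊₂ without aᵢ and aⱼ, [aᵢ _{λᵢ} aⱼ])`, where `s i j` is the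
substitution of the variables; the indices `i` and `j` are numbered from `0`. -/
def bracketSum (L : LieConformalAlgebra F A) {k l : ℕ}
    (f : MultilinearMap F (fun _ : Fin (k + 1) => A) (P F l M))
    (s : Fin (k + 1) → Fin (k + 2) → P F l M →ₗ[F] P F (k + 2) M) (a : Fin (k + 2) → A) :
    P F (k + 2) M :=
  ∑ j : Fin (k + 2), ∑ i : Fin (k + 1), if i.castSucc < j then
    (-1 : F) ^ (k + (i : ℕ) + (j : ℕ)) •
      bind (MvPolynomial.X i.castSucc : MvPolynomial (Fin (k + 2)) F)
        (s i j ∘ₗ f.toLinearMap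
          (Fin.snoc (α := fun _ => A) (fun r : Fin k => a (skip i j r)) 0) (Fin.last k))
        (L.bracket (a i.castSucc) (a j))
    else 0

/-- The value `(δγ)_{λ₁,…,λₖ₊₁}(a₁, …, aₖ₊₁)` of the differential of the `k`-cochain `γ`. -/
def deltaFun : ∀ {k : ℕ}, MultilinearMap F (fun _ : Fin k => A) (P F k M) →
    (Fin (k + 1) → A) → P F (k + 1) M
  | 0, γ, a => actAt (V.act (a 0)) 0 (ren F (Fin.succAbove 0) (γ (a ∘ Fin.succAbove 0)))
  | k + 1, γ, a =>
    (∑ i : Fin (k + 2), (-1 : F) ^ (i : ℕ) •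
      actAt (V.act (a i)) i (ren F i.succAbove (γ (a ∘ i.succAbove)))) +
    bracketSum L γ (fun i j => subst F (Fin.snoc (α := fun _ => DPoly F (k + 2))
      (fun r : Fin k => lam F (skip i j r)) (lam F i.castSucc + lam F j))) a

/-- The value `{a₁ _{λ₁} ⋯ aₖ₊₁ _{λₖ₊₁} aₖ₊₂}_{dc}` of the differential of the
`(k + 1)`-`λ`-bracket `c`. -/
def dFun {k : ℕ} (c : MultilinearMap F (fun _ : Fin (k + 1) => A) (P F k M))
    (a : Fin (k + 2) → A) : P F (k + 1) M :=
  subst F (lamDag F (k + 1))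
    ((∑ i : Fin (k + 2), (-1 : F) ^ (i : ℕ) •
      actAt (V.act (a i)) i (ren F (fun r : Fin k => i.succAbove r.castSucc)
        (c (a ∘ i.succAbove)))) +
    bracketSum L c (fun i j => ren F (skip i j)) a)

end Differentials

/-! ### Contractions and brackets of `1`-chains -/

section Products

variable {F : Type u} [Field F]
  {A : Type v} [AddCommGroup A] [Module F A] [Module F[X] A] [IsScalarTower F F[X] A]
  {M : Type w} [NonUnitalCommRing M] [Module F M] [IsScalarTower F M M] [SMulCommClass F M M]
  [Module F[X] M] [IsScalarTower F F[X] M]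
  {L : LieConformalAlgebra F A} (V : LieConformalModule L M)

/-- The operators `∂` and `a_λ` on `M` are derivations of the product of `M`. -/
structure LieConformalModule.ByDerivations : Prop where
  del_mul : ∀ m n : M, D F M (m * n) = D F M m * n + m * D F M n
  act_mul : ∀ (a : A) (m n : M), V.act a (m * n) =
    (LinearMap.mulRight F n).lTensor _ (V.act a m) + (LinearMap.mulLeft F m).lTensor _ (V.act a n)

/-- The isomorphism `F[λ₁, …, λₖ₊₁] ≃ F[λ₂, …, λₖ₊₁] ⊗ F[λ₁]`. -/
def split (F : Type u) [Field F] (k : ℕ) :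
    MvPolynomial (Fin (k + 1)) F →ₐ[F] MvPolynomial (Fin k) F ⊗[F] MvPolynomial (Fin 1) F :=
  MvPolynomial.aeval (Fin.cons (1 ⊗ₜ MvPolynomial.X 0) fun i => MvPolynomial.X i ⊗ₜ 1)

/-- For `φ : F[λ] → M`, the map `φ^μ : F[λ₁, …, λₖ₊₁] ⊗ M → F[λ₂, …, λₖ₊₁] ⊗ M` that commutes with
`λ₂, …, λₖ₊₁` and maps `f(λ₁) ⊗ m` to `φ(f)m`. -/
def contr {k : ℕ} (φ : HomL F M) : P F (k + 1) M →ₗ[F] P F k M :=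
  TensorProduct.lift <| LinearMap.mk₂ F
    (fun (f : MvPolynomial (Fin (k + 1)) F) (m : M) =>
      (LinearMap.mulRight F m ∘ₗ φ).lTensor (MvPolynomial (Fin k) F) (split F k f))
    (fun f f' m => by simp)
    (fun c f m => by simp)
    (fun f m m' => by
      rw [← LinearMap.add_apply, ← LinearMap.lTensor_add]
      congr 2
      ext; simp [mul_add])
    (fun c f m => by
      rw [← LinearMap.smul_apply, ← LinearMap.lTensor_smul]
      congr 2
      apply LinearMap.ext
      intro x
      simp [mul_smul_comm])

/-- The pairing `⟨φ, f ⊗ m⟩ = φ(f)m`. -/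
def pairing (φ : HomL F M) : P F 1 M →ₗ[F] M := TensorProduct.lift (LinearMap.mul F M ∘ₗ φ)

/-- The product of `Hom(F[λ], M)` that corresponds to the product of power series when `φ` is
identified with `∑ₙ φ(λⁿ) xⁿ/n!`: it maps `f` to the value of `φ ⊗ ψ` on `f(λ₁ + λ₂)`. -/
def conv (φ ψ : HomL F M) : HomL F M :=
  LinearMap.mul' F M ∘ₗ TensorProduct.map φ ψ ∘ₗ
    (MvPolynomial.aeval fun _ => (MvPolynomial.X 0 ⊗ₜ[F] 1 + 1 ⊗ₜ[F] MvPolynomial.X 0 :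
      MvPolynomial (Fin 1) F ⊗[F] MvPolynomial (Fin 1) F)).toLinearMap

/-- The map `f ⊗ c ↦ c ⊗ (f(λ*)φ)ψ` from `F[λ] ⊗ A` to `A ⊗ Hom(F[λ], M)`. -/
def gtFirst (φ ψ : HomL F M) : P F 1 A →ₗ[F] A ⊗[F] HomL F M :=
  TensorProduct.lift <| LinearMap.mk₂ F
    (fun (f : MvPolynomial (Fin 1) F) (c : A) => c ⊗ₜ[F] conv (φ ∘ₗ LinearMap.mulLeft F f) ψ)
    (fun f f' c => by
      rw [← TensorProduct.tmul_add]
      congr 1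
      have : φ ∘ₗ LinearMap.mulLeft F (f + f') =
          φ ∘ₗ LinearMap.mulLeft F f + φ ∘ₗ LinearMap.mulLeft F f' := by
        apply LinearMap.ext; intro x; simp [add_mul]
      rw [this]
      apply LinearMap.ext; intro x
      simp [conv, TensorProduct.map_add_left])
    (fun r f c => by
      rw [← TensorProduct.tmul_smul]
      congr 1
      have : φ ∘ₗ LinearMap.mulLeft F (r • f) = r • (φ ∘ₗ LinearMap.mulLeft F f) := by
        apply LinearMap.ext; intro x; simp
      rw [this]
      apply LinearMap.ext; intro x
      simp [conv, TensorProduct.map_smul_left])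
    (fun f c c' => TensorProduct.add_tmul _ _ _)
    (fun r f c => TensorProduct.smul_tmul' _ _ _)

/-- A representative of the bracket of the classes of `a ⊗ φ` and `b ⊗ ψ` in `Γ̃₁`. -/
def gtBr (a b : A) (φ ψ : HomL F M) : A ⊗[F] HomL F M :=
  gtFirst φ ψ (L.bracket a b) - a ⊗ₜ (pairing ψ ∘ₗ V.act b ∘ₗ φ) + b ⊗ₜ (pairing φ ∘ₗ V.act a ∘ₗ ψ)

/-- A representative of the bracket of the classes of `a ⊗ m` and `b ⊗ n` in `C₁`: the first term
is the image of `[a_λ b]` under `f ⊗ c ↦ c ⊗ (f(∂)m)n`. -/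
def cBr (a b : A) (m n : M) : A ⊗[F] M :=
  TensorProduct.comm F M A ((LinearMap.mulRight F n ∘ₗ expD F m).rTensor A (L.bracket a b)) +
    b ⊗ₜ pairing (expD F m) (V.act a n) - a ⊗ₜ pairing (expD F n) (V.act b m)

/-- `S` is the `ΠΓ̃₁`-complex `(Γ̃^•, δ)`. -/
structure IsBasicComplex {lie : LieStr F (Gt1 F A M)}
    (S : GStructure lie (fun k => Gt F A M k)) : Prop where
  br : ∀ a b φ ψ, lie.br (gt1 F a φ) (gt1 F b ψ) = Submodule.Quotient.mk (gtBr V a b φ ψ)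
  d : ∀ k (γ : Gt F A M k), ∃ γ' : Gt F A M (k + 1), (∀ a, γ'.1 a = deltaFun V γ.1 a) ∧
    S.d (DirectSum.lof F ℕ (fun k => Gt F A M k) k γ) =
      DirectSum.lof F ℕ (fun k => Gt F A M k) (k + 1) γ'
  ι : ∀ a φ k (γ : Gt F A M (k + 1)), ∃ γ' : Gt F A M k,
    (∀ b, γ'.1 b = contr φ (γ.1 (Fin.cons a b))) ∧
    S.ι (gt1 F a φ) (DirectSum.lof F ℕ (fun k => Gt F A M k) (k + 1) γ) =
      DirectSum.lof F ℕ (fun k => Gt F A M k) k γ'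

/-- `S'` is the `ΠΓ₁`-complex `Γ^• = Γ̃^•/∂Γ̃^•` induced by the `ΠΓ̃₁`-complex `S` on `Γ̃^•`. -/
structure IsReducedComplex {lie : LieStr F (Gt1 F A M)} {lie' : LieStr F (G1 F A M)}
    (S : GStructure lie (fun k => Gt F A M k)) (S' : GStructure lie' (Gam F A M)) : Prop where
  br : ∀ x y : G1 F A M, (lie'.br x y : Gt1 F A M) = lie.br x y
  d : ∀ γ, S'.d (toGam F A M γ) = toGam F A M (S.d γ)
  ι : ∀ (x : G1 F A M) γ, S'.ι x (toGam F A M γ) = toGam F A M (S.ι x γ)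

/-- `S` is the `ΠC₁`-complex `(C^•, d)`. -/
structure IsPolyComplex {lie : LieStr F (C1 F A M)} (S : GStructure lie (C F A M)) : Prop where
  br : ∀ a b m n, lie.br (c1 F a m) (c1 F b n) = Submodule.Quotient.mk (cBr V a b m n)
  d_zero : ∀ m : M, ∃ c : LamBr F A M 0,
    (∀ a, c.1 a = subst F (fun _ : Fin 1 => -del F 0) (V.act (a 0) m)) ∧
    S.d (DirectSum.lof F ℕ (C F A M) 0 (tint F A m)) = DirectSum.lof F ℕ (C F A M) 1 (ofBr c)
  d_succ : ∀ k (c : LamBr F A M k), ∃ c' : LamBr F A M (k + 1), (∀ a, c'.1 a = dFun V c.1 a) ∧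
    S.d (DirectSum.lof F ℕ (C F A M) (k + 1) (ofBr c)) =
      DirectSum.lof F ℕ (C F A M) (k + 2) (ofBr c')
  ι_one : ∀ a m (c : LamBr F A M 0),
    S.ι (c1 F a m) (DirectSum.lof F ℕ (C F A M) 1 (ofBr c)) =
      DirectSum.lof F ℕ (C F A M) 0 (tint F A (m * val0 (c.1 fun _ => a)))
  ι_succ : ∀ a m k (c : LamBr F A M (k + 1)), ∃ c' : LamBr F A M k,
    (∀ b, c'.1 b = contr (expD F m) (c.1 (Fin.cons a b))) ∧
    S.ι (c1 F a m) (DirectSum.lof F ℕ (C F A M) (k + 2) (ofBr c)) =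
      DirectSum.lof F ℕ (C F A M) (k + 1) (ofBr c')

end Products

section Psi

variable {F : Type u} [Field F]
  {A : Type v} [AddCommGroup A] [Module F A] [Module F[X] A] [IsScalarTower F F[X] A]
  {M : Type w} [AddCommGroup M] [Module F M] [Module F[X] M] [IsScalarTower F F[X] M]

/-- `ψ` is the map `ψ^• : Γ^• → C̄^•`. In degree `0` it is the identity map of `M/∂M`, and in
degree `k + 1` it maps the class of `γ` to the `(k + 1)`-`λ`-bracket
`γ_{λ₁, …, λₖ, λ†}(a₁, …, aₖ₊₁)`. -/
structure IsPsi (ψ : (⨁ k, Gam F A M k) →ₗ[F] (⨁ k, Cbar F A M k)) : Prop where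
  zero : ∀ γ : Gt F A M 0,
    incl F A M (ψ (toGam F A M (DirectSum.lof F ℕ (fun k => Gt F A M k) 0 γ))) =
      DirectSum.lof F ℕ (C F A M) 0 (tint F A (val0 (γ.1 Fin.elim0)))
  succ : ∀ k (γ : Gt F A M (k + 1)), ∃ c : LamBr F A M k,
    (∀ a, c.1 a = subst F (lamDag F k) (γ.1 a)) ∧
    incl F A M (ψ (toGam F A M (DirectSum.lof F ℕ (fun k => Gt F A M k) (k + 1) γ))) =
      DirectSum.lof F ℕ (C F A M) (k + 1) (ofBr c)

end Psi

end LieConf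

end

set_option linter.unusedSectionVars false

noncomputable section

namespace LieConf

universe u v w

/-! ### Calculus in `F[λ₁, …, λₖ] ⊗ N`: values at points, substitutions that involve `∂`, and the
operator `∂ + λ₁ + ⋯ + λₖ`. -/

section PolyTools

variable {F : Type u} [Field F] {N : Type v} [AddCommGroup N] [Module F N]

/-! In characteristic `0` the field is infinite, so a polynomial in `λ₁, …, λₖ` is determined by its
values (`ev_injective`). Introduce a symbol `a_s` for `a` in `A` and `s` in `F`, and let `[a_s,
b_t]` be the value of `[a_λ b]` at `λ = s`, placed at `s + t`. The Jacobi identity makes the space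
`Pts F A` of formal sums a left Leibniz algebra that acts on `M` (`ptData`). It need not be a Lie
algebra, because the skew-symmetry of the `λ`-bracket involves `∂`. Evaluation embeds the polynomial
cochains in the Leibniz cochains of `Pts F A` (`hat`, `hat_injective`). There the differential obeys
the recursion `(dω)(x) = L_x ω - d(ω(x))`, and `d² = 0` and the compatibility with derivations
follow by induction on the degree; Cartan's formula follows from the recursion and the Leibniz rule.
The operator `∂ + λ₁ + ⋯ + λₖ` comes from the derivation `a_s ↦ -s a_s`. The failure of
sesquilinearity is the insertion of `(∂a)_s + s a_s`, and such elements act by zero.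

Contraction by `a ⊗ φ` corresponds directly to a contraction at a point when `φ` is an evaluation.
The expressions that occur depend linearly on `φ` and only through finitely many of its values, and
on finitely many polynomials `φ` agrees with a combination of evaluations (`exists_evHom_span`).
Hence identities that hold for evaluations hold for all `φ` (`eq_zero_of_loc`); this gives `rM_hom`
and Cartan's formula `cartanM`. The brackets of `Γ̃₁` and `C₁` are two cases of one construction
(`ChainOps`): the part coming from the `λ`-bracket satisfies the Leibniz form of the Jacobi identity
exactly and is skew-symmetric modulo the relations, and the remaining terms come from an action by
derivations.

The complexes `Γ̃^•` and `C^•` are also two cases of one construction: cochains that are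
sesquilinear and skew-symmetric modulo subspaces `R k`, taken modulo `R k` (`Zmod`, `Frame`). For
`Γ̃^•` the subspaces are zero; for `C^•` they are the images of `∂ + λ₁ + ⋯ + λₖ`, which for `k ≥ 1`
are the kernels of the reduction of the last variable to `λ†` (`red_eq_zero_iff`, `mem_LamBr`). The
map `ψ^•` is then induced by an inclusion of spaces of cochains and commutes with all operators.

Injectivity of `ψ^•` holds for every `A`: for `k ≥ 1` the operator `∂ + λ₁ + ⋯ + λₖ` is injective,
so a basic cochain in its image comes from a basic cochain. For surjectivity, the values on a basis
of the free part are extended sesquilinearly and the result is skew-symmetrized. For `χ̄₁`, torsion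
dies in `Γ̃₁` because `q(-λ*)` is surjective on `Hom(F[λ], M)` for `q ≠ 0`. In a basis `Γ̃₁` is a
direct sum of copies of `Hom(F[λ], M)` on which `∂` acts as `∂ - λ*`, and the kernel of `∂ - λ*`
consists of the functionals `e_m`. -/

instance {k : ℕ} : DistribMulAction (MvPolynomial (Fin k) F) (P F k N) := inferInstance

instance {k : ℕ} : DistribSMul (MvPolynomial (Fin k) F) (P F k N) := inferInstance

instance {k : ℕ} : MulAction (MvPolynomial (Fin k) F) (P F k N) := inferInstance

instance {k : ℕ} : SMulZeroClass (MvPolynomial (Fin k) F) (P F k N) := inferInstance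

instance {k : ℕ} : SMul (MvPolynomial (Fin k) F) (P F k N) := inferInstance

/-- Induction on `F[λ₁, …, λₖ] ⊗ N`, generated by `N` through multiplication by the variables. -/
lemma P_induction {k : ℕ} {motive : P F k N → Prop} (p : P F k N)
    (one : ∀ n : N, motive ((1 : MvPolynomial (Fin k) F) ⊗ₜ n))
    (mulX : ∀ i p, motive p → motive ((MvPolynomial.X i : MvPolynomial (Fin k) F) • p))
    (add : ∀ p q, motive p → motive q → motive (p + q)) : motive p := by
  induction p using TensorProduct.induction_on with
  | zero => simpa using one 0
  | add p q hp hq => exact add p q hp hq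
  | tmul f n =>
    induction f using MvPolynomial.induction_on with
    | C a =>
      have h := one (a • n)
      rwa [← TensorProduct.smul_tmul, MvPolynomial.smul_eq_C_mul, mul_one] at h
    | add f g hf hg => rw [TensorProduct.add_tmul]; exact add _ _ hf hg
    | mul_X f i hf =>
      have h := mulX i _ hf
      rwa [TensorProduct.smul_tmul', smul_eq_mul, mul_comm] at h

variable (F) in
/-- Evaluation of the variables at a point of `Fᵏ`. -/
def ev {k : ℕ} (s : Fin k → F) : P F k N →ₗ[F] N :=
  (TensorProduct.lid F N).toLinearMap ∘ₗ (MvPolynomial.aeval s).toLinearMap.rTensor N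

lemma ev_tmul {k : ℕ} (s : Fin k → F) (f : MvPolynomial (Fin k) F) (n : N) :
    ev F s (f ⊗ₜ n) = MvPolynomial.eval s f • n := by
  simp [ev, MvPolynomial.aeval_eq_eval]

@[simp] lemma ev_one {k : ℕ} (s : Fin k → F) (n : N) : ev F s (1 ⊗ₜ n) = n := by
  simp [ev_tmul]

@[simp] lemma ev_smul {k : ℕ} (s : Fin k → F) (f : MvPolynomial (Fin k) F) (p : P F k N) :
    ev F s (f • p) = MvPolynomial.eval s f • ev F s p := by
  induction p using TensorProduct.induction_on with
  | zero => simp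
  | add p q hp hq => simp only [smul_add, map_add, hp, hq]
  | tmul g n => rw [TensorProduct.smul_tmul', ev_tmul, ev_tmul, smul_eq_mul, map_mul, mul_smul]

/-- A field of characteristic `0` is infinite, so scalar polynomials are determined by their values;
coordinates in a basis of `N` reduce the general case to this one. Most identities between
polynomial cochains are checked at points in this way. -/
lemma ev_injective [CharZero F] {k : ℕ} {p q : P F k N} (h : ∀ s, ev F s p = ev F s q) :
    p = q := by
  rw [← sub_eq_zero]
  replace h : ∀ s, ev F s (p - q) = 0 := fun s => by rw [map_sub, h, sub_self]
  generalize p - q = p at h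
  let b := Module.Free.chooseBasis F N
  let B := Algebra.TensorProduct.basis (MvPolynomial (Fin k) F) b
  apply B.repr.injective
  rw [map_zero]
  ext1 i
  have key : ∀ s (p : P F k N), b.repr (ev F s p) i = MvPolynomial.eval s (B.repr p i) := by
    intro s p
    induction p using TensorProduct.induction_on with
    | zero => simp
    | add p q hp hq => simp only [map_add, Finsupp.add_apply, hp, hq]
    | tmul g n =>
      rw [ev_tmul, Algebra.TensorProduct.basis_repr_tmul]
      simp
  apply MvPolynomial.funext
  intro s
  rw [← key, h]
  simp

/-- `F[λ₁, …, λₖ] ⊗ N` is free over a domain, hence torsion-free. -/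
lemma smul_P_eq_zero {k : ℕ} {f : MvPolynomial (Fin k) F} (hf : f ≠ 0) {p : P F k N}
    (h : f • p = 0) : p = 0 := by
  let B := Algebra.TensorProduct.basis (MvPolynomial (Fin k) F) (Module.Free.chooseBasis F N)
  apply B.repr.injective
  rw [map_zero]
  ext1 i
  have := congrArg (fun x => B.repr x i) h
  simpa [hf] using this

variable [Module F[X] N] [IsScalarTower F F[X] N]

lemma D_apply (n : N) : D F N n = (Polynomial.X : F[X]) • n := rfl

lemma DP_tmul {k : ℕ} (f : MvPolynomial (Fin k) F) (n : N) :
    DP F k (f ⊗ₜ n) = f ⊗ₜ D F N n := rfl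

@[simp] lemma DP_smul {k : ℕ} (f : MvPolynomial (Fin k) F) (p : P F k N) :
    DP F k (f • p) = f • DP F k p := by
  induction p using TensorProduct.induction_on with
  | zero => simp
  | add p q hp hq => simp only [smul_add, map_add, hp, hq]
  | tmul g n => rw [TensorProduct.smul_tmul', DP_tmul, DP_tmul, TensorProduct.smul_tmul']

@[simp] lemma ev_DP {k : ℕ} (s : Fin k → F) (p : P F k N) :
    ev F s (DP F k p) = D F N (ev F s p) := by
  induction p using TensorProduct.induction_on with
  | zero => simp
  | add p q hp hq => simp only [map_add, hp, hq]
  | tmul g n => rw [DP_tmul, ev_tmul, ev_tmul, map_smul]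

variable (F N) in
/-- The action of `F[λ₁, …, λₖ, ∂]` on `F[λ₁, …, λₖ] ⊗ N`. -/
def dact (k : ℕ) : DPoly F k →ₐ[F] Module.End F (P F k N) :=
  Algebra.TensorProduct.lift (Algebra.lsmul F F (P F k N)) (Polynomial.aeval (DP F k))
    (fun f q => by
      induction q using Polynomial.induction_on' with
      | add p q hp hq => rw [map_add]; exact hp.add_right hq
      | monomial n a =>
        rw [Polynomial.aeval_monomial]
        refine Commute.mul_right (Algebra.commutes a _).symm (Commute.pow_right ?_ n)
        exact LinearMap.ext fun p => (DP_smul f p).symm)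

lemma dact_tmul_one {k : ℕ} (f : MvPolynomial (Fin k) F) (p : P F k N) :
    dact F N k (f ⊗ₜ 1) p = f • p := by
  simp [dact]

@[simp] lemma dact_lam {k : ℕ} (i : Fin k) (p : P F k N) :
    dact F N k (lam F i) p = (MvPolynomial.X i : MvPolynomial (Fin k) F) • p :=
  dact_tmul_one _ p

@[simp] lemma dact_del {k : ℕ} (p : P F k N) : dact F N k (del F k) p = DP F k p := by
  simp [dact, del]

lemma dact_one_tmul {k : ℕ} (q : F[X]) (n : N) :
    dact F N k (1 ⊗ₜ q) (1 ⊗ₜ n) = 1 ⊗ₜ (q • n) := by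
  simp only [dact, Algebra.TensorProduct.lift_tmul, map_one, one_mul]
  induction q using Polynomial.induction_on with
  | C a =>
    rw [Polynomial.aeval_C, ← Polynomial.algebraMap_eq, algebraMap_smul, Module.algebraMap_end_apply,
      TensorProduct.tmul_smul]
  | add p q hp hq => rw [map_add, LinearMap.add_apply, hp, hq, add_smul, TensorProduct.tmul_add]
  | monomial n a h =>
    rw [pow_succ', mul_left_comm, map_mul, Polynomial.aeval_X, Module.End.mul_apply, h, DP_tmul,
      mul_smul _ (Polynomial.C a * _), D_apply]

/-- Written through the action of the commutative algebra `F[λ₁, …, λₖ, ∂]`, the substitution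
becomes multiplicative. This yields `subst_X`, which together with `subst_one` makes `P_induction`
applicable to substitutions. -/
lemma subst_tmul {l k : ℕ} (T : Fin l → DPoly F k) (f : MvPolynomial (Fin l) F) (n : N) :
    subst F T (f ⊗ₜ n) = dact F N k (MvPolynomial.aeval T f) (1 ⊗ₜ n) := by
  change ((LinearMap.toSpanSingleton F[X] N n).restrictScalars F).lTensor (MvPolynomial (Fin k) F)
        (MvPolynomial.aeval T f) = _
  generalize MvPolynomial.aeval T f = u
  induction u using TensorProduct.induction_on with
  | zero => simp
  | add p q hp hq => simp only [map_add, LinearMap.add_apply, hp, hq]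
  | tmul g q =>
    have : (g ⊗ₜ[F] q : DPoly F k) = (g ⊗ₜ 1) * (1 ⊗ₜ q) := by simp
    rw [this, map_mul (dact F N k), Module.End.mul_apply, dact_one_tmul, dact_tmul_one]
    simp [TensorProduct.smul_tmul']

@[simp] lemma subst_one {l k : ℕ} (T : Fin l → DPoly F k) (n : N) :
    subst F T ((1 : MvPolynomial (Fin l) F) ⊗ₜ n) = 1 ⊗ₜ n := by
  simp [subst_tmul]

lemma subst_X {l k : ℕ} (T : Fin l → DPoly F k) (i : Fin l) (p : P F l N) :
    subst F T ((MvPolynomial.X i : MvPolynomial (Fin l) F) • p) =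
      dact F N k (T i) (subst F T p) := by
  induction p using TensorProduct.induction_on with
  | zero => simp
  | add p q hp hq => simp only [smul_add, map_add, hp, hq]
  | tmul g n =>
    rw [TensorProduct.smul_tmul', subst_tmul, subst_tmul, smul_eq_mul, map_mul, map_mul,
      Module.End.mul_apply, MvPolynomial.aeval_X]

lemma dact_DP {k : ℕ} (u : DPoly F k) (p : P F k N) :
    dact F N k u (DP F k p) = DP F k (dact F N k u p) := by
  rw [← dact_del, ← Module.End.mul_apply, ← map_mul, mul_comm, map_mul, Module.End.mul_apply,
    dact_del]

lemma subst_DP {l k : ℕ} (T : Fin l → DPoly F k) (p : P F l N) :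
    subst F T (DP F l p) = DP F k (subst F T p) := by
  induction p using P_induction with
  | one n => rw [DP_tmul, subst_one, subst_one, DP_tmul]
  | mulX i p hp => rw [DP_smul, subst_X, hp, subst_X, dact_DP]
  | add p q hp hq => simp only [map_add, hp, hq]

lemma subst_smul_sum {l k : ℕ} (T : Fin l → DPoly F k) (p : P F l N) :
    subst F T ((∑ i, MvPolynomial.X i : MvPolynomial (Fin l) F) • p) =
      dact F N k (∑ i, T i) (subst F T p) := by
  rw [Finset.sum_smul, map_sum, map_sum, LinearMap.sum_apply]
  exact Finset.sum_congr rfl fun i _ => subst_X T i p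

lemma ren_one {l k : ℕ} (f : Fin l → Fin k) (n : N) :
    ren F f ((1 : MvPolynomial (Fin l) F) ⊗ₜ n) = 1 ⊗ₜ n := subst_one _ n

lemma ren_X {l k : ℕ} (f : Fin l → Fin k) (i : Fin l) (p : P F l N) :
    ren F f ((MvPolynomial.X i : MvPolynomial (Fin l) F) • p) =
      (MvPolynomial.X (f i) : MvPolynomial (Fin k) F) • ren F f p := by
  rw [ren, subst_X, dact_lam]

lemma ren_DP {l k : ℕ} (f : Fin l → Fin k) (p : P F l N) :
    ren F f (DP F l p) = DP F k (ren F f p) := subst_DP _ p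

lemma subst_ren {l k m : ℕ} (T : Fin k → DPoly F m) (f : Fin l → Fin k) (p : P F l N) :
    subst F T (ren F f p) = subst F (T ∘ f) p := by
  induction p using P_induction with
  | one n => rw [ren_one, subst_one, subst_one]
  | mulX i p hp => rw [ren_X, subst_X, hp, subst_X]; rfl
  | add p q hp hq => simp only [map_add, hp, hq]

lemma ren_ren {l k m : ℕ} (g : Fin k → Fin m) (f : Fin l → Fin k) (p : P F l N) :
    ren F g (ren F f p) = ren F (g ∘ f) p := subst_ren _ f p

@[simp] lemma ren_id {k : ℕ} (p : P F k N) : ren F id p = p := by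
  induction p using P_induction with
  | one n => rw [ren_one]
  | mulX i p hp => rw [ren_X, hp]; rfl
  | add p q hp hq => simp only [map_add, hp, hq]

lemma ev_ren {l k : ℕ} (f : Fin l → Fin k) (s : Fin k → F) (p : P F l N) :
    ev F s (ren F f p) = ev F (s ∘ f) p := by
  induction p using P_induction with
  | one n => rw [ren_one, ev_one, ev_one]
  | mulX i p hp => rw [ren_X, ev_smul, ev_smul, hp]; simp
  | add p q hp hq => simp only [map_add, hp, hq]

/-- Substitution of polynomials that do not involve `∂`. -/
lemma ev_subst {l k : ℕ} (T : Fin l → MvPolynomial (Fin k) F) (s : Fin k → F) (p : P F l N) :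
    ev F s (subst F (fun i => T i ⊗ₜ 1) p) = ev F (fun i => MvPolynomial.eval s (T i)) p := by
  induction p using P_induction with
  | one n => rw [subst_one, ev_one, ev_one]
  | mulX i p hp => rw [subst_X, dact_tmul_one, ev_smul, ev_smul, hp]; simp
  | add p q hp hq => simp only [map_add, hp, hq]

omit [Module F[X] N] [IsScalarTower F F[X] N] in
lemma bind_tmul {E : Type w} [AddCommGroup E] [Module F E] {k : ℕ}
    (q : MvPolynomial (Fin k) F) (g : E →ₗ[F] P F k N) (f : MvPolynomial (Fin 1) F) (e : E) :
    bind q g (f ⊗ₜ e) = MvPolynomial.aeval (fun _ => q) f • g e := rfl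

lemma bind_one {E : Type w} [AddCommGroup E] [Module F E] {k : ℕ}
    (q : MvPolynomial (Fin k) F) (g : E →ₗ[F] P F k N) (e : E) :
    bind q g (1 ⊗ₜ e) = g e := by
  rw [bind_tmul, map_one, one_smul]

lemma bind_X {E : Type w} [AddCommGroup E] [Module F E] {k : ℕ}
    (q : MvPolynomial (Fin k) F) (g : E →ₗ[F] P F k N) (i : Fin 1) (p : P F 1 E) :
    bind q g ((MvPolynomial.X i : MvPolynomial (Fin 1) F) • p) = q • bind q g p := by
  induction p using TensorProduct.induction_on with
  | zero => simp
  | add p q hp hq => simp only [smul_add, map_add, hp, hq]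
  | tmul f e =>
    rw [TensorProduct.smul_tmul', bind_tmul, bind_tmul, smul_eq_mul, map_mul, mul_smul,
      MvPolynomial.aeval_X]

lemma ev_bind {E : Type w} [AddCommGroup E] [Module F E] {k : ℕ}
    (q : MvPolynomial (Fin k) F) (g : E →ₗ[F] P F k N) (s : Fin k → F) (p : P F 1 E) :
    ev F s (bind q g p) = ev F s (g (ev F (fun _ => MvPolynomial.eval s q) p)) := by
  induction p using P_induction with
  | one n => rw [bind_one, ev_one]
  | mulX i p hp => rw [bind_X, ev_smul, hp, ev_smul, map_smul, map_smul]; simp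
  | add p q hp hq => simp only [map_add, hp, hq]

lemma actAt_tmul {k : ℕ} (g : N →ₗ[F] P F 1 N) (i : Fin k) (f : MvPolynomial (Fin k) F) (n : N) :
    actAt g i (f ⊗ₜ n) = f • ren F (fun _ => i) (g n) := rfl

@[simp] lemma actAt_smul {k : ℕ} (g : N →ₗ[F] P F 1 N) (i : Fin k) (f : MvPolynomial (Fin k) F)
    (p : P F k N) : actAt g i (f • p) = f • actAt g i p := by
  induction p using TensorProduct.induction_on with
  | zero => simp
  | add p q hp hq => simp only [smul_add, map_add, hp, hq]
  | tmul f e => rw [TensorProduct.smul_tmul', actAt_tmul, actAt_tmul, smul_eq_mul, mul_smul]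

lemma ev_actAt {k : ℕ} (g : N →ₗ[F] P F 1 N) (i : Fin k) (s : Fin k → F) (p : P F k N) :
    ev F s (actAt g i p) = ev F (fun _ => s i) (g (ev F s p)) := by
  induction p using TensorProduct.induction_on with
  | zero => simp
  | add p q hp hq => simp only [map_add, hp, hq]
  | tmul f n =>
    rw [actAt_tmul, ev_smul, ev_tmul, ev_ren, map_smul, map_smul]
    rfl

variable (F N) in
/-- The operator `∂ + λ₁ + ⋯ + λₖ`. -/
def ThP (k : ℕ) : P F k N →ₗ[MvPolynomial (Fin k) F] P F k N where
  toFun p := DP F k p + (∑ i, MvPolynomial.X i : MvPolynomial (Fin k) F) • p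
  map_add' p q := by rw [map_add, smul_add]; abel
  map_smul' f p := by
    simp only [DP_smul, RingHom.id_apply, smul_add]
    rw [smul_comm f]

lemma ThP_apply {k : ℕ} (p : P F k N) :
    ThP F N k p = DP F k p + (∑ i, MvPolynomial.X i : MvPolynomial (Fin k) F) • p := rfl

lemma ev_ThP {k : ℕ} (s : Fin k → F) (p : P F k N) :
    ev F s (ThP F N k p) = D F N (ev F s p) + (∑ i, s i) • ev F s p := by
  simp [ThP_apply]

lemma subst_ThP {l k : ℕ} (T : Fin l → DPoly F k) (p : P F l N) :
    subst F T (ThP F N l p) = dact F N k (del F k + ∑ i, T i) (subst F T p) := by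
  rw [ThP_apply, map_add, subst_DP, subst_smul_sum, map_add, LinearMap.add_apply, dact_del]

lemma dact_del_add_sum {k : ℕ} (p : P F k N) :
    dact F N k (del F k + ∑ i, lam F i) p = ThP F N k p := by
  rw [map_add, map_sum, LinearMap.add_apply, LinearMap.sum_apply, dact_del, ThP_apply,
    Finset.sum_smul]
  simp

/-- The defining property of `λ†`: the reduction kills `∂ + λ₁ + ⋯ + λₖ₊₁`. -/
lemma sum_lamDag (k : ℕ) : del F k + ∑ i, lamDag F k i = 0 := by
  rw [Fin.sum_univ_castSucc]
  simp only [lamDag, dag, Fin.snoc_castSucc, Fin.snoc_last]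
  abel

/-- The reduction `λₖ₊₁ ↦ λ†`. -/
lemma red_ThP {k : ℕ} (p : P F (k + 1) N) : subst F (lamDag F k) (ThP F N (k + 1) p) = 0 := by
  rw [subst_ThP, sum_lamDag, map_zero, LinearMap.zero_apply]

lemma ren_perm_ThP {k : ℕ} (σ : Equiv.Perm (Fin k)) (p : P F k N) :
    ren F σ (ThP F N k p) = ThP F N k (ren F σ p) := by
  rw [ren, subst_ThP, Equiv.sum_comp σ (fun i => lam F i), dact_del_add_sum]

lemma red_lift {k : ℕ} (p : P F k N) : subst F (lamDag F k) (ren F Fin.castSucc p) = p := by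
  rw [subst_ren]
  have : lamDag F k ∘ Fin.castSucc = fun i => lam F (id i) := by
    ext i; simp [lamDag]
  rw [this]
  exact ren_id p

/-- Modulo `∂ + λ₁ + ⋯ + λₖ₊₁` the last variable equals `λ†`, so a polynomial is congruent to its
reduction, regarded as independent of the last variable. -/
lemma lift_red_sub {k : ℕ} (p : P F (k + 1) N) :
    ∃ q, p - ren F Fin.castSucc (subst F (lamDag F k) p) = ThP F N (k + 1) q := by
  induction p using P_induction with
  | one n => exact ⟨0, by rw [subst_one, ren_one, sub_self, map_zero]⟩
  | add p q hp hq =>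
    obtain ⟨p', hp⟩ := hp
    obtain ⟨q', hq⟩ := hq
    exact ⟨p' + q', by rw [map_add, map_add, map_add, ← hp, ← hq]; abel⟩
  | mulX i p hp =>
    obtain ⟨p', hp⟩ := hp
    cases i using Fin.lastCases with
    | cast i =>
      refine ⟨(MvPolynomial.X i.castSucc : MvPolynomial (Fin (k + 1)) F) • p', ?_⟩
      rw [map_smul (ThP F N (k + 1)), ← hp, subst_X]
      simp only [lamDag, Fin.snoc_castSucc, dact_lam]
      rw [ren_X, smul_sub]
    | last =>
      -- The first summand arises because `λₖ₊₁ - λ†` is the operator `∂ + λ₁ + ⋯ + λₖ₊₁` itself.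
      refine ⟨ren F Fin.castSucc (subst F (lamDag F k) p) +
        (MvPolynomial.X (Fin.last k) : MvPolynomial (Fin (k + 1)) F) • p', ?_⟩
      rw [map_add, map_smul (ThP F N (k + 1)), ← hp, subst_X]
      simp only [lamDag, Fin.snoc_last, dag]
      rw [map_sub, map_neg, map_sum, LinearMap.sub_apply, LinearMap.neg_apply,
        LinearMap.sum_apply, dact_del]
      simp only [dact_lam]
      rw [map_sub, map_neg, map_sum, smul_sub, ThP_apply]
      simp only [ren_X]
      rw [ren_DP, Fin.sum_univ_castSucc, add_smul, Finset.sum_smul]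
      abel

lemma red_eq_zero_iff {k : ℕ} (p : P F (k + 1) N) :
    subst F (lamDag F k) p = 0 ↔ p ∈ LinearMap.range (ThP F N (k + 1)) := by
  constructor
  · intro h
    obtain ⟨q, hq⟩ := lift_red_sub p
    rw [h, map_zero, sub_zero] at hq
    exact ⟨q, hq.symm⟩
  · rintro ⟨q, rfl⟩
    exact red_ThP q

/-- The automorphism `λₖ₊₁ ↦ λₖ₊₁ - λ₁ - ⋯ - λₖ - ∂` shows that `∂ + λ₁ + ⋯ + λₖ₊₁` is injective. -/
lemma ThP_injective (k : ℕ) : Function.Injective (ThP F N (k + 1)) := by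
  let T : Fin (k + 1) → DPoly F (k + 1) := Fin.snoc (α := fun _ => DPoly F (k + 1))
    (fun i => lam F i.castSucc) (lam F (Fin.last k) - ∑ i : Fin k, lam F i.castSucc - del F (k + 1))
  let T' : Fin (k + 1) → DPoly F (k + 1) := Fin.snoc (α := fun _ => DPoly F (k + 1))
    (fun i => lam F i.castSucc) (lam F (Fin.last k) + ∑ i : Fin k, lam F i.castSucc + del F (k + 1))
  have hT : ∀ p : P F (k + 1) N, subst F T' (subst F T p) = p := by
    intro p
    induction p using P_induction with
    | one n => rw [subst_one, subst_one]
    | add p q hp hq => rw [map_add, map_add, hp, hq]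
    | mulX i p hp =>
      cases i using Fin.lastCases with
      | cast i =>
        rw [subst_X]
        simp only [T, Fin.snoc_castSucc, dact_lam]
        rw [subst_X, hp]
        simp only [T', Fin.snoc_castSucc, dact_lam]
      | last =>
        rw [subst_X]
        simp only [T, Fin.snoc_last, map_sub, map_sum, LinearMap.sub_apply, LinearMap.sum_apply,
          dact_lam, dact_del]
        rw [subst_X, subst_DP, hp]
        simp only [subst_X]
        simp only [T', Fin.snoc_last, Fin.snoc_castSucc, map_add, map_sum, LinearMap.add_apply,
          LinearMap.sum_apply, dact_lam, dact_del]
        rw [hp]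
        abel
  rw [← LinearMap.ker_eq_bot, LinearMap.ker_eq_bot']
  intro p hp
  have h := subst_ThP T p
  rw [hp, map_zero] at h
  -- The change of variables turns the operator into multiplication by the last variable.
  have hs : del F (k + 1) + ∑ i, T i = lam F (Fin.last k) := by
    rw [Fin.sum_univ_castSucc]
    simp only [T, Fin.snoc_castSucc, Fin.snoc_last]
    abel
  rw [hs, dact_lam] at h
  rw [← hT p, smul_P_eq_zero (MvPolynomial.X_ne_zero _) h.symm, map_zero]

end PolyTools

/-! ### Cartan calculus for a Leibniz algebra `g` with a module `M` -/

section Leibniz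

variable {F : Type u} [Field F] {g : Type v} [AddCommGroup g] [Module F g]
  {M : Type w} [AddCommGroup M] [Module F M]

variable (F g M) in
/-- Multilinear cochains on `g` with values in `M`. -/
abbrev MG (k : ℕ) := MultilinearMap F (fun _ : Fin k => g) M

/-- The operators on cochains are defined by recursion on their contractions; this lemma makes
induction on the degree the method of proof. -/
lemma MG.curry_ext {k : ℕ} {ω ω' : MG F g M (k + 1)} (h : ∀ x, ω.curryLeft x = ω'.curryLeft x) :
    ω = ω' := by
  ext x
  have := congrArg (fun f => f (Fin.tail x)) (h (x 0))
  simpa using this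

variable (F g M) in
/-- The derivation of cochains induced by endomorphisms of `g` and of `M`. -/
def derMG : ∀ k, (Module.End F g × Module.End F M) →ₗ[F] MG F g M k →ₗ[F] MG F g M k
  | 0 => LinearMap.mk₂ F (fun p ω => p.2.compMultilinearMap ω)
      (fun p q ω => by ext; simp) (fun c p ω => by ext; simp) (fun p ω ω' => by ext; simp)
      (fun c p ω => by ext; simp)
  | k + 1 => LinearMap.mk₂ F
      (fun p ω => LinearMap.uncurryLeft (derMG k p ∘ₗ ω.curryLeft - ω.curryLeft ∘ₗ p.1))
      (fun p q ω => MG.curry_ext fun x => by ext; simp; abel)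
      (fun c p ω => MG.curry_ext fun x => by ext; simp [smul_sub])
      (fun p ω ω' => MG.curry_ext fun x => by
        have : (ω + ω').curryLeft = ω.curryLeft + ω'.curryLeft := rfl
        ext; simp [this]; abel)
      (fun c p ω => MG.curry_ext fun x => by
        have : (c • ω).curryLeft = c • ω.curryLeft := rfl
        ext; simp [this, smul_sub])

lemma derMG_zero (p : Module.End F g × Module.End F M) (ω : MG F g M 0) (x) :
    derMG F g M 0 p ω x = p.2 (ω x) := rfl

lemma curry_derMG {k : ℕ} (p : Module.End F g × Module.End F M) (ω : MG F g M (k + 1)) (x : g) :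
    (derMG F g M (k + 1) p ω).curryLeft x =
      derMG F g M k p (ω.curryLeft x) - ω.curryLeft (p.1 x) := by
  ext y
  simp [derMG]

lemma derMG_apply {k : ℕ} (p : Module.End F g × Module.End F M) (ω : MG F g M k) (x : Fin k → g) :
    derMG F g M k p ω x = p.2 (ω x) - ∑ r, ω (Function.update x r (p.1 (x r))) := by
  induction k with
  | zero => simp [derMG_zero]
  | succ k ih =>
    obtain ⟨x0, y, rfl⟩ : ∃ x0 y, x = Fin.cons x0 y := ⟨x 0, Fin.tail x, by simp⟩
    have h := congrArg (fun f => f y) (curry_derMG p ω x0)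
    simp only [MultilinearMap.curryLeft_apply, sub_apply, ih] at h
    rw [h, Fin.sum_univ_succ, sub_sub, add_comm (∑ r, _)]
    simp only [Fin.cons_zero, Fin.cons_succ, Fin.update_cons_zero, Fin.cons_update]

/-- Pairs of endomorphisms act on cochains as a Lie algebra; contracting by one argument lowers the
degree. -/
lemma derMG_comm {k : ℕ} (p q : Module.End F g × Module.End F M) (ω : MG F g M k) :
    derMG F g M k p (derMG F g M k q ω) - derMG F g M k q (derMG F g M k p ω) =
      derMG F g M k (p * q - q * p) ω := by
  induction k with
  | zero => ext x; simp [derMG_zero]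
  | succ k ih =>
    refine MG.curry_ext fun x => ?_
    have h : ∀ a b : MG F g M (k + 1), (a - b).curryLeft x = a.curryLeft x - b.curryLeft x :=
      fun a b => rfl
    rw [h]
    repeat rw [curry_derMG]
    rw [map_sub, map_sub, ← ih]
    simp only [Prod.fst_sub, LinearMap.sub_apply, map_sub, Prod.fst_mul, Module.End.mul_apply]
    abel

/-- A (left) Leibniz algebra with a module. -/
structure LeibnizData (F : Type u) [Field F] (g : Type v) [AddCommGroup g] [Module F g]
    (M : Type w) [AddCommGroup M] [Module F M] where
  br : g →ₗ[F] g →ₗ[F] g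
  ac : g →ₗ[F] M →ₗ[F] M
  leibniz : ∀ x y z, br x (br y z) = br (br x y) z + br y (br x z)
  ac_br : ∀ x y m, ac (br x y) m = ac x (ac y m) - ac y (ac x m)

namespace LeibnizData

variable (G : LeibnizData F g M)

/-- The Lie derivative. -/
def lie (k : ℕ) : g →ₗ[F] MG F g M k →ₗ[F] MG F g M k := derMG F g M k ∘ₗ G.br.prod G.ac

lemma lie_apply' {k : ℕ} (x : g) (ω : MG F g M k) :
    G.lie k x ω = derMG F g M k (G.br x, G.ac x) ω := rfl

/-- The differential of the Leibniz complex. -/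
def dL : ∀ k, MG F g M k →ₗ[F] MG F g M (k + 1)
  | 0 => (multilinearCurryLeftEquiv F (fun _ : Fin 1 => g) M).symm.toLinearMap ∘ₗ (G.lie 0).flip
  | k + 1 => (multilinearCurryLeftEquiv F (fun _ : Fin (k + 2) => g) M).symm.toLinearMap ∘ₗ
      ((G.lie (k + 1)).flip - (dL k).compRight F ∘ₗ
        (multilinearCurryLeftEquiv F (fun _ : Fin (k + 1) => g) M).toLinearMap)

lemma curry_dL_zero (ω : MG F g M 0) (x : g) : (G.dL 0 ω).curryLeft x = G.lie 0 x ω := by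
  ext y
  simp [dL]

lemma curry_dL {k : ℕ} (ω : MG F g M (k + 1)) (x : g) :
    (G.dL (k + 1) ω).curryLeft x = G.lie (k + 1) x ω - G.dL k (ω.curryLeft x) := by
  ext y
  simp [dL]

/-- A pair of endomorphisms of `g` and `M` compatible with the bracket and the action. -/
structure IsDer (p : Module.End F g × Module.End F M) : Prop where
  br : ∀ x y, p.1 (G.br x y) = G.br (p.1 x) y + G.br x (p.1 y)
  ac : ∀ x m, p.2 (G.ac x m) = G.ac (p.1 x) m + G.ac x (p.2 m)

lemma isDer_lie (x : g) : G.IsDer (G.br x, G.ac x) where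
  br := G.leibniz x
  ac y m := by simp [G.ac_br]

variable {G}

/-- The commutator of the pairs `p` and `(G.br x, G.ac x)` is the pair of `p.1 x`, precisely because
`p` is a derivation; the rest is `derMG_comm`. -/
lemma IsDer.lie {p : Module.End F g × Module.End F M} (hp : G.IsDer p) {k : ℕ} (x : g)
    (ω : MG F g M k) :
    derMG F g M k p (G.lie k x ω) = G.lie k x (derMG F g M k p ω) + G.lie k (p.1 x) ω := by
  rw [← sub_eq_iff_eq_add', lie_apply', lie_apply', derMG_comm, lie_apply']
  congr 2
  ext1
  · ext y
    simp [hp.br]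
  · ext m
    simp [hp.ac]

/-- Induction through `(dω)(x) = L_x ω - d(ω(x))`. It is used twice: for the inner derivations it
gives `[L_x, d] = 0`, and for `ptScale` it gives the compatibility of the differential with `∂ + λ₁
+ ⋯ + λₖ`. -/
lemma IsDer.dL {p : Module.End F g × Module.End F M} (hp : G.IsDer p) {k : ℕ}
    (ω : MG F g M k) :
    derMG F g M (k + 1) p (G.dL k ω) = G.dL k (derMG F g M k p ω) := by
  induction k with
  | zero =>
    refine MG.curry_ext fun x => ?_
    rw [curry_derMG, curry_dL_zero, curry_dL_zero, curry_dL_zero, hp.lie]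
    abel
  | succ k ih =>
    refine MG.curry_ext fun x => ?_
    rw [curry_derMG, curry_dL, curry_dL, curry_dL, map_sub, ih, hp.lie, curry_derMG, map_sub]
    abel

variable (G)

lemma lie_dL {k : ℕ} (x : g) (ω : MG F g M k) :
    G.lie (k + 1) x (G.dL k ω) = G.dL k (G.lie k x ω) := (G.isDer_lie x).dL ω

/-- Contracted by `x`, the left side is `L_x dω - d(L_x ω) + d(d(ω(x)))`: the first two terms cancel
by `lie_dL` and the last vanishes by induction. -/
lemma dL_dL {k : ℕ} (ω : MG F g M k) : G.dL (k + 1) (G.dL k ω) = 0 := by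
  induction k with
  | zero =>
    refine MG.curry_ext fun x => ?_
    rw [curry_dL, curry_dL_zero, lie_dL, sub_self]
    rfl
  | succ k ih =>
    refine MG.curry_ext fun x => ?_
    rw [curry_dL, curry_dL, map_sub, ih, lie_dL, sub_zero, sub_self]
    rfl

/-- Since the bracket is only a left Leibniz bracket, every argument acts on the value and on the
arguments that stand after it, each result replacing the argument acted upon. This is the recursion
unfolded. -/
lemma dL_apply {k : ℕ} (ω : MG F g M k) (x : Fin (k + 1) → g) :
    G.dL k ω x = ∑ i : Fin (k + 1), (-1 : F) ^ (i : ℕ) •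
      (G.ac (x i) (ω (x ∘ i.succAbove)) - ∑ r : Fin k, if i ≤ r.castSucc then
        ω (Function.update (x ∘ i.succAbove) r (G.br (x i) (x (i.succAbove r)))) else 0) := by
  induction k with
  | zero =>
    have h := congrArg (fun f => f (Fin.tail x)) (G.curry_dL_zero ω (x 0))
    simp only [MultilinearMap.curryLeft_apply, Fin.cons_self_tail] at h
    rw [h, lie_apply', derMG_zero, Fin.sum_univ_one]
    simp only [Finset.univ_eq_empty, Finset.sum_empty, sub_zero, Fin.val_zero, pow_zero, one_smul]
    rfl
  | succ k ih =>
    obtain ⟨x0, y, rfl⟩ : ∃ x0 y, x = Fin.cons x0 y := ⟨x 0, Fin.tail x, by simp⟩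
    have h := congrArg (fun f => f y) (G.curry_dL ω x0)
    simp only [MultilinearMap.curryLeft_apply, sub_apply] at h
    have e : (Fin.cons x0 y : Fin (k + 2) → g) ∘ Fin.succAbove 0 = y := by
      funext r
      simp
    rw [h, lie_apply', derMG_apply, ih, Fin.sum_univ_succ (n := k + 1), sub_eq_add_neg, ← Finset.sum_neg_distrib]
    congr 1
    · rw [Fin.val_zero, pow_zero, one_smul]
      simp only [Fin.cons_zero, Fin.zero_le, if_true, Fin.succAbove_zero, Fin.cons_succ]
      erw [e]
    · refine Finset.sum_congr rfl fun i _ => ?_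
      simp only [Fin.cons_succ]
      rw [Fin.val_succ, pow_succ, mul_neg_one, neg_smul]
      have e1 : (Fin.cons x0 y : Fin (k + 2) → g) ∘ i.succ.succAbove =
          Fin.cons (α := fun _ => g) x0 (y ∘ i.succAbove) := by
        funext r
        cases r using Fin.cases <;> simp
      -- The argument `x0` stands before the acting one, so it is not acted upon.
      rw [e1, Fin.sum_univ_succ, if_neg (by simp), zero_add]
      congr 2
      refine congrArg₂ _ rfl (Finset.sum_congr rfl fun r _ => ?_)
      rw [← Fin.succ_castSucc]
      simp only [Fin.succ_le_succ_iff, Fin.succ_succAbove_succ, Fin.cons_succ, ← Fin.cons_update]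
      rfl

end LeibnizData

/-! #### Skew-symmetric cochains -/

/-- Skew-symmetry of cochains. -/
def IsSkew {k : ℕ} (ω : MG F g M k) : Prop :=
  ∀ (σ : Equiv.Perm (Fin k)) x, ω (x ∘ σ) = (Equiv.Perm.sign σ : ℤ) • ω x

/-- `Equiv.Perm.decomposeFin.symm (0, σ)` is `σ` extended by a fixed first index. -/
lemma cons_comp_decomposeFin {X : Type*} {k : ℕ} (x : X) (y : Fin k → X)
    (σ : Equiv.Perm (Fin k)) :
    (Fin.cons x y : Fin (k + 1) → X) ∘ (Equiv.Perm.decomposeFin.symm (0, σ)) =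
      Fin.cons x (y ∘ σ) := by
  funext r
  cases r using Fin.cases <;> simp

lemma IsSkew.curryLeft {k : ℕ} {ω : MG F g M (k + 1)} (h : IsSkew ω) (x : g) :
    IsSkew (ω.curryLeft x) := fun σ y => by
  rw [MultilinearMap.curryLeft_apply, MultilinearMap.curryLeft_apply]
  erw [← cons_comp_decomposeFin, h]
  simp

lemma IsSkew.curry_curry {k : ℕ} {ω : MG F g M (k + 2)} (h : IsSkew ω) (x y : g) :
    (ω.curryLeft x).curryLeft y + (ω.curryLeft y).curryLeft x = 0 := by
  ext z
  have := h (Equiv.swap 0 1) (Fin.cons y (Fin.cons x z))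
  rw [Equiv.Perm.sign_swap (by simp)] at this
  have e : (Fin.cons y (Fin.cons x z : Fin (k + 1) → g) : Fin (k + 2) → g) ∘ (Equiv.swap 0 1) =
      Fin.cons x (Fin.cons y z : Fin (k + 1) → g) := by
    funext r
    refine Fin.cases ?_ (fun r => Fin.cases ?_ (fun r => ?_) r) r
    · simp
    · simp
    · rw [Function.comp_apply, Equiv.swap_apply_of_ne_of_ne]
      · simp
      · simp
      · simp [Fin.ext_iff]
  rw [e] at this
  simp only [add_apply, MultilinearMap.curryLeft_apply, this]
  simp

/-- Exchanging the equal arguments gives `ω x = -ω x`, and `2` is invertible. -/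
lemma IsSkew.alternating [CharZero F] {k : ℕ} {ω : MG F g M k} (h : IsSkew ω) {x : Fin k → g}
    {i j : Fin k} (hx : x i = x j) (hij : i ≠ j) : ω x = 0 := by
  have := h (Equiv.swap i j) x
  rw [Equiv.Perm.sign_swap hij] at this
  have e : x ∘ Equiv.swap i j = x := by
    funext r
    rw [Function.comp_apply, Equiv.swap_apply_def]
    split_ifs <;> simp_all
  rw [e] at this
  have h2 : (2 : F) • ω x = 0 := by
    rw [two_smul]
    nth_rw 1 [this]
    simp
  exact (smul_eq_zero.1 h2).resolve_left two_ne_zero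

/-- Both values are compared with the one that has `z` in the first place. This moves a bracket from
the place where `dL_apply` leaves it to the last place, as in the usual formula for the
differential. -/
lemma IsSkew.map_insertNth [CharZero F] {k : ℕ} {ω : MG F g M (k + 1)} (h : IsSkew ω)
    (r : Fin (k + 1)) (z : g) (x : Fin k → g) :
    ω (r.insertNth z x) = (-1 : F) ^ (k + (r : ℕ)) • ω (Fin.snoc (α := fun _ => g) x z) := by
  let f : AlternatingMap F g M (Fin (k + 1)) :=
    { ω with map_eq_zero_of_eq' := fun x i j hx hij => h.alternating hx hij }
  have h1 : ω (r.insertNth z x) = (-1 : ℤ) ^ (r : ℕ) • ω (Matrix.vecCons z x) :=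
    f.map_insertNth r z x
  have h2 : ω ((Fin.last k).insertNth z x) = (-1 : ℤ) ^ k • ω (Matrix.vecCons z x) := by
    have := f.map_insertNth (Fin.last k) z x
    rwa [Fin.val_last] at this
  rw [Fin.insertNth_last'] at h2
  rw [h1, h2, ← Int.cast_smul_eq_zsmul F, ← Int.cast_smul_eq_zsmul F, smul_smul]
  congr 1
  push_cast
  rw [pow_add]
  have : ((-1 : F) ^ k) * (-1) ^ k = 1 := by rw [← mul_pow]; simp
  linear_combination (-(-1 : F) ^ (r : ℕ)) * this

namespace LeibnizData

variable (G : LeibnizData F g M)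

/-- The differential of a skew-symmetric cochain fails to be skew-symmetric only through the
symmetric part of the Leibniz bracket. For polynomial cochains that part is absorbed by
sesquilinearity, see `symFun_mem`. -/
lemma dL_swap {k : ℕ} {ω : MG F g M k} (h : IsSkew ω) (j : Fin k) (x : Fin (k + 1) → g) :
    G.dL k ω x + G.dL k ω (x ∘ Equiv.swap j.castSucc j.succ) = (-1 : F) ^ ((j : ℕ) + 1) •
      ω (Function.update (x ∘ j.succ.succAbove) j
        (G.br (x j.castSucc) (x j.succ) + G.br (x j.succ) (x j.castSucc))) := by
  induction k with
  | zero => exact j.elim0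
  | succ k ih =>
    obtain ⟨x0, y, rfl⟩ : ∃ x0 y, x = Fin.cons x0 y := ⟨x 0, Fin.tail x, by simp⟩
    cases j using Fin.cases with
    | zero =>
      obtain ⟨x1, z, rfl⟩ : ∃ x1 z, y = Fin.cons x1 z := ⟨y 0, Fin.tail y, by simp⟩
      have e : (Fin.cons x0 (Fin.cons x1 z : Fin (k + 1) → g) : Fin (k + 2) → g) ∘
          (Equiv.swap (Fin.castSucc 0) (Fin.succ 0)) =
          Fin.cons x1 (Fin.cons x0 z : Fin (k + 1) → g) := by
        funext r
        refine Fin.cases ?_ (fun r => Fin.cases ?_ (fun r => ?_) r) r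
        · simp
        · simp
        · rw [Function.comp_apply, Equiv.swap_apply_of_ne_of_ne]
          · simp
          · simp
          · simp [Fin.ext_iff]
      have e2 : (Fin.cons x0 (Fin.cons x1 z : Fin (k + 1) → g) : Fin (k + 2) → g) ∘
          (Fin.succ (0 : Fin (k + 1))).succAbove = Fin.cons x0 z := by
        funext r
        cases r using Fin.cases <;> simp
      -- The recursion is unfolded twice. The Lie derivatives cancel in pairs, the second
      -- contractions cancel by skew-symmetry of `ω`, and only the brackets remain.
      have key : ((G.dL (k + 1) ω).curryLeft x0).curryLeft x1 +
          ((G.dL (k + 1) ω).curryLeft x1).curryLeft x0 =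
          - ω.curryLeft (G.br x0 x1 + G.br x1 x0) := by
        have hs : ∀ (a b : MG F g M (k + 1)) t, (a - b).curryLeft t =
            a.curryLeft t - b.curryLeft t := fun a b t => rfl
        rw [curry_dL, curry_dL, hs, hs]
        rw [lie_apply', lie_apply', curry_derMG, curry_derMG, map_add]
        cases k with
        | zero =>
          rw [curry_dL_zero, curry_dL_zero, lie_apply', lie_apply']
          abel
        | succ k =>
          rw [curry_dL, curry_dL, lie_apply', lie_apply']
          have := h.curry_curry x0 x1
          rw [← eq_neg_iff_add_eq_zero] at this
          rw [this, map_neg]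
          abel
      rw [e, e2]
      have := congrArg (fun f => f z) key
      simp only [add_apply, MultilinearMap.curryLeft_apply,
        neg_apply] at this
      erw [this]
      simp
    | succ j =>
      have e : (Fin.cons x0 y : Fin (k + 2) → g) ∘
          (Equiv.swap (Fin.castSucc j.succ) (Fin.succ j.succ)) =
          Fin.cons x0 (y ∘ Equiv.swap j.castSucc j.succ) := by
        funext r
        cases r using Fin.cases with
        | zero =>
          rw [Function.comp_apply, Equiv.swap_apply_of_ne_of_ne]
          · rfl
          · rw [← Fin.succ_castSucc]; exact (Fin.succ_ne_zero _).symm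
          · exact (Fin.succ_ne_zero _).symm
        | succ r =>
          simp only [Function.comp_apply, Fin.cons_succ, ← Fin.succ_castSucc,
            Equiv.swap_apply_def, Fin.succ_inj]
          split_ifs <;> rfl
      have e2 : (Fin.cons x0 y : Fin (k + 2) → g) ∘ (Fin.succ j.succ).succAbove =
          Fin.cons x0 (y ∘ j.succ.succAbove) := by
        funext r
        cases r using Fin.cases <;> simp
      have hd : ∀ y', G.dL (k + 1) ω (Fin.cons x0 y') =
          G.lie (k + 1) x0 ω y' - G.dL k (ω.curryLeft x0) y' := fun y' =>
        congrArg (fun f => f y') (G.curry_dL ω x0)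
      rw [e, e2, hd, hd]
      -- The Lie derivative of a skew-symmetric cochain is skew-symmetric, so it does not contribute
      -- when the first argument stays fixed.
      have hl : G.lie (k + 1) x0 ω (y ∘ Equiv.swap j.castSucc j.succ) =
          - G.lie (k + 1) x0 ω y := by
        have hne : j.castSucc ≠ j.succ := by simp [Fin.ext_iff]
        rw [lie_apply', derMG_apply, derMG_apply, h, Equiv.Perm.sign_swap hne]
        simp only [Units.val_neg, Units.val_one, neg_smul, one_smul, map_neg]
        rw [neg_sub, sub_eq_add_neg, add_comm, sub_eq_add_neg, add_left_inj,
          ← Finset.sum_neg_distrib]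
        refine Fintype.sum_equiv (Equiv.swap j.castSucc j.succ) _ _ fun r => ?_
        have := h (Equiv.swap j.castSucc j.succ) (Function.update y
          (Equiv.swap j.castSucc j.succ r) (G.br x0 (y (Equiv.swap j.castSucc j.succ r))))
        rw [Equiv.Perm.sign_swap hne] at this
        simp only [Units.val_neg, Units.val_one, neg_smul, one_smul] at this
        rw [neg_eq_iff_eq_neg, ← this]
        congr 1
        funext t
        simp only [Function.update_apply, Function.comp_apply, EmbeddingLike.apply_eq_iff_eq]
      have := ih (h.curryLeft x0) j y
      rw [hl]
      simp only [MultilinearMap.curryLeft_apply] at this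
      simp only [Fin.cons_succ, ← Fin.succ_castSucc, Fin.val_succ]
      rw [pow_succ, mul_neg_one, neg_smul, ← Fin.cons_update]
      erw [← this]
      abel

end LeibnizData

end Leibniz

/-! ### Cartan calculus with coefficients in a commutative algebra. -/

section LeibnizCartan

variable {F : Type u} [Field F] {g : Type v} [AddCommGroup g] [Module F g]
  {M : Type w} [NonUnitalCommRing M] [Module F M] [IsScalarTower F M M] [SMulCommClass F M M]

variable (F g) in
/-- Multiplication of cochains by an element of `M`. -/
def mulMG (k : ℕ) (m : M) : MG F g M k →ₗ[F] MG F g M k :=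
  LinearMap.compMultilinearMapₗ F (LinearMap.mulLeft F m)

lemma mulMG_apply {k : ℕ} (m : M) (ω : MG F g M k) (x : Fin k → g) :
    mulMG F g k m ω x = m * ω x := rfl

lemma curry_mulMG {k : ℕ} (m : M) (ω : MG F g M (k + 1)) (x : g) :
    (mulMG F g (k + 1) m ω).curryLeft x = mulMG F g k m (ω.curryLeft x) := rfl

lemma mulMG_comm {k : ℕ} (m n : M) (ω : MG F g M k) :
    mulMG F g k m (mulMG F g k n ω) = mulMG F g k n (mulMG F g k m ω) := by
  ext x
  simp only [mulMG_apply]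
  rw [← mul_assoc, mul_comm m, mul_assoc]

lemma mulMG_mulMG {k : ℕ} (m n : M) (ω : MG F g M k) :
    mulMG F g k m (mulMG F g k n ω) = mulMG F g k (m * n) ω := by
  ext x
  simp only [mulMG_apply, mul_assoc]

namespace LeibnizData

variable (G : LeibnizData F g M)

/-- The exterior product of the differential of `m` with a cochain. -/
def wedge (m : M) : ∀ k, MG F g M k →ₗ[F] MG F g M (k + 1)
  | 0 => (multilinearCurryLeftEquiv F (fun _ : Fin 1 => g) M).symm.toLinearMap ∘ₗ
      (LinearMap.mk₂ F (fun x ω => mulMG F g 0 (G.ac x m) ω)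
        (fun x y ω => by ext; simp [mulMG_apply, add_mul])
        (fun c x ω => by ext; simp [mulMG_apply, smul_mul_assoc])
        (fun x ω ω' => by simp) (fun c x ω => by simp)).flip
  | k + 1 => (multilinearCurryLeftEquiv F (fun _ : Fin (k + 2) => g) M).symm.toLinearMap ∘ₗ
      ((LinearMap.mk₂ F (fun x ω => mulMG F g (k + 1) (G.ac x m) ω)
        (fun x y ω => by ext; simp [mulMG_apply, add_mul])
        (fun c x ω => by ext; simp [mulMG_apply, smul_mul_assoc])
        (fun x ω ω' => by simp) (fun c x ω => by simp)).flip - (wedge m k).compRight F ∘ₗ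
        (multilinearCurryLeftEquiv F (fun _ : Fin (k + 1) => g) M).toLinearMap)

lemma curry_wedge_zero (m : M) (ω : MG F g M 0) (x : g) :
    (G.wedge m 0 ω).curryLeft x = mulMG F g 0 (G.ac x m) ω := by
  ext y
  simp [wedge]

lemma curry_wedge {k : ℕ} (m : M) (ω : MG F g M (k + 1)) (x : g) :
    (G.wedge m (k + 1) ω).curryLeft x =
      mulMG F g (k + 1) (G.ac x m) ω - G.wedge m k (ω.curryLeft x) := by
  ext y
  simp [wedge]

lemma wedge_mulMG {k : ℕ} (m n : M) (ω : MG F g M k) :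
    G.wedge m k (mulMG F g k n ω) = mulMG F g (k + 1) n (G.wedge m k ω) := by
  induction k with
  | zero =>
    refine MG.curry_ext fun x => ?_
    rw [curry_wedge_zero, curry_mulMG, curry_wedge_zero, mulMG_comm]
  | succ k ih =>
    refine MG.curry_ext fun x => ?_
    rw [curry_wedge, curry_mulMG, curry_mulMG, curry_wedge, ih, map_sub, mulMG_comm]

variable {G} (hG : ∀ x m n, G.ac x (m * n) = G.ac x m * n + m * G.ac x n)
include hG

lemma lie_mulMG {k : ℕ} (x : g) (m : M) (ω : MG F g M k) :
    G.lie k x (mulMG F g k m ω) = mulMG F g k m (G.lie k x ω) + mulMG F g k (G.ac x m) ω := by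
  ext y
  simp only [lie_apply', derMG_apply, add_apply, mulMG_apply, hG, mul_sub, Finset.mul_sum]
  abel

/-- The Leibniz rule `d(mω) = m dω + dm ∧ ω`; the recursion in `wedge` is the one forced by this
rule. -/
lemma dL_mulMG {k : ℕ} (m : M) (ω : MG F g M k) :
    G.dL k (mulMG F g k m ω) = mulMG F g (k + 1) m (G.dL k ω) + G.wedge m k ω := by
  have ha : ∀ {k} (a b : MG F g M (k + 1)) x, (a + b).curryLeft x = a.curryLeft x + b.curryLeft x :=
    fun a b x => rfl
  induction k with
  | zero =>
    refine MG.curry_ext fun x => ?_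
    rw [curry_dL_zero, ha, curry_wedge_zero, curry_mulMG, curry_dL_zero, lie_mulMG hG]
  | succ k ih =>
    refine MG.curry_ext fun x => ?_
    rw [curry_dL, ha, curry_wedge, curry_mulMG, curry_mulMG, ih, curry_dL, lie_mulMG hG, map_sub]
    abel

omit hG in
variable (G) in
/-- The Lie derivative along `m ⊗ x`, by Cartan's formula. -/
def lieX (m : M) (x : g) : ∀ k, MG F g M k → MG F g M k
  | 0, ω => mulMG F g 0 m ((G.dL 0 ω).curryLeft x)
  | k + 1, ω => G.dL k (mulMG F g k m (ω.curryLeft x)) +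
      mulMG F g (k + 1) m ((G.dL (k + 1) ω).curryLeft x)

/-- In `d(m ω(x)) + m (dω)(x)` the two terms `m d(ω(x))` cancel, which leaves a formula without the
differential. -/
lemma lieX_succ {k : ℕ} (m : M) (x : g) (ω : MG F g M (k + 1)) :
    G.lieX m x (k + 1) ω = mulMG F g (k + 1) m (G.lie (k + 1) x ω) + G.wedge m k (ω.curryLeft x) := by
  rw [lieX, dL_mulMG hG, curry_dL, map_sub]
  abel

/-- Cartan's formula for the commutator of a Lie derivative and a contraction. -/
lemma cartan {k : ℕ} {ω : MG F g M (k + 1)} (hω : IsSkew ω) (m n : M) (x y : g) :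
    G.lieX m x k (mulMG F g k n (ω.curryLeft y)) -
        mulMG F g k n ((G.lieX m x (k + 1) ω).curryLeft y) =
      mulMG F g k (m * n) (ω.curryLeft (G.br x y)) +
        mulMG F g k (m * G.ac x n) (ω.curryLeft y) - mulMG F g k (n * G.ac y m) (ω.curryLeft x) := by
  have ha : ∀ {k} (a b : MG F g M (k + 1)) x, (a + b).curryLeft x = a.curryLeft x + b.curryLeft x :=
    fun a b x => rfl
  cases k with
  | zero =>
    rw [lieX_succ hG, lieX, curry_dL_zero, lie_mulMG hG, ha, curry_mulMG, curry_wedge_zero,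
      lie_apply', lie_apply', curry_derMG]
    simp only [map_sub, map_add, mulMG_mulMG]
    rw [mul_comm n m]
    abel
  | succ k =>
    rw [lieX_succ hG, lieX_succ hG, lie_mulMG hG, ha, curry_mulMG, curry_wedge,
      lie_apply', lie_apply', curry_mulMG, curry_derMG, wedge_mulMG]
    -- The two exterior-product terms cancel because the contractions by `x` and `y` anticommute on
    -- `ω`.
    have h : (ω.curryLeft y).curryLeft x = - (ω.curryLeft x).curryLeft y :=
      eq_neg_of_add_eq_zero_left (hω.curry_curry y x)
    rw [h]
    simp only [map_sub, map_add, map_neg, mulMG_mulMG]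
    rw [mul_comm n m]
    abel

end LeibnizData

end LeibnizCartan

/-! ### The Leibniz algebra of points -/

section PointAlgebra

variable {F : Type u} [Field F]
  {A : Type v} [AddCommGroup A] [Module F A] [Module F[X] A] [IsScalarTower F F[X] A]
  {M : Type w} [AddCommGroup M] [Module F M] [Module F[X] M] [IsScalarTower F F[X] M]

variable (F A) in
/-- Formal sums of pairs `(s, a)`, written `a_s`, of an element of `A` and a value of `λ`. -/
abbrev Pts := Π₀ _ : F, A

open Classical in
variable (F) in
/-- The element `a_s`. -/
def pt (s : F) : A →ₗ[F] Pts F A := DFinsupp.lsingle (M := fun _ : F => A) s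

open Classical in
/-- Linear maps out of `Pts F A`. -/
def ptLift {N : Type*} [AddCommGroup N] [Module F N] (f : F → A →ₗ[F] N) : Pts F A →ₗ[F] N :=
  DFinsupp.lsum F f

@[simp] lemma ptLift_pt {N : Type*} [AddCommGroup N] [Module F N] (f : F → A →ₗ[F] N) (s : F)
    (a : A) : ptLift f (pt F s a) = f s a := by
  simp [ptLift, pt]

variable (F) in
/-- The value of a polynomial in one variable at `s`. -/
abbrev ev1 {N : Type*} [AddCommGroup N] [Module F N] (s : F) : P F 1 N →ₗ[F] N := ev F (fun _ => s)

variable (L : LieConformalAlgebra F A)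

/-- The Jacobi identity at `λ = s`, `μ = t`; its term in `λ + μ` is the reason for placing the
bracket of `a_s` and `b_t` at `s + t`. -/
lemma jacobi_ev (a b c : A) (s t : F) :
    ev1 F s (L.bracket a (ev1 F t (L.bracket b c))) =
      ev1 F (s + t) (L.bracket (ev1 F s (L.bracket a b)) c) +
        ev1 F t (L.bracket b (ev1 F s (L.bracket a c))) := by
  have h := congrArg (ev F (fun i : Fin 2 => if i = 0 then s else t)) (L.jacobi a b c)
  have e : ∀ q, ev F (fun i : Fin 2 => if i = 0 then s else t)
      (subst F (fun _ => lam F (0 : Fin 2) + lam F 1) q) = ev1 F (s + t) (q : P F 1 A) := by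
    intro q
    have := ev_subst (fun _ : Fin 1 => (MvPolynomial.X 0 + MvPolynomial.X 1 : MvPolynomial (Fin 2) F))
      (fun i : Fin 2 => if i = 0 then s else t) q
    simp only [TensorProduct.add_tmul, map_add, MvPolynomial.eval_X, if_true, one_ne_zero,
      if_false] at this
    exact this
  rw [ev_bind, map_sub, ev_actAt, ev_actAt, ev_ren, ev_ren, LinearMap.comp_apply, e,
    sub_eq_iff_eq_add] at h
  simpa [Function.comp_def] using h

/-- The bracket `[a_s, b_t] = [a_λ b]|_{λ = s}` placed at `s + t`. -/
def ptBr : Pts F A →ₗ[F] Pts F A →ₗ[F] Pts F A :=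
  ptLift fun s => LinearMap.flip (ptLift fun t => LinearMap.flip
    (L.bracket.compr₂ (pt F (s + t) ∘ₗ ev1 F s)))

lemma ptBr_pt (s t : F) (a b : A) :
    ptBr L (pt F s a) (pt F t b) = pt F (s + t) (ev1 F s (L.bracket a b)) := by
  simp [ptBr]

variable {L}
variable (V : LieConformalModule L M)

lemma act_jacobi_ev (a b : A) (m : M) (s t : F) :
    ev1 F s (V.act a (ev1 F t (V.act b m))) =
      ev1 F (s + t) (V.act (ev1 F s (L.bracket a b)) m) +
        ev1 F t (V.act b (ev1 F s (V.act a m))) := by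
  have h := congrArg (ev F (fun i : Fin 2 => if i = 0 then s else t)) (V.jacobi a b m)
  have e : ∀ q, ev F (fun i : Fin 2 => if i = 0 then s else t)
      (subst F (fun _ => lam F (0 : Fin 2) + lam F 1) q) = ev1 F (s + t) (q : P F 1 M) := by
    intro q
    have := ev_subst (fun _ : Fin 1 => (MvPolynomial.X 0 + MvPolynomial.X 1 : MvPolynomial (Fin 2) F))
      (fun i : Fin 2 => if i = 0 then s else t) q
    simp only [TensorProduct.add_tmul, map_add, MvPolynomial.eval_X, if_true, one_ne_zero,
      if_false] at this
    exact this
  rw [ev_bind, map_sub, ev_actAt, ev_actAt, ev_ren, ev_ren, LinearMap.comp_apply, e,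
    sub_eq_iff_eq_add] at h
  simpa [Function.comp_def] using h

/-- The action of `a_s` on `M`. -/
def ptAc : Pts F A →ₗ[F] M →ₗ[F] M := ptLift fun s => V.act.compr₂ (ev1 F s)

lemma ptAc_pt (s : F) (a : A) (m : M) : ptAc V (pt F s a) m = ev1 F s (V.act a m) := by
  simp [ptAc]

lemma pt_induction {motive : Pts F A → Prop} (x : Pts F A) (zero : motive 0)
    (add : ∀ x y, motive x → motive y → motive (x + y)) (h : ∀ s a, motive (pt F s a)) :
    motive x := by
  classical
  induction x using DFinsupp.induction with
  | h0 => exact zero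
  | ha i b f _ _ hf => exact add _ _ (h i b) hf

/-- The Leibniz algebra of points and its module `M`. -/
def ptData : LeibnizData F (Pts F A) M where
  br := ptBr L
  ac := ptAc V
  leibniz x y z := by
    induction x using pt_induction with
    | zero => simp
    | add x x' h h' => simp only [map_add, LinearMap.add_apply, h, h']; abel
    | h s a =>
    induction y using pt_induction with
    | zero => simp
    | add x x' h h' => simp only [map_add, LinearMap.add_apply, h, h']; abel
    | h t b =>
    induction z using pt_induction with
    | zero => simp
    | add x x' h h' => simp only [map_add, h, h']; abel
    | h r c =>
      rw [ptBr_pt, ptBr_pt, ptBr_pt, ptBr_pt, ptBr_pt, ptBr_pt, jacobi_ev, map_add, add_assoc,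
        add_left_comm t s r]
  ac_br x y m := by
    induction x using pt_induction with
    | zero => simp
    | add x x' h h' => simp only [map_add, LinearMap.add_apply, h, h']; abel
    | h s a =>
    induction y using pt_induction with
    | zero => simp
    | add x x' h h' => simp only [map_add, LinearMap.add_apply, h, h']; abel
    | h t b =>
      rw [ptBr_pt, ptAc_pt, ptAc_pt, ptAc_pt, ptAc_pt, ptAc_pt, act_jacobi_ev, add_sub_cancel_right]

variable (F A) in
/-- The endomorphism `a_s ↦ -s a_s`. -/
def ptScale : Pts F A →ₗ[F] Pts F A := ptLift fun s => -s • pt F s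

variable (F A) in
/-- The endomorphism `a_s ↦ (∂a)_s + s a_s`. -/
def ptDel : Pts F A →ₗ[F] Pts F A := ptLift fun s => pt F s ∘ₗ D F A + s • pt F s

lemma ptScale_pt (s : F) (a : A) : ptScale F A (pt F s a) = -(s • pt F s a) := by
  simp [ptScale]

lemma ptDel_pt (s : F) (a : A) : ptDel F A (pt F s a) = pt F s (D F A a) + s • pt F s a := by
  simp [ptDel]

/-- The bracket adds the indices `s` and `t`, so multiplication by the negative of the index is a
derivation. Compatibility with the action is sesquilinearity in the module argument. By `hat_thM`
the induced operator on cochains is `∂ + λ₁ + ⋯ + λₖ`. -/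
lemma isDer_ptScale : (ptData V).IsDer (ptScale F A, D F M) where
  br x y := by
    induction x using pt_induction with
    | zero => simp
    | add x x' h h' => simp only [map_add, LinearMap.add_apply, h, h']; abel
    | h s a =>
    induction y using pt_induction with
    | zero => simp
    | add x x' h h' => simp only [map_add, h, h']; abel
    | h t b =>
      simp only [ptData, ptScale_pt, map_neg, map_smul, LinearMap.neg_apply, LinearMap.smul_apply,
        ptBr_pt, add_smul]
      abel
  ac x m := by
    induction x using pt_induction with
    | zero => simp
    | add x x' h h' => simp only [map_add, LinearMap.add_apply, h, h']; abel
    | h s a =>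
      simp only [ptData, ptScale_pt, map_neg, map_smul, LinearMap.neg_apply, LinearMap.smul_apply,
        ptAc_pt, V.sesq_right, map_add, ev_DP, ev_smul, MvPolynomial.eval_X]
      abel

/-- Sesquilinearity in the left argument says that the elements `(∂a)_s + s a_s` annihilate from the
left. Therefore the Lie derivatives along these elements vanish, see `lie_ptDel`. -/
lemma ptBr_ptDel_left (L : LieConformalAlgebra F A) (x y : Pts F A) : ptBr L (ptDel F A x) y = 0 := by
  induction x using pt_induction with
  | zero => simp
  | add x x' h h' => simp only [map_add, LinearMap.add_apply, h, h', add_zero]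
  | h s a =>
  induction y using pt_induction with
  | zero => simp
  | add x x' h h' => simp only [map_add, h, h', add_zero]
  | h t b =>
    simp only [ptDel_pt, map_add, LinearMap.add_apply, map_smul, LinearMap.smul_apply, ptBr_pt,
      L.sesq_left, map_neg, ev_smul, MvPolynomial.eval_X]
    simp

lemma ptAc_ptDel (x : Pts F A) (m : M) : ptAc V (ptDel F A x) m = 0 := by
  induction x using pt_induction with
  | zero => simp
  | add x x' h h' => simp only [map_add, LinearMap.add_apply, h, h', add_zero]
  | h s a =>
    simp only [ptDel_pt, map_add, LinearMap.add_apply, map_smul, LinearMap.smul_apply, ptAc_pt,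
      V.sesq_left, map_neg, ev_smul, MvPolynomial.eval_X]
    simp

lemma lie_ptDel {k : ℕ} (x : Pts F A) : (ptData V).lie k (ptDel F A x) = 0 := by
  have h1 : (ptData V).br (ptDel F A x) = 0 := LinearMap.ext fun y => ptBr_ptDel_left L x y
  have h2 : (ptData V).ac (ptDel F A x) = 0 := LinearMap.ext fun y => ptAc_ptDel V x y
  ext1 ω
  rw [LeibnizData.lie_apply', h1, h2]
  exact (congrArg (fun f => f ω) (map_zero (derMG F (Pts F A) M k)) :)

/-! ### Polynomial cochains -/

variable (F A M) in
/-- Multilinear maps `A^k → F[λ₁, …, λₖ] ⊗ M`. -/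
abbrev Mult (k : ℕ) := MultilinearMap F (fun _ : Fin k => A) (P F k M)

open Classical in
/-- The extension of a multilinear map to the points. -/
def hat (k : ℕ) : Mult F A M k →ₗ[F] MG F (Pts F A) M k :=
  (MultilinearMap.fromDFinsuppEquiv (fun _ : Fin k => F) F).toLinearMap ∘ₗ
    LinearMap.pi fun s => LinearMap.compMultilinearMapₗ F (ev F s)

lemma hat_pt {k : ℕ} (γ : Mult F A M k) (s : Fin k → F) (a : Fin k → A) :
    hat k γ (fun i => pt F (s i) (a i)) = ev F s (γ a) := by
  classical
  simp only [hat, LinearMap.comp_apply, LinearEquiv.coe_coe]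
  exact MultilinearMap.fromDFinsuppEquiv_single (M := fun _ _ => A) _ s a

lemma MG_pt_ext {k : ℕ} {ω ω' : MG F (Pts F A) M k}
    (h : ∀ (s : Fin k → F) (a : Fin k → A),
      ω (fun i => pt F (s i) (a i)) = ω' (fun i => pt F (s i) (a i))) : ω = ω' := by
  classical
  refine MultilinearMap.dfinsupp_ext fun s => ?_
  ext a
  exact h s a

lemma hat_eq_iff {k : ℕ} {γ : Mult F A M k} {ω : MG F (Pts F A) M k} :
    hat k γ = ω ↔ ∀ s a, ω (fun i => pt F (s i) (a i)) = ev F s (γ a) :=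
  ⟨fun h s a => by rw [← h, hat_pt], fun h => MG_pt_ext fun s a => by rw [hat_pt, h]⟩

lemma hat_injective [CharZero F] (k : ℕ) : Function.Injective (hat (F := F) (A := A) (M := M) k) := by
  intro γ γ' h
  ext a
  refine ev_injective fun s => ?_
  rw [← hat_pt, h, hat_pt]

lemma update_pt {k : ℕ} (s : Fin k → F) (a : Fin k → A) (i : Fin k) (t : F) (b : A) :
    Function.update (fun i => pt F (s i) (a i)) i (pt F t b) =
      fun j => pt F (Function.update s i t j) (Function.update a i b j) := by
  funext j
  by_cases h : j = i
  · subst h; simp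
  · simp [h]

lemma hat_update {k : ℕ} (γ : Mult F A M k) (s : Fin k → F) (a : Fin k → A) (i : Fin k) (t : F)
    (b : A) : hat k γ (Function.update (fun i => pt F (s i) (a i)) i (pt F t b)) =
      ev F (Function.update s i t) (γ (Function.update a i b)) := by
  rw [update_pt, hat_pt]

/-- A polynomial-valued function whose values at all points are given by a multilinear map. -/
def ofHat [CharZero F] {k : ℕ} (f : (Fin k → A) → P F k M) (ω : MG F (Pts F A) M k)
    (h : ∀ s a, ω (fun i => pt F (s i) (a i)) = ev F s (f a)) : Mult F A M k :=
  MultilinearMap.mk' f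
    -- Multilinearity is tested at points, where it is that of `ω`.
    (fun a i x y => ev_injective fun s => by
      have e : ∀ z, ev F s (f (Function.update a i z)) =
          ω (Function.update (fun i => pt F (s i) (a i)) i (pt F (s i) z)) := fun z => by
        rw [← h, update_pt, Function.update_eq_self]
      rw [map_add, e, e, e, map_add, MultilinearMap.map_update_add])
    (fun a i c x => ev_injective fun s => by
      have e : ∀ z, ev F s (f (Function.update a i z)) =
          ω (Function.update (fun i => pt F (s i) (a i)) i (pt F (s i) z)) := fun z => by
        rw [← h, update_pt, Function.update_eq_self]
      rw [map_smul, e, e, map_smul, MultilinearMap.map_update_smul])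

end PointAlgebra

/-! ### The differential on polynomial cochains -/

section PolyDifferential

variable {F : Type u} [Field F] [CharZero F]
  {A : Type v} [AddCommGroup A] [Module F A] [Module F[X] A] [IsScalarTower F F[X] A]
  {M : Type w} [AddCommGroup M] [Module F M] [Module F[X] M] [IsScalarTower F F[X] M]
  {L : LieConformalAlgebra F A} (V : LieConformalModule L M)

lemma toLinearMap_apply' {k : ℕ} (γ : Mult F A M k) (a : Fin k → A) (r : Fin k) (c : A) :
    γ.toLinearMap a r c = γ (Function.update a r c) := rfl

variable (F) in
/-- The values of the variables when the `i`-th argument acts on the `r`-th remaining one. -/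
def mergeT {k : ℕ} (i : Fin (k + 1)) (r : Fin k) (r' : Fin k) : MvPolynomial (Fin (k + 1)) F :=
  MvPolynomial.X (i.succAbove r') + if r' = r then MvPolynomial.X i else 0

/-- The substitution of the variables when the `i`-th argument acts on the `r`-th remaining one. -/
def mergeS {N : Type*} [AddCommGroup N] [Module F N] [Module F[X] N] [IsScalarTower F F[X] N]
    {k : ℕ} (i : Fin (k + 1)) (r : Fin k) : P F k N →ₗ[F] P F (k + 1) N :=
  subst F fun r' => mergeT F i r r' ⊗ₜ 1

lemma ev_mergeS {k : ℕ} (i : Fin (k + 1)) (r : Fin k) (s : Fin (k + 1) → F) (p : P F k M) :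
    ev F s (mergeS i r p) =
      ev F (Function.update (s ∘ i.succAbove) r (s (i.succAbove r) + s i)) p := by
  rw [mergeS, ev_subst]
  congr 2
  funext r'
  by_cases h : r' = r
  · subst h; simp [mergeT]
  · simp [mergeT, h]

/-- The substitution adds `λᵢ` to one of the remaining variables, so the sum of the variables
becomes the full sum. -/
lemma mergeS_ThP {k : ℕ} (i : Fin (k + 1)) (r : Fin k) (p : P F k M) :
    mergeS i r (ThP F M k p) = ThP F M (k + 1) (mergeS i r p) := by
  refine ev_injective fun s => ?_
  rw [ev_mergeS, ev_ThP, ev_ThP, ev_mergeS, Fin.sum_univ_succAbove s i,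
    Finset.sum_update_of_mem (Finset.mem_univ r), ← Finset.erase_eq, ← Finset.add_sum_erase Finset.univ _ (Finset.mem_univ r)]
  congr 2
  simp only [Function.comp_apply]
  ring

/-- By sesquilinearity in the module argument, moving `∂` past `a_{λᵢ}` supplies `λᵢ`, the one
variable missing from the sum. -/
lemma actAt_ren_ThP {k : ℕ} (b : A) (i : Fin (k + 1)) (p : P F k M) :
    actAt (V.act b) i (ren F i.succAbove (ThP F M k p)) =
      ThP F M (k + 1) (actAt (V.act b) i (ren F i.succAbove p)) := by
  refine ev_injective fun s => ?_
  rw [ev_actAt, ev_ren, ev_ThP, ev_ThP, ev_actAt, ev_ren, map_add, V.sesq_right, map_smul, map_add,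
    map_add, ev_DP, ev_smul, map_smul, Fin.sum_univ_succAbove s i]
  simp only [MvPolynomial.eval_X, Function.comp_apply, add_smul]
  abel

lemma bind_comp_linear {E N N' : Type*} [AddCommGroup E] [Module F E] [AddCommGroup N] [Module F N]
    [AddCommGroup N'] [Module F N'] {k : ℕ} (q : MvPolynomial (Fin k) F) (g : E →ₗ[F] P F k N)
    (T : P F k N →ₗ[MvPolynomial (Fin k) F] P F k N') (p : P F 1 E) :
    bind q (T.restrictScalars F ∘ₗ g) p = T (bind q g p) := by
  induction p using TensorProduct.induction_on with
  | zero => simp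
  | add p q hp hq => simp only [map_add, hp, hq]
  | tmul f e => rw [bind_tmul, bind_tmul, map_smul]; rfl

/-- The `i`-th term of the Leibniz differential. -/
def lieFun {k : ℕ} (γ : Mult F A M k) (i : Fin (k + 1)) (a : Fin (k + 1) → A) : P F (k + 1) M :=
  actAt (V.act (a i)) i (ren F i.succAbove (γ (a ∘ i.succAbove))) -
    ∑ r : Fin k, if i ≤ r.castSucc then
      bind (MvPolynomial.X i : MvPolynomial (Fin (k + 1)) F)
        (mergeS i r ∘ₗ γ.toLinearMap (a ∘ i.succAbove) r) (L.bracket (a i) (a (i.succAbove r)))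
    else 0

lemma ev_bind_mergeS {k : ℕ} (γ : Mult F A M k) (i : Fin (k + 1)) (r : Fin k) (l : Fin (k + 1))
    (a : Fin k → A) (s : Fin (k + 1) → F) (p : P F 1 A) :
    ev F s (bind (MvPolynomial.X l : MvPolynomial (Fin (k + 1)) F)
        (mergeS i r ∘ₗ γ.toLinearMap a r) p) =
      hat k γ (Function.update (fun j => pt F (s (i.succAbove j)) (a j)) r
        (pt F (s (i.succAbove r) + s i) (ev1 F (s l) p))) := by
  rw [hat_update (s := fun j => s (i.succAbove j)), ev_bind, LinearMap.comp_apply, ev_mergeS,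
    MvPolynomial.eval_X, toLinearMap_apply']
  rfl

lemma ev_lieFun {k : ℕ} (γ : Mult F A M k) (i : Fin (k + 1)) (a : Fin (k + 1) → A)
    (s : Fin (k + 1) → F) (x : Fin (k + 1) → Pts F A) (hx : x = fun i => pt F (s i) (a i)) :
    ev F s (lieFun V γ i a) = (ptData V).ac (x i) (hat k γ (x ∘ i.succAbove)) -
      ∑ r : Fin k, if i ≤ r.castSucc then hat k γ (Function.update (x ∘ i.succAbove) r
        ((ptData V).br (x i) (x (i.succAbove r)))) else 0 := by
  subst hx
  rw [lieFun, map_sub, map_sum]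
  congr 1
  · rw [ev_actAt, ev_ren]
    simp only [ptData, ptAc_pt]
    congr 2
    exact (hat_pt γ (s ∘ i.succAbove) (a ∘ i.succAbove)).symm
  · refine Finset.sum_congr rfl fun r _ => ?_
    split_ifs
    · rw [ev_bind_mergeS]
      simp only [ptData, ptBr_pt]
      rw [add_comm (s i)]
      rfl
    · simp

lemma hat_ofHat {k : ℕ} (f : (Fin k → A) → P F k M) (ω : MG F (Pts F A) M k)
    (h : ∀ s a, ω (fun i => pt F (s i) (a i)) = ev F s (f a)) : hat k (ofHat f ω h) = ω :=
  hat_eq_iff.2 h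

/-- The Leibniz differential of polynomial cochains. -/
def dM (k : ℕ) : Mult F A M k →ₗ[F] Mult F A M (k + 1) where
  toFun γ := ofHat (fun a => ∑ i : Fin (k + 1), (-1 : F) ^ (i : ℕ) • lieFun V γ i a)
    ((ptData V).dL k (hat k γ)) (fun s a => by
      rw [LeibnizData.dL_apply, map_sum]
      exact Finset.sum_congr rfl fun i _ => by rw [map_smul, ev_lieFun V γ i a s _ rfl])
  map_add' γ γ' := hat_injective _ (by simp only [hat_ofHat, map_add])
  map_smul' c γ := hat_injective _ (by simp only [hat_ofHat, map_smul, RingHom.id_apply])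

lemma dM_apply {k : ℕ} (γ : Mult F A M k) (a : Fin (k + 1) → A) :
    dM V k γ a = ∑ i : Fin (k + 1), (-1 : F) ^ (i : ℕ) • lieFun V γ i a := rfl

/-- With `hat_injective`, this transports every identity of the Leibniz calculus to polynomial
cochains. -/
lemma hat_dM {k : ℕ} (γ : Mult F A M k) : hat (k + 1) (dM V k γ) = (ptData V).dL k (hat k γ) :=
  hat_eq_iff.2 fun s a => by
    rw [LeibnizData.dL_apply, dM_apply, map_sum]
    exact Finset.sum_congr rfl fun i _ => by rw [map_smul, ev_lieFun V γ i a s _ rfl]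

lemma dM_dM {k : ℕ} (γ : Mult F A M k) : dM V (k + 1) (dM V k γ) = 0 := by
  apply hat_injective
  rw [hat_dM, hat_dM, LeibnizData.dL_dL, map_zero]

/-- The Lie derivative as a cochain with one more argument. -/
def lopL (k : ℕ) : MG F (Pts F A) M k →ₗ[F] MG F (Pts F A) M (k + 1) :=
  (multilinearCurryLeftEquiv F (fun _ : Fin (k + 1) => Pts F A) M).symm.toLinearMap ∘ₗ
    ((ptData V).lie k).flip

lemma curry_lopL {k : ℕ} (ω : MG F (Pts F A) M k) (x : Pts F A) :
    (lopL V k ω).curryLeft x = (ptData V).lie k x ω := by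
  ext y
  simp [lopL]

lemma lopL_apply {k : ℕ} (ω : MG F (Pts F A) M k) (x : Fin (k + 1) → Pts F A) :
    lopL V k ω x = (ptData V).ac (x 0) (ω (x ∘ Fin.succAbove 0)) -
      ∑ r : Fin k, if (0 : Fin (k + 1)) ≤ r.castSucc then
        ω (Function.update (x ∘ Fin.succAbove 0) r
          ((ptData V).br (x 0) (x (Fin.succAbove 0 r)))) else 0 := by
  obtain ⟨x0, y, rfl⟩ : ∃ x0 y, x = Fin.cons x0 y := ⟨x 0, Fin.tail x, by simp⟩
  have h := congrArg (fun f => f y) (curry_lopL V ω x0)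
  have e : (Fin.cons x0 y : Fin (k + 1) → Pts F A) ∘ Fin.succAbove 0 = y := by
    funext r
    simp
  simp only [MultilinearMap.curryLeft_apply, LeibnizData.lie_apply', derMG_apply] at h
  rw [h, e]
  simp

/-- The Lie derivative as a polynomial cochain with one more argument. -/
def lopM (k : ℕ) : Mult F A M k →ₗ[F] Mult F A M (k + 1) where
  toFun γ := ofHat (fun a => lieFun V γ 0 a) (lopL V k (hat k γ)) (fun s a => by
    rw [ev_lieFun V γ 0 a s _ rfl, lopL_apply])
  map_add' γ γ' := hat_injective _ (by simp only [hat_ofHat, map_add])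
  map_smul' c γ := hat_injective _ (by simp only [hat_ofHat, map_smul, RingHom.id_apply])

lemma hat_lopM {k : ℕ} (γ : Mult F A M k) : hat (k + 1) (lopM V k γ) = lopL V k (hat k γ) :=
  hat_eq_iff.2 fun s a => by
    change _ = ev F s (lieFun V γ 0 a)
    rw [ev_lieFun V γ 0 a s _ rfl, lopL_apply]

variable (F A M) in
/-- The operator `∂ + λ₁ + ⋯ + λₖ` on cochains. -/
def thM (k : ℕ) : Mult F A M k →ₗ[F] Mult F A M k :=
  LinearMap.compMultilinearMapₗ F ((ThP F M k).restrictScalars F)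

lemma thM_apply {k : ℕ} (γ : Mult F A M k) (a : Fin k → A) :
    thM F A M k γ a = ThP F M k (γ a) := rfl

/-- At points, each index contributes its scalar `s r`, the value of `λᵣ`; the sign in `ptScale`
cancels the one with which arguments enter a derivation of cochains. -/
lemma hat_thM {k : ℕ} (γ : Mult F A M k) :
    hat k (thM F A M k γ) = derMG F (Pts F A) M k (ptScale F A, D F M) (hat k γ) := by
  refine hat_eq_iff.2 fun s a => ?_
  rw [derMG_apply, thM_apply, ev_ThP, hat_pt, Finset.sum_smul, sub_eq_add_neg,
    ← Finset.sum_neg_distrib]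
  congr 1
  refine Finset.sum_congr rfl fun r _ => ?_
  simp only [ptScale_pt]
  rw [← neg_smul, MultilinearMap.map_update_smul, Function.update_eq_self, hat_pt]
  simp

lemma dM_thM {k : ℕ} (γ : Mult F A M k) :
    dM V k (thM F A M k γ) = thM F A M (k + 1) (dM V k γ) := by
  apply hat_injective
  rw [hat_dM, hat_thM, hat_thM, hat_dM, (isDer_ptScale V).dL]

lemma lopM_thM {k : ℕ} (γ : Mult F A M k) :
    lopM V k (thM F A M k γ) = thM F A M (k + 1) (lopM V k γ) := by
  apply hat_injective
  rw [hat_lopM, hat_thM, hat_thM, hat_lopM]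
  refine MG.curry_ext fun x => ?_
  rw [curry_lopL, curry_derMG, curry_lopL, curry_lopL, (isDer_ptScale V).lie, add_sub_cancel_right]

/-- The action of permutations on cochains. -/
def permM {k : ℕ} (σ : Equiv.Perm (Fin k)) : Mult F A M k →ₗ[F] Mult F A M k :=
  LinearMap.compMultilinearMapₗ F (ren F σ) ∘ₗ
    (MultilinearMap.domDomCongrLinearEquiv F F A (P F k M) σ).toLinearMap

lemma permM_apply {k : ℕ} (σ : Equiv.Perm (Fin k)) (γ : Mult F A M k) (a : Fin k → A) :
    permM σ γ a = ren F σ (γ (a ∘ σ)) := rfl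

lemma hat_permM {k : ℕ} (σ : Equiv.Perm (Fin k)) (γ : Mult F A M k) (x : Fin k → Pts F A) :
    hat k (permM σ γ) x = hat k γ (x ∘ σ) := by
  have : hat k (permM σ γ) = (hat k γ).domDomCongr σ := by
    refine hat_eq_iff.2 fun s a => ?_
    rw [permM_apply, ev_ren]
    exact hat_pt γ (s ∘ σ) (a ∘ σ)
  rw [this]
  rfl

lemma permM_mul {k : ℕ} (σ τ : Equiv.Perm (Fin k)) (γ : Mult F A M k) :
    permM (σ * τ) γ = permM σ (permM τ γ) := by
  ext a
  rw [permM_apply, permM_apply, permM_apply, ren_ren]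
  rfl

lemma permM_thM {k : ℕ} (σ : Equiv.Perm (Fin k)) (γ : Mult F A M k) :
    permM σ (thM F A M k γ) = thM F A M k (permM σ γ) := by
  ext a
  rw [permM_apply, thM_apply, thM_apply, permM_apply, ren_perm_ThP]

/-- The defect of sesquilinearity in the `l`-th argument. -/
def edel {k : ℕ} (l : Fin k) : Mult F A M k →ₗ[F] Mult F A M k :=
  MultilinearMap.compLinearMapₗ (Function.update (fun _ => LinearMap.id) l (D F A)) +
    LinearMap.compMultilinearMapₗ F
      (Algebra.lsmul F F (P F k M) (MvPolynomial.X l : MvPolynomial (Fin k) F))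

lemma edel_apply {k : ℕ} (l : Fin k) (γ : Mult F A M k) (a : Fin k → A) :
    edel l γ a = γ (Function.update a l (D F A (a l))) +
      (MvPolynomial.X l : MvPolynomial (Fin k) F) • γ a := by
  have : (fun i => (Function.update (fun _ => LinearMap.id) l (D F A) : Fin k → A →ₗ[F] A) i (a i))
      = Function.update a l (D F A (a l)) := by
    funext i
    by_cases h : i = l
    · subst h; simp
    · simp [h]
  rw [← this]
  rfl

lemma hat_edel {k : ℕ} (l : Fin k) (γ : Mult F A M k) (x : Fin k → Pts F A) :
    hat k (edel l γ) x = hat k γ (Function.update x l (ptDel F A (x l))) := by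
  have : hat k (edel l γ) = (hat k γ).compLinearMap
      (Function.update (fun _ => LinearMap.id) l (ptDel F A)) := by
    refine hat_eq_iff.2 fun s a => ?_
    have e : ∀ x : Fin k → Pts F A, (hat k γ).compLinearMap
        (Function.update (fun _ => LinearMap.id) l (ptDel F A)) x =
        hat k γ (Function.update x l (ptDel F A (x l))) := by
      intro x
      rw [MultilinearMap.compLinearMap_apply]
      congr 1
      funext i
      by_cases h : i = l
      · subst h; simp
      · simp [h]
    rw [e, ptDel_pt, MultilinearMap.map_update_add, MultilinearMap.map_update_smul,
      Function.update_eq_self, hat_update, Function.update_eq_self, edel_apply, hat_pt, map_add,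
      ev_smul, MvPolynomial.eval_X]
  rw [this, MultilinearMap.compLinearMap_apply]
  congr 1
  funext i
  by_cases h : i = l
  · subst h; simp
  · simp [h]

lemma edel_thM {k : ℕ} (l : Fin k) (γ : Mult F A M k) :
    edel l (thM F A M k γ) = thM F A M k (edel l γ) := by
  ext a
  rw [edel_apply, thM_apply, thM_apply, thM_apply, edel_apply, map_add, map_smul]

lemma edel_permM {k : ℕ} (l : Fin k) (σ : Equiv.Perm (Fin k)) (γ : Mult F A M k) :
    edel (σ l) (permM σ γ) = permM σ (edel l γ) := by
  ext a
  rw [edel_apply, permM_apply, permM_apply, permM_apply, edel_apply, map_add, ren_X]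
  congr 3
  funext i
  simp only [Function.comp_apply, Function.update_apply, EmbeddingLike.apply_eq_iff_eq]

lemma edel_dM_zero (γ : Mult F A M 0) : edel 0 (dM V 0 γ) = 0 := by
  apply hat_injective
  rw [map_zero]
  ext x
  rw [hat_edel, hat_dM]
  have h := congrArg (fun f => f (Fin.tail x))
    (LeibnizData.curry_dL_zero (ptData V) (hat 0 γ) (ptDel F A (x 0)))
  rw [lie_ptDel] at h
  obtain ⟨x0, y, rfl⟩ : ∃ x0 y, x = Fin.cons x0 y := ⟨x 0, Fin.tail x, by simp⟩
  rw [Fin.update_cons_zero]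
  simpa [MultilinearMap.curryLeft_apply] using h

/-- Write `e` for the defect of `γ` in the first argument. The Lie derivative along `(∂a)_s + s a_s`
vanishes, so the defect of `dγ` contracted by `x` is `-d(e(x))`. By the recursion this is `(de)(x) -
L_x e`, which involves only operators applied to `e`. -/
lemma edel_dM {k : ℕ} (γ : Mult F A M (k + 1)) :
    edel 0 (dM V (k + 1) γ) = dM V (k + 1) (edel 0 γ) - lopM V (k + 1) (edel 0 γ) := by
  have key : ∀ {k} (γ : Mult F A M (k + 1)) x, (hat (k + 1) (edel 0 γ)).curryLeft x =
      (hat (k + 1) γ).curryLeft (ptDel F A x) := by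
    intro k γ x
    ext y
    rw [MultilinearMap.curryLeft_apply, hat_edel]
    simp
  apply hat_injective
  refine MG.curry_ext fun x => ?_
  rw [key, hat_dM, LeibnizData.curry_dL, lie_ptDel, map_sub, hat_dM, hat_lopM]
  change _ = ((ptData V).dL (k + 1) _).curryLeft x - (lopL V (k + 1) _).curryLeft x
  rw [LeibnizData.curry_dL, curry_lopL, key]
  simp

/-- The cochain obtained by inserting `[a_j, a_{j+1}] + [a_{j+1}, a_j]`. -/
def symFun (L : LieConformalAlgebra F A) {k : ℕ} (γ : Mult F A M k) (j : Fin k)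
    (a : Fin (k + 1) → A) : P F (k + 1) M :=
  bind (MvPolynomial.X j.castSucc : MvPolynomial (Fin (k + 1)) F)
      (mergeS j.succ j ∘ₗ γ.toLinearMap (a ∘ j.succ.succAbove) j)
      (L.bracket (a j.castSucc) (a j.succ)) +
    bind (MvPolynomial.X j.succ : MvPolynomial (Fin (k + 1)) F)
      (mergeS j.succ j ∘ₗ γ.toLinearMap (a ∘ j.succ.succAbove) j)
      (L.bracket (a j.succ) (a j.castSucc))

/-- Exact skew-symmetry of a polynomial cochain. -/
def IsSkewM {k : ℕ} (γ : Mult F A M k) : Prop :=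
  ∀ σ : Equiv.Perm (Fin k), permM σ γ = (Equiv.Perm.sign σ : ℤ) • γ

lemma IsSkewM.hat {k : ℕ} {γ : Mult F A M k} (h : IsSkewM γ) : IsSkew (hat k γ) := fun σ x => by
  rw [← hat_permM, h, map_zsmul]
  rfl

/-- The counterpart of `dL_swap` for polynomial cochains. -/
lemma dM_swap {k : ℕ} {γ : Mult F A M k} (h : IsSkewM γ) (j : Fin k) (a : Fin (k + 1) → A) :
    dM V k γ a + permM (Equiv.swap j.castSucc j.succ) (dM V k γ) a =
      (-1 : F) ^ ((j : ℕ) + 1) • symFun L γ j a := by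
  refine ev_injective fun s => ?_
  have := LeibnizData.dL_swap (ptData V) h.hat j (fun i => pt F (s i) (a i))
  rw [← hat_dM, ← hat_permM, hat_pt, hat_pt] at this
  rw [map_add, this, map_smul, symFun, map_add, ev_bind_mergeS, ev_bind_mergeS,
    MultilinearMap.map_update_add]
  have e : j.succ.succAbove j = j.castSucc := by simp
  simp only [ptData, ptBr_pt, e, add_comm (s j.succ)]
  rfl

end PolyDifferential

/-! ### Comparison of the usual formula for the differential with the Leibniz one. -/

section DeltaFun

variable {F : Type u} [Field F] [CharZero F]
  {A : Type v} [AddCommGroup A] [Module F A] [Module F[X] A] [IsScalarTower F F[X] A]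
  {M : Type w} [AddCommGroup M] [Module F M] [Module F[X] M] [IsScalarTower F F[X] M]
  {L : LieConformalAlgebra F A} (V : LieConformalModule L M)

/-- The substitution in the second sum of the differential `deltaFun`. -/
def lastS {k : ℕ} (i : Fin (k + 1)) (j : Fin (k + 2)) : P F (k + 1) M →ₗ[F] P F (k + 2) M :=
  subst F (Fin.snoc (α := fun _ => DPoly F (k + 2)) (fun r : Fin k => lam F (skip i j r))
    (lam F i.castSucc + lam F j))

lemma ev_lastS {k : ℕ} (i : Fin (k + 1)) (j : Fin (k + 2)) (s : Fin (k + 2) → F)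
    (p : P F (k + 1) M) : ev F s (lastS i j p) =
      ev F (Fin.snoc (α := fun _ => F) (s ∘ skip i j) (s i.castSucc + s j)) p := by
  have e : (Fin.snoc (α := fun _ => DPoly F (k + 2)) (fun r : Fin k => lam F (skip i j r))
      (lam F i.castSucc + lam F j)) = fun r => (Fin.snoc (α := fun _ => MvPolynomial (Fin (k + 2)) F)
        (fun r : Fin k => MvPolynomial.X (skip i j r))
        (MvPolynomial.X i.castSucc + MvPolynomial.X j) r : MvPolynomial (Fin (k + 2)) F) ⊗ₜ 1 := by
    funext r
    cases r using Fin.lastCases with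
    | cast r => simp [lam]
    | last => simp [lam, TensorProduct.add_tmul]
  rw [lastS, e, ev_subst]
  congr 2
  funext r
  cases r using Fin.lastCases <;> simp

/-- Omitting `i` and then the `r`-th remaining index gives the same enumeration as omitting `r.succ`
and then `i`. -/
lemma skip_eq {k : ℕ} {i r : Fin (k + 1)} (h : i ≤ r) (t : Fin k) :
    i.castSucc.succAbove (r.succAbove t) = skip i r.succ t := by
  simp only [skip, Fin.succAbove, Fin.ext_iff, Fin.lt_def, Fin.le_def] at *
  split_ifs <;> simp_all <;> omega

/-- The last variable becomes `λᵢ + λⱼ`, so the sum of the variables becomes the full sum. -/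
lemma lastS_ThP {k : ℕ} {i : Fin (k + 1)} {j : Fin (k + 2)} (h : i.castSucc < j)
    (p : P F (k + 1) M) : lastS i j (ThP F M (k + 1) p) = ThP F M (k + 2) (lastS i j p) := by
  refine ev_injective fun s => ?_
  obtain ⟨r, rfl⟩ : ∃ r, j = Fin.succ r := ⟨j.pred (Fin.ne_zero_of_lt h), by simp⟩
  have hir : i ≤ r := Fin.castSucc_lt_succ_iff.1 h
  rw [ev_lastS, ev_ThP, ev_ThP, ev_lastS, Fin.sum_univ_castSucc, Fin.sum_univ_succAbove s i.castSucc,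
    Fin.sum_univ_succAbove (fun t => s (i.castSucc.succAbove t)) r]
  congr 2
  simp only [Fin.snoc_castSucc, Fin.snoc_last, Function.comp_apply, skip_eq hir]
  rw [Fin.succAbove_of_le_castSucc i.castSucc r (Fin.castSucc_le_castSucc_iff.2 hir)]
  ring

lemma ev_deltaFun {k : ℕ} (γ : Mult F A M (k + 1)) (a : Fin (k + 2) → A) (s : Fin (k + 2) → F)
    (x : Fin (k + 2) → Pts F A) (hx : x = fun i => pt F (s i) (a i)) :
    ev F s (deltaFun V γ a) = (∑ i : Fin (k + 2), (-1 : F) ^ (i : ℕ) •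
      (ptData V).ac (x i) (hat (k + 1) γ (x ∘ i.succAbove))) +
      ∑ j : Fin (k + 2), ∑ i : Fin (k + 1), if i.castSucc < j then
        (-1 : F) ^ (k + (i : ℕ) + (j : ℕ)) • hat (k + 1) γ
          (Fin.snoc (α := fun _ => Pts F A) (x ∘ skip i j) ((ptData V).br (x i.castSucc) (x j)))
        else 0 := by
  subst hx
  rw [deltaFun, map_add, map_sum, bracketSum, map_sum]
  congr 1
  · refine Finset.sum_congr rfl fun i _ => ?_
    rw [map_smul, ev_actAt, ev_ren]
    simp only [ptData, ptAc_pt]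
    congr 3
    exact (hat_pt γ (s ∘ i.succAbove) (a ∘ i.succAbove)).symm
  · refine Finset.sum_congr rfl fun j _ => ?_
    rw [map_sum]
    refine Finset.sum_congr rfl fun i _ => ?_
    split_ifs
    · rw [map_smul]
      change _ • ev F s (bind _ (lastS i j ∘ₗ _) _) = _
      rw [ev_bind, LinearMap.comp_apply, ev_lastS, toLinearMap_apply', Fin.update_snoc_last]
      simp only [ptData, ptBr_pt]
      rw [← hat_pt]
      congr 2
      funext r
      cases r using Fin.lastCases <;> simp
    · simp

/-- For skew-symmetric cochains the Leibniz differential is given by the usual formula. -/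
lemma deltaFun_eq {k : ℕ} {γ : Mult F A M k} (h : IsSkewM γ) (a : Fin (k + 1) → A) :
    deltaFun V γ a = dM V k γ a := by
  refine ev_injective fun s => ?_
  obtain ⟨x, hx⟩ : ∃ x, x = fun i => pt F (s i) (a i) := ⟨_, rfl⟩
  rw [← hat_pt, hat_dM, ← hx, LeibnizData.dL_apply]
  cases k with
  | zero =>
    subst hx
    rw [deltaFun, ev_actAt, ev_ren, Fin.sum_univ_one]
    simp only [Finset.univ_eq_empty, Finset.sum_empty, sub_zero, Fin.val_zero, pow_zero, one_smul,
      ptData, ptAc_pt]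
    congr 2
    exact (hat_pt γ (s ∘ Fin.succAbove 0) (a ∘ Fin.succAbove 0)).symm
  | succ k =>
    rw [ev_deltaFun V γ a s x hx]
    clear hx
    simp only [smul_sub, Finset.sum_sub_distrib]
    rw [sub_eq_add_neg]
    congr 1
    -- For `j = r.succ` the Leibniz formula has the bracket in place `r`. Moving it to the last
    -- place costs `(-1) ^ (k + r)`, which accounts for the sign in the usual formula.
    have key : ∀ (i : Fin (k + 1)) (r : Fin (k + 1)),
        (if i.castSucc < r.succ then (-1 : F) ^ (k + (i : ℕ) + (r.succ : ℕ)) • hat (k + 1) γ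
          (Fin.snoc (α := fun _ => Pts F A) (x ∘ skip i r.succ)
            ((ptData V).br (x i.castSucc) (x r.succ))) else 0) =
        -((-1 : F) ^ (i.castSucc : ℕ) • if i.castSucc ≤ r.castSucc then hat (k + 1) γ
          (Function.update (x ∘ i.castSucc.succAbove) r
            ((ptData V).br (x i.castSucc) (x (i.castSucc.succAbove r)))) else 0) := by
      intro i r
      simp only [Fin.castSucc_lt_succ_iff, Fin.castSucc_le_castSucc_iff]
      split_ifs with hir
      · have e : ∀ z, Function.update (x ∘ i.castSucc.succAbove) r z =
            r.insertNth z (x ∘ skip i r.succ) := by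
          intro z
          rw [← Fin.insertNth_removeNth]
          congr 1
          funext t
          simp only [Fin.removeNth, Function.comp_apply, skip_eq hir]
        rw [e, h.hat.map_insertNth,
          Fin.succAbove_of_le_castSucc i.castSucc r (Fin.castSucc_le_castSucc_iff.2 hir), smul_smul,
          ← neg_smul]
        congr 1
        rw [Fin.val_succ, Fin.val_castSucc]
        ring
      · simp
    rw [Fin.sum_univ_succ]
    have h1 : (∑ i : Fin (k + 1), if i.castSucc < (0 : Fin (k + 2)) then
        (-1 : F) ^ (k + (i : ℕ) + ((0 : Fin (k + 2)) : ℕ)) • hat (k + 1) γ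
          (Fin.snoc (α := fun _ => Pts F A) (x ∘ skip i 0) ((ptData V).br (x i.castSucc) (x 0)))
        else 0) = 0 := Finset.sum_eq_zero fun i _ => if_neg (by simp)
    rw [h1, zero_add, Finset.sum_comm]
    simp only [key]
    -- The last argument has no later argument to act on, so its terms are zero.
    rw [Fin.sum_univ_castSucc (n := k + 1)]
    have h2 : ∀ f : Fin (k + 1) → M, (∑ r : Fin (k + 1), if Fin.last (k + 1) ≤ r.castSucc then
        f r else 0) = 0 := fun f => Finset.sum_eq_zero fun r _ => if_neg (by simp)
    rw [h2, smul_zero, add_zero]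
    simp only [Finset.smul_sum, Finset.sum_neg_distrib]

lemma bind_add {E N : Type*} [AddCommGroup E] [Module F E] [AddCommGroup N] [Module F N] {k : ℕ}
    (q : MvPolynomial (Fin k) F) (g g' : E →ₗ[F] P F k N) (p : P F 1 E) :
    bind q (g + g') p = bind q g p + bind q g' p := by
  induction p using TensorProduct.induction_on with
  | zero => simp
  | add p q hp hq => simp only [map_add, hp, hq]; abel
  | tmul f e => rw [bind_tmul, bind_tmul, bind_tmul, LinearMap.add_apply, smul_add]

lemma toLinearMap_add {k : ℕ} (γ γ' : Mult F A M k) (a : Fin k → A) (r : Fin k) :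
    (γ + γ').toLinearMap a r = γ.toLinearMap a r + γ'.toLinearMap a r := rfl

lemma toLinearMap_thM {k : ℕ} (γ : Mult F A M k) (a : Fin k → A) (r : Fin k) :
    (thM F A M k γ).toLinearMap a r = (ThP F M k).restrictScalars F ∘ₗ γ.toLinearMap a r := rfl

lemma deltaFun_add {k : ℕ} (γ γ' : Mult F A M k) (a : Fin (k + 1) → A) :
    deltaFun V (γ + γ') a = deltaFun V γ a + deltaFun V γ' a := by
  cases k with
  | zero => simp only [deltaFun, add_apply, map_add]
  | succ k =>
    have hb : ∀ s : Fin (k + 1) → Fin (k + 2) → P F (k + 1) M →ₗ[F] P F (k + 2) M,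
        bracketSum L (γ + γ') s a = bracketSum L γ s a + bracketSum L γ' s a := by
      intro s
      simp only [bracketSum, ← Finset.sum_add_distrib]
      refine Finset.sum_congr rfl fun j _ => Finset.sum_congr rfl fun i _ => ?_
      split_ifs
      · rw [toLinearMap_add, LinearMap.comp_add, bind_add, smul_add]
      · simp
    simp only [deltaFun, add_apply, map_add, hb, smul_add, Finset.sum_add_distrib]
    abel

/-- This is needed for cochains without any symmetry: in `red_deltaFun` it is applied to an
arbitrary `θ` with `γ - alt γ = (∂ + λ₁ + ⋯ + λₖ₊₁)θ`. -/
lemma deltaFun_thM {k : ℕ} (γ : Mult F A M k) (a : Fin (k + 1) → A) :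
    deltaFun V (thM F A M k γ) a = ThP F M (k + 1) (deltaFun V γ a) := by
  cases k with
  | zero =>
    rw [deltaFun, thM_apply]
    exact actAt_ren_ThP V (a 0) 0 (γ (a ∘ Fin.succAbove 0))
  | succ k =>
    have hb : bracketSum L (thM F A M (k + 1) γ) lastS a =
        ThP F M (k + 2) (bracketSum L γ lastS a) := by
      simp only [bracketSum, map_sum]
      refine Finset.sum_congr rfl fun j _ => Finset.sum_congr rfl fun i _ => ?_
      split_ifs with hij
      · rw [toLinearMap_thM, LinearMap.map_smul_of_tower]
        refine congrArg _ (Eq.trans ?_ (bind_comp_linear _ _ (ThP F M (k + 2)) _))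
        congr 2
        refine LinearMap.ext fun c => ?_
        exact lastS_ThP hij _
      · simp
    change (_ + bracketSum L (thM F A M (k + 1) γ) lastS a : P F (k + 2) M) = ThP F M (k + 2)
      (_ + bracketSum L γ lastS a)
    rw [map_add, hb, map_sum]
    congr 1
    refine Finset.sum_congr rfl fun i _ => ?_
    rw [thM_apply, LinearMap.map_smul_of_tower, actAt_ren_ThP]

end DeltaFun

/-! ### Cochains modulo a coefficient subsystem -/

section Membership

variable {F : Type u} [Field F] [CharZero F]
  {A : Type v} [AddCommGroup A] [Module F A] [Module F[X] A] [IsScalarTower F F[X] A]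
  {M : Type w} [AddCommGroup M] [Module F M] [Module F[X] M] [IsScalarTower F F[X] M]
  {L : LieConformalAlgebra F A} (V : LieConformalModule L M)

/-- Modulo `Q` the operator `∂` on the argument of `g` acts as `-(q + q')`. Hence `-λ - ∂` at `λ =
q` acts as `q'`. -/
lemma bind_reflect {k : ℕ} (Q : Submodule (MvPolynomial (Fin k) F) (P F k M))
    (q q' : MvPolynomial (Fin k) F) (g : A →ₗ[F] P F k M)
    (hg : ∀ c, g (D F A c) + (q + q') • g c ∈ Q) (p : P F 1 A) :
    bind q' g p - bind q g (subst F (fun _ => -lam F (0 : Fin 1) - del F 1) p) ∈ Q := by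
  have hD : ∀ u : P F 1 A, bind q g (DP F 1 u) + (q + q') • bind q g u ∈ Q := by
    intro u
    induction u using P_induction with
    | one n => rw [DP_tmul, bind_one, bind_one]; exact hg n
    | mulX i p hp =>
      rw [DP_smul, bind_X, bind_X, smul_comm, ← smul_add]
      exact Q.smul_mem _ hp
    | add p p' hp hp' =>
      rw [map_add, map_add, map_add, smul_add, add_add_add_comm]
      exact Q.add_mem hp hp'
  induction p using P_induction with
  | one n => rw [subst_one, bind_one, bind_one, sub_self]; exact Q.zero_mem
  | add p p' hp hp' =>
    rw [map_add, map_add, map_add, add_sub_add_comm]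
    exact Q.add_mem hp hp'
  | mulX i p hp =>
    rw [bind_X, subst_X, map_sub, map_neg, LinearMap.sub_apply, LinearMap.neg_apply, dact_lam,
      dact_del, map_sub, map_neg, bind_X]
    have h1 := Q.smul_mem q' hp
    have h2 := hD (subst F (fun _ => -lam F (0 : Fin 1) - del F 1) p)
    convert Q.add_mem h1 h2 using 1
    rw [smul_sub, add_smul]
    abel

/-- Skew-symmetry of the `λ`-bracket makes the two inserted brackets opposite up to `λ ↦ -λ - ∂`.
The inserted argument carries the variable `λⱼ + λⱼ₊₁`, so `bind_reflect` absorbs the difference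
when `γ` is sesquilinear modulo `Q`. -/
lemma symFun_mem {k : ℕ} (Q : Submodule (MvPolynomial (Fin k) F) (P F k M))
    (Q' : Submodule (MvPolynomial (Fin (k + 1)) F) (P F (k + 1) M)) (γ : Mult F A M k) (j : Fin k)
    (hQ : ∀ p ∈ Q, mergeS j.succ j p ∈ Q') (hγ : ∀ a, edel j γ a ∈ Q) (a : Fin (k + 1) → A) :
    symFun L γ j a ∈ Q' := by
  rw [symFun, L.skew (a j.castSucc), map_neg, neg_add_eq_sub]
  refine bind_reflect Q' _ _ _ (fun c => ?_) _
  have := hQ _ (hγ (Function.update (a ∘ j.succ.succAbove) j c))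
  rw [edel_apply, map_add, mergeS, subst_X, Function.update_self,
    Function.update_idem] at this
  have e : mergeT F j.succ j j ⊗ₜ[F] (1 : F[X]) =
      ((MvPolynomial.X j.castSucc + MvPolynomial.X j.succ : MvPolynomial (Fin (k + 1)) F) ⊗ₜ 1) := by
    simp [mergeT]
  rw [e, dact_tmul_one] at this
  exact this

end Membership

/-! ### Contractions -/

section Contractions

variable {F : Type u} [Field F]
  {A : Type v} [AddCommGroup A] [Module F A] [Module F[X] A] [IsScalarTower F F[X] A]
  {M : Type w} [NonUnitalCommRing M] [Module F M] [IsScalarTower F M M] [SMulCommClass F M M]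
  [Module F[X] M] [IsScalarTower F F[X] M]

lemma lamStar_apply (φ : HomL F M) (f : MvPolynomial (Fin 1) F) :
    lamStar F M φ f = φ (MvPolynomial.X 0 * f) := rfl

lemma delHom_apply (φ : HomL F M) (f : MvPolynomial (Fin 1) F) :
    delHom F M φ f = D F M (φ f) := rfl

lemma expD_apply (m : M) (f : MvPolynomial (Fin 1) F) :
    expD F m f = MvPolynomial.aeval (fun _ => (Polynomial.X : F[X])) f • m := rfl

lemma expD_one (m : M) : expD F m 1 = m := by
  rw [expD_apply, map_one, one_smul]

/-- The evaluation at `λ = s`, multiplied by `m`. -/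
def evHom (s : F) (m : M) : HomL F M :=
  (MvPolynomial.aeval (fun _ : Fin 1 => s)).toLinearMap.smulRight m

lemma evHom_apply (s : F) (m : M) (f : MvPolynomial (Fin 1) F) :
    evHom s m f = MvPolynomial.eval (fun _ => s) f • m := by
  simp [evHom, MvPolynomial.aeval_eq_eval]

lemma lamStar_evHom (s : F) (m : M) : lamStar F M (evHom s m) = s • evHom s m := by
  refine LinearMap.ext fun f => ?_
  rw [lamStar_apply, evHom_apply, LinearMap.smul_apply, evHom_apply, map_mul, MvPolynomial.eval_X,
    mul_smul]

lemma contr_tmul {k : ℕ} (φ : HomL F M) (f : MvPolynomial (Fin (k + 1)) F) (m : M) :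
    contr φ (f ⊗ₜ m : P F (k + 1) M) =
      (LinearMap.mulRight F m ∘ₗ φ).lTensor (MvPolynomial (Fin k) F) (split F k f) := rfl

lemma contr_one {k : ℕ} (φ : HomL F M) (m : M) :
    contr φ (1 ⊗ₜ m : P F (k + 1) M) = 1 ⊗ₜ (φ 1 * m) := by
  rw [contr_tmul, map_one, Algebra.TensorProduct.one_def, LinearMap.lTensor_tmul]
  rfl

lemma contr_X_zero {k : ℕ} (φ : HomL F M) (p : P F (k + 1) M) :
    contr φ ((MvPolynomial.X 0 : MvPolynomial (Fin (k + 1)) F) • p) = contr (lamStar F M φ) p := by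
  induction p using TensorProduct.induction_on with
  | zero => simp
  | add p q hp hq => simp only [smul_add, map_add, hp, hq]
  | tmul f m =>
    rw [TensorProduct.smul_tmul', contr_tmul, contr_tmul, smul_eq_mul, map_mul]
    generalize split F k f = u
    induction u using TensorProduct.induction_on with
    | zero => simp
    | add p q hp hq => simp only [mul_add, map_add, hp, hq]
    | tmul f g =>
      simp [split, lamStar_apply]

lemma contr_X_succ {k : ℕ} (φ : HomL F M) (i : Fin k) (p : P F (k + 1) M) :
    contr φ ((MvPolynomial.X i.succ : MvPolynomial (Fin (k + 1)) F) • p) =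
      (MvPolynomial.X i : MvPolynomial (Fin k) F) • contr φ p := by
  induction p using TensorProduct.induction_on with
  | zero => simp
  | add p q hp hq => simp only [smul_add, map_add, hp, hq]
  | tmul f m =>
    rw [TensorProduct.smul_tmul', contr_tmul, contr_tmul, smul_eq_mul, map_mul]
    generalize split F k f = u
    induction u using TensorProduct.induction_on with
    | zero => simp
    | add p q hp hq => simp only [mul_add, map_add, hp, hq, smul_add]
    | tmul f g =>
      simp [split, TensorProduct.smul_tmul']

lemma contr_add {k : ℕ} (φ ψ : HomL F M) (p : P F (k + 1) M) :
    contr (φ + ψ) p = contr φ p + contr ψ p := by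
  induction p using P_induction generalizing φ ψ with
  | one n => rw [contr_one, contr_one, contr_one, LinearMap.add_apply, add_mul,
      TensorProduct.tmul_add]
  | add p q hp hq => rw [map_add, map_add, map_add, hp, hq]; abel
  | mulX i p hp =>
    cases i using Fin.cases with
    | zero => rw [contr_X_zero, contr_X_zero, contr_X_zero, map_add, hp]
    | succ i => rw [contr_X_succ, contr_X_succ, contr_X_succ, hp, smul_add]

lemma contr_smul {k : ℕ} (c : F) (φ : HomL F M) (p : P F (k + 1) M) :
    contr (c • φ) p = c • contr φ p := by
  induction p using P_induction generalizing φ with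
  | one n => rw [contr_one, contr_one, LinearMap.smul_apply, smul_mul_assoc,
      TensorProduct.tmul_smul]
  | add p q hp hq => rw [map_add, map_add, hp, hq, smul_add]
  | mulX i p hp =>
    cases i using Fin.cases with
    | zero => rw [contr_X_zero, contr_X_zero, map_smul, hp]
    | succ i => rw [contr_X_succ, contr_X_succ, hp, smul_comm]

variable (F M) in
lemma ev_contr_evHom {k : ℕ} (s : F) (m : M) (t : Fin k → F) (p : P F (k + 1) M) :
    ev F t (contr (evHom s m) p) = m * ev F (Fin.cons s t : Fin (k + 1) → F) p := by
  induction p using P_induction with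
  | one n => rw [contr_one, ev_one, ev_one, evHom_apply, map_one, one_smul]
  | add p q hp hq => rw [map_add, map_add, map_add, hp, hq, mul_add]
  | mulX i p hp =>
    cases i using Fin.cases with
    | zero =>
      rw [contr_X_zero, lamStar_evHom, contr_smul, map_smul, hp, ev_smul, MvPolynomial.eval_X,
        Fin.cons_zero, mul_smul_comm]
    | succ i =>
      rw [contr_X_succ, ev_smul, ev_smul, hp, MvPolynomial.eval_X, MvPolynomial.eval_X,
        Fin.cons_succ, mul_smul_comm]

lemma contr_ren {k : ℕ} (φ : HomL F M) (σ : Equiv.Perm (Fin k)) (p : P F (k + 1) M) :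
    contr φ (ren F (Equiv.Perm.decomposeFin.symm (0, σ)) p) = ren F σ (contr φ p) := by
  induction p using P_induction generalizing φ with
  | one n => rw [ren_one, contr_one, ren_one]
  | add p q hp hq => simp only [map_add, hp, hq]
  | mulX i p hp =>
    cases i using Fin.cases with
    | zero =>
      rw [ren_X, Equiv.Perm.decomposeFin_symm_apply_zero, contr_X_zero, contr_X_zero, hp]
    | succ i =>
      rw [ren_X, Equiv.Perm.decomposeFin_symm_apply_succ, Equiv.swap_self, Equiv.refl_apply,
        contr_X_succ, contr_X_succ, hp, ren_X]

lemma contr_contr {k : ℕ} (φ ψ : HomL F M) (p : P F (k + 2) M) :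
    contr φ (contr ψ p) = contr ψ (contr φ (ren F (Equiv.swap 0 1) p)) := by
  induction p using P_induction generalizing φ ψ with
  | one n =>
    rw [ren_one, contr_one, contr_one, contr_one, contr_one, mul_left_comm]
  | add p q hp hq => simp only [map_add, hp, hq]
  | mulX i p hp =>
    cases i using Fin.cases with
    | zero =>
      rw [ren_X, Equiv.swap_apply_left, contr_X_zero, hp, ← Fin.succ_zero_eq_one, contr_X_succ,
        contr_X_zero]
    | succ i =>
      cases i using Fin.cases with
      | zero =>
        rw [ren_X, Fin.succ_zero_eq_one, Equiv.swap_apply_right, contr_X_zero,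
          ← Fin.succ_zero_eq_one, contr_X_succ, contr_X_zero, hp]
        rfl
      | succ i =>
        rw [ren_X, Equiv.swap_apply_of_ne_of_ne (Fin.succ_ne_zero _)
          (by rw [← Fin.succ_zero_eq_one, Ne, Fin.succ_inj]; exact Fin.succ_ne_zero _), contr_X_succ, contr_X_succ, contr_X_succ,
          contr_X_succ, hp]

/-- Contraction by `φ` turns the contracted variable into `λ*φ`, and moving the derivation `∂` out
of `φ(f)m` produces `-∂φ`. For `φ = e_m` these cancel, and the contraction commutes with the
operator (`iM_expD_thM`). -/
lemma contr_ThP (hD : ∀ m n : M, D F M (m * n) = D F M m * n + m * D F M n) {k : ℕ}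
    (φ : HomL F M) (p : P F (k + 1) M) :
    contr φ (ThP F M (k + 1) p) =
      ThP F M k (contr φ p) + contr (lamStar F M φ - delHom F M φ) p := by
  induction p using P_induction generalizing φ with
  | one n =>
    rw [ThP_apply, ThP_apply, DP_tmul, map_add, Finset.sum_smul, map_sum, Fin.sum_univ_succ,
      contr_X_zero]
    simp only [contr_X_succ, contr_one, ← Finset.sum_smul, DP_tmul, hD, LinearMap.sub_apply,
      delHom_apply, sub_mul, TensorProduct.tmul_add, TensorProduct.tmul_sub]
    abel
  | add p q hp hq => simp only [map_add, hp, hq]; abel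
  | mulX i p hp =>
    have hc : lamStar F M (delHom F M φ) = delHom F M (lamStar F M φ) := rfl
    cases i using Fin.cases with
    | zero => rw [map_smul, contr_X_zero, contr_X_zero, contr_X_zero, hp, map_sub, hc]
    | succ i => rw [map_smul, contr_X_succ, contr_X_succ, contr_X_succ, hp, map_smul, smul_add]

lemma pairing_one (φ : HomL F M) (m : M) : pairing φ ((1 : MvPolynomial (Fin 1) F) ⊗ₜ m) = φ 1 * m :=
  rfl

lemma pairing_tmul (φ : HomL F M) (f : MvPolynomial (Fin 1) F) (m : M) :
    pairing φ (f ⊗ₜ m) = φ f * m := rfl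

lemma pairing_X (φ : HomL F M) (p : P F 1 M) :
    pairing φ ((MvPolynomial.X 0 : MvPolynomial (Fin 1) F) • p) = pairing (lamStar F M φ) p := by
  induction p using TensorProduct.induction_on with
  | zero => simp
  | add p q hp hq => rw [smul_add, map_add, map_add, hp, hq]
  | tmul f n => rfl

lemma pairing_evHom (s : F) (m : M) (p : P F 1 M) : pairing (evHom s m) p = m * ev1 F s p := by
  induction p using TensorProduct.induction_on with
  | zero => simp
  | add p q hp hq => rw [map_add, map_add, hp, hq, mul_add]
  | tmul f n => rw [pairing_tmul, evHom_apply, ev_tmul, smul_mul_assoc, mul_smul_comm]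

lemma val0_tmul (f : MvPolynomial (Fin 0) F) (m : M) :
    val0 (f ⊗ₜ[F] m) = MvPolynomial.isEmptyAlgEquiv F (Fin 0) f • m := by
  simp [val0]

lemma val0_one (m : M) : val0 ((1 : MvPolynomial (Fin 0) F) ⊗ₜ[F] m) = m := by
  rw [val0_tmul, map_one, one_smul]

lemma one_val0 (p : P F 0 M) : (1 : MvPolynomial (Fin 0) F) ⊗ₜ[F] val0 p = p := by
  induction p using P_induction with
  | one n => rw [val0_one]
  | mulX i => exact i.elim0
  | add p q hp hq => rw [map_add, TensorProduct.tmul_add, hp, hq]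

lemma ev_eq_val0 (s : Fin 0 → F) (p : P F 0 M) : ev F s p = val0 p := by
  obtain ⟨n, rfl⟩ : ∃ n, p = 1 ⊗ₜ n := ⟨_, (one_val0 p).symm⟩
  rw [val0_one, ev_one]

lemma val0_contr (φ : HomL F M) (p : P F 1 M) : val0 (contr φ p) = pairing φ p := by
  induction p using P_induction generalizing φ with
  | one n => rw [contr_one, val0_one, pairing_one]
  | add p q hp hq => rw [map_add, map_add, map_add, hp, hq]
  | mulX i p hp =>
    rw [Subsingleton.elim i 0, contr_X_zero, hp, pairing_X]

/-! #### Contractions of cochains -/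

variable (F A M) in
/-- The contraction of a cochain by `a ⊗ φ`. -/
def iM (k : ℕ) : A →ₗ[F] HomL F M →ₗ[F] Mult F A M (k + 1) →ₗ[F] Mult F A M k :=
  LinearMap.mk₂ F
    (fun a φ => LinearMap.compMultilinearMapₗ F (contr φ) ∘ₗ
      { toFun := fun γ => γ.curryLeft a, map_add' := fun _ _ => rfl, map_smul' := fun _ _ => rfl })
    (fun a a' φ => LinearMap.ext fun γ => MultilinearMap.ext fun b => by
      change contr φ (γ.curryLeft (a + a') b) =
        contr φ (γ.curryLeft a b) + contr φ (γ.curryLeft a' b)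
      rw [map_add, add_apply, map_add])
    (fun c a φ => LinearMap.ext fun γ => MultilinearMap.ext fun b => by
      change contr φ (γ.curryLeft (c • a) b) = c • contr φ (γ.curryLeft a b)
      rw [map_smul, smul_apply, map_smul])
    (fun a φ φ' => LinearMap.ext fun γ => MultilinearMap.ext fun b => contr_add _ _ _)
    (fun c a φ => LinearMap.ext fun γ => MultilinearMap.ext fun b => contr_smul _ _ _)

lemma iM_apply {k : ℕ} (a : A) (φ : HomL F M) (γ : Mult F A M (k + 1)) (b : Fin k → A) :
    iM F A M k a φ γ b = contr φ (γ (Fin.cons a b)) := rfl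

/-- An evaluation at `s` with coefficient `m` contracts as the point `a_s`, followed by
multiplication by `m`. Other functionals are reached through `eq_zero_of_loc`. -/
lemma hat_iM_evHom {k : ℕ} (a : A) (s : F) (m : M) (γ : Mult F A M (k + 1)) :
    hat k (iM F A M k a (evHom s m) γ) =
      mulMG F (Pts F A) k m ((hat (k + 1) γ).curryLeft (pt F s a)) := by
  refine hat_eq_iff.2 fun t b => ?_
  rw [mulMG_apply, MultilinearMap.curryLeft_apply, iM_apply, ev_contr_evHom, ← hat_pt]
  congr 2
  funext r
  cases r using Fin.cases <;> rfl

variable [CharZero F]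

lemma edel_iM {k : ℕ} (l : Fin k) (a : A) (φ : HomL F M) (γ : Mult F A M (k + 1)) :
    edel l (iM F A M k a φ γ) = iM F A M k a φ (edel l.succ γ) := by
  ext b
  rw [edel_apply, iM_apply, iM_apply, iM_apply, edel_apply, map_add, contr_X_succ, Fin.cons_succ,
    ← Fin.cons_update]

/-- Contracting the defect in the first argument is contraction by the relation `∂a ⊗ φ + a ⊗ λ*φ`
of `Γ̃₁`. On sesquilinear cochains the contraction therefore depends only on the class in `Γ̃₁`. -/
lemma iM_edel_zero {k : ℕ} (a : A) (φ : HomL F M) (γ : Mult F A M (k + 1)) :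
    iM F A M k a φ (edel 0 γ) = iM F A M k (D F A a) φ γ + iM F A M k a (lamStar F M φ) γ := by
  ext b
  rw [add_apply, iM_apply, iM_apply, iM_apply, edel_apply, map_add, contr_X_zero, Fin.cons_zero,
    Fin.update_cons_zero]

lemma iM_thM (hD : ∀ m n : M, D F M (m * n) = D F M m * n + m * D F M n) {k : ℕ} (a : A)
    (φ : HomL F M) (γ : Mult F A M (k + 1)) :
    iM F A M k a φ (thM F A M (k + 1) γ) =
      thM F A M k (iM F A M k a φ γ) + iM F A M k a (lamStar F M φ - delHom F M φ) γ := by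
  ext b
  rw [add_apply, iM_apply, iM_apply, thM_apply, thM_apply, iM_apply, contr_ThP hD]

lemma iM_expD_thM (hD : ∀ m n : M, D F M (m * n) = D F M m * n + m * D F M n) {k : ℕ} (a : A)
    (m : M) (γ : Mult F A M (k + 1)) :
    iM F A M k a (expD F m) (thM F A M (k + 1) γ) = thM F A M k (iM F A M k a (expD F m) γ) := by
  rw [iM_thM hD, lamStar_expD, delHom_expD, sub_self, map_zero, LinearMap.zero_apply, add_zero]

lemma permM_iM {k : ℕ} (σ : Equiv.Perm (Fin k)) (a : A) (φ : HomL F M)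
    (γ : Mult F A M (k + 1)) :
    permM σ (iM F A M k a φ γ) =
      iM F A M k a φ (permM (Equiv.Perm.decomposeFin.symm (0, σ)) γ) := by
  ext b
  rw [permM_apply, iM_apply, iM_apply, permM_apply, contr_ren]
  exact congrArg (fun x => ren F σ (contr φ (γ x))) (cons_comp_decomposeFin a b σ).symm

lemma iM_iM {k : ℕ} {γ : Mult F A M (k + 2)} (h : IsSkewM γ) (a b : A) (φ ψ : HomL F M) :
    iM F A M k a φ (iM F A M (k + 1) b ψ γ) + iM F A M k b ψ (iM F A M (k + 1) a φ γ) = 0 := by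
  ext c
  have h1 := congrArg (fun f => f (Fin.cons a (Fin.cons b c))) (h (Equiv.swap 0 1))
  rw [Equiv.Perm.sign_swap (by simp)] at h1
  have e : (Fin.cons a (Fin.cons b c : Fin (k + 1) → A) : Fin (k + 2) → A) ∘ (Equiv.swap 0 1) =
      Fin.cons b (Fin.cons a c) := by
    funext r
    cases r using Fin.cases with
    | zero => simp
    | succ r =>
      cases r using Fin.cases with
      | zero => simp
      | succ r =>
        rw [Function.comp_apply, Equiv.swap_apply_of_ne_of_ne (Fin.succ_ne_zero _)
          (by rw [← Fin.succ_zero_eq_one, Ne, Fin.succ_inj]; exact Fin.succ_ne_zero _)]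
        simp
  simp only [permM_apply] at h1
  rw [e] at h1
  rw [add_apply, iM_apply, iM_apply, iM_apply, iM_apply, contr_contr, h1]
  simp

end Contractions

/-! ### Lie algebra structures on quotients -/

section LieQuotient

variable {F : Type u} [Field F] {T : Type v} [AddCommGroup T] [Module F T]

/-- The bilinear map induced on a quotient. -/
def quotBilin (R : Submodule F T) (β : T →ₗ[F] T →ₗ[F] T) (h1 : ∀ x ∈ R, ∀ y, β x y ∈ R)
    (h2 : ∀ x, ∀ y ∈ R, β x y ∈ R) : T ⧸ R →ₗ[F] T ⧸ R →ₗ[F] T ⧸ R :=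
  R.liftQ (LinearMap.mk₂ F (fun x => R.mapQ R (β x) (h2 x))
      (fun x x' y => by
        obtain ⟨y, rfl⟩ := R.mkQ_surjective y
        simp)
      (fun c x y => by
        obtain ⟨y, rfl⟩ := R.mkQ_surjective y
        simp)
      (fun x y y' => map_add _ y y') (fun c x y => map_smul _ c y))
    (fun x hx => LinearMap.ext fun y => by
      obtain ⟨y, rfl⟩ := R.mkQ_surjective y
      simpa using h1 x hx y)

/-- A bracket that satisfies the axioms of a Lie algebra modulo a subspace. -/
def LieStr.ofQuot (R : Submodule F T) (β : T →ₗ[F] T →ₗ[F] T) (h1 : ∀ x ∈ R, ∀ y, β x y ∈ R)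
    (h2 : ∀ x, ∀ y ∈ R, β x y ∈ R) (h3 : ∀ x, β x x ∈ R)
    (h4 : ∀ x y z, β x (β y z) - (β (β x y) z + β y (β x z)) ∈ R) : LieStr F (T ⧸ R) where
  br := quotBilin R β h1 h2
  br_self x := by
    obtain ⟨x, rfl⟩ := R.mkQ_surjective x
    exact (Submodule.Quotient.mk_eq_zero R).2 (h3 x)
  jacobi x y z := by
    obtain ⟨x, rfl⟩ := R.mkQ_surjective x
    obtain ⟨y, rfl⟩ := R.mkQ_surjective y
    obtain ⟨z, rfl⟩ := R.mkQ_surjective z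
    exact (Submodule.Quotient.eq R).2 (h4 x y z)

end LieQuotient

/-! ### Lie algebras of chains -/

section Chains

variable {F : Type u} [Field F]
  {A : Type v} [AddCommGroup A] [Module F A] [Module F[X] A] [IsScalarTower F F[X] A]

/-- The operations from which a bracket on a quotient of `A ⊗ H` is built. -/
structure ChainOps (F : Type u) [Field F] (A : Type v) [AddCommGroup A] [Module F A]
    (H : Type w) [AddCommGroup H] [Module F H] where
  mu : H →ₗ[F] H →ₗ[F] H
  δ : H →ₗ[F] H
  r : A →ₗ[F] H →ₗ[F] H →ₗ[F] H

namespace ChainOps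

variable {H : Type w} [AddCommGroup H] [Module F H] (S : ChainOps F A H)

/-- The subspace of relations. -/
def rel : Submodule F (A ⊗[F] H) :=
  LinearMap.range ((D F A).rTensor H + S.δ.lTensor A)

/-- The action of polynomials in `δ`. -/
def pol : MvPolynomial (Fin 1) F →ₐ[F] Module.End F H :=
  (Polynomial.aeval (R := F) (A := Module.End F H) S.δ).comp
    (MvPolynomial.aeval fun _ => (Polynomial.X : F[X]))

lemma pol_X_mul (i : Fin 1) (f : MvPolynomial (Fin 1) F) (h : H) :
    S.pol (MvPolynomial.X i * f) h = S.pol f (S.δ h) := by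
  rw [mul_comm, map_mul, Module.End.mul_apply]
  simp [pol]

lemma pol_X_pol (i : Fin 1) (f : MvPolynomial (Fin 1) F) (h : H) :
    S.pol (MvPolynomial.X i) (S.pol f h) = S.pol f (S.δ h) := by
  rw [← pol_X_mul S i, map_mul, Module.End.mul_apply]

/-- The map `f ⊗ c ↦ c ⊗ (f(δ)h)k`. -/
def first : H →ₗ[F] H →ₗ[F] P F 1 A →ₗ[F] A ⊗[F] H :=
  LinearMap.mk₂ F (fun h k => (TensorProduct.comm F H A).toLinearMap ∘ₗ
      (S.mu.flip k ∘ₗ S.pol.toLinearMap.flip h).rTensor A)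
    (fun h h' k => by rw [← LinearMap.comp_add, ← LinearMap.rTensor_add]; simp [LinearMap.comp_add])
    (fun c h k => by rw [← LinearMap.comp_smul, ← LinearMap.rTensor_smul]; simp [LinearMap.comp_smul])
    (fun h k k' => by rw [← LinearMap.comp_add, ← LinearMap.rTensor_add]; simp [LinearMap.add_comp])
    (fun c h k => by rw [← LinearMap.comp_smul, ← LinearMap.rTensor_smul]; simp [LinearMap.smul_comp])

lemma first_tmul (h k : H) (f : MvPolynomial (Fin 1) F) (c : A) :
    S.first h k (f ⊗ₜ c) = c ⊗ₜ S.mu (S.pol f h) k := rfl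

lemma first_one (h k : H) (c : A) : S.first h k (1 ⊗ₜ c) = c ⊗ₜ S.mu h k := by
  rw [first_tmul, map_one]
  rfl

lemma first_X (h k : H) (i : Fin 1) (p : P F 1 A) :
    S.first h k ((MvPolynomial.X i : MvPolynomial (Fin 1) F) • p) = S.first (S.δ h) k p := by
  induction p using TensorProduct.induction_on with
  | zero => simp
  | add p q hp hq => rw [smul_add, map_add, map_add, hp, hq]
  | tmul f c =>
    rw [TensorProduct.smul_tmul', smul_eq_mul, first_tmul, first_tmul, pol_X_mul]

/-- The part of the bracket that comes from the `λ`-bracket of `A`. -/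
def b0 (L : LieConformalAlgebra F A) : A ⊗[F] H →ₗ[F] A ⊗[F] H →ₗ[F] A ⊗[F] H :=
  TensorProduct.lift (LinearMap.mk₂ F
    (fun a h => TensorProduct.lift (LinearMap.mk₂ F (fun b k => S.first h k (L.bracket a b))
      (by intros; simp) (by intros; simp) (by intros; simp) (by intros; simp)))
    (by intros; ext; simp) (by intros; ext; simp) (by intros; ext; simp) (by intros; ext; simp))

lemma b0_tmul (L : LieConformalAlgebra F A) (a b : A) (h k : H) :
    S.b0 L (a ⊗ₜ h) (b ⊗ₜ k) = S.first h k (L.bracket a b) := rfl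

/-- The action of chains on `H`. -/
def rT : A ⊗[F] H →ₗ[F] H →ₗ[F] H := TensorProduct.lift S.r

/-- The action of chains on chains through the second factor. -/
def rho : A ⊗[F] H →ₗ[F] A ⊗[F] H →ₗ[F] A ⊗[F] H := LinearMap.lTensorHom A ∘ₗ S.rT

lemma rho_apply (x : A ⊗[F] H) : S.rho x = (S.rT x).lTensor A := rfl

/-- The bracket of chains. -/
def brT (L : LieConformalAlgebra F A) : A ⊗[F] H →ₗ[F] A ⊗[F] H →ₗ[F] A ⊗[F] H :=
  S.b0 L + S.rho - S.rho.flip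

lemma brT_apply (L : LieConformalAlgebra F A) (x y : A ⊗[F] H) :
    S.brT L x y = S.b0 L x y + S.rho x y - S.rho y x := rfl

lemma brT_tmul (L : LieConformalAlgebra F A) (a b : A) (h k : H) :
    S.brT L (a ⊗ₜ h) (b ⊗ₜ k) =
      S.first h k (L.bracket a b) + b ⊗ₜ S.r a h k - a ⊗ₜ S.r b k h := rfl

/-- The axioms under which the bracket of chains is a Lie bracket. -/
structure Laws (L : LieConformalAlgebra F A) : Prop where
  mu_comm : ∀ h k, S.mu h k = S.mu k h
  mu_assoc : ∀ h k l, S.mu (S.mu h k) l = S.mu h (S.mu k l)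
  δ_mu : ∀ h k, S.δ (S.mu h k) = S.mu (S.δ h) k + S.mu h (S.δ k)
  r_del : ∀ a h, S.r (D F A a) h + S.r a (S.δ h) = 0
  r_δ : ∀ a h k, S.r a h (S.δ k) = S.δ (S.r a h k)
  r_mu : ∀ a h k l, S.r a h (S.mu k l) = S.mu (S.r a h k) l + S.mu k (S.r a h l)
  r_hom : ∀ a b h k l, S.rT (S.brT L (a ⊗ₜ h) (b ⊗ₜ k)) l =
    S.r a h (S.r b k l) - S.r b k (S.r a h l)

variable {S} {L : LieConformalAlgebra F A} (hS : S.Laws L)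
include hS

lemma first_deriv {T : H →ₗ[F] H} (hT : ∀ h, T (S.δ h) = S.δ (T h))
    (hmu : ∀ h k, T (S.mu h k) = S.mu (T h) k + S.mu h (T k)) (h k : H) (p : P F 1 A) :
    T.lTensor A (S.first h k p) = S.first (T h) k p + S.first h (T k) p := by
  induction p using P_induction generalizing h with
  | one n => rw [first_one, first_one, first_one, LinearMap.lTensor_tmul, hmu,
      TensorProduct.tmul_add]
  | mulX i p hp => rw [first_X, first_X, first_X, hp, hT]
  | add p q hp hq => simp only [map_add, hp, hq]; abel

/-- Applying `∂` to the `A`-factor and `δ` to either factor of the product amounts to applying `∂ ⊗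
1 + 1 ⊗ δ`, that is, to a relation. -/
lemma first_DP (h k : H) (p : P F 1 A) :
    S.first h k (DP F 1 p) + S.first (S.δ h) k p + S.first h (S.δ k) p ∈ S.rel := by
  rw [add_assoc, ← first_deriv hS (fun _ => rfl) hS.δ_mu]
  refine ⟨S.first h k p, ?_⟩
  rw [LinearMap.add_apply]
  congr 1
  induction p using P_induction generalizing h with
  | one n => rw [DP_tmul, first_one, first_one, LinearMap.rTensor_tmul]
  | mulX i p hp => rw [DP_smul, first_X, first_X, hp]
  | add p q hp hq => simp only [map_add, hp, hq]

/-- The variable acts as `δ` on `h`, and modulo relations `∂` acts as `-δ` on `h` minus `δ` on `k`.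
So `-λ - ∂` acts as `δ` on `k`. -/
lemma first_reflect (h k : H) (p : P F 1 A) :
    S.first h k (subst F (fun _ => -lam F (0 : Fin 1) - del F 1) p) - S.first k h p ∈ S.rel := by
  induction p using P_induction generalizing k with
  | one n =>
    rw [subst_one, first_one, first_one, hS.mu_comm, sub_self]
    exact S.rel.zero_mem
  | mulX i p hp =>
    rw [subst_X, first_X, map_sub, map_neg, LinearMap.sub_apply, LinearMap.neg_apply, dact_lam,
      dact_del, map_sub, map_neg, first_X]
    have h1 := S.rel.sub_mem (hp (S.δ k))
      (first_DP hS h k (subst F (fun _ => -lam F (0 : Fin 1) - del F 1) p))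
    convert h1 using 1
    abel
  | add p q hp hq =>
    rw [map_add, map_add, map_add, add_sub_add_comm]
    exact S.rel.add_mem (hp k) (hq k)

/-- By sesquilinearity on the left, `∂a ⊗ h` and `a ⊗ δh` contribute opposite terms, so the
vanishing is exact and not merely modulo relations. -/
lemma b0_rel_left {x : A ⊗[F] H} (hx : x ∈ S.rel) : S.b0 L x = 0 := by
  obtain ⟨x, rfl⟩ := hx
  induction x using TensorProduct.induction_on with
  | zero => simp
  | add x y hx hy => rw [map_add, map_add, hx, hy, add_zero]
  | tmul a h =>
    ext b k
    change S.first h k (L.bracket (D F A a) b) + S.first (S.δ h) k (L.bracket a b) = 0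
    rw [L.sesq_left, map_neg, first_X, neg_add_cancel]

lemma b0_skew (x y : A ⊗[F] H) : S.b0 L x y + S.b0 L y x ∈ S.rel := by
  induction x using TensorProduct.induction_on with
  | zero => simp
  | add x x' hx hx' =>
    convert S.rel.add_mem hx hx' using 1
    simp only [map_add, LinearMap.add_apply]; abel
  | tmul a h =>
  induction y using TensorProduct.induction_on with
  | zero => simp
  | add x x' hx hx' =>
    convert S.rel.add_mem hx hx' using 1
    simp only [map_add, LinearMap.add_apply]; abel
  | tmul b k =>
    rw [b0_tmul, b0_tmul, L.skew, map_neg, neg_add_eq_sub, ← neg_sub]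
    exact S.rel.neg_mem (first_reflect hS h k _)

omit hS in
variable (S) in
/-- The map `λ₁ⁱ λ₂ʲ c ↦ c ⊗ (δⁱh)(δʲk)l`. -/
def second (h k l : H) : P F 2 A →ₗ[F] A ⊗[F] H :=
  (TensorProduct.comm F H A).toLinearMap ∘ₗ (LinearMap.rTensor A
    (S.mu.flip l ∘ₗ TensorProduct.lift S.mu ∘ₗ (TensorProduct.map
      -- `split` puts `λ₁` into the second tensor factor, which is why `k` comes before `h`.
      (S.pol.toLinearMap.flip k)
      (S.pol.toLinearMap.flip h)) ∘ₗ
        (split F 1).toLinearMap))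

lemma second_one (h k l : H) (c : A) : S.second h k l (1 ⊗ₜ c) = c ⊗ₜ S.mu (S.mu h k) l := by
  simp [second, Algebra.TensorProduct.one_def, hS.mu_comm h k]

lemma second_X (h k l : H) (i : Fin 2) (p : P F 2 A) :
    S.second h k l ((MvPolynomial.X i : MvPolynomial (Fin 2) F) • p) =
      S.second (if i = 0 then S.δ h else h) (if i = 0 then k else S.δ k) l p := by
  induction p using TensorProduct.induction_on with
  | zero => simp
  | add p q hp hq => simp only [smul_add, map_add, hp, hq]
  | tmul f c =>
    rw [TensorProduct.smul_tmul', smul_eq_mul]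
    simp only [second, LinearMap.comp_apply, LinearMap.rTensor_tmul, AlgHom.toLinearMap_apply,
      map_mul]
    generalize split F 1 f = u
    induction u using TensorProduct.induction_on with
    | zero => simp
    | add p q hp hq => simp only [mul_add, map_add, hp, hq, TensorProduct.add_tmul]
    | tmul f g =>
      fin_cases i
      · simp [split, pol_X_pol]
      · simp [split, pol_X_pol]

lemma second_ren_zero (h k l : H) (p : P F 1 A) :
    S.second h k l (ren F (fun _ => 0) p) = S.first h (S.mu k l) p := by
  induction p using P_induction generalizing h with
  | one n => rw [ren_one, second_one hS, first_one, hS.mu_assoc]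
  | mulX i p hp => rw [ren_X, second_X hS, first_X, if_pos rfl, if_pos rfl, hp]
  | add p q hp hq => simp only [map_add, hp, hq]

lemma second_ren_one (h k l : H) (p : P F 1 A) :
    S.second h k l (ren F (fun _ => 1) p) = S.first k (S.mu h l) p := by
  induction p using P_induction generalizing k with
  | one n => rw [ren_one, second_one hS, first_one, hS.mu_comm h k, hS.mu_assoc]
  | mulX i p hp =>
    rw [ren_X, second_X hS, first_X, if_neg one_ne_zero, if_neg one_ne_zero, hp]
  | add p q hp hq => simp only [map_add, hp, hq]

lemma second_subst (h k l : H) (p : P F 1 A) :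
    S.second h k l (subst F (fun _ => lam F (0 : Fin 2) + lam F 1) p) =
      S.first (S.mu h k) l p := by
  induction p using P_induction generalizing h k with
  | one n => rw [subst_one, second_one hS, first_one]
  | mulX i p hp =>
    rw [subst_X, map_add, LinearMap.add_apply, dact_lam, dact_lam, map_add, second_X hS,
      second_X hS, first_X, if_pos rfl, if_pos rfl, if_neg one_ne_zero, if_neg one_ne_zero, hp, hp,
      hS.δ_mu, map_add, LinearMap.add_apply, LinearMap.add_apply]
  | add p q hp hq => simp only [map_add, hp, hq]

lemma second_act_zero (a : A) (h k l : H) (p : P F 1 A) :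
    S.second h k l (actAt (L.bracket a) (0 : Fin 2) (ren F (fun _ => 1) p)) =
      S.b0 L (a ⊗ₜ h) (S.first k l p) := by
  induction p using P_induction generalizing k with
  | one n =>
    rw [ren_one, first_one, b0_tmul, actAt_tmul, one_smul, second_ren_zero hS]
  | mulX i p hp =>
    rw [ren_X, actAt_smul, second_X hS, first_X, if_neg one_ne_zero, if_neg one_ne_zero, hp]
  | add p q hp hq => simp only [map_add, hp, hq]

lemma second_act_one (a : A) (h k l : H) (p : P F 1 A) :
    S.second h k l (actAt (L.bracket a) (1 : Fin 2) (ren F (fun _ => 0) p)) =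
      S.b0 L (a ⊗ₜ k) (S.first h l p) := by
  induction p using P_induction generalizing h with
  | one n =>
    rw [ren_one, first_one, b0_tmul, actAt_tmul, one_smul, second_ren_one hS]
  | mulX i p hp =>
    rw [ren_X, actAt_smul, second_X hS, first_X, if_pos rfl, if_pos rfl, hp]
  | add p q hp hq => simp only [map_add, hp, hq]

lemma second_bind (c : A) (h k l : H) (p : P F 1 A) :
    S.second h k l (bind (MvPolynomial.X 0 : MvPolynomial (Fin 2) F)
        (subst F (fun _ => lam F (0 : Fin 2) + lam F 1) ∘ₗ L.bracket.flip c) p) =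
      S.b0 L (S.first h k p) (c ⊗ₜ l) := by
  induction p using P_induction generalizing h with
  | one n =>
    rw [bind_one, first_one, b0_tmul, LinearMap.comp_apply, second_subst hS]
    rfl
  | mulX i p hp =>
    rw [bind_X, second_X hS, first_X, if_pos rfl, if_pos rfl, hp]
  | add p q hp hq => simp only [map_add, hp, hq, LinearMap.add_apply]

/-- Applying `second h k l` to the Jacobi identity of `A` turns its three terms into the three
iterated brackets; no relation is needed. -/
lemma b0_jacobi (x y z : A ⊗[F] H) :
    S.b0 L x (S.b0 L y z) = S.b0 L (S.b0 L x y) z + S.b0 L y (S.b0 L x z) := by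
  induction x using TensorProduct.induction_on with
  | zero => simp
  | add x x' hx hx' => simp only [map_add, LinearMap.add_apply, hx, hx']; abel
  | tmul a h =>
  induction y using TensorProduct.induction_on with
  | zero => simp
  | add x x' hx hx' => simp only [map_add, LinearMap.add_apply, hx, hx']; abel
  | tmul b k =>
  induction z using TensorProduct.induction_on with
  | zero => simp
  | add x x' hx hx' => simp only [map_add, hx, hx']; abel
  | tmul c l =>
    rw [← sub_eq_iff_eq_add, b0_tmul, b0_tmul, b0_tmul, ← second_act_zero hS,
      ← second_act_one hS, ← second_bind hS, ← map_sub, L.jacobi]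

lemma rT_rel {x : A ⊗[F] H} (hx : x ∈ S.rel) : S.rT x = 0 := by
  obtain ⟨x, rfl⟩ := hx
  induction x using TensorProduct.induction_on with
  | zero => simp
  | add x y hx hy => rw [map_add, map_add, hx, hy, add_zero]
  | tmul a h => exact hS.r_del a h

lemma rT_δ (x : A ⊗[F] H) (k : H) : S.rT x (S.δ k) = S.δ (S.rT x k) := by
  induction x using TensorProduct.induction_on with
  | zero => simp
  | add x y hx hy => simp only [map_add, LinearMap.add_apply, hx, hy]
  | tmul a h => exact hS.r_δ a h k

lemma rT_mu (x : A ⊗[F] H) (k l : H) :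
    S.rT x (S.mu k l) = S.mu (S.rT x k) l + S.mu k (S.rT x l) := by
  induction x using TensorProduct.induction_on with
  | zero => simp
  | add x y hx hy => simp only [map_add, LinearMap.add_apply, hx, hy]; abel
  | tmul a h => exact hS.r_mu a h k l

lemma rT_brT (x y : A ⊗[F] H) (l : H) :
    S.rT (S.brT L x y) l = S.rT x (S.rT y l) - S.rT y (S.rT x l) := by
  induction x using TensorProduct.induction_on with
  | zero => simp
  | add x x' hx hx' => simp only [map_add, LinearMap.add_apply, hx, hx']; abel
  | tmul a h =>
  induction y using TensorProduct.induction_on with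
  | zero => simp
  | add x x' hx hx' => simp only [map_add, LinearMap.add_apply, hx, hx']; abel
  | tmul b k => exact hS.r_hom a b h k l

lemma rho_mem (x : A ⊗[F] H) {y : A ⊗[F] H} (hy : y ∈ S.rel) : S.rho x y ∈ S.rel := by
  obtain ⟨y, rfl⟩ := hy
  refine ⟨S.rho x y, ?_⟩
  induction y using TensorProduct.induction_on with
  | zero => simp
  | add y y' hy hy' => simp only [map_add, hy, hy']
  | tmul b k =>
    simp only [rho_apply, LinearMap.lTensor_tmul, LinearMap.add_apply, LinearMap.rTensor_tmul,
      map_add, rT_δ hS]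

lemma rho_rel {x : A ⊗[F] H} (hx : x ∈ S.rel) : S.rho x = 0 := by
  rw [rho, LinearMap.comp_apply, rT_rel hS hx, map_zero]

lemma rho_brT (x y z : A ⊗[F] H) :
    S.rho (S.brT L x y) z = S.rho x (S.rho y z) - S.rho y (S.rho x z) := by
  induction z using TensorProduct.induction_on with
  | zero => simp
  | add x x' hx hx' => simp only [map_add, hx, hx']; abel
  | tmul c l =>
    simp only [rho_apply, LinearMap.lTensor_tmul, rT_brT hS, TensorProduct.tmul_sub]

/-- The action of a chain on `H` is a derivation of the product and commutes with `δ`, the two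
operations used by `first`. -/
lemma rho_b0 (x y z : A ⊗[F] H) :
    S.rho x (S.b0 L y z) = S.b0 L (S.rho x y) z + S.b0 L y (S.rho x z) := by
  induction y using TensorProduct.induction_on with
  | zero => simp
  | add x x' hx hx' => simp only [map_add, LinearMap.add_apply, hx, hx']; abel
  | tmul b k =>
  induction z using TensorProduct.induction_on with
  | zero => simp
  | add x x' hx hx' => simp only [map_add, hx, hx']; abel
  | tmul c l =>
    rw [b0_tmul, rho_apply, LinearMap.lTensor_tmul, LinearMap.lTensor_tmul, b0_tmul, b0_tmul,
      first_deriv hS (rT_δ hS x) (rT_mu hS x)]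

lemma brT_rel_left {x : A ⊗[F] H} (hx : x ∈ S.rel) (y : A ⊗[F] H) : S.brT L x y ∈ S.rel := by
  rw [brT_apply, b0_rel_left hS hx, rho_rel hS hx, LinearMap.zero_apply, zero_add, zero_sub]
  exact S.rel.neg_mem (rho_mem hS y hx)

lemma brT_skew (x y : A ⊗[F] H) : S.brT L x y + S.brT L y x ∈ S.rel := by
  convert b0_skew hS x y using 1
  rw [brT_apply, brT_apply]
  abel

lemma brT_rel_right (x : A ⊗[F] H) {y : A ⊗[F] H} (hy : y ∈ S.rel) : S.brT L x y ∈ S.rel := by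
  have := S.rel.sub_mem (brT_skew hS x y) (brT_rel_left hS hy x)
  rwa [add_sub_cancel_right] at this

/-- All terms cancel by `b0_jacobi`, `rho_brT` and `rho_b0`, except for one instance of the failure
of skew-symmetry of `b0`, which is a relation. -/
lemma brT_jacobi (x y z : A ⊗[F] H) :
    S.brT L x (S.brT L y z) - (S.brT L (S.brT L x y) z + S.brT L y (S.brT L x z)) ∈ S.rel := by
  convert b0_skew hS (S.rho z x) y using 1
  rw [brT_apply S L x (S.brT L y z), brT_apply S L (S.brT L x y), brT_apply S L y (S.brT L x z),
    rho_brT hS, rho_brT hS, rho_brT hS, brT_apply, brT_apply, brT_apply]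
  simp only [map_add, map_sub, LinearMap.add_apply, LinearMap.sub_apply, rho_b0 hS,
    b0_jacobi hS x y z]
  abel

/-- The Lie algebra of chains. -/
def Laws.lie [CharZero F] : LieStr F ((A ⊗[F] H) ⧸ S.rel) :=
  LieStr.ofQuot S.rel (S.brT L) (fun _ hx y => brT_rel_left hS hx y)
    (fun x _ hy => brT_rel_right hS x hy)
    (fun x => by
      -- Skew-symmetry modulo relations gives `2[x, x] = 0` in the quotient, and `2` is invertible.
      have := S.rel.smul_mem (2⁻¹ : F) (brT_skew hS x x)
      rwa [← two_smul F, smul_smul, inv_mul_cancel₀ two_ne_zero, one_smul] at this)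
    (brT_jacobi hS)

end ChainOps

end Chains

/-! ### Functionals that depend on finitely many coefficients -/

section Locality

variable {F : Type u} [Field F]
  {M : Type w} [AddCommGroup M] [Module F M]

/-- `T φ` depends on finitely many values of `φ` only. -/
def Loc {Z : Type*} [AddCommGroup Z] (T : HomL F M → Z) : Prop :=
  ∃ S : Set (MvPolynomial (Fin 1) F), S.Finite ∧ ∀ φ, (∀ f ∈ S, φ f = 0) → T φ = 0

variable {Z : Type*} [AddCommGroup Z] {T T' : HomL F M → Z}

lemma Loc.apply (f : MvPolynomial (Fin 1) F) : Loc (fun φ : HomL F M => φ f) :=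
  ⟨{f}, Set.finite_singleton f, fun _ h => h f rfl⟩

lemma Loc.zero : Loc (fun _ : HomL F M => (0 : Z)) := ⟨∅, Set.finite_empty, fun _ _ => rfl⟩

lemma Loc.add (h : Loc T) (h' : Loc T') : Loc (fun φ => T φ + T' φ) := by
  obtain ⟨S, hS, h⟩ := h
  obtain ⟨S', hS', h'⟩ := h'
  refine ⟨S ∪ S', hS.union hS', fun φ hφ => ?_⟩
  beta_reduce
  rw [h φ fun f hf => hφ f (Or.inl hf), h' φ fun f hf => hφ f (Or.inr hf), add_zero]

lemma Loc.comp {Z' : Type*} [AddCommGroup Z'] (h : Loc T) (g : Z → Z') (hg : g 0 = 0) :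
    Loc (fun φ => g (T φ)) := by
  obtain ⟨S, hS, h⟩ := h
  exact ⟨S, hS, fun φ hφ => by beta_reduce; rw [h φ hφ, hg]⟩

lemma Loc.sub (h : Loc T) (h' : Loc T') : Loc (fun φ => T φ - T' φ) := by
  simpa only [sub_eq_add_neg] using h.add (h'.comp Neg.neg neg_zero)

lemma Loc.of_finite {Z' ι : Type*} [AddCommGroup Z'] {T' : ι → HomL F M → Z'} {s : Set ι} (hs : s.Finite)
    (h : ∀ i ∈ s, Loc (T' i)) (hT : ∀ φ, (∀ i ∈ s, T' i φ = 0) → T φ = 0) : Loc T := by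
  choose! S hS hS' using h
  refine ⟨⋃ i ∈ s, S i, hs.biUnion hS, fun φ hφ => hT φ fun i hi => hS' i hi φ fun f hf => ?_⟩
  exact hφ f (Set.mem_biUnion hi hf)

lemma Loc.precomp (h : Loc T) (U : HomL F M → HomL F M) (hU : ∀ f, Loc (fun φ => U φ f)) :
    Loc (fun φ => T (U φ)) := by
  obtain ⟨S, hS, h⟩ := h
  choose! S' hS' hU using hU
  refine ⟨⋃ f ∈ S, S' f, hS.biUnion fun f _ => hS' f, fun φ hφ => h _ fun f hf => ?_⟩
  exact hU f φ fun g hg => hφ g (Set.mem_biUnion hf hg)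

end Locality

/-! ### Approximation of functionals on `F[λ]` by evaluations. -/

section Approximation

variable {F : Type u} [Field F] [CharZero F]
  {M : Type w} [NonUnitalCommRing M] [Module F M]
  [Module F[X] M] [IsScalarTower F F[X] M]

/-- On the finite-dimensional span of `S` the evaluations at points of `F` span the dual space,
since a polynomial that vanishes on an infinite field is zero. Expanding `φ` in a basis of the span
reduces `M`-valued functionals to scalar ones. -/
lemma exists_evHom_span (S : Set (MvPolynomial (Fin 1) F)) (hS : S.Finite) (φ : HomL F M) :
    ∃ φ' ∈ Submodule.span F (Set.range fun p : F × M => evHom p.1 p.2), ∀ f ∈ S, φ' f = φ f := by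
  let W := Submodule.span F S
  have : FiniteDimensional F W := FiniteDimensional.span_of_finite F hS
  let E : Submodule F (Module.Dual F W) := Submodule.span F
    (Set.range fun s : F => (MvPolynomial.aeval (fun _ : Fin 1 => s)).toLinearMap ∘ₗ W.subtype)
  have hE : E = ⊤ := by
    rw [← Subspace.dualCoannihilator_dualAnnihilator_eq (W := E)]
    -- The common kernel of the evaluations is zero, so they span the dual.
    have : E.dualCoannihilator = ⊥ := by
      rw [eq_bot_iff]
      intro x hx
      rw [Submodule.mem_dualCoannihilator] at hx
      refine Subtype.ext (MvPolynomial.funext fun s => ?_)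
      have := hx _ (Submodule.subset_span ⟨s 0, rfl⟩)
      have e : s = fun _ => s 0 := funext fun i => by rw [Subsingleton.elim i 0]
      rw [e]
      simpa [MvPolynomial.aeval_eq_eval] using this
    rw [this, Submodule.dualAnnihilator_bot]
  have key : ∀ (c : Module.Dual F W) (m : M),
      ∃ φ' ∈ Submodule.span F (Set.range fun p : F × M => evHom p.1 p.2),
        ∀ x : W, φ' (x : MvPolynomial (Fin 1) F) = c x • m := by
    intro c m
    have hc : c ∈ E := hE ▸ Submodule.mem_top
    induction hc using Submodule.span_induction with
    | mem c hc =>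
      obtain ⟨s, rfl⟩ := hc
      exact ⟨evHom s m, Submodule.subset_span ⟨(s, m), rfl⟩, fun x => rfl⟩
    | zero => exact ⟨0, Submodule.zero_mem _, fun x => by simp⟩
    | add c c' _ _ h h' =>
      obtain ⟨φ1, h1, h2⟩ := h
      obtain ⟨φ1', h1', h2'⟩ := h'
      exact ⟨φ1 + φ1', Submodule.add_mem _ h1 h1', fun x => by
        rw [LinearMap.add_apply, h2, h2', LinearMap.add_apply, add_smul]⟩
    | smul r c _ h =>
      obtain ⟨φ1, h1, h2⟩ := h
      exact ⟨r • φ1, Submodule.smul_mem _ r h1, fun x => by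
        rw [LinearMap.smul_apply, h2, LinearMap.smul_apply, smul_assoc]⟩
  let b := Module.finBasis F W
  choose Φ hΦ hΦ' using fun i => key (b.coord i) (φ (b i))
  refine ⟨∑ i, Φ i, Submodule.sum_mem _ fun i _ => hΦ i, fun f hf => ?_⟩
  let x : W := ⟨f, Submodule.subset_span hf⟩
  have : φ f = φ (∑ i, b.repr x i • b i : W) := by rw [b.sum_repr]
  rw [this, LinearMap.sum_apply, Submodule.coe_sum, map_sum]
  exact Finset.sum_congr rfl fun i _ => by rw [hΦ' i x, Submodule.coe_smul, map_smul]; rfl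

/-- A linear map of `φ` that depends on finitely many values of `φ` is determined by its values at
the evaluations. -/
lemma eq_zero_of_loc {Z : Type*} [AddCommGroup Z] [Module F Z] (T : HomL F M →ₗ[F] Z)
    (hT : Loc T) (h : ∀ s m, T (evHom s m) = 0) (φ : HomL F M) : T φ = 0 := by
  obtain ⟨S, hS, hT⟩ := hT
  obtain ⟨φ', h1, h2⟩ := exists_evHom_span S hS φ
  have h3 : T φ' = 0 := by
    have : Submodule.span F (Set.range fun p : F × M => evHom p.1 p.2) ≤ LinearMap.ker T := by
      rw [Submodule.span_le]
      rintro _ ⟨p, rfl⟩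
      exact h p.1 p.2
    exact this h1
  rw [← sub_add_cancel φ φ', map_add, h3, add_zero]
  exact hT _ fun f hf => by rw [LinearMap.sub_apply, h2 f hf, sub_self]

lemma loc_contr {k : ℕ} (p : P F (k + 1) M) [IsScalarTower F M M] [SMulCommClass F M M] :
    Loc (fun φ : HomL F M => contr φ p) := by
  induction p using P_induction with
  | one n =>
    simp only [contr_one]
    exact (Loc.apply (M := M) 1).comp (fun m => (1 : MvPolynomial (Fin k) F) ⊗ₜ (m * n)) (by simp)
  | mulX i p hp =>
    cases i using Fin.cases with
    | zero =>
      simp only [contr_X_zero]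
      exact hp.precomp (lamStar F M) fun f => Loc.apply _
    | succ i =>
      simp only [contr_X_succ]
      exact hp.comp (fun q => (MvPolynomial.X i : MvPolynomial (Fin k) F) • q) (smul_zero _)
  | add p q hp hq =>
    simp only [map_add]
    exact hp.add hq

lemma loc_pairing (p : P F 1 M) [IsScalarTower F M M] [SMulCommClass F M M] :
    Loc (fun φ : HomL F M => pairing φ p) := by
  simp only [← val0_contr]
  exact (loc_contr p).comp val0 (map_zero _)

end Approximation

/-! ### The Lie algebras of basic and of polynomial chains -/

section ChainLaws

variable {F : Type u} [Field F]
  {A : Type v} [AddCommGroup A] [Module F A] [Module F[X] A] [IsScalarTower F F[X] A]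
  {M : Type w} [NonUnitalCommRing M] [Module F M] [IsScalarTower F M M] [SMulCommClass F M M]
  [Module F[X] M] [IsScalarTower F F[X] M]
  {L : LieConformalAlgebra F A} (V : LieConformalModule L M)

/-- Induction on polynomials in one variable. -/
lemma poly_induction {motive : MvPolynomial (Fin 1) F → Prop} (f : MvPolynomial (Fin 1) F)
    (one : motive 1) (smul : ∀ (c : F) f, motive f → motive (c • f))
    (add : ∀ f g, motive f → motive g → motive (f + g))
    (mulX : ∀ f, motive f → motive (MvPolynomial.X 0 * f)) : motive f := by
  induction f using MvPolynomial.induction_on with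
  | C a =>
    rw [← mul_one (MvPolynomial.C a), ← MvPolynomial.smul_eq_C_mul]
    exact smul a 1 one
  | add p q hp hq => exact add p q hp hq
  | mul_X p i hp => rw [mul_comm, Subsingleton.elim i 0]; exact mulX p hp

lemma conv_apply (φ ψ : HomL F M) (f : MvPolynomial (Fin 1) F) :
    conv φ ψ f = LinearMap.mul' F M (TensorProduct.map φ ψ
      (MvPolynomial.aeval (fun _ => (MvPolynomial.X 0 ⊗ₜ[F] 1 + 1 ⊗ₜ[F] MvPolynomial.X 0 :
        MvPolynomial (Fin 1) F ⊗[F] MvPolynomial (Fin 1) F)) f)) := rfl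

lemma conv_one (φ ψ : HomL F M) : conv φ ψ 1 = φ 1 * ψ 1 := by
  rw [conv_apply, map_one, Algebra.TensorProduct.one_def, TensorProduct.map_tmul,
    LinearMap.mul'_apply]

/-- This makes `λ*` a derivation of the product. Together with the value at `1` it determines the
product, so identities follow by induction on the polynomial, with the functionals left arbitrary.
-/
lemma conv_X (φ ψ : HomL F M) (f : MvPolynomial (Fin 1) F) :
    conv φ ψ (MvPolynomial.X 0 * f) = conv (lamStar F M φ) ψ f + conv φ (lamStar F M ψ) f := by
  rw [conv_apply, conv_apply, conv_apply, map_mul, MvPolynomial.aeval_X]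
  generalize MvPolynomial.aeval (fun _ => (MvPolynomial.X 0 ⊗ₜ[F] 1 + 1 ⊗ₜ[F] MvPolynomial.X 0 :
        MvPolynomial (Fin 1) F ⊗[F] MvPolynomial (Fin 1) F)) f = u
  induction u using TensorProduct.induction_on with
  | zero => simp
  | add u u' h h' => simp only [mul_add, map_add, h, h']; abel
  | tmul f g => simp [add_mul, lamStar_apply]

variable (F M) in
/-- The product of `Hom(F[λ], M)` as a bilinear map. -/
def convL : HomL F M →ₗ[F] HomL F M →ₗ[F] HomL F M :=
  LinearMap.mk₂ F conv
    (fun φ φ' ψ => LinearMap.ext fun f => by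
      simp [conv_apply, TensorProduct.map_add_left])
    (fun c φ ψ => LinearMap.ext fun f => by
      simp [conv_apply, TensorProduct.map_smul_left])
    (fun φ ψ ψ' => LinearMap.ext fun f => by
      simp [conv_apply, TensorProduct.map_add_right])
    (fun c φ ψ => LinearMap.ext fun f => by
      simp [conv_apply, TensorProduct.map_smul_right])

lemma convL_apply (φ ψ : HomL F M) : convL F M φ ψ = conv φ ψ := rfl

lemma conv_comm (φ ψ : HomL F M) : conv φ ψ = conv ψ φ := by
  refine LinearMap.ext fun f => ?_
  induction f using poly_induction generalizing φ ψ with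
  | one => rw [conv_one, conv_one, mul_comm]
  | smul c f h => rw [map_smul, map_smul, h]
  | add f g h h' => rw [map_add, map_add, h, h']
  | mulX f h => rw [conv_X, conv_X, h, h φ, add_comm]

lemma lamStar_conv (φ ψ : HomL F M) :
    lamStar F M (conv φ ψ) = conv (lamStar F M φ) ψ + conv φ (lamStar F M ψ) :=
  LinearMap.ext fun f => conv_X φ ψ f

lemma conv_assoc (φ ψ χ : HomL F M) : conv (conv φ ψ) χ = conv φ (conv ψ χ) := by
  refine LinearMap.ext fun f => ?_
  induction f using poly_induction generalizing φ ψ χ with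
  | one => rw [conv_one, conv_one, conv_one, conv_one, mul_assoc]
  | smul c f h => rw [map_smul, map_smul, h]
  | add f g h h' => rw [map_add, map_add, h, h']
  | mulX f h =>
    rw [conv_X, conv_X, lamStar_conv, lamStar_conv, ← convL_apply (_ + _), map_add,
      ← convL_apply _ (_ + _), map_add, LinearMap.add_apply, LinearMap.add_apply,
      LinearMap.add_apply, convL_apply, convL_apply, convL_apply, convL_apply, h, h, h]
    abel

lemma comp_conv {T : M →ₗ[F] M} (hT : ∀ m n, T (m * n) = T m * n + m * T n) (φ ψ : HomL F M) :
    T ∘ₗ conv φ ψ = conv (T ∘ₗ φ) ψ + conv φ (T ∘ₗ ψ) := by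
  refine LinearMap.ext fun f => ?_
  rw [LinearMap.add_apply, LinearMap.comp_apply]
  induction f using poly_induction generalizing φ ψ with
  | one => rw [conv_one, conv_one, conv_one, hT]; rfl
  | smul c f h => rw [map_smul, map_smul, map_smul, map_smul, h, smul_add]
  | add f g h h' => simp only [map_add, h, h']; abel
  | mulX f h =>
    rw [conv_X, conv_X, conv_X, map_add, h, h]
    change _ + _ + (_ + _) = conv (T ∘ₗ lamStar F M φ) ψ f + conv (T ∘ₗ φ) (lamStar F M ψ) f +
      (conv (lamStar F M φ) (T ∘ₗ ψ) f + conv φ (T ∘ₗ lamStar F M ψ) f)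
    abel

/-- Evaluations correspond to exponential series, whose exponents add. This is the counterpart of
placing `[a_s, b_t]` at `s + t`. -/
lemma conv_evHom (s t : F) (m n : M) : conv (evHom s m) (evHom t n) = evHom (s + t) (m * n) := by
  refine LinearMap.ext fun f => ?_
  induction f using poly_induction with
  | one => simp [conv_one, evHom_apply]
  | smul c f h => rw [map_smul, map_smul, h]
  | add f g h h' => rw [map_add, map_add, h, h']
  | mulX f h =>
    rw [conv_X, lamStar_evHom, lamStar_evHom, ← convL_apply, ← convL_apply, map_smul, map_smul,
      LinearMap.smul_apply, LinearMap.smul_apply, LinearMap.smul_apply, convL_apply, h,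
      ← lamStar_apply, lamStar_evHom, LinearMap.smul_apply, add_smul]

/-- `e_m` corresponds to the series `exp(x∂)m`, and the exponential of a derivation is
multiplicative. -/
lemma conv_expD (hD : ∀ m n : M, D F M (m * n) = D F M m * n + m * D F M n) (m n : M) :
    conv (expD F m) (expD F n) = expD F (m * n) := by
  refine LinearMap.ext fun f => ?_
  induction f using poly_induction generalizing m n with
  | one => simp only [conv_one, expD_one]
  | smul c f h => rw [map_smul, map_smul, h]
  | add f g h h' => rw [map_add, map_add, h, h']
  | mulX f h =>
    rw [conv_X, lamStar_expD, lamStar_expD, h, h, ← lamStar_apply, lamStar_expD, hD, map_add,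
      LinearMap.add_apply]

/-- The action of `a ⊗ φ` on `M`. -/
def rM : A →ₗ[F] HomL F M →ₗ[F] M →ₗ[F] M :=
  LinearMap.mk₂ F (fun a φ => pairing φ ∘ₗ V.act a)
    (fun a a' φ => by rw [map_add, LinearMap.comp_add])
    (fun c a φ => by rw [map_smul, LinearMap.comp_smul])
    (fun a φ φ' => LinearMap.ext fun m => by
      simp only [LinearMap.comp_apply, LinearMap.add_apply, ← val0_contr, contr_add, map_add])
    (fun c a φ => LinearMap.ext fun m => by
      simp only [LinearMap.comp_apply, LinearMap.smul_apply, ← val0_contr, contr_smul, map_smul])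

lemma rM_apply (a : A) (φ : HomL F M) (m : M) : rM V a φ m = pairing φ (V.act a m) := rfl

lemma rM_evHom (a : A) (s : F) (m n : M) : rM V a (evHom s m) n = m * ev1 F s (V.act a n) :=
  pairing_evHom s m _

lemma rM_del (a : A) (φ : HomL F M) : rM V (D F A a) φ + rM V a (lamStar F M φ) = 0 := by
  refine LinearMap.ext fun m => ?_
  rw [LinearMap.add_apply, rM_apply, rM_apply, V.sesq_left, map_neg, pairing_X, neg_add_cancel]
  rfl

variable {V} in
lemma rM_mul (hV : V.ByDerivations) (a : A) (φ : HomL F M) (m n : M) :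
    rM V a φ (m * n) = rM V a φ m * n + m * rM V a φ n := by
  rw [rM_apply, rM_apply, rM_apply, hV.act_mul, map_add]
  congr 1
  · induction V.act a m using TensorProduct.induction_on with
    | zero => simp
    | add p q hp hq => rw [map_add, map_add, map_add, hp, hq, add_mul]
    | tmul f m' => simp [pairing_tmul, mul_assoc]
  · induction V.act a n using TensorProduct.induction_on with
    | zero => simp
    | add p q hp hq => rw [map_add, map_add, map_add, hp, hq, mul_add]
    | tmul f m' => simp [pairing_tmul, mul_left_comm]

variable {V} in
lemma ev_act_mul (hV : V.ByDerivations) (a : A) (s : F) (m n : M) :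
    ev1 F s (V.act a (m * n)) = ev1 F s (V.act a m) * n + m * ev1 F s (V.act a n) := by
  rw [hV.act_mul, map_add]
  congr 1
  · induction V.act a m using TensorProduct.induction_on with
    | zero => simp
    | add p q hp hq => rw [map_add, map_add, map_add, hp, hq, add_mul]
    | tmul f m' => simp [ev_tmul, smul_mul_assoc]
  · induction V.act a n using TensorProduct.induction_on with
    | zero => simp
    | add p q hp hq => rw [map_add, map_add, map_add, hp, hq, mul_add]
    | tmul f m' => simp [ev_tmul, mul_smul_comm]

variable {V} in
lemma ptAc_mul (hV : V.ByDerivations) (x : Pts F A) (m n : M) :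
    (ptData V).ac x (m * n) = (ptData V).ac x m * n + m * (ptData V).ac x n := by
  induction x using pt_induction with
  | zero => simp
  | add x y hx hy => simp only [map_add, LinearMap.add_apply, hx, hy, add_mul, mul_add]; abel
  | h s a => simp only [ptData, ptAc_pt, ev_act_mul hV]

/-- The operations of the Lie algebra of basic `1`-chains. -/
def gtOps : ChainOps F A (HomL F M) where
  mu := convL F M
  δ := lamStar F M
  r := (rM V).compr₂ (LinearMap.llcomp F (MvPolynomial (Fin 1) F) M M)

/-- The operations of the Lie algebra of polynomial `1`-chains. -/
def cOps : ChainOps F A M where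
  mu := LinearMap.mul F M
  δ := D F M
  r := (rM V).compl₂ (expD F)

lemma pol_gtOps (f : MvPolynomial (Fin 1) F) (φ : HomL F M) :
    (gtOps V).pol f φ = φ ∘ₗ LinearMap.mulLeft F f := by
  induction f using poly_induction generalizing φ with
  | one => rw [map_one]; ext; simp
  | smul c f h => rw [map_smul, LinearMap.smul_apply, h]; ext; simp
  | add f g h h' =>
    rw [map_add, LinearMap.add_apply, h, h']
    refine LinearMap.ext fun g => ?_
    simp [add_mul]
  | mulX f h =>
    rw [ChainOps.pol_X_mul, h]
    refine LinearMap.ext fun g => ?_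
    simp [gtOps, lamStar_apply]

lemma pol_cOps (f : MvPolynomial (Fin 1) F) (m : M) : (cOps V).pol f m = expD F m f := by
  induction f using poly_induction generalizing m with
  | one => rw [map_one, expD_one]; rfl
  | smul c f h => rw [map_smul, LinearMap.smul_apply, h, map_smul]
  | add f g h h' => rw [map_add, LinearMap.add_apply, h, h', map_add]
  | mulX f h =>
    rw [ChainOps.pol_X_mul, h, ← lamStar_apply, lamStar_expD]
    rfl

lemma gtBr_eq (a b : A) (φ ψ : HomL F M) :
    gtBr V a b φ ψ = (gtOps V).brT L (a ⊗ₜ φ) (b ⊗ₜ ψ) := by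
  have h : gtFirst φ ψ (L.bracket a b) = (gtOps V).first φ ψ (L.bracket a b) := by
    induction L.bracket a b using TensorProduct.induction_on with
    | zero => simp
    | add p q hp hq => rw [map_add, map_add, hp, hq]
    | tmul f c => rw [ChainOps.first_tmul, pol_gtOps]; rfl
  rw [ChainOps.brT_tmul, ← h, sub_eq_add_neg, add_right_comm, ← sub_eq_add_neg]
  rfl

lemma cBr_eq (a b : A) (m n : M) :
    cBr V a b m n = (cOps V).brT L (a ⊗ₜ m) (b ⊗ₜ n) := by
  have h : TensorProduct.comm F M A
      ((LinearMap.mulRight F n ∘ₗ expD F m).rTensor A (L.bracket a b)) =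
        (cOps V).first m n (L.bracket a b) := by
    induction L.bracket a b using TensorProduct.induction_on with
    | zero => simp
    | add p q hp hq => rw [map_add, map_add, map_add, hp, hq]
    | tmul f c => rw [ChainOps.first_tmul, pol_cOps]; rfl
  rw [ChainOps.brT_tmul, ← h]
  rfl

lemma first_evHom (s t : F) (m n : M) (p : P F 1 A) :
    (gtOps V).first (evHom s m) (evHom t n) p = ev1 F s p ⊗ₜ evHom (s + t) (m * n) := by
  induction p using P_induction with
  | one c => rw [ChainOps.first_one, ev_one, ← conv_evHom]; rfl
  | mulX i p hp =>
    rw [ChainOps.first_X, ev_smul, MvPolynomial.eval_X, ← TensorProduct.smul_tmul', ← hp]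
    change (gtOps V).first (lamStar F M _) _ _ = _
    rw [lamStar_evHom, map_smul, LinearMap.smul_apply, LinearMap.smul_apply]
  | add p q hp hq => rw [map_add, map_add, hp, hq, TensorProduct.add_tmul]

/-- On evaluations the bracket is that of `m a_s` and `n b_t` regarded as vector fields with
coefficients: the bracket of the points multiplied by `mn`, plus the derivatives of the
coefficients. -/
lemma brT_evHom (a b : A) (s t : F) (m n : M) :
    (gtOps V).brT L (a ⊗ₜ evHom s m) (b ⊗ₜ evHom t n) =
      ev1 F s (L.bracket a b) ⊗ₜ evHom (s + t) (m * n) +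
        b ⊗ₜ evHom t (m * ev1 F s (V.act a n)) - a ⊗ₜ evHom s (n * ev1 F t (V.act b m)) := by
  have h : ∀ (a : A) (s t : F) (m n : M), (gtOps V).r a (evHom s m) (evHom t n) =
      evHom t (m * ev1 F s (V.act a n)) := by
    intro a s t m n
    refine LinearMap.ext fun f => ?_
    change rM V a (evHom s m) (evHom t n f) = _
    rw [evHom_apply, map_smul, rM_evHom, evHom_apply]
  rw [ChainOps.brT_tmul, first_evHom, h, h]

lemma loc_conv (ψ : HomL F M) (f : MvPolynomial (Fin 1) F) : Loc (fun φ => conv φ ψ f) := by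
  simp only [conv_apply]
  induction MvPolynomial.aeval (fun _ => (MvPolynomial.X 0 ⊗ₜ[F] 1 + 1 ⊗ₜ[F] MvPolynomial.X 0 :
        MvPolynomial (Fin 1) F ⊗[F] MvPolynomial (Fin 1) F)) f using TensorProduct.induction_on with
  | zero => simpa using Loc.zero
  | add u v hu hv => simpa only [map_add] using hu.add hv
  | tmul g h =>
    simp only [TensorProduct.map_tmul, LinearMap.mul'_apply]
    exact (Loc.apply g).comp (fun m => m * ψ h) (zero_mul _)

variable [CharZero F]

/-- Each value involves finitely many values of `φ` because `[a_λ b]` and `a_λ n` have finitely many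
coefficients. This and `loc_brT_right` allow brackets to be tested on evaluations. -/
lemma loc_brT_left {Z : Type*} [AddCommGroup Z] [Module F Z] (Ξ : A ⊗[F] HomL F M →ₗ[F] Z)
    (hΞ : ∀ c, Loc (fun φ => Ξ (c ⊗ₜ φ))) (a : A) (y : A ⊗[F] HomL F M) :
    Loc (fun φ => Ξ ((gtOps V).brT L (a ⊗ₜ φ) y)) := by
  induction y using TensorProduct.induction_on with
  | zero => simpa using Loc.zero
  | add x y hx hy => simpa only [map_add] using hx.add hy
  | tmul b ψ =>
    simp only [ChainOps.brT_tmul, map_add, map_sub]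
    refine Loc.sub (Loc.add ?_ ?_) ?_
    · induction L.bracket a b using TensorProduct.induction_on with
      | zero => simpa using Loc.zero
      | add x y hx hy => simpa only [map_add] using hx.add hy
      | tmul f c =>
        simp only [ChainOps.first_tmul]
        refine (hΞ c).precomp (fun φ => (gtOps V).mu ((gtOps V).pol f φ) ψ) fun g => ?_
        refine (loc_conv ψ g).precomp ((gtOps V).pol f) fun g' => ?_
        simp only [pol_gtOps]
        exact Loc.apply _
    · exact (hΞ b).precomp (fun φ => (gtOps V).r a φ ψ) fun g => loc_pairing (V.act a (ψ g))
    · exact (hΞ a).precomp (fun φ => (gtOps V).r b ψ φ) fun g =>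
        (Loc.apply g).comp (rM V b ψ) (map_zero _)

lemma loc_brT_right {Z : Type*} [AddCommGroup Z] [Module F Z] (Ξ : A ⊗[F] HomL F M →ₗ[F] Z)
    (hΞ : ∀ c, Loc (fun φ => Ξ (c ⊗ₜ φ))) (b : A) (x : A ⊗[F] HomL F M) :
    Loc (fun ψ => Ξ ((gtOps V).brT L x (b ⊗ₜ ψ))) := by
  induction x using TensorProduct.induction_on with
  | zero => simpa using Loc.zero
  | add x y hx hy => simpa only [map_add, LinearMap.add_apply] using hx.add hy
  | tmul a φ =>
    simp only [ChainOps.brT_tmul, map_add, map_sub]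
    refine Loc.sub (Loc.add ?_ ?_) ?_
    · induction L.bracket a b using TensorProduct.induction_on with
      | zero => simpa using Loc.zero
      | add x y hx hy => simpa only [map_add] using hx.add hy
      | tmul f c =>
        simp only [ChainOps.first_tmul]
        refine (hΞ c).precomp (fun ψ => (gtOps V).mu ((gtOps V).pol f φ) ψ) fun g => ?_
        change Loc fun ψ => conv ((gtOps V).pol f φ) ψ g
        simp only [conv_comm ((gtOps V).pol f φ)]
        exact loc_conv _ g
    · exact (hΞ b).precomp ((gtOps V).r a φ) fun g =>
        (Loc.apply g).comp (rM V a φ) (map_zero _)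
    · exact (hΞ a).precomp (fun ψ => (gtOps V).r b ψ φ) fun g => loc_pairing (V.act b (φ g))

variable {V}

/-- For evaluations this is the Jacobi identity of the action at two points together with the
derivation property. -/
lemma rM_hom (hV : V.ByDerivations) (a b : A) (φ ψ : HomL F M) (l : M) :
    TensorProduct.lift (rM V) ((gtOps V).brT L (a ⊗ₜ φ) (b ⊗ₜ ψ)) l =
      rM V a φ (rM V b ψ l) - rM V b ψ (rM V a φ l) := by
  have hΞ : ∀ c, Loc (fun φ => (TensorProduct.lift (rM V)).flip l (c ⊗ₜ φ)) := fun c =>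
    loc_pairing (V.act c l)
  -- The functionals are freed one at a time: `φ` stays an evaluation while `ψ` becomes arbitrary.
  have key : ∀ s m ψ, TensorProduct.lift (rM V)
      ((gtOps V).brT L (a ⊗ₜ evHom s m) (b ⊗ₜ ψ)) l -
      (rM V a (evHom s m) (rM V b ψ l) - rM V b ψ (rM V a (evHom s m) l)) = 0 := by
    intro s m ψ
    refine eq_zero_of_loc ((TensorProduct.lift (rM V)).flip l ∘ₗ
      (gtOps V).brT L (a ⊗ₜ evHom s m) ∘ₗ TensorProduct.mk F A _ b -
      (rM V a (evHom s m) ∘ₗ (rM V b).flip l - (rM V b).flip (rM V a (evHom s m) l)))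
      ?_ (fun t n => ?_) ψ
    · refine (loc_brT_right V _ hΞ b _).sub (Loc.sub ?_ (loc_pairing _))
      exact (loc_pairing (V.act b l)).comp (rM V a (evHom s m)) (map_zero _)
    · change TensorProduct.lift (rM V)
        ((gtOps V).brT L (a ⊗ₜ evHom s m) (b ⊗ₜ evHom t n)) l -
        (rM V a (evHom s m) (rM V b (evHom t n) l) -
          rM V b (evHom t n) (rM V a (evHom s m) l)) = 0
      rw [brT_evHom]
      simp only [map_add, map_sub, TensorProduct.lift.tmul, LinearMap.add_apply,
        LinearMap.sub_apply, rM_evHom, ev_act_mul hV, act_jacobi_ev V a b l s t, mul_add]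
      simp only [mul_assoc, mul_left_comm n m]
      abel
  rw [← sub_eq_zero]
  refine eq_zero_of_loc ((TensorProduct.lift (rM V)).flip l ∘ₗ
      ((gtOps V).brT L).flip (b ⊗ₜ ψ) ∘ₗ TensorProduct.mk F A _ a -
      ((rM V a).flip (rM V b ψ l) - rM V b ψ ∘ₗ (rM V a).flip l)) ?_ (fun s m => key s m ψ) φ
  refine (loc_brT_left V _ hΞ a _).sub (Loc.sub (loc_pairing _) ?_)
  exact (loc_pairing (V.act a l)).comp (rM V b ψ) (map_zero _)

lemma gtOps_laws (hV : V.ByDerivations) : (gtOps V).Laws L where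
  mu_comm := conv_comm
  mu_assoc := conv_assoc
  δ_mu := lamStar_conv
  r_del a φ := LinearMap.ext fun ψ => LinearMap.ext fun f =>
    congrArg (fun T => T (ψ f)) (rM_del V a φ)
  r_δ a φ ψ := rfl
  r_mu a φ ψ χ := comp_conv (rM_mul hV a φ) ψ χ
  r_hom a b φ ψ χ := by
    have h : ∀ x, (gtOps V).rT x χ = TensorProduct.lift (rM V) x ∘ₗ χ := by
      intro x
      induction x using TensorProduct.induction_on with
      | zero => simp
      | add x y hx hy => rw [map_add, map_add, LinearMap.add_apply, hx, hy, LinearMap.add_comp]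
      | tmul a φ => rfl
    rw [h]
    exact LinearMap.ext fun f => rM_hom hV a b φ ψ (χ f)

end ChainLaws

/-! ### Lie algebra structures on subalgebras and on quotients by ideals. -/

section LieTransfer

variable {F : Type u} [Field F] {g : Type v} [AddCommGroup g] [Module F g] (lie : LieStr F g)

lemma LieStr.br_swap (x y : g) : lie.br y x = -lie.br x y := by
  have := lie.br_self (x + y)
  simp only [map_add, LinearMap.add_apply, lie.br_self, zero_add, add_zero] at this
  exact eq_neg_of_add_eq_zero_left this

/-- The Lie algebra structure on a subalgebra. -/
def LieStr.sub (N : Submodule F g) (h : ∀ x y : N, lie.br x y ∈ N) : LieStr F N where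
  br := LinearMap.mk₂ F (fun x y => ⟨lie.br x y, h x y⟩)
    (by intros; ext; simp) (by intros; ext; simp) (by intros; ext; simp) (by intros; ext; simp)
  br_self x := Subtype.ext (lie.br_self x)
  jacobi x y z := Subtype.ext (lie.jacobi x y z)

/-- The Lie algebra structure on the image of a linear map whose kernel is an ideal. -/
def LieStr.ofSurjective {g' : Type w} [AddCommGroup g'] [Module F g'] (f : g →ₗ[F] g')
    (hf : Function.Surjective f) (h : ∀ x, f x = 0 → ∀ y, f (lie.br x y) = 0) :
    {lie' : LieStr F g' // ∀ x y, f (lie.br x y) = lie'.br (f x) (f y)} := by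
  let σ := (f.exists_rightInverse_of_surjective (LinearMap.range_eq_top.2 hf)).choose
  have hσ' := (f.exists_rightInverse_of_surjective (LinearMap.range_eq_top.2 hf)).choose_spec
  have hσ : ∀ x, f (σ x) = x := fun x => congrArg (fun T => T x) hσ'
  have h' : ∀ y, f y = 0 → ∀ x, f (lie.br x y) = 0 := fun y hy x => by
    rw [lie.br_swap, map_neg, h y hy, neg_zero]
  have key : ∀ x y, f (lie.br (σ (f x)) (σ (f y))) = f (lie.br x y) := by
    intro x y
    have h1 := h (σ (f x) - x) (by rw [map_sub, hσ, sub_self]) (σ (f y))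
    have h2 := h' (σ (f y) - y) (by rw [map_sub, hσ, sub_self]) x
    rw [map_sub, LinearMap.sub_apply, map_sub, sub_eq_zero] at h1
    rw [map_sub, map_sub, sub_eq_zero] at h2
    rw [h1, h2]
  refine ⟨⟨(lie.br.compl₁₂ σ σ).compr₂ f, fun x => ?_, fun x y z => ?_⟩, fun x y => (key x y).symm⟩
  · change f (lie.br (σ x) (σ x)) = 0
    rw [lie.br_self, map_zero]
  · obtain ⟨x, rfl⟩ := hf x
    obtain ⟨y, rfl⟩ := hf y
    obtain ⟨z, rfl⟩ := hf z
    change f (lie.br (σ (f x)) (σ (f (lie.br (σ (f y)) (σ (f z)))))) =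
      f (lie.br (σ (f (lie.br (σ (f x)) (σ (f y))))) (σ (f z))) +
        f (lie.br (σ (f y)) (σ (f (lie.br (σ (f x)) (σ (f z))))))
    simp only [key]
    rw [lie.jacobi, map_add]

end LieTransfer

/-! ### Vanishing of sesquilinear maps on torsion. -/

section Torsion

variable {F : Type u} [Field F]
  {A : Type v} [AddCommGroup A] [Module F A] [Module F[X] A] [IsScalarTower F F[X] A]
  {N : Type w} [AddCommGroup N] [Module F N]

lemma sesq_smul {k : ℕ} (i : Fin k) (g : A →ₗ[F] P F k N)
    (h : ∀ a, g (D F A a) = -((MvPolynomial.X i : MvPolynomial (Fin k) F) • g a)) (q : F[X]) (a : A) :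
    g (q • a) = Polynomial.aeval (-(MvPolynomial.X i : MvPolynomial (Fin k) F)) q • g a := by
  induction q using Polynomial.induction_on' generalizing a with
  | add p q hp hq => rw [add_smul, map_add, hp, hq, map_add, add_smul]
  | monomial n c =>
    induction n generalizing a with
    | zero =>
      rw [Polynomial.monomial_zero_left, Polynomial.aeval_C, algebraMap_smul,
        ← Polynomial.algebraMap_eq, algebraMap_smul, map_smul]
    | succ n ih =>
      rw [← Polynomial.monomial_mul_X, mul_smul, ih, ← D_apply, h, map_mul, Polynomial.aeval_X,
        mul_smul, neg_smul]

lemma aeval_neg_X_ne_zero {k : ℕ} (i : Fin k) {q : F[X]} (hq : q ≠ 0) :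
    Polynomial.aeval (-(MvPolynomial.X i : MvPolynomial (Fin k) F)) q ≠ 0 := by
  intro h
  apply hq
  -- Sending every variable to `-X` recovers `q`.
  have := congrArg (MvPolynomial.aeval (fun _ : Fin k => -(Polynomial.X : F[X]))) h
  rw [map_zero, ← Polynomial.aeval_algHom_apply, map_neg, MvPolynomial.aeval_X, neg_neg] at this
  simpa using this

/-- If `q • t = 0` with `q ≠ 0`, then the nonzero polynomial `q(-λᵢ)` kills `g t`, and the target is
torsion-free. -/
lemma torsion_vanish {k : ℕ} (i : Fin k) (g : A →ₗ[F] P F k N)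
    (h : ∀ a, g (D F A a) = -((MvPolynomial.X i : MvPolynomial (Fin k) F) • g a)) {t : A}
    (ht : t ∈ Submodule.torsion F[X] A) : g t = 0 := by
  obtain ⟨⟨q, hq⟩, hqt⟩ := ht
  have h1 := sesq_smul i g h q t
  rw [show q • t = 0 from hqt, map_zero] at h1
  exact smul_P_eq_zero (aeval_neg_X_ne_zero i (nonZeroDivisors.ne_zero hq)) h1.symm

end Torsion

/-! ### The Lie algebras `ΠΓ̃₁`, `ΠΓ₁`, `ΠC₁`, `ΠC̄₁` and the homomorphisms between them. -/

section ChainLie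

variable {F : Type u} [Field F] [CharZero F]
  {A : Type v} [AddCommGroup A] [Module F A] [Module F[X] A] [IsScalarTower F F[X] A]
  {M : Type w} [NonUnitalCommRing M] [Module F M] [IsScalarTower F M M] [SMulCommClass F M M]
  [Module F[X] M] [IsScalarTower F F[X] M]
  {L : LieConformalAlgebra F A} {V : LieConformalModule L M} (hV : V.ByDerivations)

lemma val0_ThP (p : P F 0 M) : val0 (ThP F M 0 p) = D F M (val0 p) := by
  rw [← ev_eq_val0 Fin.elim0, ← ev_eq_val0 Fin.elim0, ev_ThP]
  simp

lemma sesq_right_ThP (V : LieConformalModule L M) (a : A) (m : M) :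
    V.act a (D F M m) = ThP F M 1 (V.act a m) := by
  rw [V.sesq_right, ThP_apply]
  simp

include hV

/-- Moving `∂` past `a_λ` costs `λ`, which the contraction turns into `λ*`. So the action of `a ⊗ φ`
commutes with `∂` up to the action of `a ⊗ (∂ - λ*)φ`, which is zero for `φ = e_m`. -/
lemma D_rM (a : A) (φ : HomL F M) (m : M) :
    D F M (rM V a φ m) = rM V a φ (D F M m) + rM V a (delHom F M φ - lamStar F M φ) m := by
  rw [rM_apply, rM_apply, sesq_right_ThP, ← val0_contr, ← val0_contr, contr_ThP hV.del_mul,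
    map_add, val0_ThP, val0_contr, val0_contr, ← rM_apply, ← rM_apply, map_sub, map_sub,
    LinearMap.sub_apply, LinearMap.sub_apply]
  abel

lemma rM_expD_D (a : A) (m n : M) :
    rM V a (expD F m) (D F M n) = D F M (rM V a (expD F m) n) := by
  rw [D_rM hV, lamStar_expD, delHom_expD, sub_self, map_zero]
  simp

lemma expD_rM (a : A) (m n : M) :
    expD F (rM V a (expD F m) n) = rM V a (expD F m) ∘ₗ expD F n := by
  refine LinearMap.ext fun f => ?_
  induction f using poly_induction generalizing n with
  | one => rw [LinearMap.comp_apply, expD_one, expD_one]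
  | smul c f h => rw [map_smul, map_smul, h]
  | add f g h h' => rw [map_add, map_add, h, h']
  | mulX f h =>
    rw [← lamStar_apply, lamStar_expD, ← rM_expD_D hV, h, LinearMap.comp_apply,
      LinearMap.comp_apply, ← lamStar_expD, lamStar_apply]

/-- `m ↦ e_m` intertwines the products, the operators `δ` and the actions of the two sets of
operations. The representation property for `C₁` is thereby inherited from the one for `Γ̃₁`. -/
lemma expD_brT (x y : A ⊗[F] M) :
    (expD F).lTensor A ((cOps V).brT L x y) =
      (gtOps V).brT L ((expD F).lTensor A x) ((expD F).lTensor A y) := by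
  induction x using TensorProduct.induction_on with
  | zero => simp
  | add x x' hx hx' => simp only [map_add, LinearMap.add_apply, hx, hx']
  | tmul a m =>
  induction y using TensorProduct.induction_on with
  | zero => simp
  | add x x' hx hx' => simp only [map_add, hx, hx']
  | tmul b n =>
    have h1 : ∀ (a b : A) (m n : M), b ⊗ₜ expD F ((cOps V).r a m n) =
        b ⊗ₜ[F] (gtOps V).r a (expD F m) (expD F n) := fun a b m n =>
      congrArg (fun φ => b ⊗ₜ φ) (expD_rM hV a m n)
    have h2 : ∀ p, (expD F).lTensor A ((cOps V).first m n p) =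
        (gtOps V).first (expD F m) (expD F n) p := by
      intro p
      induction p using P_induction generalizing m with
      | one c =>
        rw [ChainOps.first_one, ChainOps.first_one, LinearMap.lTensor_tmul]
        exact congrArg (fun φ => c ⊗ₜ φ) (conv_expD hV.del_mul m n).symm
      | mulX i p hp =>
        rw [ChainOps.first_X, ChainOps.first_X, hp]
        exact congrArg (fun φ => (gtOps V).first φ (expD F n) p) (lamStar_expD F M m).symm
      | add p q hp hq => simp only [map_add, hp, hq]
    rw [ChainOps.brT_tmul, LinearMap.lTensor_tmul, LinearMap.lTensor_tmul, ChainOps.brT_tmul,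
      map_sub, map_add, h2, LinearMap.lTensor_tmul, LinearMap.lTensor_tmul, h1, h1]

lemma cOps_laws : (cOps V).Laws L where
  mu_comm := mul_comm
  mu_assoc := mul_assoc
  δ_mu := hV.del_mul
  r_del a m := by
    change rM V (D F A a) (expD F m) + rM V a (expD F (D F M m)) = 0
    rw [← lamStar_expD, rM_del]
  r_δ a m n := rM_expD_D hV a m n
  r_mu a m := rM_mul hV a (expD F m)
  r_hom a b m n l := by
    have h : ∀ x, (cOps V).rT x l = TensorProduct.lift (rM V) ((expD F).lTensor A x) l := by
      intro x
      induction x using TensorProduct.induction_on with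
      | zero => simp
      | add x y hx hy => simp only [map_add, LinearMap.add_apply, hx, hy]
      | tmul a m => rfl
    rw [h, expD_brT hV]
    exact rM_hom hV a b (expD F m) (expD F n) l

/-- The Lie algebra `ΠΓ̃₁`. -/
def lieGt1 : LieStr F (Gt1 F A M) := (gtOps_laws hV).lie

/-- The Lie algebra `ΠC₁`. -/
def lieC1 : LieStr F (C1 F A M) := (cOps_laws hV).lie

lemma lieGt1_mk (x y : A ⊗[F] HomL F M) :
    (lieGt1 hV).br (Submodule.Quotient.mk x) (Submodule.Quotient.mk y) =
      Submodule.Quotient.mk ((gtOps V).brT L x y) := rfl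

lemma lieC1_mk (x y : A ⊗[F] M) :
    (lieC1 hV).br (Submodule.Quotient.mk x) (Submodule.Quotient.mk y) =
      Submodule.Quotient.mk ((cOps V).brT L x y) := rfl

omit hV [CharZero F] in
-- Modulo relations `∂ ⊗ 1` is `-1 ⊗ λ*`, so `∂` acts on the second factor alone, as `∂ - λ*`.
lemma delGt1_mk (x : A ⊗[F] HomL F M) :
    delGt1 F A M (Submodule.Quotient.mk x) =
      Submodule.Quotient.mk ((delHom F M - lamStar F M).lTensor A x) := by
  refine (Submodule.Quotient.eq _).2 ⟨x, ?_⟩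
  rw [LinearMap.lTensor_sub]
  simp only [LinearMap.add_apply, LinearMap.sub_apply]
  abel

/-- `∂ - λ*` is a derivation of all the operations from which the bracket is built, even before
relations are imposed. Hence its kernel in `Γ̃₁` is a subalgebra. -/
lemma theta_brT (x y : A ⊗[F] HomL F M) :
    (delHom F M - lamStar F M).lTensor A ((gtOps V).brT L x y) =
      (gtOps V).brT L ((delHom F M - lamStar F M).lTensor A x) y +
        (gtOps V).brT L x ((delHom F M - lamStar F M).lTensor A y) := by
  have hr : ∀ a φ ψ, (delHom F M - lamStar F M) ((gtOps V).r a φ ψ) =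
      (gtOps V).r a ((delHom F M - lamStar F M) φ) ψ +
        (gtOps V).r a φ ((delHom F M - lamStar F M) ψ) := by
    intro a φ ψ
    refine LinearMap.ext fun f => ?_
    change D F M (rM V a φ (ψ f)) - rM V a φ (ψ (MvPolynomial.X 0 * f)) =
      rM V a (delHom F M φ - lamStar F M φ) (ψ f) +
        rM V a φ (D F M (ψ f) - ψ (MvPolynomial.X 0 * f))
    rw [D_rM hV, map_sub (rM V a φ)]
    abel
  induction x using TensorProduct.induction_on with
  | zero => simp
  | add x x' hx hx' => simp only [map_add, LinearMap.add_apply, hx, hx']; abel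
  | tmul a φ =>
  induction y using TensorProduct.induction_on with
  | zero => simp
  | add x x' hx hx' => simp only [map_add, hx, hx']; abel
  | tmul b ψ =>
    rw [LinearMap.lTensor_tmul, LinearMap.lTensor_tmul, ChainOps.brT_tmul, ChainOps.brT_tmul,
      ChainOps.brT_tmul, map_sub, map_add, LinearMap.lTensor_tmul, LinearMap.lTensor_tmul, hr, hr,
      ChainOps.first_deriv (gtOps_laws hV) (T := delHom F M - lamStar F M) (fun φ => rfl),
      TensorProduct.tmul_add, TensorProduct.tmul_add]
    · abel
    · intro φ ψ
      have h1 : delHom F M (conv φ ψ) = conv (delHom F M φ) ψ + conv φ (delHom F M ψ) :=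
        comp_conv hV.del_mul φ ψ
      change delHom F M (conv φ ψ) - lamStar F M (conv φ ψ) =
        convL F M (delHom F M φ - lamStar F M φ) ψ + convL F M φ (delHom F M ψ - lamStar F M ψ)
      rw [h1, lamStar_conv, map_sub, map_sub, LinearMap.sub_apply]
      simp only [convL_apply]
      abel

lemma delGt1_br (x y : Gt1 F A M) : delGt1 F A M ((lieGt1 hV).br x y) =
    (lieGt1 hV).br (delGt1 F A M x) y + (lieGt1 hV).br x (delGt1 F A M y) := by
  obtain ⟨x, rfl⟩ := Submodule.Quotient.mk_surjective _ x
  obtain ⟨y, rfl⟩ := Submodule.Quotient.mk_surjective _ y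
  rw [lieGt1_mk, delGt1_mk, delGt1_mk, delGt1_mk, lieGt1_mk, lieGt1_mk, theta_brT hV]
  rfl

/-- The Lie algebra `ΠΓ₁`. -/
def lieG1 : LieStr F (G1 F A M) := (lieGt1 hV).sub (G1 F A M) fun x y => by
  change delGt1 F A M _ = 0
  rw [delGt1_br, show delGt1 F A M x = 0 from x.2, show delGt1 F A M y = 0 from y.2]
  simp

lemma chi1_br (x y : C1 F A M) :
    chi1 F A M ((lieC1 hV).br x y) = (lieG1 hV).br (chi1 F A M x) (chi1 F A M y) := by
  obtain ⟨x, rfl⟩ := Submodule.Quotient.mk_surjective _ x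
  obtain ⟨y, rfl⟩ := Submodule.Quotient.mk_surjective _ y
  refine Subtype.ext ?_
  change chi1' F A M ((lieC1 hV).br (Submodule.Quotient.mk x) (Submodule.Quotient.mk y)) =
    (lieGt1 hV).br (Submodule.Quotient.mk ((expD F).lTensor A x))
      (Submodule.Quotient.mk ((expD F).lTensor A y))
  rw [lieC1_mk, lieGt1_mk, ← expD_brT hV]
  rfl

variable (F A) in
/-- The quotient map of `A` by its torsion. -/
def torQ : A →ₗ[F] Abar F A := (Submodule.torsion F[X] A).mkQ.restrictScalars F

omit hV [CharZero F] in
variable (F A) in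
lemma torQ_surjective : Function.Surjective (torQ F A) := by
  intro x
  obtain ⟨a, rfl⟩ := Submodule.Quotient.mk_surjective _ x
  exact ⟨a, rfl⟩

omit hV [CharZero F] in
lemma torQ_torsion {t : A} (ht : t ∈ Submodule.torsion F[X] A) : torQ F A t = 0 :=
  (Submodule.Quotient.mk_eq_zero _).2 ht

omit hV [CharZero F] in
lemma toC1bar_mk (x : A ⊗[F] M) : toC1bar F A M (Submodule.Quotient.mk x) =
    Submodule.Quotient.mk ((torQ F A).rTensor M x) := rfl

omit hV [CharZero F] in
variable (F A M) in
lemma toC1bar_surjective : Function.Surjective (toC1bar F A M) := by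
  intro x
  obtain ⟨x, rfl⟩ := Submodule.Quotient.mk_surjective _ x
  obtain ⟨y, hy⟩ := LinearMap.rTensor_surjective M (torQ_surjective F A) x
  exact ⟨Submodule.Quotient.mk y, by rw [← hy]; rfl⟩

omit hV [CharZero F] in
/-- A linear map that vanishes on the classes of `t ⊗ m` with `t` a torsion element vanishes on
the kernel of `C₁ → C̄₁`. -/
lemma toC1bar_ker {Z : Type*} [AddCommGroup Z] [Module F Z] (T : C1 F A M →ₗ[F] Z)
    (hT : ∀ t ∈ Submodule.torsion F[X] A, ∀ m, T (c1 F t m) = 0) {x : C1 F A M}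
    (hx : toC1bar F A M x = 0) : T x = 0 := by
  obtain ⟨x, rfl⟩ := Submodule.Quotient.mk_surjective _ x
  let q := torQ F A
  obtain ⟨z, hz⟩ := (Submodule.Quotient.mk_eq_zero _).1 hx
  obtain ⟨z, rfl⟩ := LinearMap.rTensor_surjective M (torQ_surjective F A) z
  -- After subtraction of a relation lifted from `Ā ⊗ M`, right exactness of the tensor product
  -- leaves an element that comes from `Tor A ⊗ M`.
  have h1 : q.rTensor M (x - ((D F A).rTensor M + (D F M).lTensor A) z) = 0 := by
    rw [map_sub, sub_eq_zero]
    change q.rTensor M x = _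
    refine Eq.trans hz.symm ?_
    clear hz hx
    induction z using TensorProduct.induction_on with
    | zero => simp
    | add x y hx hy => rw [map_add, map_add, map_add, map_add, hx, hy]
    | tmul a m => simp [q, torQ, D]
  have hex : Function.Exact (((Submodule.torsion F[X] A).subtype.restrictScalars F)) q := by
    intro a
    refine (Submodule.Quotient.mk_eq_zero _).trans ?_
    simp
  obtain ⟨u, hu⟩ := (rTensor_exact M hex (torQ_surjective F A) _).1 h1
  have h2 : (Submodule.Quotient.mk x : C1 F A M) = Submodule.Quotient.mk
      (((Submodule.torsion F[X] A).subtype.restrictScalars F).rTensor M u) := by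
    rw [hu]
    refine (Submodule.Quotient.eq _).2 ⟨z, ?_⟩
    abel
  rw [h2]
  clear hu h2
  induction u using TensorProduct.induction_on with
  | zero => simp
  | add x y hx hy => rw [map_add, Submodule.Quotient.mk_add, map_add, hx, hy, add_zero]
  | tmul t m => exact hT t t.2 m

omit hV [CharZero F] in
lemma bracket_torsion (L : LieConformalAlgebra F A) {t : A} (ht : t ∈ Submodule.torsion F[X] A) :
    L.bracket t = 0 :=
  LinearMap.ext fun b => torsion_vanish 0 (L.bracket.flip b) (fun a => L.sesq_left a b) ht

omit hV [CharZero F] in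
lemma act_torsion (V : LieConformalModule L M) {t : A} (ht : t ∈ Submodule.torsion F[X] A) :
    V.act t = 0 :=
  LinearMap.ext fun b => torsion_vanish 0 (V.act.flip b) (fun a => V.sesq_left a b) ht

/-- A torsion element has zero bracket and zero action, so the only term left has a torsion element
as first factor and dies in `C̄₁`. -/
lemma toC1bar_br (x : C1 F A M) (hx : toC1bar F A M x = 0) (y : C1 F A M) :
    toC1bar F A M ((lieC1 hV).br x y) = 0 := by
  refine toC1bar_ker (toC1bar F A M ∘ₗ (lieC1 hV).br.flip y) (fun t ht m => ?_) hx
  obtain ⟨y, rfl⟩ := Submodule.Quotient.mk_surjective _ y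
  change toC1bar F A M (Submodule.Quotient.mk ((cOps V).brT L (t ⊗ₜ m) y)) = 0
  induction y using TensorProduct.induction_on with
  | zero => simp
  | add x y hx hy => rw [map_add, Submodule.Quotient.mk_add, map_add, hx, hy, add_zero]
  | tmul b n =>
    have h1 : (cOps V).r t m n = 0 := by
      change pairing (expD F m) (V.act t n) = 0
      rw [act_torsion V ht]
      simp
    rw [ChainOps.brT_tmul, bracket_torsion L ht, h1]
    rw [toC1bar_mk]
    simp [torQ_torsion ht]

/-- The Lie algebra `ΠC̄₁`. -/
def lieC1bar : LieStr F (C1bar F A M) :=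
  ((lieC1 hV).ofSurjective (toC1bar F A M) (toC1bar_surjective F A M) (toC1bar_br hV)).1

lemma toC1bar_lie (x y : C1 F A M) :
    toC1bar F A M ((lieC1 hV).br x y) = (lieC1bar hV).br (toC1bar F A M x) (toC1bar F A M y) :=
  ((lieC1 hV).ofSurjective (toC1bar F A M) (toC1bar_surjective F A M) (toC1bar_br hV)).2 x y

end ChainLie

/-! ### Cartan's formula for polynomial cochains -/

section PolyCartan

variable {F : Type u} [Field F] [CharZero F]
  {A : Type v} [AddCommGroup A] [Module F A] [Module F[X] A] [IsScalarTower F F[X] A]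
  {M : Type w} [NonUnitalCommRing M] [Module F M] [IsScalarTower F M M] [SMulCommClass F M M]
  [Module F[X] M] [IsScalarTower F F[X] M]
  {L : LieConformalAlgebra F A} (V : LieConformalModule L M)

/-- The Lie derivative along `a ⊗ φ`. -/
def lieM (a : A) : ∀ k, HomL F M →ₗ[F] Mult F A M k →ₗ[F] Mult F A M k
  | 0 => LinearMap.lcomp F _ (dM V 0) ∘ₗ iM F A M 0 a
  | k + 1 => LinearMap.llcomp F _ _ _ (dM V k) ∘ₗ iM F A M k a +
      LinearMap.lcomp F _ (dM V (k + 1)) ∘ₗ iM F A M (k + 1) a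

lemma lieM_zero (a : A) (φ : HomL F M) (γ : Mult F A M 0) :
    lieM V a 0 φ γ = iM F A M 0 a φ (dM V 0 γ) := rfl

lemma lieM_succ {k : ℕ} (a : A) (φ : HomL F M) (γ : Mult F A M (k + 1)) :
    lieM V a (k + 1) φ γ = dM V k (iM F A M k a φ γ) + iM F A M (k + 1) a φ (dM V (k + 1) γ) := rfl

lemma hat_lieM_evHom {k : ℕ} (a : A) (s : F) (m : M) (γ : Mult F A M k) :
    hat k (lieM V a k (evHom s m) γ) = (ptData V).lieX m (pt F s a) k (hat k γ) := by
  cases k with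
  | zero => rw [lieM_zero, hat_iM_evHom, hat_dM]; rfl
  | succ k =>
    rw [lieM_succ, map_add, hat_dM, hat_iM_evHom, hat_iM_evHom, hat_dM]
    rfl

lemma exists_finite_bind {E N : Type*} [AddCommGroup E] [Module F E] [AddCommGroup N] [Module F N]
    {k : ℕ} (q : MvPolynomial (Fin k) F) (p : P F 1 E) :
    ∃ S : Set E, S.Finite ∧ ∀ g : E →ₗ[F] P F k N, (∀ e ∈ S, g e = 0) → bind q g p = 0 := by
  induction p using TensorProduct.induction_on with
  | zero => exact ⟨∅, Set.finite_empty, fun g _ => map_zero _⟩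
  | add p p' hp hp' =>
    obtain ⟨S, hS, h⟩ := hp
    obtain ⟨S', hS', h'⟩ := hp'
    refine ⟨S ∪ S', hS.union hS', fun g hg => ?_⟩
    rw [map_add, h g fun e he => hg e (Or.inl he), h' g fun e he => hg e (Or.inr he), add_zero]
  | tmul f e =>
    refine ⟨{e}, Set.finite_singleton e, fun g hg => ?_⟩
    rw [bind_tmul, hg e rfl, smul_zero]

/-- A `λ`-bracket has finitely many coefficients, so one value of `dγ` involves finitely many values
of `γ`. This lets locality in `φ` pass through the differential. -/
lemma exists_finite_dM {k : ℕ} (a : Fin (k + 1) → A) :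
    ∃ S : Set (Fin k → A), S.Finite ∧
      ∀ γ : Mult F A M k, (∀ b ∈ S, γ b = 0) → dM V k γ a = 0 := by
  choose S hS h using fun (i : Fin (k + 1)) (r : Fin k) => exists_finite_bind (F := F) (N := M)
    (MvPolynomial.X i : MvPolynomial (Fin (k + 1)) F) (L.bracket (a i) (a (i.succAbove r)))
  refine ⟨Set.range (fun i : Fin (k + 1) => a ∘ i.succAbove) ∪ ⋃ i, ⋃ r,
    (fun e => Function.update (a ∘ i.succAbove) r e) '' S i r, ?_, fun γ hγ => ?_⟩
  · exact (Set.finite_range _).union (Set.finite_iUnion fun i => Set.finite_iUnion fun r =>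
      (hS i r).image _)
  · rw [dM_apply]
    refine Finset.sum_eq_zero fun i _ => ?_
    rw [lieFun, hγ _ (Or.inl ⟨i, rfl⟩), map_zero, map_zero, zero_sub, Finset.sum_eq_zero, neg_zero,
      smul_zero]
    intro r _
    split_ifs
    · refine h i r _ fun e he => ?_
      rw [LinearMap.comp_apply, MultilinearMap.toLinearMap_apply, hγ, map_zero]
      exact Or.inr (Set.mem_iUnion₂.2 ⟨i, r, e, he, rfl⟩)
    · rfl

lemma loc_dM {k : ℕ} (T : HomL F M → Mult F A M k) (hT : ∀ b, Loc (fun φ => T φ b))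
    (a : Fin (k + 1) → A) : Loc (fun φ => dM V k (T φ) a) := by
  obtain ⟨S, hS, h⟩ := exists_finite_dM V a
  exact Loc.of_finite (T' := fun b φ => T φ b) hS (fun b _ => hT b) fun φ hφ => h _ hφ

lemma loc_iM {k : ℕ} (a : A) (γ : Mult F A M (k + 1)) (b : Fin k → A) :
    Loc (fun φ => iM F A M k a φ γ b) := loc_contr _

lemma loc_iM_right {k : ℕ} (a : A) (φ : HomL F M) (T : HomL F M → Mult F A M (k + 1))
    (hT : ∀ b, Loc (fun φ => T φ b)) (b : Fin k → A) :
    Loc (fun ψ => iM F A M k a φ (T ψ) b) :=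
  (hT _).comp (contr φ) (map_zero _)

lemma loc_lieM {k : ℕ} (a : A) (γ : Mult F A M k) (b : Fin k → A) :
    Loc (fun φ => lieM V a k φ γ b) := by
  cases k with
  | zero => exact loc_iM a _ b
  | succ k =>
    exact (loc_dM V (fun φ => iM F A M k a φ γ) (loc_iM a γ) b).add (loc_iM a _ b)

lemma loc_lieM_right {k : ℕ} (a : A) (φ : HomL F M) (T : HomL F M → Mult F A M k)
    (hT : ∀ b, Loc (fun φ => T φ b)) (b : Fin k → A) :
    Loc (fun ψ => lieM V a k φ (T ψ) b) := by
  cases k with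
  | zero => exact loc_iM_right a φ _ (loc_dM V T hT) b
  | succ k =>
    exact (loc_dM V _ (loc_iM_right a φ T hT) b).add (loc_iM_right a φ _ (loc_dM V T hT) b)

variable (F A M) in
/-- Contraction by an element of `A ⊗ Hom(F[λ], M)`. -/
def iT (k : ℕ) : A ⊗[F] HomL F M →ₗ[F] Mult F A M (k + 1) →ₗ[F] Mult F A M k :=
  TensorProduct.lift (iM F A M k)

lemma iT_tmul {k : ℕ} (a : A) (φ : HomL F M) : iT F A M k (a ⊗ₜ φ) = iM F A M k a φ := rfl

variable {V}

lemma cartan_evHom (hV : V.ByDerivations) {k : ℕ} {γ : Mult F A M (k + 1)} (hγ : IsSkewM γ)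
    (a b : A) (s t : F) (m n : M) :
    lieM V a k (evHom s m) (iM F A M k b (evHom t n) γ) -
        iM F A M k b (evHom t n) (lieM V a (k + 1) (evHom s m) γ) =
      iT F A M k ((gtOps V).brT L (a ⊗ₜ evHom s m) (b ⊗ₜ evHom t n)) γ := by
  apply hat_injective
  rw [map_sub, hat_lieM_evHom, hat_iM_evHom, hat_iM_evHom, hat_lieM_evHom,
    LeibnizData.cartan (ptAc_mul hV) hγ.hat, brT_evHom]
  simp only [map_add, map_sub, LinearMap.add_apply, LinearMap.sub_apply, iT_tmul, hat_iM_evHom,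
    ptData, ptBr_pt, ptAc_pt]

/-- Cartan's formula for the commutator of a Lie derivative and a contraction. -/
lemma cartanM (hV : V.ByDerivations) {k : ℕ} {γ : Mult F A M (k + 1)} (hγ : IsSkewM γ)
    (a b : A) (φ ψ : HomL F M) :
    lieM V a k φ (iM F A M k b ψ γ) - iM F A M k b ψ (lieM V a (k + 1) φ γ) =
      iT F A M k ((gtOps V).brT L (a ⊗ₜ φ) (b ⊗ₜ ψ)) γ := by
  let Ev : (Fin k → A) → Mult F A M k →ₗ[F] P F k M := fun c =>
    { toFun := fun γ => γ c, map_add' := fun _ _ => rfl, map_smul' := fun _ _ => rfl }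
  have hΞ : ∀ c d, Loc (fun φ => (Ev c ∘ₗ (iT F A M k).flip γ) (d ⊗ₜ φ)) := fun c d =>
    loc_iM d γ c
  -- The formula for two evaluations is extended to all `ψ` and after that to all `φ`.
  have key : ∀ s m ψ, lieM V a k (evHom s m) (iM F A M k b ψ γ) -
      iM F A M k b ψ (lieM V a (k + 1) (evHom s m) γ) -
      iT F A M k ((gtOps V).brT L (a ⊗ₜ evHom s m) (b ⊗ₜ ψ)) γ = 0 := by
    intro s m ψ
    ext c
    refine eq_zero_of_loc (Ev c ∘ₗ (lieM V a k (evHom s m) ∘ₗ (iM F A M k b).flip γ -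
      (iM F A M k b).flip (lieM V a (k + 1) (evHom s m) γ) -
      (iT F A M k).flip γ ∘ₗ (gtOps V).brT L (a ⊗ₜ evHom s m) ∘ₗ TensorProduct.mk F A _ b))
      ?_ (fun t n => ?_) ψ
    · exact ((loc_lieM_right V a (evHom s m) _ (loc_iM b γ) c).sub (loc_iM b _ c)).sub
        (loc_brT_right V (Ev c ∘ₗ (iT F A M k).flip γ) (hΞ c) b _)
    · exact congrArg (Ev c) (sub_eq_zero.2 (cartan_evHom hV hγ a b s t m n))
  rw [← sub_eq_zero]
  ext c
  refine eq_zero_of_loc (Ev c ∘ₗ ((lieM V a k).flip (iM F A M k b ψ γ) -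
      iM F A M k b ψ ∘ₗ (lieM V a (k + 1)).flip γ -
      (iT F A M k).flip γ ∘ₗ ((gtOps V).brT L).flip (b ⊗ₜ ψ) ∘ₗ TensorProduct.mk F A _ a))
      ?_ (fun s m => congrArg (Ev c) (key s m ψ)) φ
  exact ((loc_lieM V a _ c).sub (loc_iM_right b ψ _ (loc_lieM V a γ) c)).sub
    (loc_brT_left V (Ev c ∘ₗ (iT F A M k).flip γ) (hΞ c) a _)

end PolyCartan

/-! ### Cochains modulo a subspace -/

section Cocycles

variable {F : Type u} [Field F] [CharZero F]
  {A : Type v} [AddCommGroup A] [Module F A] [Module F[X] A] [IsScalarTower F F[X] A]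
  {M : Type w} [AddCommGroup M] [Module F M] [Module F[X] M] [IsScalarTower F F[X] M]
  {L : LieConformalAlgebra F A} (V : LieConformalModule L M)

/-- The cochains that are sesquilinear and skew-symmetric modulo a subspace `R`. -/
def Zmod {k : ℕ} (R : Submodule F (Mult F A M k)) : Submodule F (Mult F A M k) where
  carrier := {γ | (∀ l, edel l γ ∈ R) ∧
    ∀ σ : Equiv.Perm (Fin k), permM σ γ - (Equiv.Perm.sign σ : ℤ) • γ ∈ R}
  add_mem' := by
    rintro γ γ' ⟨h1, h2⟩ ⟨h1', h2'⟩
    refine ⟨fun l => ?_, fun σ => ?_⟩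
    · rw [map_add]; exact R.add_mem (h1 l) (h1' l)
    · rw [map_add, smul_add, add_sub_add_comm]; exact R.add_mem (h2 σ) (h2' σ)
  zero_mem' := ⟨fun l => by rw [map_zero]; exact R.zero_mem, fun σ => by
    rw [map_zero, smul_zero, sub_zero]; exact R.zero_mem⟩
  smul_mem' := by
    rintro c γ ⟨h1, h2⟩
    refine ⟨fun l => ?_, fun σ => ?_⟩
    · rw [map_smul]; exact R.smul_mem c (h1 l)
    · have := R.smul_mem c (h2 σ)
      rw [smul_sub] at this
      rw [map_smul, smul_comm]
      exact this

/-- The conditions on subspaces `R k` of the spaces of cochains under which the differential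
preserves the spaces `Zmod (R k)`. -/
structure Stable (V : LieConformalModule L M) (R : ∀ k, Submodule F (Mult F A M k)) : Prop where
  dM : ∀ k, ∀ γ ∈ R k, dM V k γ ∈ R (k + 1)
  lopM : ∀ k, ∀ γ ∈ R k, lopM V k γ ∈ R (k + 1)
  edel : ∀ k l, ∀ γ ∈ R k, edel l γ ∈ R k
  permM : ∀ k σ, ∀ γ ∈ R k, permM σ γ ∈ R k
  symFun : ∀ k (γ : Mult F A M k) (j : Fin k), (∀ l, LieConf.edel l γ ∈ R k) →
    ∀ η : Mult F A M (k + 1), (∀ a, η a = symFun L γ j a) → η ∈ R (k + 1)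

variable {V} {R : ∀ k, Submodule F (Mult F A M k)}

lemma Stable.le (hR : Stable V R) (k : ℕ) : R k ≤ Zmod (R k) := fun γ hγ =>
  ⟨fun l => hR.edel k l γ hγ, fun σ => (R k).sub_mem (hR.permM k σ γ hγ) (zsmul_mem hγ _)⟩

/-- The skew-symmetrization of a cochain. -/
def alt {k : ℕ} (γ : Mult F A M k) : Mult F A M k :=
  ((Fintype.card (Equiv.Perm (Fin k)) : F)⁻¹) • ∑ σ : Equiv.Perm (Fin k),
    (Equiv.Perm.sign σ : ℤ) • permM σ γ

lemma alt_skew {k : ℕ} (γ : Mult F A M k) : IsSkewM (alt γ) := by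
  intro τ
  rw [alt, map_smul, map_sum, smul_comm, Finset.smul_sum (r := (Equiv.Perm.sign τ : ℤ)),
    ← Equiv.sum_comp (Equiv.mulLeft τ) (fun σ => (Equiv.Perm.sign τ : ℤ) • (Equiv.Perm.sign σ : ℤ) • permM σ γ)]
  congr 1
  refine Finset.sum_congr rfl fun σ _ => ?_
  rw [map_zsmul, ← permM_mul, Equiv.coe_mulLeft, map_mul, smul_smul]
  congr 1
  rw [Units.val_mul, ← mul_assoc, ← Units.val_mul, Int.units_mul_self, Units.val_one, one_mul]

/-- The difference is the average of the elements `γ - sign(σ) σγ`, all of which lie in `R`. -/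
lemma alt_sub_mem {k : ℕ} {R : Submodule F (Mult F A M k)} {γ : Mult F A M k}
    (hγ : ∀ σ : Equiv.Perm (Fin k), permM σ γ - (Equiv.Perm.sign σ : ℤ) • γ ∈ R) :
    γ - alt γ ∈ R := by
  have hc : (Fintype.card (Equiv.Perm (Fin k)) : F) ≠ 0 := Nat.cast_ne_zero.2 Fintype.card_ne_zero
  have h : ∀ σ : Equiv.Perm (Fin k), γ - (Equiv.Perm.sign σ : ℤ) • permM σ γ ∈ R := by
    intro σ
    have := R.neg_mem (zsmul_mem (hγ σ) (Equiv.Perm.sign σ : ℤ))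
    rwa [smul_sub, smul_smul, ← Units.val_mul, Int.units_mul_self, Units.val_one, one_smul,
      neg_sub] at this
  have := R.smul_mem ((Fintype.card (Equiv.Perm (Fin k)) : F)⁻¹)
    (R.sum_mem fun σ (_ : σ ∈ Finset.univ) => h σ)
  rwa [Finset.sum_sub_distrib, smul_sub, Finset.sum_const, Finset.card_univ,
    ← Nat.cast_smul_eq_nsmul F, smul_smul, inv_mul_cancel₀ hc, one_smul] at this

/-- The permutations that act by their sign modulo `R` form a submonoid because `R` is stable, and
adjacent transpositions generate the symmetric group. -/
lemma sign_sub_mem_of_swap {k : ℕ} {R : Submodule F (Mult F A M (k + 1))}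
    (hR : ∀ σ, ∀ γ ∈ R, permM σ γ ∈ R) {η : Mult F A M (k + 1)}
    (h : ∀ j : Fin k, η + permM (Equiv.swap j.castSucc j.succ) η ∈ R)
    (σ : Equiv.Perm (Fin (k + 1))) : permM σ η - (Equiv.Perm.sign σ : ℤ) • η ∈ R := by
  let T : Submonoid (Equiv.Perm (Fin (k + 1))) :=
    { carrier := {σ | permM σ η - (Equiv.Perm.sign σ : ℤ) • η ∈ R}
      one_mem' := by
        have : permM (1 : Equiv.Perm (Fin (k + 1))) η = η := by
          ext a
          exact ren_id (η a)
        simp [this]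
      mul_mem' := fun {σ τ} hσ hτ => by
        have h1 := R.add_mem (hR σ _ hτ) (zsmul_mem hσ (Equiv.Perm.sign τ : ℤ))
        rw [map_sub, ← permM_mul, map_zsmul, smul_sub, smul_smul] at h1
        change permM (σ * τ) η - (Equiv.Perm.sign (σ * τ) : ℤ) • η ∈ R
        rw [map_mul, mul_comm, Units.val_mul]
        convert h1 using 1
        abel }
  have : T = ⊤ := by
    rw [eq_top_iff, ← Equiv.Perm.mclosure_swap_castSucc_succ, Submonoid.closure_le]
    rintro _ ⟨j, rfl⟩
    change permM _ η - _ ∈ R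
    rw [Equiv.Perm.sign_swap (Fin.castSucc_lt_succ).ne]
    simpa [add_comm] using h j
  exact (this ▸ Submonoid.mem_top σ : σ ∈ T)

/-- Modulo `R` the cochain may be replaced by its skew-symmetrization. Skew-symmetry of the
differential then follows from `dM_swap` and the condition `symFun`. Sesquilinearity is obtained in
the first argument from `edel_dM` and carried to the others by transpositions. -/
lemma Stable.dM_mem (hR : Stable V R) {k : ℕ} {γ : Mult F A M k} (hγ : γ ∈ Zmod (R k)) :
    LieConf.dM V k γ ∈ Zmod (R (k + 1)) := by
  have h1 := alt_sub_mem hγ.2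
  suffices h : LieConf.dM V k (alt γ) ∈ Zmod (R (k + 1)) by
    have := (Zmod (R (k + 1))).add_mem h (hR.le _ (hR.dM _ _ h1))
    rwa [← map_add, add_sub_cancel] at this
  have h2 : alt γ ∈ Zmod (R k) := by
    have := (Zmod (R k)).sub_mem hγ (hR.le _ h1)
    rwa [sub_sub_cancel] at this
  have hs : ∀ σ, LieConf.permM σ (LieConf.dM V k (alt γ)) -
      (Equiv.Perm.sign σ : ℤ) • LieConf.dM V k (alt γ) ∈ R (k + 1) := by
    refine sign_sub_mem_of_swap (hR.permM _) fun j => ?_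
    have := hR.symFun k (alt γ) j h2.1 ((-1 : F) ^ ((j : ℕ) + 1) • (LieConf.dM V k (alt γ) +
      LieConf.permM (Equiv.swap j.castSucc j.succ) (LieConf.dM V k (alt γ)))) (fun a => by
        rw [smul_apply, add_apply, dM_swap V (alt_skew γ), smul_smul, ← mul_pow]
        simp)
    have := (R (k + 1)).smul_mem ((-1 : F) ^ ((j : ℕ) + 1)) this
    rw [smul_smul, ← mul_pow] at this
    simpa using this
  refine ⟨fun l => ?_, hs⟩
  have h0 : LieConf.edel 0 (LieConf.dM V k (alt γ)) ∈ R (k + 1) := by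
    cases k with
    | zero => rw [edel_dM_zero]; exact (R 1).zero_mem
    | succ k =>
      rw [edel_dM]
      exact (R _).sub_mem (hR.dM _ _ (h2.1 0)) (hR.lopM _ _ (h2.1 0))
  -- The transposition of `0` and `l` moves the defect to the argument `l`, and it changes the
  -- differential only by its sign modulo `R`.
  have h3 := hR.permM _ (Equiv.swap 0 l) _ h0
  rw [← edel_permM, Equiv.swap_apply_left] at h3
  have h4 := (R (k + 1)).sub_mem h3 (hR.edel _ l _ (hs (Equiv.swap 0 l)))
  rw [map_sub, sub_sub_cancel, map_zsmul] at h4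
  have h5 := zsmul_mem h4 (Equiv.Perm.sign (Equiv.swap 0 l) : ℤ)
  rwa [smul_smul, ← Units.val_mul, Int.units_mul_self, Units.val_one, one_smul] at h5

variable (V) in
lemma stable_bot : Stable V (fun k => (⊥ : Submodule F (Mult F A M k))) where
  dM k γ h := by rw [(Submodule.mem_bot F).1 h, map_zero]; exact Submodule.zero_mem _
  lopM k γ h := by rw [(Submodule.mem_bot F).1 h, map_zero]; exact Submodule.zero_mem _
  edel k l γ h := by rw [(Submodule.mem_bot F).1 h, map_zero]; exact Submodule.zero_mem _
  permM k σ γ h := by rw [(Submodule.mem_bot F).1 h, map_zero]; exact Submodule.zero_mem _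
  symFun k γ j h η hη := by
    rw [Submodule.mem_bot]
    ext a
    -- With zero subspaces on both sides, `symFun_mem` says that the cochain vanishes exactly.
    rw [hη a]
    refine (Submodule.mem_bot (MvPolynomial (Fin (k + 1)) F)).1
      (symFun_mem ⊥ ⊥ γ j (fun p hp => ?_) (fun a => ?_) a)
    · rw [(Submodule.mem_bot _).1 hp, map_zero]; exact Submodule.zero_mem _
    · rw [(Submodule.mem_bot F).1 (h j)]; exact Submodule.zero_mem _

/-- Preimages of the single values are chosen by a linear right inverse onto the range, so they form
a multilinear map again. -/
lemma mem_range_thM {k : ℕ} {γ : Mult F A M k} :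
    γ ∈ LinearMap.range (thM F A M k) ↔ ∀ a, γ a ∈ LinearMap.range (ThP F M k) := by
  constructor
  · rintro ⟨θ, rfl⟩ a
    exact ⟨θ a, rfl⟩
  · intro h
    let T : P F k M →ₗ[F] P F k M := (ThP F M k).restrictScalars F
    obtain ⟨σ, hσ⟩ := T.rangeRestrict.exists_rightInverse_of_surjective T.range_rangeRestrict
    let γ' : MultilinearMap F (fun _ : Fin k => A) (LinearMap.range T) :=
      γ.codRestrict (LinearMap.range T) h
    refine ⟨σ.compMultilinearMap γ', ?_⟩
    ext a
    exact congrArg Subtype.val (congrArg (fun f => f (γ' a)) hσ)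

variable (V) in
lemma stable_thM : Stable V (fun k => LinearMap.range (thM F A M k)) where
  dM k γ h := by obtain ⟨θ, rfl⟩ := h; exact ⟨_, (dM_thM V θ).symm⟩
  lopM k γ h := by obtain ⟨θ, rfl⟩ := h; exact ⟨_, (lopM_thM V θ).symm⟩
  edel k l γ h := by obtain ⟨θ, rfl⟩ := h; exact ⟨_, (edel_thM l θ).symm⟩
  permM k σ γ h := by obtain ⟨θ, rfl⟩ := h; exact ⟨_, (permM_thM σ θ).symm⟩
  symFun k γ j h η hη := by
    rw [mem_range_thM]
    intro a
    rw [hη a]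
    refine symFun_mem (LinearMap.range (ThP F M k)) (LinearMap.range (ThP F M (k + 1))) γ j ?_
      (mem_range_thM.1 (h j)) a
    rintro _ ⟨p, rfl⟩
    exact ⟨_, (mergeS_ThP j.succ j p).symm⟩

end Cocycles

/-! ### Complexes given degree by degree -/

section Components

variable {F : Type u} [Field F]

/-- A linear right inverse of a surjective linear map. -/
def sect {X Y : Type*} [AddCommGroup X] [Module F X] [AddCommGroup Y] [Module F Y] (q : X →ₗ[F] Y)
    (hq : Function.Surjective q) : Y →ₗ[F] X :=
  (q.exists_rightInverse_of_surjective (LinearMap.range_eq_top.2 hq)).choose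

lemma sect_spec {X Y : Type*} [AddCommGroup X] [Module F X] [AddCommGroup Y] [Module F Y]
    (q : X →ₗ[F] Y) (hq : Function.Surjective q) (y : Y) : q (sect q hq y) = y :=
  congrArg (fun T => T y)
    (q.exists_rightInverse_of_surjective (LinearMap.range_eq_top.2 hq)).choose_spec

variable {g : Type*} [AddCommGroup g] [Module F g]

/-- The components of the operators of a `𝔤`-complex. -/
structure Cplx (lie : LieStr F g) (B : ℕ → Type*) [∀ k, AddCommGroup (B k)]
    [∀ k, Module F (B k)] where
  d : ∀ k, B k →ₗ[F] B (k + 1)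
  i : ∀ k, g →ₗ[F] B (k + 1) →ₗ[F] B k
  d_d : ∀ k b, d (k + 1) (d k b) = 0
  i_i : ∀ k x y b, i k x (i (k + 1) y b) + i k y (i (k + 1) x b) = 0
  cartan_zero : ∀ x y b, i 0 x (d 0 (i 0 y b)) - i 0 y (d 0 (i 0 x b) + i 1 x (d 1 b)) =
    i 0 (lie.br x y) b
  cartan_succ : ∀ k x y b, d k (i k x (i (k + 1) y b)) + i (k + 1) x (d (k + 1) (i (k + 1) y b)) -
      i (k + 1) y (d (k + 1) (i (k + 1) x b) + i (k + 2) x (d (k + 2) b)) =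
    i (k + 1) (lie.br x y) b

namespace Cplx

variable {lie : LieStr F g} {B : ℕ → Type*} [∀ k, AddCommGroup (B k)] [∀ k, Module F (B k)]
  (S : Cplx lie B)

/-- The differential of the direct sum. -/
def dSum : Module.End F (⨁ k, B k) :=
  DirectSum.toModule F ℕ _ fun k => DirectSum.lof F ℕ B (k + 1) ∘ₗ S.d k

lemma dSum_lof (k : ℕ) (b : B k) :
    S.dSum (DirectSum.lof F ℕ B k b) = DirectSum.lof F ℕ B (k + 1) (S.d k b) := by
  simp [dSum]

/-- The components of the contractions, with values in the direct sum. -/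
def iAux (x : g) : ∀ k, B k →ₗ[F] ⨁ k, B k
  | 0 => 0
  | k + 1 => DirectSum.lof F ℕ B k ∘ₗ S.i k x

/-- The contractions of the direct sum. -/
def iSum : g →ₗ[F] Module.End F (⨁ k, B k) where
  toFun x := DirectSum.toModule F ℕ _ (S.iAux x)
  map_add' x y := by
    refine DirectSum.linearMap_ext F fun k => ?_
    cases k <;> ext <;> simp [iAux]
  map_smul' c x := by
    refine DirectSum.linearMap_ext F fun k => ?_
    cases k <;> ext <;> simp [iAux]

lemma iSum_lof_zero (x : g) (b : B 0) : S.iSum x (DirectSum.lof F ℕ B 0 b) = 0 := by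
  simp [iSum, iAux]

lemma iSum_lof_succ (x : g) (k : ℕ) (b : B (k + 1)) :
    S.iSum x (DirectSum.lof F ℕ B (k + 1) b) = DirectSum.lof F ℕ B k (S.i k x b) := by
  simp [iSum, iAux]

lemma dSum_dSum : S.dSum * S.dSum = 0 := by
  refine DirectSum.linearMap_ext F fun k => LinearMap.ext fun b => ?_
  simp only [LinearMap.comp_apply, Module.End.mul_apply, dSum_lof, S.d_d, map_zero,
    LinearMap.zero_apply]

/-- The Lie derivatives of the direct sum. -/
def lSum : g →ₗ[F] Module.End F (⨁ k, B k) :=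
  (LinearMap.mulLeft F S.dSum + LinearMap.mulRight F S.dSum) ∘ₗ S.iSum

lemma lSum_apply (x : g) : S.lSum x = S.dSum * S.iSum x + S.iSum x * S.dSum := rfl

lemma dSum_lSum (x : g) : S.dSum * S.lSum x - S.lSum x * S.dSum = 0 := by
  rw [lSum_apply, mul_add, add_mul, ← mul_assoc, S.dSum_dSum, zero_mul, zero_add,
    mul_assoc (S.iSum x), S.dSum_dSum, mul_zero, add_zero, mul_assoc, sub_self]

lemma lSum_iSum (x y : g) :
    S.lSum x * S.iSum y - S.iSum y * S.lSum x = S.iSum (lie.br x y) := by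
  refine DirectSum.linearMap_ext F fun k => LinearMap.ext fun b => ?_
  -- Contractions vanish in degree `0`, which makes degrees `0` and `1` special.
  rcases k with _ | _ | k
  · simp only [LinearMap.comp_apply, LinearMap.sub_apply, LinearMap.add_apply, lSum_apply,
      Module.End.mul_apply, dSum_lof, iSum_lof_zero, iSum_lof_succ, map_zero, map_add, sub_self,
      add_zero]
  · simp only [LinearMap.comp_apply, LinearMap.sub_apply, LinearMap.add_apply, lSum_apply,
      Module.End.mul_apply, dSum_lof, iSum_lof_zero, iSum_lof_succ, map_zero, zero_add,
      ← map_add, ← map_sub, S.cartan_zero]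
  · simp only [LinearMap.comp_apply, LinearMap.sub_apply, LinearMap.add_apply, lSum_apply,
      Module.End.mul_apply, dSum_lof, iSum_lof_succ, ← map_add, ← map_sub, S.cartan_succ]

/-- The `𝔤`-complex with given components. -/
def toG : GStructure lie B where
  d := S.dSum
  ι := S.iSum
  L := S.lSum
  d_deg := by
    rintro k _ ⟨b, rfl⟩
    exact ⟨_, (S.dSum_lof k b).symm⟩
  ι_deg_zero := by
    rintro x _ ⟨b, rfl⟩
    exact S.iSum_lof_zero x b
  ι_deg := by
    rintro x k _ ⟨b, rfl⟩
    exact ⟨_, (S.iSum_lof_succ x k b).symm⟩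
  L_deg := by
    rintro x k _ ⟨b, rfl⟩
    rw [lSum_apply, LinearMap.add_apply, Module.End.mul_apply, Module.End.mul_apply, dSum_lof,
      iSum_lof_succ]
    refine Submodule.add_mem _ ?_ ⟨_, rfl⟩
    cases k with
    | zero => rw [iSum_lof_zero, map_zero]; exact Submodule.zero_mem _
    | succ k => rw [iSum_lof_succ, dSum_lof]; exact ⟨_, rfl⟩
  d_d := S.dSum_dSum
  d_ι x := (S.lSum_apply x).symm
  d_L := S.dSum_lSum
  ι_ι x y := by
    refine DirectSum.linearMap_ext F fun k => LinearMap.ext fun b => ?_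
    rcases k with _ | _ | k
    · simp [iSum_lof_zero]
    · simp [iSum_lof_zero, iSum_lof_succ]
    · simp only [LinearMap.comp_apply, LinearMap.add_apply, Module.End.mul_apply, iSum_lof_succ,
        ← map_add, S.i_i, map_zero, LinearMap.zero_apply]
  L_ι := S.lSum_iSum
  L_L x y := by
    have h := S.lSum_iSum x y
    have hd := sub_eq_zero.1 (S.dSum_lSum x)
    -- `L_x` commutes with `d`, so `[L_x, [d, ι_y]] = [d, [L_x, ι_y]]`.
    have e : S.lSum x * (S.dSum * S.iSum y + S.iSum y * S.dSum) -
        (S.dSum * S.iSum y + S.iSum y * S.dSum) * S.lSum x =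
        S.dSum * (S.lSum x * S.iSum y - S.iSum y * S.lSum x) +
          (S.lSum x * S.iSum y - S.iSum y * S.lSum x) * S.dSum := by
      have h1 : S.iSum y * S.dSum * S.lSum x = S.iSum y * S.lSum x * S.dSum := by
        rw [mul_assoc, hd, mul_assoc]
      have h2 : S.lSum x * S.dSum * S.iSum y = S.dSum * S.lSum x * S.iSum y := by rw [← hd]
      simp only [mul_add, add_mul, mul_sub, sub_mul, ← mul_assoc]
      rw [h1, h2]
      abel
    rw [S.lSum_apply y, e, h, ← lSum_apply]

/-- The complex induced on quotients. -/
def quot {g' : Type*} [AddCommGroup g'] [Module F g'] {lie' : LieStr F g'} (π : g' →ₗ[F] g)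
    (hπ : ∀ x y, π (lie'.br x y) = lie.br (π x) (π y)) {B' : ℕ → Type*}
    [∀ k, AddCommGroup (B' k)] [∀ k, Module F (B' k)] (q : ∀ k, B k →ₗ[F] B' k)
    (hq : ∀ k, Function.Surjective (q k)) (hd : ∀ k b, q k b = 0 → q (k + 1) (S.d k b) = 0)
    (hi : ∀ k x b, q (k + 1) b = 0 → q k (S.i k (π x) b) = 0) :
    {S' : Cplx lie' B' // (∀ k b, S'.d k (q k b) = q (k + 1) (S.d k b)) ∧
      ∀ k x b, S'.i k x (q (k + 1) b) = q k (S.i k (π x) b)} := by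
  -- The operators are defined through linear sections; `hd` and `hi` make them independent of the
  -- section.
  let d' : ∀ k, B' k →ₗ[F] B' (k + 1) := fun k => q (k + 1) ∘ₗ S.d k ∘ₗ sect (q k) (hq k)
  let i' : ∀ k, g' →ₗ[F] B' (k + 1) →ₗ[F] B' k := fun k =>
    ((S.i k).compl₁₂ π (sect (q (k + 1)) (hq (k + 1)))).compr₂ (q k)
  have hd' : ∀ k b, d' k (q k b) = q (k + 1) (S.d k b) := by
    intro k b
    have := hd k (sect (q k) (hq k) (q k b) - b) (by rw [map_sub, sect_spec, sub_self])
    rwa [map_sub, map_sub, sub_eq_zero] at this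
  have hi' : ∀ k x b, i' k x (q (k + 1) b) = q k (S.i k (π x) b) := by
    intro k x b
    have := hi k x (sect (q (k + 1)) (hq (k + 1)) (q (k + 1) b) - b)
      (by rw [map_sub, sect_spec, sub_self])
    rwa [map_sub, map_sub, sub_eq_zero] at this
  refine ⟨⟨d', i', fun k b => ?_, fun k x y b => ?_, fun x y b => ?_, fun k x y b => ?_⟩, hd', hi'⟩
  · obtain ⟨b, rfl⟩ := hq k b
    rw [hd', hd', S.d_d, map_zero]
  · obtain ⟨b, rfl⟩ := hq _ b
    rw [hi', hi', hi', hi', ← map_add, S.i_i, map_zero]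
  · obtain ⟨b, rfl⟩ := hq _ b
    simp only [hi', hd', ← map_add, ← map_sub, S.cartan_zero, hπ]
  · obtain ⟨b, rfl⟩ := hq _ b
    simp only [hi', hd', ← map_add, ← map_sub, S.cartan_succ, hπ]

/-- The complex induced on a graded subspace, with the Lie algebra replaced by a quotient. -/
def sub {g' : Type*} [AddCommGroup g'] [Module F g'] {lie' : LieStr F g'} (p : g →ₗ[F] g')
    (hp : Function.Surjective p) (hbr : ∀ x y, p (lie.br x y) = lie'.br (p x) (p y))
    (N : ∀ k, Submodule F (B k)) (hd : ∀ k, ∀ b ∈ N k, S.d k b ∈ N (k + 1))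
    (hi : ∀ k x, ∀ b ∈ N (k + 1), S.i k x b ∈ N k)
    (hker : ∀ k x, p x = 0 → ∀ b ∈ N (k + 1), S.i k x b = 0) :
    {S' : Cplx lie' (fun k => N k) // (∀ k (b : N k), (S'.d k b : B (k + 1)) = S.d k b) ∧
      ∀ k x (b : N (k + 1)), (S'.i k (p x) b : B k) = S.i k x b} := by
  let d' : ∀ k, N k →ₗ[F] N (k + 1) := fun k => (S.d k).restrict (hd k)
  let i' : ∀ k, g' →ₗ[F] N (k + 1) →ₗ[F] N k := fun k =>
    LinearMap.mk₂ F (fun x b => ⟨S.i k (sect p hp x) b, hi k _ b b.2⟩)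
      (by intros; ext; simp) (by intros; ext; simp) (by intros; ext; simp) (by intros; ext; simp)
  have hd' : ∀ k (b : N k), (d' k b : B (k + 1)) = S.d k b := fun k b => rfl
  have hi' : ∀ k x (b : N (k + 1)), (i' k (p x) b : B k) = S.i k x b := by
    intro k x b
    have := hker k (sect p hp (p x) - x) (by rw [map_sub, sect_spec, sub_self]) b b.2
    rwa [map_sub, LinearMap.sub_apply, sub_eq_zero] at this
  refine ⟨⟨d', i', fun k b => ?_, fun k x y b => ?_, fun x y b => ?_, fun k x y b => ?_⟩, hd', hi'⟩
  · exact Subtype.ext (S.d_d k b)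
  · obtain ⟨x, rfl⟩ := hp x
    obtain ⟨y, rfl⟩ := hp y
    refine Subtype.ext ?_
    simp only [Submodule.coe_add, hi', S.i_i, Submodule.coe_zero]
  · obtain ⟨x, rfl⟩ := hp x
    obtain ⟨y, rfl⟩ := hp y
    refine Subtype.ext ?_
    simp only [← hbr, Submodule.coe_add, Submodule.coe_sub, hi', hd', S.cartan_zero]
  · obtain ⟨x, rfl⟩ := hp x
    obtain ⟨y, rfl⟩ := hp y
    refine Subtype.ext ?_
    simp only [← hbr, Submodule.coe_add, Submodule.coe_sub, hi', hd', S.cartan_succ]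

end Cplx

/-- A family of maps that commutes with the components of the operators commutes with the
operators. -/
lemma Cplx.lmap_comm {lie : LieStr F g} {B : ℕ → Type*} [∀ k, AddCommGroup (B k)]
    [∀ k, Module F (B k)] (S : Cplx lie B) {g' : Type*} [AddCommGroup g'] [Module F g']
    {lie' : LieStr F g'} {B' : ℕ → Type*} [∀ k, AddCommGroup (B' k)] [∀ k, Module F (B' k)]
    (S' : Cplx lie' B') (f : ∀ k, B k →ₗ[F] B' k)
    (hd : ∀ k b, f (k + 1) (S.d k b) = S'.d k (f k b)) :
    (∀ b, DirectSum.lmap f (S.toG.d b) = S'.toG.d (DirectSum.lmap f b)) ∧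
    ∀ x x', (∀ k b, f k (S.i k x b) = S'.i k x' (f (k + 1) b)) →
      ∀ b, DirectSum.lmap f (S.toG.ι x b) = S'.toG.ι x' (DirectSum.lmap f b) := by
  constructor
  · intro b
    have : DirectSum.lmap f ∘ₗ S.toG.d = S'.toG.d ∘ₗ DirectSum.lmap f := by
      refine DirectSum.linearMap_ext F fun k => LinearMap.ext fun b => ?_
      simp only [LinearMap.comp_apply, Cplx.toG, Cplx.dSum_lof, DirectSum.lmap_lof, hd]
    exact congrArg (fun T => T b) this
  · intro x x' h b
    have : DirectSum.lmap f ∘ₗ S.toG.ι x = S'.toG.ι x' ∘ₗ DirectSum.lmap f := by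
      refine DirectSum.linearMap_ext F fun k => LinearMap.ext fun b => ?_
      cases k with
      | zero => simp only [LinearMap.comp_apply, Cplx.toG, Cplx.iSum_lof_zero, DirectSum.lmap_lof,
          map_zero]
      | succ k =>
        simp only [LinearMap.comp_apply, Cplx.toG, Cplx.iSum_lof_succ, DirectSum.lmap_lof, h]
    exact congrArg (fun T => T b) this

/-- A map that commutes with the differentials and contractions is a morphism. -/
lemma isGMorphism_of {h : Type*} [AddCommGroup h] [Module F h] {lie : LieStr F g}
    {lie' : LieStr F h} {B B' : ℕ → Type*} [∀ k, AddCommGroup (B k)] [∀ k, Module F (B k)]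
    [∀ k, AddCommGroup (B' k)] [∀ k, Module F (B' k)] (S : GStructure lie B)
    (S' : GStructure lie' B') (π : g →ₗ[F] h) (ρ : (⨁ k, B k) →ₗ[F] (⨁ k, B' k))
    (map_br : ∀ x y, π (lie.br x y) = lie'.br (π x) (π y))
    (map_deg : ∀ k, ∀ b ∈ homog F B k, ρ b ∈ homog F B' k)
    (map_d : ∀ b, ρ (S.d b) = S'.d (ρ b))
    (map_ι : ∀ X b, ρ (S.ι X b) = S'.ι (π X) (ρ b)) : IsGMorphism S S' π ρ where
  map_br := map_br
  map_deg := map_deg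
  map_d := map_d
  map_ι := map_ι
  map_L X b := by
    rw [← S.d_ι, ← S'.d_ι]
    simp only [LinearMap.add_apply, Module.End.mul_apply, map_add, map_d, map_ι]

lemma lmap_homog {B B' : ℕ → Type*} [∀ k, AddCommGroup (B k)] [∀ k, Module F (B k)]
    [∀ k, AddCommGroup (B' k)] [∀ k, Module F (B' k)] (f : ∀ k, B k →ₗ[F] B' k) :
    ∀ k, ∀ b ∈ homog F B k, DirectSum.lmap f b ∈ homog F B' k := by
  rintro k _ ⟨b, rfl⟩
  rw [DirectSum.lmap_lof]
  exact ⟨_, rfl⟩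

end Components

/-! ### Contractions by tensors -/

section TensorContractions

variable {F : Type u} [Field F] [CharZero F]
  {A : Type v} [AddCommGroup A] [Module F A] [Module F[X] A] [IsScalarTower F F[X] A]
  {M : Type w} [NonUnitalCommRing M] [Module F M] [IsScalarTower F M M] [SMulCommClass F M M]
  [Module F[X] M] [IsScalarTower F F[X] M]
  {L : LieConformalAlgebra F A} {V : LieConformalModule L M}

lemma edel_iT {k : ℕ} (l : Fin k) (x : A ⊗[F] HomL F M) (γ : Mult F A M (k + 1)) :
    edel l (iT F A M k x γ) = iT F A M k x (edel l.succ γ) := by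
  induction x using TensorProduct.induction_on with
  | zero => simp
  | add x y hx hy => simp only [map_add, LinearMap.add_apply, hx, hy]
  | tmul a φ => exact edel_iM l a φ γ

lemma permM_iT {k : ℕ} (σ : Equiv.Perm (Fin k)) (x : A ⊗[F] HomL F M) (γ : Mult F A M (k + 1)) :
    permM σ (iT F A M k x γ) =
      iT F A M k x (permM (Equiv.Perm.decomposeFin.symm (0, σ)) γ) := by
  induction x using TensorProduct.induction_on with
  | zero => simp
  | add x y hx hy => simp only [map_add, LinearMap.add_apply, hx, hy]
  | tmul a φ => exact permM_iM σ a φ γ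

lemma iT_edel_zero {k : ℕ} (x : A ⊗[F] HomL F M) (γ : Mult F A M (k + 1)) :
    iT F A M k x (edel 0 γ) =
      iT F A M k (((D F A).rTensor (HomL F M) + (lamStar F M).lTensor A) x) γ := by
  induction x using TensorProduct.induction_on with
  | zero => simp
  | add x y hx hy => simp only [map_add, LinearMap.add_apply, hx, hy]
  | tmul a φ =>
    rw [iT_tmul, iM_edel_zero]
    simp only [LinearMap.add_apply, LinearMap.rTensor_tmul, LinearMap.lTensor_tmul, map_add,
      iT_tmul]

lemma iT_thM (hV : V.ByDerivations) {k : ℕ} (x : A ⊗[F] HomL F M) (γ : Mult F A M (k + 1)) :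
    iT F A M k x (thM F A M (k + 1) γ) = thM F A M k (iT F A M k x γ) -
      iT F A M k ((delHom F M - lamStar F M).lTensor A x) γ := by
  induction x using TensorProduct.induction_on with
  | zero => simp
  | add x y hx hy =>
    simp only [map_add, LinearMap.add_apply, hx, hy]
    abel
  | tmul a φ =>
    rw [iT_tmul, iM_thM hV.del_mul, LinearMap.lTensor_tmul, iT_tmul]
    simp only [LinearMap.sub_apply, map_sub]
    abel

lemma iT_expD_thM (hV : V.ByDerivations) {k : ℕ} (x : A ⊗[F] M) (γ : Mult F A M (k + 1)) :
    iT F A M k ((expD F).lTensor A x) (thM F A M (k + 1) γ) =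
      thM F A M k (iT F A M k ((expD F).lTensor A x) γ) := by
  induction x using TensorProduct.induction_on with
  | zero => simp
  | add x y hx hy => simp only [map_add, LinearMap.add_apply, hx, hy]
  | tmul a m => exact iM_expD_thM hV.del_mul a m γ

lemma iT_iT {k : ℕ} {γ : Mult F A M (k + 2)} (h : IsSkewM γ) (x y : A ⊗[F] HomL F M) :
    iT F A M k x (iT F A M (k + 1) y γ) + iT F A M k y (iT F A M (k + 1) x γ) = 0 := by
  induction x using TensorProduct.induction_on with
  | zero => simp
  | add x x' hx hx' =>
    simp only [map_add, LinearMap.add_apply]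
    rw [add_add_add_comm, hx, hx', add_zero]
  | tmul a φ =>
    induction y using TensorProduct.induction_on with
    | zero => simp
    | add y y' hy hy' =>
      simp only [map_add, LinearMap.add_apply]
      rw [add_add_add_comm, hy, hy', add_zero]
    | tmul b ψ => exact iM_iM h a b φ ψ

lemma cartan_iT_zero (hV : V.ByDerivations) {γ : Mult F A M 1} (hγ : IsSkewM γ)
    (x y : A ⊗[F] HomL F M) :
    iT F A M 0 x (dM V 0 (iT F A M 0 y γ)) -
        iT F A M 0 y (dM V 0 (iT F A M 0 x γ) + iT F A M 1 x (dM V 1 γ)) =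
      iT F A M 0 ((gtOps V).brT L x y) γ := by
  induction x using TensorProduct.induction_on with
  | zero => simp
  | add x x' hx hx' =>
    simp only [map_add, LinearMap.add_apply, ← hx, ← hx']
    abel
  | tmul a φ =>
    induction y using TensorProduct.induction_on with
    | zero => simp
    | add y y' hy hy' =>
      simp only [map_add, LinearMap.add_apply] at hy hy' ⊢
      rw [← hy, ← hy']
      abel
    | tmul b ψ => exact cartanM hV hγ a b φ ψ

lemma cartan_iT_succ (hV : V.ByDerivations) {k : ℕ} {γ : Mult F A M (k + 2)} (hγ : IsSkewM γ)
    (x y : A ⊗[F] HomL F M) :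
    dM V k (iT F A M k x (iT F A M (k + 1) y γ)) +
        iT F A M (k + 1) x (dM V (k + 1) (iT F A M (k + 1) y γ)) -
        iT F A M (k + 1) y (dM V (k + 1) (iT F A M (k + 1) x γ) +
          iT F A M (k + 2) x (dM V (k + 2) γ)) =
      iT F A M (k + 1) ((gtOps V).brT L x y) γ := by
  induction x using TensorProduct.induction_on with
  | zero => simp
  | add x x' hx hx' =>
    simp only [map_add, LinearMap.add_apply] at hx hx' ⊢
    rw [← hx, ← hx']
    abel
  | tmul a φ =>
    induction y using TensorProduct.induction_on with
    | zero => simp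
    | add y y' hy hy' =>
      simp only [map_add, LinearMap.add_apply] at hy hy' ⊢
      rw [← hy, ← hy']
      abel
    | tmul b ψ => exact cartanM hV hγ a b φ ψ

end TensorContractions

/-! ### Complexes of cochains modulo a subspace -/

section Frames

variable {F : Type u} [Field F] [CharZero F]
  {A : Type v} [AddCommGroup A] [Module F A] [Module F[X] A] [IsScalarTower F F[X] A]
  {M : Type w} [NonUnitalCommRing M] [Module F M] [IsScalarTower F M M] [SMulCommClass F M M]
  [Module F[X] M] [IsScalarTower F F[X] M]
  {L : LieConformalAlgebra F A} (V : LieConformalModule L M)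

instance {k : ℕ} (R : Submodule F (Mult F A M k)) : AddCommGroup (Zmod R) :=
  Submodule.addCommGroup _

/-- A presentation of a Lie algebra `g` by tensors `j x`, and of a graded space `B` by cochains
modulo the subspaces `R k`. -/
structure Frame {g : Type*} [AddCommGroup g] [Module F g] (lie : LieStr F g) (B : ℕ → Type*)
    [∀ k, AddCommGroup (B k)] [∀ k, Module F (B k)] (X : Type*) [AddCommGroup X] [Module F X] where
  R : ∀ k, Submodule F (Mult F A M k)
  stable : Stable V R
  p : X →ₗ[F] g
  p_surj : Function.Surjective p
  j : X →ₗ[F] A ⊗[F] HomL F M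
  j_R : ∀ k x, ∀ γ ∈ R (k + 1), iT F A M k (j x) γ ∈ R k
  j_ker : ∀ x, p x = 0 →
    ∃ z, j x = ((D F A).rTensor (HomL F M) + (lamStar F M).lTensor A) (j z)
  j_br : ∀ x y, ∃ z, p z = lie.br (p x) (p y) ∧ j z = (gtOps V).brT L (j x) (j y)
  q : ∀ k, Zmod (R k) →ₗ[F] B k
  q_surj : ∀ k, Function.Surjective (q k)
  q_ker : ∀ k z, q k z = 0 ↔ z.1 ∈ R k

namespace Frame

variable {V} {g : Type*} [AddCommGroup g] [Module F g] {lie : LieStr F g} {B : ℕ → Type*}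
    [∀ k, AddCommGroup (B k)] [∀ k, Module F (B k)] {X : Type*} [AddCommGroup X] [Module F X]
    (S : Frame V lie B X)

/-- The differential of the cochains that are sesquilinear and skew-symmetric modulo `R`. -/
def dZ (k : ℕ) : Zmod (S.R k) →ₗ[F] Zmod (S.R (k + 1)) :=
  (dM V k).restrict fun _ h => S.stable.dM_mem h

lemma iT_mem {k : ℕ} (x : X) {γ : Mult F A M (k + 1)} (h : γ ∈ Zmod (S.R (k + 1))) :
    iT F A M k (S.j x) γ ∈ Zmod (S.R k) := by
  refine ⟨fun l => ?_, fun σ => ?_⟩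
  · rw [edel_iT]
    exact S.j_R k x _ (h.1 _)
  · have := S.j_R k x _ (h.2 (Equiv.Perm.decomposeFin.symm (0, σ)))
    rw [map_sub, ← permM_iT, map_zsmul] at this
    simpa using this

/-- The contractions of the cochains that are sesquilinear and skew-symmetric modulo `R`. -/
def iZ (k : ℕ) : X →ₗ[F] Zmod (S.R (k + 1)) →ₗ[F] Zmod (S.R k) :=
  LinearMap.mk₂ F (fun x z => ⟨iT F A M k (S.j x) z.1, S.iT_mem x z.2⟩)
    (by intros; ext; simp) (by intros; ext; simp) (by intros; ext; simp) (by intros; ext; simp)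

/-- The differential on `B`. -/
def dB (k : ℕ) : B k →ₗ[F] B (k + 1) := S.q (k + 1) ∘ₗ S.dZ k ∘ₗ sect (S.q k) (S.q_surj k)

/-- The contractions on `B`. -/
def iB (k : ℕ) : g →ₗ[F] B (k + 1) →ₗ[F] B k :=
  ((S.iZ k).compl₁₂ (sect S.p S.p_surj) (sect (S.q (k + 1)) (S.q_surj (k + 1)))).compr₂ (S.q k)

lemma dB_q (k : ℕ) (z : Zmod (S.R k)) : S.dB k (S.q k z) = S.q (k + 1) (S.dZ k z) := by
  have h : S.q (k + 1) (S.dZ k (sect (S.q k) (S.q_surj k) (S.q k z) - z)) = 0 := by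
    rw [S.q_ker]
    refine S.stable.dM _ _ ((S.q_ker _ (sect (S.q k) (S.q_surj k) (S.q k z) - z)).1 ?_)
    rw [map_sub, sect_spec, sub_self]
  rwa [map_sub, map_sub, sub_eq_zero] at h

lemma iB_q (k : ℕ) (x : X) (z : Zmod (S.R (k + 1))) :
    S.iB k (S.p x) (S.q (k + 1) z) = S.q k (S.iZ k x z) := by
  have h1 : S.q k (S.iZ k (sect S.p S.p_surj (S.p x) - x) z) = 0 := by
    rw [S.q_ker]
    obtain ⟨y, hy⟩ := S.j_ker (sect S.p S.p_surj (S.p x) - x)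
      (by rw [map_sub, sect_spec, sub_self])
    change iT F A M k (S.j _) z.1 ∈ _
    -- A tensor with zero class acts as a relation, that is, through the defect of the cochain in
    -- its first argument, which lies in `R`.
    rw [hy, ← iT_edel_zero]
    exact S.j_R _ _ _ (z.2.1 0)
  have h2 : S.q k (S.iZ k (sect S.p S.p_surj (S.p x))
      (sect (S.q (k + 1)) (S.q_surj (k + 1)) (S.q (k + 1) z) - z)) = 0 := by
    rw [S.q_ker]
    refine S.j_R _ _ _ ((S.q_ker _ _).1 ?_)
    rw [map_sub, sect_spec, sub_self]
  rw [map_sub, map_sub, sub_eq_zero] at h2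
  rw [map_sub, LinearMap.sub_apply, map_sub, sub_eq_zero] at h1
  exact h2.trans h1

/-- The anticommutation of contractions and Cartan's formula are available for exactly
skew-symmetric cochains, so classes are represented by skew-symmetrizations. -/
lemma exists_skew (k : ℕ) (b : B k) : ∃ z, IsSkewM z.1 ∧ S.q k z = b := by
  obtain ⟨z, rfl⟩ := S.q_surj k b
  have h := alt_sub_mem z.2.2
  have h' : alt z.1 ∈ Zmod (S.R k) := by
    have := (Zmod (S.R k)).sub_mem z.2 (S.stable.le _ h)
    rwa [sub_sub_cancel] at this
  refine ⟨⟨alt z.1, h'⟩, alt_skew _, ?_⟩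
  rw [← sub_eq_zero, ← map_sub, S.q_ker, ← neg_sub, Submodule.coe_neg]
  exact (S.R k).neg_mem h

/-- The complex of a presentation. -/
def cplx (hV : V.ByDerivations) : Cplx lie B where
  d := S.dB
  i := S.iB
  d_d k b := by
    obtain ⟨z, rfl⟩ := S.q_surj k b
    rw [dB_q, dB_q, S.q_ker]
    change dM V _ (dM V _ z.1) ∈ _
    rw [dM_dM]
    exact Submodule.zero_mem _
  i_i k x y b := by
    obtain ⟨z, hz, rfl⟩ := S.exists_skew _ b
    obtain ⟨x, rfl⟩ := S.p_surj x
    obtain ⟨y, rfl⟩ := S.p_surj y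
    rw [iB_q, iB_q, iB_q, iB_q, ← map_add, S.q_ker]
    change iT F A M _ _ (iT F A M _ _ z.1) + iT F A M _ _ (iT F A M _ _ z.1) ∈ _
    rw [iT_iT hz]
    exact Submodule.zero_mem _
  cartan_zero x y b := by
    obtain ⟨z, hz, rfl⟩ := S.exists_skew _ b
    obtain ⟨x, rfl⟩ := S.p_surj x
    obtain ⟨y, rfl⟩ := S.p_surj y
    obtain ⟨t, ht, ht'⟩ := S.j_br x y
    rw [← ht]
    simp only [iB_q, dB_q, ← map_add, ← map_sub]
    congr 1
    refine Subtype.ext ?_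
    change _ = iT F A M 0 (S.j t) z.1
    rw [ht']
    exact cartan_iT_zero hV hz (S.j x) (S.j y)
  cartan_succ k x y b := by
    obtain ⟨z, hz, rfl⟩ := S.exists_skew _ b
    obtain ⟨x, rfl⟩ := S.p_surj x
    obtain ⟨y, rfl⟩ := S.p_surj y
    obtain ⟨t, ht, ht'⟩ := S.j_br x y
    rw [← ht]
    simp only [iB_q, dB_q, ← map_add, ← map_sub]
    congr 1
    refine Subtype.ext ?_
    change _ = iT F A M (k + 1) (S.j t) z.1
    rw [ht']
    exact cartan_iT_succ hV hz (S.j x) (S.j y)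

end Frame

end Frames

/-! ### Basic and reduced cochains -/

section BasicComplex

variable {F : Type u} [Field F] [CharZero F]
  {A : Type v} [AddCommGroup A] [Module F A] [Module F[X] A] [IsScalarTower F F[X] A]
  {M : Type w} [NonUnitalCommRing M] [Module F M] [IsScalarTower F M M] [SMulCommClass F M M]
  [Module F[X] M] [IsScalarTower F F[X] M]
  {L : LieConformalAlgebra F A} {V : LieConformalModule L M}

lemma mem_Gt {k : ℕ} {γ : Mult F A M k} : γ ∈ Gt F A M k ↔ γ ∈ Zmod (⊥ : Submodule F (Mult F A M k)) := by
  constructor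
  · rintro ⟨h1, h2⟩
    refine ⟨fun l => (Submodule.mem_bot F).2 ?_, fun σ => (Submodule.mem_bot F).2 ?_⟩
    · ext a
      rw [edel_apply, h1, neg_add_cancel]
      rfl
    · rw [sub_eq_zero]
      ext a
      exact h2 σ a
  · rintro ⟨h1, h2⟩
    refine ⟨fun a i => ?_, fun σ a => ?_⟩
    · have := congrArg (fun f => f a) ((Submodule.mem_bot F).1 (h1 i))
      exact eq_neg_of_add_eq_zero_left ((edel_apply i γ a).symm.trans this)
    · have := sub_eq_zero.1 ((Submodule.mem_bot F).1 (h2 σ))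
      exact congrArg (fun f => f a) this

lemma Gt_skew {k : ℕ} (γ : Gt F A M k) : IsSkewM γ.1 := fun σ => by
  ext a
  exact γ.2.2 σ a

lemma Gt_edel {k : ℕ} (γ : Gt F A M k) (l : Fin k) : edel l γ.1 = 0 :=
  (Submodule.mem_bot F).1 ((mem_Gt.1 γ.2).1 l)

variable (F A M) in
/-- The space of basic cochains as a space of cochains modulo `0`. -/
def toGt (k : ℕ) : Zmod (⊥ : Submodule F (Mult F A M k)) →ₗ[F] Gt F A M k :=
  Submodule.inclusion fun _ h => mem_Gt.2 h

lemma toGt_surjective (k : ℕ) : Function.Surjective (toGt F A M k) := fun γ =>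
  ⟨⟨γ.1, mem_Gt.1 γ.2⟩, rfl⟩

/-- The presentation of the complex of basic cochains. -/
def basicFrame (hV : V.ByDerivations) :
    Frame V (lieGt1 hV) (fun k => Gt F A M k) (A ⊗[F] HomL F M) where
  R _ := ⊥
  stable := stable_bot V
  p := (relGt1 F A M).mkQ
  p_surj := Submodule.Quotient.mk_surjective _
  j := LinearMap.id
  j_R k x γ h := by
    rw [(Submodule.mem_bot F).1 h, map_zero]
    exact Submodule.zero_mem _
  j_ker x h := by
    obtain ⟨z, hz⟩ := (Submodule.Quotient.mk_eq_zero _).1 h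
    exact ⟨z, hz.symm⟩
  j_br x y := ⟨(gtOps V).brT L x y, rfl, rfl⟩
  q := toGt F A M
  q_surj := toGt_surjective
  q_ker k z := by
    rw [Submodule.mem_bot]
    exact Submodule.mk_eq_zero _ _

/-- The complex of basic cochains. -/
def basicCplx (hV : V.ByDerivations) : Cplx (lieGt1 hV) (fun k => Gt F A M k) :=
  (basicFrame hV).cplx hV

lemma basicCplx_d (hV : V.ByDerivations) (k : ℕ) (γ : Gt F A M k) :
    ((basicCplx hV).d k γ).1 = dM V k γ.1 :=
  congrArg Subtype.val ((basicFrame hV).dB_q k ⟨γ.1, mem_Gt.1 γ.2⟩)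

lemma basicCplx_i (hV : V.ByDerivations) (k : ℕ) (x : A ⊗[F] HomL F M) (γ : Gt F A M (k + 1)) :
    ((basicCplx hV).i k (Submodule.Quotient.mk x) γ).1 = iT F A M k x γ.1 := by
  have h := (basicFrame hV).iB_q k x ⟨γ.1, mem_Gt.1 γ.2⟩
  have hp : (basicFrame hV).p x = Submodule.Quotient.mk x := rfl
  have hq : (basicFrame hV).q (k + 1) ⟨γ.1, mem_Gt.1 γ.2⟩ = γ := rfl
  rw [hp, hq] at h
  exact congrArg Subtype.val h

lemma isBasicComplex (hV : V.ByDerivations) : IsBasicComplex V (basicCplx hV).toG where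
  br a b φ ψ := by
    rw [gtBr_eq V]
    exact lieGt1_mk hV _ _
  d k γ := by
    refine ⟨(basicCplx hV).d k γ, fun a => ?_, (basicCplx hV).dSum_lof k γ⟩
    rw [basicCplx_d, deltaFun_eq V (Gt_skew γ)]
  ι a φ k γ := by
    refine ⟨(basicCplx hV).i k (gt1 F a φ) γ, fun b => ?_, (basicCplx hV).iSum_lof_succ (gt1 F a φ) k γ⟩
    rw [gt1, basicCplx_i]
    rfl

lemma mem_delGt {k : ℕ} {γ : Gt F A M k} :
    γ ∈ delGt F A M k ↔ ∃ θ : Gt F A M k, γ.1 = thM F A M k θ.1 := by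
  constructor
  · rintro ⟨θ, h⟩
    exact ⟨θ, MultilinearMap.ext h⟩
  · rintro ⟨θ, h⟩
    exact ⟨θ, fun a => congrArg (fun f => f a) h⟩

/-- The complex of reduced cochains, with the values of its operators. -/
def reducedCplx' (hV : V.ByDerivations) :
    {S' : Cplx (lieG1 hV) (Gam F A M) //
      (∀ k b, S'.d k ((delGt F A M k).mkQ b) = (delGt F A M (k + 1)).mkQ ((basicCplx hV).d k b)) ∧
      ∀ k x b, S'.i k x ((delGt F A M (k + 1)).mkQ b) =
        (delGt F A M k).mkQ ((basicCplx hV).i k ((G1 F A M).subtype x) b)} :=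
  (basicCplx hV).quot (G1 F A M).subtype (fun _ _ => rfl) (fun k => (delGt F A M k).mkQ)
    (fun k => Submodule.Quotient.mk_surjective _)
    (fun k γ h => by
      obtain ⟨θ, hθ⟩ := mem_delGt.1 ((Submodule.Quotient.mk_eq_zero _).1 h)
      refine (Submodule.Quotient.mk_eq_zero _).2 (mem_delGt.2 ⟨(basicCplx hV).d k θ, ?_⟩)
      rw [basicCplx_d, basicCplx_d, hθ, dM_thM])
    (fun k x γ h => by
      obtain ⟨θ, hθ⟩ := mem_delGt.1 ((Submodule.Quotient.mk_eq_zero _).1 h)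
      obtain ⟨x, hx⟩ := x
      obtain ⟨x, rfl⟩ := Submodule.Quotient.mk_surjective _ x
      refine (Submodule.Quotient.mk_eq_zero _).2
        (mem_delGt.2 ⟨(basicCplx hV).i k (Submodule.Quotient.mk x) θ, ?_⟩)
      change ((basicCplx hV).i k (Submodule.Quotient.mk x) γ).1 = _
      replace hx : delGt1 F A M (Submodule.Quotient.mk x) = 0 := hx
      rw [delGt1_mk, Submodule.Quotient.mk_eq_zero] at hx
      obtain ⟨z, hz⟩ := hx
      -- For a chain killed by `∂` the correction term in `iT_thM` is contraction by a relation,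
      -- which is zero on the sesquilinear cochain `θ`.
      rw [basicCplx_i, basicCplx_i, hθ, iT_thM hV, ← hz, ← iT_edel_zero, Gt_edel, map_zero,
        sub_zero])

/-- The complex of reduced cochains. -/
def reducedCplx (hV : V.ByDerivations) : Cplx (lieG1 hV) (Gam F A M) := (reducedCplx' hV).1

lemma isReducedComplex (hV : V.ByDerivations) :
    IsReducedComplex (basicCplx hV).toG (reducedCplx hV).toG where
  br _ _ := rfl
  d γ := (((basicCplx hV).lmap_comm (reducedCplx hV) (fun k => (delGt F A M k).mkQ)
    fun k b => ((reducedCplx' hV).2.1 k b).symm).1 γ).symm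
  ι x γ := (((basicCplx hV).lmap_comm (reducedCplx hV) (fun k => (delGt F A M k).mkQ)
    fun k b => ((reducedCplx' hV).2.1 k b).symm).2 x.1 x
    (fun k b => ((reducedCplx' hV).2.2 k x b).symm) γ).symm

end BasicComplex

/-! ### `λ`-brackets as cochains modulo the image of `∂ + λ₁ + ⋯ + λₖ` -/

section Reduction

variable {F : Type u} [Field F] [CharZero F]
  {A : Type v} [AddCommGroup A] [Module F A] [Module F[X] A] [IsScalarTower F F[X] A]
  {M : Type w} [NonUnitalCommRing M] [Module F M] [IsScalarTower F M M] [SMulCommClass F M M]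
  [Module F[X] M] [IsScalarTower F F[X] M]

variable (F A M) in
/-- The reduction `λₖ₊₁ ↦ λ†` of cochains. -/
def redM (k : ℕ) : Mult F A M (k + 1) →ₗ[F] MultilinearMap F (fun _ : Fin (k + 1) => A) (P F k M) :=
  LinearMap.compMultilinearMapₗ F (subst F (lamDag F k))

variable (F A M) in
/-- A `λ`-bracket as a cochain that does not depend on `λₖ₊₁`. -/
def liftM (k : ℕ) : MultilinearMap F (fun _ : Fin (k + 1) => A) (P F k M) →ₗ[F] Mult F A M (k + 1) :=
  LinearMap.compMultilinearMapₗ F (ren F Fin.castSucc)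

lemma redM_apply {k : ℕ} (γ : Mult F A M (k + 1)) (a : Fin (k + 1) → A) :
    redM F A M k γ a = subst F (lamDag F k) (γ a) := rfl

lemma liftM_apply {k : ℕ} (c : MultilinearMap F (fun _ : Fin (k + 1) => A) (P F k M))
    (a : Fin (k + 1) → A) : liftM F A M k c a = ren F Fin.castSucc (c a) := rfl

lemma redM_liftM {k : ℕ} (c : MultilinearMap F (fun _ : Fin (k + 1) => A) (P F k M)) :
    redM F A M k (liftM F A M k c) = c := by
  ext a
  exact red_lift (c a)

lemma redM_eq_zero_iff {k : ℕ} {γ : Mult F A M (k + 1)} :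
    redM F A M k γ = 0 ↔ γ ∈ LinearMap.range (thM F A M (k + 1)) := by
  rw [mem_range_thM]
  simp only [← red_eq_zero_iff]
  constructor
  · intro h a
    exact congrArg (fun f => f a) h
  · intro h
    ext a
    exact h a

lemma redM_thM {k : ℕ} (γ : Mult F A M (k + 1)) : redM F A M k (thM F A M (k + 1) γ) = 0 := by
  ext a
  exact red_ThP (γ a)

lemma redM_edel {k : ℕ} (l : Fin (k + 1)) (γ : Mult F A M (k + 1)) (a : Fin (k + 1) → A) :
    redM F A M k (edel l γ) a = redM F A M k γ (Function.update a l (D F A (a l))) +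
      dact F M k (lamDag F k l) (redM F A M k γ a) := by
  rw [redM_apply, edel_apply, map_add, subst_X]
  rfl

/-- A polynomial differs from the lift of its reduction by an element in the image of `∂ + λ₁ + ⋯ +
λₖ₊₁`. Permuting the values `λ₁, …, λₖ, λ†` does not change their sum, so the permuted substitution
kills this image too. -/
lemma subst_lamDag_comp {k : ℕ} (σ : Equiv.Perm (Fin (k + 1))) (p : P F (k + 1) M) :
    subst F (lamDag F k ∘ σ) p =
      subst F (fun j : Fin k => lamDag F k (σ j.castSucc)) (subst F (lamDag F k) p) := by
  obtain ⟨q, hq⟩ := lift_red_sub p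
  rw [sub_eq_iff_eq_add] at hq
  conv_lhs => rw [hq]
  rw [map_add, subst_ThP, subst_ren]
  have : del F k + ∑ i, (lamDag F k ∘ σ) i = 0 :=
    (congrArg (del F k + ·) (Equiv.sum_comp σ (lamDag F k))).trans (sum_lamDag k)
  rw [this, map_zero, LinearMap.zero_apply, zero_add]
  rfl

lemma redM_permM {k : ℕ} (σ : Equiv.Perm (Fin (k + 1))) (γ : Mult F A M (k + 1))
    (a : Fin (k + 1) → A) :
    redM F A M k (permM σ γ) a =
      subst F (fun j : Fin k => lamDag F k (σ j.castSucc)) (redM F A M k γ (a ∘ σ)) := by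
  rw [redM_apply, permM_apply, subst_ren, subst_lamDag_comp]
  rfl

lemma dact_lamDag_last {k : ℕ} (p : P F k M) : dact F M k (lamDag F k (Fin.last k)) p =
    -((∑ i, MvPolynomial.X i : MvPolynomial (Fin k) F) • p + DP F k p) := by
  rw [lamDag, Fin.snoc_last, dag, map_sub, map_neg, map_sum, LinearMap.sub_apply,
    LinearMap.neg_apply, LinearMap.sum_apply, dact_del, Finset.sum_smul]
  simp only [dact_lam]
  abel

lemma dact_lamDag_castSucc {k : ℕ} (i : Fin k) (p : P F k M) :
    dact F M k (lamDag F k i.castSucc) p = (MvPolynomial.X i : MvPolynomial (Fin k) F) • p := by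
  rw [lamDag, Fin.snoc_castSucc, dact_lam]

/-- The conditions on a `λ`-bracket are the reductions of sesquilinearity and skew-symmetry, so they
hold exactly when these properties hold for `γ` modulo the kernel of the reduction. -/
lemma mem_LamBr {k : ℕ} {γ : Mult F A M (k + 1)} :
    redM F A M k γ ∈ LamBr F A M k ↔ γ ∈ Zmod (LinearMap.range (thM F A M (k + 1))) := by
  have hs : ∀ (σ : Equiv.Perm (Fin (k + 1))) (x y : P F k M),
      x = (Equiv.Perm.sign σ : ℤ) • y ↔ y = (Equiv.Perm.sign σ : ℤ) • x := by
    intro σ x y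
    have h : (Equiv.Perm.sign σ : ℤ) * (Equiv.Perm.sign σ : ℤ) = 1 := by
      rw [← Units.val_mul, Int.units_mul_self, Units.val_one]
    constructor <;> rintro rfl <;> rw [smul_smul, h, one_smul]
  constructor
  · rintro ⟨h1, h2, h3⟩
    refine ⟨fun l => redM_eq_zero_iff.1 ?_, fun σ => redM_eq_zero_iff.1 ?_⟩
    · ext a
      rw [redM_edel]
      cases l using Fin.lastCases with
      | last => rw [h2, dact_lamDag_last, add_neg_cancel]; rfl
      | cast i => rw [h1, dact_lamDag_castSucc, neg_add_cancel]; rfl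
    · rw [map_sub, map_zsmul, sub_eq_zero]
      ext a
      rw [redM_permM]
      exact (hs _ _ _).1 (h3 σ a)
  · rintro ⟨h1, h2⟩
    have h1' : ∀ l a, redM F A M k γ (Function.update a l (D F A (a l))) +
        dact F M k (lamDag F k l) (redM F A M k γ a) = 0 := fun l a => by
      rw [← redM_edel, redM_eq_zero_iff.2 (h1 l)]
      rfl
    refine ⟨fun a i => ?_, fun a => ?_, fun σ a => ?_⟩
    · have := h1' i.castSucc a
      rw [dact_lamDag_castSucc] at this
      exact eq_neg_of_add_eq_zero_left this
    · have := h1' (Fin.last k) a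
      rw [dact_lamDag_last] at this
      exact add_neg_eq_zero.1 this
    · have := redM_eq_zero_iff.2 (h2 σ)
      rw [map_sub, map_zsmul, sub_eq_zero] at this
      have := congrArg (fun f => f a) this
      rw [← redM_permM]
      exact (hs _ _ _).1 this

lemma liftM_mem {k : ℕ} (c : LamBr F A M k) :
    liftM F A M k c.1 ∈ Zmod (LinearMap.range (thM F A M (k + 1))) := by
  rw [← mem_LamBr, redM_liftM]
  exact c.2

variable (F A M) in
/-- The projections of the spaces of cochains modulo `∂ + λ₁ + ⋯ + λₖ` to the spaces `Cᵏ`. -/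
def toC : ∀ k, Zmod (LinearMap.range (thM F A M k)) →ₗ[F] C F A M k
  | 0 =>
    { toFun := fun z => tint F A (val0 (z.1 Fin.elim0))
      map_add' := fun z z' => by
        change tint F A (val0 (z.1 Fin.elim0 + z'.1 Fin.elim0)) = _
        rw [map_add]
        rfl
      map_smul' := fun r z => by
        change tint F A (val0 (r • z.1 Fin.elim0)) = _
        rw [map_smul]
        rfl }
  | k + 1 =>
    { toFun := fun z => ofBr (⟨redM F A M k z.1, mem_LamBr.2 z.2⟩ : LamBr F A M k)
      map_add' := fun z z' => by
        refine Subtype.ext (map_add (redM F A M k) z.1 z'.1)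
      map_smul' := fun r z => by
        refine Subtype.ext (map_smul (redM F A M k) r z.1) }

variable (F A) in
/-- The cochain of degree `0` with a given value. -/
def const0 (m : M) : Mult F A M 0 := MultilinearMap.constOfIsEmpty F _ (1 ⊗ₜ m)

lemma const0_mem (R : Submodule F (Mult F A M 0)) (m : M) : const0 F A m ∈ Zmod R := by
  refine ⟨fun l => l.elim0, fun σ => ?_⟩
  have : permM σ (const0 F A m) - (Equiv.Perm.sign σ : ℤ) • const0 F A m = 0 := by
    rw [Subsingleton.elim σ 1, sub_eq_zero]
    ext a
    simp [permM_apply, const0, ren_one]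
  rw [this]
  exact R.zero_mem

lemma toC_const0 (m : M) : toC F A M 0 ⟨const0 F A m, const0_mem _ m⟩ = tint F A m := by
  change tint F A (val0 (1 ⊗ₜ m)) = _
  rw [val0_one]

lemma toC_succ (k : ℕ) (z : Zmod (LinearMap.range (thM F A M (k + 1)))) :
    toC F A M (k + 1) z = ofBr ⟨redM F A M k z.1, mem_LamBr.2 z.2⟩ := rfl

lemma toC_liftM {k : ℕ} (c : LamBr F A M k) :
    toC F A M (k + 1) ⟨liftM F A M k c.1, liftM_mem c⟩ = ofBr c := by
  rw [toC_succ]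
  congr 1
  exact Subtype.ext (redM_liftM c.1)

lemma toC_surjective : ∀ k, Function.Surjective (toC F A M k)
  | 0 => fun c => by
    obtain ⟨c⟩ := c
    obtain ⟨m, rfl⟩ := Submodule.Quotient.mk_surjective _ c
    exact ⟨_, toC_const0 m⟩
  | _ + 1 => fun c => ⟨_, toC_liftM c⟩

lemma toC_eq_zero_iff : ∀ k (z : Zmod (LinearMap.range (thM F A M k))),
    toC F A M k z = 0 ↔ z.1 ∈ LinearMap.range (thM F A M k)
  | 0 => fun z => by
    have h : toC F A M 0 z = 0 ↔ (Submodule.Quotient.mk (val0 (z.1 Fin.elim0)) :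
        M ⧸ LinearMap.range (D F M)) = 0 := ULift.up_injective.eq_iff
    -- Without variables the operator `∂ + λ₁ + ⋯ + λₖ` is the action of `∂` on `M`, so its image is
    -- that of `∂`.
    rw [h, Submodule.Quotient.mk_eq_zero, mem_range_thM]
    constructor
    · rintro ⟨m, hm⟩ a
      refine ⟨1 ⊗ₜ m, ?_⟩
      rw [Subsingleton.elim a Fin.elim0, ← one_val0 (ThP F M 0 (1 ⊗ₜ m)), val0_ThP, val0_one, hm, one_val0]
    · intro h
      obtain ⟨p, hp⟩ := h Fin.elim0
      exact ⟨val0 p, by rw [← hp, val0_ThP]⟩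
  | k + 1 => fun z => by
    rw [← redM_eq_zero_iff, toC_succ]
    exact Submodule.mk_eq_zero _ _

end Reduction

/-! ### The complex of `λ`-brackets -/

section PolyComplex

variable {F : Type u} [Field F] [CharZero F]
  {A : Type v} [AddCommGroup A] [Module F A] [Module F[X] A] [IsScalarTower F F[X] A]
  {M : Type w} [NonUnitalCommRing M] [Module F M] [IsScalarTower F M M] [SMulCommClass F M M]
  [Module F[X] M] [IsScalarTower F F[X] M]
  {L : LieConformalAlgebra F A} {V : LieConformalModule L M}

/-- The presentation of the complex of `λ`-brackets. -/
def polyFrame (hV : V.ByDerivations) : Frame V (lieC1 hV) (C F A M) (A ⊗[F] M) where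
  R k := LinearMap.range (thM F A M k)
  stable := stable_thM V
  p := (relC1 F A M).mkQ
  p_surj := Submodule.Quotient.mk_surjective _
  j := (expD F).lTensor A
  j_R k x γ h := by
    obtain ⟨θ, rfl⟩ := h
    exact ⟨_, (iT_expD_thM hV x θ).symm⟩
  j_ker x h := by
    obtain ⟨z, rfl⟩ := (Submodule.Quotient.mk_eq_zero _).1 h
    refine ⟨z, ?_⟩
    clear h
    induction z using TensorProduct.induction_on with
    | zero => simp
    | add x y hx hy =>
      simp only [map_add] at hx hy ⊢
      rw [hx, hy]
    | tmul a m => simp [lamStar_expD]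
  j_br x y := ⟨(cOps V).brT L x y, rfl, expD_brT hV x y⟩
  q := toC F A M
  q_surj := toC_surjective
  q_ker := toC_eq_zero_iff

/-- The complex of `λ`-brackets. -/
def polyCplx (hV : V.ByDerivations) : Cplx (lieC1 hV) (C F A M) := (polyFrame hV).cplx hV

lemma polyCplx_d (hV : V.ByDerivations) (k : ℕ)
    (z : Zmod (LinearMap.range (thM F A M k))) :
    (polyCplx hV).d k (toC F A M k z) =
      toC F A M (k + 1) ⟨dM V k z.1, (stable_thM V).dM_mem z.2⟩ :=
  (polyFrame hV).dB_q k z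

lemma polyCplx_i (hV : V.ByDerivations) (k : ℕ) (x : A ⊗[F] M)
    (z : Zmod (LinearMap.range (thM F A M (k + 1)))) :
    (polyCplx hV).i k (Submodule.Quotient.mk x) (toC F A M (k + 1) z) =
      toC F A M k ⟨iT F A M k ((expD F).lTensor A x) z.1, (polyFrame hV).iT_mem x z.2⟩ :=
  (polyFrame hV).iB_q k x z

/-- A `λ`-bracket is regarded as a cochain independent of its last variable, so the substitution `λᵢ
+ λⱼ` in that variable has no effect. -/
lemma dFun_eq_red {k : ℕ} (c : MultilinearMap F (fun _ : Fin (k + 1) => A) (P F k M))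
    (a : Fin (k + 2) → A) :
    dFun V c a = subst F (lamDag F (k + 1)) (deltaFun V (liftM F A M k c) a) := by
  have h : ∀ (i : Fin (k + 1)) (j : Fin (k + 2)) (b : Fin (k + 1) → A),
      subst F (Fin.snoc (α := fun _ => DPoly F (k + 2))
        (fun r : Fin k => lam F (skip i j r)) (lam F i.castSucc + lam F j)) ∘ₗ
          (liftM F A M k c).toLinearMap b (Fin.last k) =
        ren F (skip i j) ∘ₗ c.toLinearMap b (Fin.last k) := by
    intro i j b
    refine LinearMap.ext fun x => ?_
    simp only [LinearMap.comp_apply, MultilinearMap.toLinearMap_apply, liftM_apply, subst_ren]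
    rw [ren]
    congr 2
    funext r
    simp
  simp only [dFun, deltaFun, bracketSum, h, liftM_apply, ren_ren]
  rfl

/-- The usual formula and the Leibniz one agree on `alt γ`. On `γ` each differs from its value on
`alt γ` by an element that the reduction kills. -/
lemma red_deltaFun {k : ℕ} {γ : Mult F A M (k + 1)}
    (hγ : γ ∈ Zmod (LinearMap.range (thM F A M (k + 1)))) (a : Fin (k + 2) → A) :
    subst F (lamDag F (k + 1)) (deltaFun V γ a) = redM F A M (k + 1) (dM V (k + 1) γ) a := by
  obtain ⟨θ, hθ⟩ := alt_sub_mem hγ.2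
  have h : γ = alt γ + thM F A M (k + 1) θ := by rw [hθ, add_sub_cancel]
  have h1 : dM V (k + 1) γ = dM V (k + 1) (alt γ) + thM F A M (k + 2) (dM V (k + 1) θ) := by
    rw [← dM_thM, ← map_add, ← h]
  have h2 : deltaFun V γ a = deltaFun V (alt γ) a + ThP F M (k + 2) (deltaFun V θ a) := by
    rw [← deltaFun_thM, ← deltaFun_add, ← h]
  rw [h1, map_add, redM_thM, add_zero, h2, map_add, red_ThP, add_zero,
    deltaFun_eq V (alt_skew γ), redM_apply]

lemma contr_ren_castSucc {k : ℕ} (φ : HomL F M) (p : P F (k + 1) M) :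
    contr φ (ren F Fin.castSucc p) = ren F Fin.castSucc (contr φ p) := by
  induction p using P_induction generalizing φ with
  | one n => rw [ren_one, contr_one, contr_one, ren_one]
  | add p q hp hq => simp only [map_add, hp, hq]
  | mulX i p hp =>
    rw [ren_X]
    cases i using Fin.cases with
    | zero => rw [Fin.castSucc_zero, contr_X_zero, contr_X_zero, hp]
    | succ i => rw [← Fin.succ_castSucc, contr_X_succ, contr_X_succ, ren_X, hp]

lemma isPolyComplex (hV : V.ByDerivations) : IsPolyComplex V (polyCplx hV).toG where
  br a b m n := by
    rw [cBr_eq V]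
    exact lieC1_mk hV _ _
  d_zero m := by
    have h := polyCplx_d hV 0 ⟨const0 F A m, const0_mem _ m⟩
    rw [toC_const0, toC_succ] at h
    refine ⟨⟨redM F A M 0 (dM V 0 (const0 F A m)), _⟩, fun a => ?_,
      ((polyCplx hV).dSum_lof 0 (tint F A m)).trans (congrArg _ h)⟩
    change subst F (lamDag F 0) (dM V 0 (const0 F A m) a) = _
    rw [dM_apply, Fin.sum_univ_one, lieFun]
    simp only [Finset.univ_eq_empty, Finset.sum_empty, sub_zero, Fin.val_zero, pow_zero, one_smul]
    rw [const0, MultilinearMap.constOfIsEmpty_apply, Function.const_apply, ren_one, actAt_tmul, one_smul, subst_ren]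
    congr 2
  d_succ k c := by
    have h := polyCplx_d hV (k + 1) ⟨liftM F A M k c.1, liftM_mem c⟩
    rw [toC_liftM, toC_succ] at h
    refine ⟨⟨redM F A M (k + 1) (dM V (k + 1) (liftM F A M k c.1)), _⟩, fun a => ?_,
      ((polyCplx hV).dSum_lof (k + 1) (ofBr c)).trans (congrArg _ h)⟩
    rw [dFun_eq_red, red_deltaFun (liftM_mem c)]
  ι_one a m c := by
    have h := polyCplx_i hV 0 (a ⊗ₜ m) ⟨liftM F A M 0 c.1, liftM_mem c⟩
    rw [toC_liftM] at h
    refine ((polyCplx hV).iSum_lof_succ (c1 F a m) 0 (ofBr c)).trans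
      (congrArg _ (h.trans (congrArg (tint F A) ?_)))
    change val0 (contr (expD F m) (ren F Fin.castSucc (c.1 (Fin.cons a Fin.elim0)))) = _
    have h1 : (Fin.cons a Fin.elim0 : Fin 1 → A) = fun _ => a := by
      funext i
      fin_cases i
      rfl
    rw [h1, ← one_val0 (c.1 fun _ => a), ren_one, contr_one, expD_one, val0_one, val0_one]
  ι_succ a m k c := by
    have h := polyCplx_i hV (k + 1) (a ⊗ₜ m) ⟨liftM F A M (k + 1) c.1, liftM_mem c⟩
    rw [toC_liftM, toC_succ] at h
    refine ⟨⟨redM F A M k (iT F A M (k + 1) ((expD F).lTensor A (a ⊗ₜ m))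
      (liftM F A M (k + 1) c.1)), _⟩, fun b => ?_,
      ((polyCplx hV).iSum_lof_succ (c1 F a m) (k + 1) (ofBr c)).trans (congrArg _ h)⟩
    change subst F (lamDag F k) (contr (expD F m) (ren F Fin.castSucc (c.1 (Fin.cons a b)))) = _
    rw [contr_ren_castSucc, red_lift]

end PolyComplex

/-! ### The subcomplex of the `λ`-brackets that vanish on torsion -/

section Torsion

variable {F : Type u} [Field F] [CharZero F]
  {A : Type v} [AddCommGroup A] [Module F A] [Module F[X] A] [IsScalarTower F F[X] A]
  {M : Type w} [NonUnitalCommRing M] [Module F M] [IsScalarTower F M M] [SMulCommClass F M M]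
  [Module F[X] M] [IsScalarTower F F[X] M]
  {L : LieConformalAlgebra F A} {V : LieConformalModule L M}

/-- The cochain vanishes if one of the arguments is a torsion element. -/
def VanishTor {k : ℕ} (γ : Mult F A M k) : Prop :=
  ∀ a i, a i ∈ Submodule.torsion F[X] A → γ a = 0

lemma bracket_torsion_right (L : LieConformalAlgebra F A) {t : A}
    (ht : t ∈ Submodule.torsion F[X] A) (a : A) : L.bracket a t = 0 := by
  rw [L.skew, bracket_torsion L ht, LinearMap.zero_apply, map_zero, neg_zero]

lemma actAt_zero {k : ℕ} (i : Fin k) : actAt (0 : M →ₗ[F] P F 1 M) i = 0 := by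
  refine TensorProduct.ext' fun f n => ?_
  rw [actAt_tmul, LinearMap.zero_apply, map_zero, smul_zero, LinearMap.zero_apply]

/-- In each term the torsion argument acts, is acted upon, or stays an argument of `γ`. The action
and the brackets vanish in the first two cases, and `γ` vanishes in the last. -/
lemma VanishTor.dM {k : ℕ} {γ : Mult F A M k} (hγ : VanishTor γ) : VanishTor (dM V k γ) := by
  intro a i hi
  rw [dM_apply]
  refine Finset.sum_eq_zero fun j _ => ?_
  suffices h : lieFun V γ j a = 0 by rw [h, smul_zero]
  rw [lieFun]
  by_cases hj : i = j
  · subst hj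
    rw [act_torsion V hi, actAt_zero, bracket_torsion L hi]
    simp
  · obtain ⟨r, rfl⟩ := Fin.exists_succAbove_eq hj
    rw [hγ (a ∘ j.succAbove) r hi, map_zero, map_zero, zero_sub, neg_eq_zero]
    refine Finset.sum_eq_zero fun s _ => ?_
    by_cases hs : s = r
    · subst hs
      rw [bracket_torsion_right L hi, map_zero, ite_self]
    · have : γ.toLinearMap (a ∘ j.succAbove) s = 0 := by
        refine LinearMap.ext fun e => hγ _ r ?_
        rwa [Function.update_of_ne (Ne.symm hs)]
      rw [this, LinearMap.comp_zero]
      have h0 : ∀ p : P F 1 A, bind (MvPolynomial.X j : MvPolynomial (Fin (k + 1)) F)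
          (0 : A →ₗ[F] P F (k + 1) M) p = 0 := by
        obtain h := exists_finite_bind (F := F) (N := M) (E := A)
          (MvPolynomial.X j : MvPolynomial (Fin (k + 1)) F)
        intro p
        obtain ⟨S, -, h⟩ := h p
        exact h 0 fun _ _ => rfl
      rw [h0, ite_self]

lemma VanishTor.iT {k : ℕ} {γ : Mult F A M (k + 1)} (hγ : VanishTor γ) (x : A ⊗[F] HomL F M) :
    VanishTor (iT F A M k x γ) := by
  intro a i hi
  induction x using TensorProduct.induction_on with
  | zero => simp
  | add x y hx hy => rw [map_add, LinearMap.add_apply, add_apply, hx, hy, add_zero]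
  | tmul b φ =>
    rw [iT_tmul, iM_apply, hγ (Fin.cons b a) i.succ (by rwa [Fin.cons_succ]), map_zero]

/-- A basic cochain has a variable of its own for every argument, so `torsion_vanish` applies to
each of them. This is why `ψ^•` takes values in `C̄^•`. -/
lemma Gt_vanishTor {k : ℕ} (γ : Gt F A M k) : VanishTor γ.1 := by
  intro a i hi
  have := torsion_vanish i (γ.1.toLinearMap a i) (fun b => by
    have := γ.2.1 (Function.update a i b) i
    simpa using this) hi
  simpa using this

lemma toC_mem_Cbar : ∀ {k : ℕ} {z : Zmod (LinearMap.range (thM F A M k))},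
    VanishTor z.1 → toC F A M k z ∈ Cbar F A M k
  | 0, _, _ => trivial
  | k + 1, z, h => fun a i hi => by
    change subst F (lamDag F k) (z.1 a) = 0
    rw [h a i hi, map_zero]

lemma exists_toC_of_mem_Cbar : ∀ {k : ℕ} {b : C F A M k}, b ∈ Cbar F A M k →
    ∃ z : Zmod (LinearMap.range (thM F A M k)), VanishTor z.1 ∧ toC F A M k z = b
  | 0, b, _ => by
    obtain ⟨z, hz⟩ := toC_surjective 0 b
    exact ⟨z, fun _ i => i.elim0, hz⟩
  | k + 1, b, h => by
    refine ⟨_, fun a i hi => ?_, toC_liftM b⟩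
    rw [liftM_apply, show b.1 a = 0 from h a i hi, map_zero]

/-- The complex of the `λ`-brackets that vanish on torsion, with the values of its operators. -/
def barCplx' (hV : V.ByDerivations) :
    {S' : Cplx (lieC1bar hV) (fun k => Cbar F A M k) //
      (∀ k (b : Cbar F A M k), (S'.d k b : C F A M (k + 1)) = (polyCplx hV).d k b) ∧
      ∀ k x (b : Cbar F A M (k + 1)),
        (S'.i k (toC1bar F A M x) b : C F A M k) = (polyCplx hV).i k x b} :=
  (polyCplx hV).sub (toC1bar F A M) (toC1bar_surjective F A M) (toC1bar_lie hV) (Cbar F A M)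
    (fun k b hb => by
      obtain ⟨z, hz, rfl⟩ := exists_toC_of_mem_Cbar hb
      rw [polyCplx_d]
      exact toC_mem_Cbar hz.dM)
    (fun k x b hb => by
      obtain ⟨z, hz, rfl⟩ := exists_toC_of_mem_Cbar hb
      obtain ⟨x, rfl⟩ := Submodule.Quotient.mk_surjective _ x
      rw [polyCplx_i]
      exact toC_mem_Cbar (hz.iT _))
    (fun k x hx b hb => by
      obtain ⟨z, hz, rfl⟩ := exists_toC_of_mem_Cbar hb
      refine toC1bar_ker (((polyCplx hV).i k).flip (toC F A M (k + 1) z)) (fun t ht m => ?_) hx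
      rw [LinearMap.flip_apply, c1, polyCplx_i, toC_eq_zero_iff]
      convert Submodule.zero_mem _
      ext a
      change contr (expD F m) (z.1 (Fin.cons t a)) = 0
      rw [hz _ 0 ht, map_zero])

/-- The complex of the `λ`-brackets that vanish on torsion. -/
def barCplx (hV : V.ByDerivations) : Cplx (lieC1bar hV) (fun k => Cbar F A M k) := (barCplx' hV).1

lemma isGMorphism_incl (hV : V.ByDerivations) :
    IsGMorphism ((barCplx hV).toG.pullback (toC1bar F A M) (toC1bar_lie hV)) (polyCplx hV).toG
      LinearMap.id (incl F A M) := by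
  have h := (barCplx hV).lmap_comm (polyCplx hV) (fun k => (Cbar F A M k).subtype)
    (barCplx' hV).2.1
  exact isGMorphism_of _ _ _ _ (fun _ _ => rfl) (lmap_homog fun k => (Cbar F A M k).subtype) h.1
    fun x => h.2 (toC1bar F A M x) x fun k b => (barCplx' hV).2.2 k x b

lemma Gt_le {k : ℕ} : Gt F A M k ≤ Zmod (LinearMap.range (thM F A M k)) := fun γ hγ => by
  obtain ⟨h1, h2⟩ := mem_Gt.1 hγ
  exact ⟨fun l => bot_le (a := LinearMap.range (thM F A M k)) (h1 l),
    fun σ => bot_le (a := LinearMap.range (thM F A M k)) (h2 σ)⟩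

variable (F A M) in
/-- The reduction of basic cochains. -/
def gtToCbar (k : ℕ) : Gt F A M k →ₗ[F] Cbar F A M k :=
  (toC F A M k ∘ₗ Submodule.inclusion Gt_le).codRestrict (Cbar F A M k) fun γ =>
    toC_mem_Cbar (Gt_vanishTor γ)

lemma gtToCbar_coe {k : ℕ} (γ : Gt F A M k) :
    (gtToCbar F A M k γ : C F A M k) = toC F A M k ⟨γ.1, Gt_le γ.2⟩ := rfl

lemma delGt_le_ker (k : ℕ) : delGt F A M k ≤ LinearMap.ker (gtToCbar F A M k) := fun γ hγ => by
  obtain ⟨θ, hθ⟩ := mem_delGt.1 hγ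
  refine Subtype.ext ((toC_eq_zero_iff k _).2 ⟨θ.1, hθ.symm⟩)

variable (F A M) in
/-- The components of the map `ψ^•`. -/
def psiK (k : ℕ) : Gam F A M k →ₗ[F] Cbar F A M k :=
  (delGt F A M k).liftQ (gtToCbar F A M k) (delGt_le_ker k)

lemma psiK_mkQ {k : ℕ} (γ : Gt F A M k) :
    psiK F A M k ((delGt F A M k).mkQ γ) = gtToCbar F A M k γ := rfl

variable (F A M) in
/-- The map `ψ^•`. -/
def psi : (⨁ k, Gam F A M k) →ₗ[F] (⨁ k, Cbar F A M k) := DirectSum.lmap (psiK F A M)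

lemma incl_psi_lof {k : ℕ} (γ : Gt F A M k) :
    incl F A M (psi F A M (toGam F A M (DirectSum.lof F ℕ (fun k => Gt F A M k) k γ))) =
      DirectSum.lof F ℕ (C F A M) k (toC F A M k ⟨γ.1, Gt_le γ.2⟩) := by
  rw [toGam, DirectSum.lmap_lof, psi, DirectSum.lmap_lof, incl, DirectSum.lmap_lof]
  rfl

lemma isPsi_psi : IsPsi (psi F A M) where
  zero γ := incl_psi_lof γ
  succ k γ := ⟨⟨redM F A M k γ.1, mem_LamBr.2 (Gt_le γ.2)⟩, fun _ => rfl, incl_psi_lof γ⟩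

/-- On representatives both complexes use the same operators `dM` and `iT`, so a basic cochain
represents corresponding elements before and after applying them. -/
lemma isGMorphism_psi (hV : V.ByDerivations) :
    IsGMorphism ((reducedCplx hV).toG.pullback (chi1 F A M) (chi1_br hV))
      ((barCplx hV).toG.pullback (toC1bar F A M) (toC1bar_lie hV)) LinearMap.id (psi F A M) := by
  have hd : ∀ k b, psiK F A M (k + 1) ((reducedCplx hV).d k b) =
      (barCplx hV).d k (psiK F A M k b) := by
    intro k b
    obtain ⟨γ, rfl⟩ := Submodule.Quotient.mk_surjective _ b
    refine Subtype.ext ?_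
    have h1 := (reducedCplx' hV).2.1 k γ
    have h2 := (barCplx' hV).2.1 k (gtToCbar F A M k γ)
    rw [gtToCbar_coe, polyCplx_d] at h2
    refine (congrArg (fun x => (psiK F A M (k + 1) x : C F A M (k + 1))) h1).trans
      (Eq.trans ?_ h2.symm)
    rw [psiK_mkQ, gtToCbar_coe]
    congr 1
    exact Subtype.ext (basicCplx_d hV k γ)
  have h := (reducedCplx hV).lmap_comm (barCplx hV) (psiK F A M) hd
  refine isGMorphism_of _ _ _ _ (fun _ _ => rfl) (lmap_homog (psiK F A M)) h.1
    fun x => h.2 (chi1 F A M x) (toC1bar F A M x) fun k b => ?_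
  obtain ⟨γ, rfl⟩ := Submodule.Quotient.mk_surjective _ b
  obtain ⟨x, rfl⟩ := Submodule.Quotient.mk_surjective _ x
  refine Subtype.ext ?_
  have h1 := (reducedCplx' hV).2.2 k (chi1 F A M (Submodule.Quotient.mk x)) γ
  have h2 := (barCplx' hV).2.2 k (Submodule.Quotient.mk x) (gtToCbar F A M (k + 1) γ)
  rw [gtToCbar_coe, polyCplx_i] at h2
  refine (congrArg (fun x => (psiK F A M k x : C F A M k)) h1).trans (Eq.trans ?_ h2.symm)
  rw [psiK_mkQ, gtToCbar_coe]
  congr 1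
  exact Subtype.ext (basicCplx_i hV k ((expD F).lTensor A x) γ)

end Torsion

/-! ### The action of `F[∂]` on chains -/

section ChainAction

variable {F : Type u} [Field F]
  {A : Type v} [AddCommGroup A] [Module F A] [Module F[X] A] [IsScalarTower F F[X] A]
  {H : Type w} [AddCommGroup H] [Module F H]

/-- Modulo relations `∂` on the first factor is `-δ` on the second. -/
lemma mk_smul_tmul (δ : H →ₗ[F] H) (q : F[X]) (a : A) (h : H) :
    (Submodule.Quotient.mk ((q • a) ⊗ₜ[F] h) :
      (A ⊗[F] H) ⧸ LinearMap.range ((D F A).rTensor H + δ.lTensor A)) =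
        Submodule.Quotient.mk (a ⊗ₜ[F] Polynomial.aeval (-δ) q h) := by
  induction q using Polynomial.induction_on' generalizing a h with
  | add p q hp hq =>
    rw [add_smul, TensorProduct.add_tmul, Submodule.Quotient.mk_add, hp, hq, map_add,
      LinearMap.add_apply, TensorProduct.tmul_add, Submodule.Quotient.mk_add]
  | monomial n c =>
    induction n generalizing a h with
    | zero =>
      rw [Polynomial.monomial_zero_left, Polynomial.aeval_C, ← Polynomial.algebraMap_eq,
        algebraMap_smul, Module.algebraMap_end_apply, TensorProduct.smul_tmul]
    | succ n ih =>
      rw [← Polynomial.monomial_mul_X, mul_smul, ih, map_mul, Polynomial.aeval_X,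
        Module.End.mul_apply]
      refine (Submodule.Quotient.eq _).2 ⟨a ⊗ₜ (Polynomial.aeval (-δ) (Polynomial.monomial n c) h), ?_⟩
      rw [LinearMap.add_apply, LinearMap.rTensor_tmul, LinearMap.lTensor_tmul]
      have hc : Polynomial.aeval (-δ) (Polynomial.monomial n c) (-δ h) =
          -δ (Polynomial.aeval (-δ) (Polynomial.monomial n c) h) := by
        have := congrArg (fun p => Polynomial.aeval (-δ) p h)
          (mul_comm (Polynomial.monomial n c) Polynomial.X)
        simpa only [map_mul, Polynomial.aeval_X, Module.End.mul_apply, LinearMap.neg_apply]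
          using this
      rw [LinearMap.neg_apply, hc, TensorProduct.tmul_neg, sub_neg_eq_add]
      rfl

end ChainAction

/-! ### The map `χ̄₁`: torsion in `Γ̃₁` and the kernel of `∂ - λ*`. -/

section Chi

variable {F : Type u} [Field F] [CharZero F]
  {A : Type v} [AddCommGroup A] [Module F A] [Module F[X] A] [IsScalarTower F F[X] A]
  {M : Type w} [NonUnitalCommRing M] [Module F M] [IsScalarTower F M M] [SMulCommClass F M M]
  [Module F[X] M] [IsScalarTower F F[X] M]
  {L : LieConformalAlgebra F A} {V : LieConformalModule L M}

lemma gt1_smul (q : F[X]) (a : A) (φ : HomL F M) :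
    gt1 F (q • a) φ = gt1 F a (Polynomial.aeval (-lamStar F M) q φ) :=
  mk_smul_tmul (lamStar F M) q a φ

lemma c1_smul (q : F[X]) (a : A) (m : M) :
    c1 F (q • a) m = c1 F a (Polynomial.aeval (-D F M) q m) :=
  mk_smul_tmul (D F M) q a m

lemma aeval_lamStar (q : F[X]) (φ : HomL F M) :
    Polynomial.aeval (-lamStar F M) q φ = φ ∘ₗ LinearMap.mulLeft F
      (Polynomial.aeval (-(MvPolynomial.X 0 : MvPolynomial (Fin 1) F)) q) := by
  induction q using Polynomial.induction_on' generalizing φ with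
  | add p q hp hq =>
    rw [map_add, LinearMap.add_apply, hp, hq]
    ext
    simp [add_mul]
  | monomial n c =>
    induction n generalizing φ with
    | zero =>
      rw [Polynomial.monomial_zero_left, Polynomial.aeval_C, Polynomial.aeval_C,
        Module.algebraMap_end_apply]
      refine LinearMap.ext fun f => ?_
      simp [← MvPolynomial.smul_eq_C_mul]
    | succ n ih =>
      rw [← Polynomial.monomial_mul_X, map_mul, Polynomial.aeval_X, Module.End.mul_apply, ih]
      refine LinearMap.ext fun f => ?_
      simp only [LinearMap.neg_apply, LinearMap.comp_apply, LinearMap.mulLeft_apply, map_mul,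
        Polynomial.aeval_X, lamStar_apply]
      rw [← map_neg]
      congr 1
      ring

/-- The operator is dual to multiplication by the nonzero polynomial `q(-λ)`, which is injective and
has a linear left inverse. -/
lemma aeval_lamStar_surjective {q : F[X]} (hq : q ≠ 0) :
    Function.Surjective (Polynomial.aeval (-lamStar F M) q) := by
  intro φ
  obtain ⟨g, hg⟩ := (LinearMap.mulLeft F
    (Polynomial.aeval (-(MvPolynomial.X 0 : MvPolynomial (Fin 1) F)) q)).exists_leftInverse_of_injective
    (LinearMap.ker_eq_bot.2 (mul_right_injective₀ (aeval_neg_X_ne_zero 0 hq)))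
  exact ⟨φ ∘ₗ g, by rw [aeval_lamStar, LinearMap.comp_assoc, hg, LinearMap.comp_id]⟩

/-- If `q • t = 0` and `φ = q(-λ*)ψ`, then the class of `t ⊗ φ` is that of `(q • t) ⊗ ψ`. So `χ₁`
factors through `C̄₁`. -/
lemma gt1_torsion {t : A} (ht : t ∈ Submodule.torsion F[X] A) (φ : HomL F M) : gt1 F t φ = 0 := by
  obtain ⟨⟨q, hq⟩, hqt⟩ := ht
  obtain ⟨ψ, rfl⟩ := aeval_lamStar_surjective (nonZeroDivisors.ne_zero hq) φ
  rw [← gt1_smul, show q • t = 0 from hqt, gt1, TensorProduct.zero_tmul]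
  rfl

lemma chi1_ker {x : C1 F A M} (hx : toC1bar F A M x = 0) : chi1 F A M x = 0 :=
  toC1bar_ker (chi1 F A M) (fun _ ht m => Subtype.ext (gt1_torsion ht (expD F m))) hx

variable (F A M) in
/-- The map `χ̄₁`. -/
def chibar : C1bar F A M →ₗ[F] G1 F A M :=
  chi1 F A M ∘ₗ sect (toC1bar F A M) (toC1bar_surjective F A M)

lemma chibar_toC1bar (x : C1 F A M) : chibar F A M (toC1bar F A M x) = chi1 F A M x := by
  rw [← sub_eq_zero, chibar, LinearMap.comp_apply, ← map_sub]
  refine chi1_ker ?_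
  rw [map_sub, sect_spec, sub_self]

lemma toC1bar_torsion {t : A} (ht : t ∈ Submodule.torsion F[X] A) (m : M) :
    toC1bar F A M (c1 F t m) = 0 := by
  rw [c1, toC1bar_mk, LinearMap.rTensor_tmul, torQ_torsion ht, TensorProduct.zero_tmul]
  rfl

lemma chibar_br (hV : V.ByDerivations) (x y : C1bar F A M) :
    chibar F A M ((lieC1bar hV).br x y) = (lieG1 hV).br (chibar F A M x) (chibar F A M y) := by
  obtain ⟨x, rfl⟩ := toC1bar_surjective F A M x
  obtain ⟨y, rfl⟩ := toC1bar_surjective F A M y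
  rw [← toC1bar_lie, chibar_toC1bar, chibar_toC1bar, chibar_toC1bar, chi1_br]

/-- The condition `φ(λf) = ∂φ(f)` determines `φ` by its value at `1`. -/
lemma eq_expD {φ : HomL F M} (h : delHom F M φ = lamStar F M φ) : φ = expD F (φ 1) := by
  refine LinearMap.ext fun f => ?_
  induction f using poly_induction with
  | one => rw [expD_one]
  | smul c f h => rw [map_smul, map_smul, h]
  | add f g h h' => rw [map_add, map_add, h, h']
  | mulX f hf =>
    rw [← lamStar_apply, ← h, delHom_apply, hf, ← delHom_apply, delHom_expD, ← lamStar_expD,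
      lamStar_apply]

end Chi

/-! ### Modules that are sums of a torsion module and a free module -/

section FreeBasis

variable {F : Type u} [Field F] [CharZero F]
  {A : Type v} [AddCommGroup A] [Module F A] [Module F[X] A] [IsScalarTower F F[X] A]
  {M : Type w} [NonUnitalCommRing M] [Module F M] [IsScalarTower F M M] [SMulCommClass F M M]
  [Module F[X] M] [IsScalarTower F F[X] M]

/-- The elements `u i` form a basis of a complement of the torsion of `A`, and `pr` gives the
coordinates. -/
structure TorFree {I : Type*} (u : I → A) (pr : A →ₗ[F[X]] I →₀ F[X]) : Prop where
  pr_u : ∀ i, pr (u i) = Finsupp.single i 1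
  sub_mem : ∀ a, a - Finsupp.linearCombination F[X] u (pr a) ∈ Submodule.torsion F[X] A

lemma exists_torFree {U : Submodule F[X] A} (hU : IsCompl (Submodule.torsion F[X] A) U)
    [Module.Free F[X] U] :
    ∃ (u : Module.Free.ChooseBasisIndex F[X] U → A) (pr : A →ₗ[F[X]] _), TorFree u pr := by
  let b := Module.Free.chooseBasis F[X] U
  let π := U.projectionOnto (Submodule.torsion F[X] A) hU.symm
  refine ⟨fun i => b i, b.repr.toLinearMap ∘ₗ π, fun i => ?_, fun a => ?_⟩
  · rw [LinearMap.comp_apply, Submodule.projectionOnto_apply_left]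
    exact b.repr_self i
  · have h : Finsupp.linearCombination F[X] (fun i => (b i : A)) (b.repr (π a)) = π a := by
      rw [← Submodule.coe_subtype, ← b.linearCombination_repr (π a),
        Finsupp.apply_linearCombination, b.linearCombination_repr]
      rfl
    rw [LinearMap.comp_apply, LinearEquiv.coe_coe, h,
      ← Submodule.projectionOnto_apply_eq_zero_iff hU.symm, map_sub, sub_eq_zero]
    exact (Submodule.projectionOnto_apply_left hU.symm (π a)).symm

variable {I : Type*} {u : I → A} {pr : A →ₗ[F[X]] I →₀ F[X]} (hu : TorFree u pr)

include hu

lemma TorFree.induction {motive : A → Prop} (a : A)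
    (torsion : ∀ t ∈ Submodule.torsion F[X] A, motive t) (smul : ∀ (q : F[X]) i, motive (q • u i))
    (add : ∀ a b, motive a → motive b → motive (a + b)) : motive a := by
  rw [← sub_add_cancel a (Finsupp.linearCombination F[X] u (pr a))]
  refine add _ _ (torsion _ (hu.sub_mem a)) ?_
  induction pr a using Finsupp.induction_linear with
  | zero => rw [map_zero]; exact torsion _ (Submodule.zero_mem _)
  | add f g hf hg => rw [map_add]; exact add _ _ hf hg
  | single i q => rw [Finsupp.linearCombination_single]; exact smul q i

omit hu [CharZero F]

variable (M u) in
/-- The chains `∑ uᵢ ⊗ φᵢ`. -/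
def gtOfFinsupp : (I →₀ HomL F M) →ₗ[F] Gt1 F A M :=
  Finsupp.lsum F fun i => (relGt1 F A M).mkQ ∘ₗ TensorProduct.mk F A (HomL F M) (u i)

variable (M u) in
/-- The chains `∑ uᵢ ⊗ mᵢ`. -/
def cOfFinsupp : (I →₀ M) →ₗ[F] C1bar F A M :=
  Finsupp.lsum F fun i => toC1bar F A M ∘ₗ (relC1 F A M).mkQ ∘ₗ TensorProduct.mk F A M (u i)

lemma gtOfFinsupp_single (i : I) (φ : HomL F M) :
    gtOfFinsupp M u (Finsupp.single i φ) = gt1 F (u i) φ := by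
  simp [gtOfFinsupp, gt1]

lemma cOfFinsupp_single (i : I) (m : M) :
    cOfFinsupp M u (Finsupp.single i m) = toC1bar F A M (c1 F (u i) m) := by
  simp [cOfFinsupp, c1]

lemma delGt1_gtOfFinsupp (z : I →₀ HomL F M) : delGt1 F A M (gtOfFinsupp M u z) =
    gtOfFinsupp M u (Finsupp.mapRange.linearMap (delHom F M - lamStar F M) z) := by
  induction z using Finsupp.induction_linear with
  | zero => simp
  | add f g hf hg => simp only [map_add, hf, hg]
  | single i φ =>
    rw [gtOfFinsupp_single, gt1, delGt1_mk, LinearMap.lTensor_tmul,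
      Finsupp.mapRange.linearMap_apply, Finsupp.mapRange_single, gtOfFinsupp_single]
    rfl

variable [CharZero F]

lemma chibar_cOfFinsupp (z : I →₀ M) : (chibar F A M (cOfFinsupp M u z) : Gt1 F A M) =
    gtOfFinsupp M u (Finsupp.mapRange.linearMap (expD F) z) := by
  induction z using Finsupp.induction_linear with
  | zero => simp
  | add f g hf hg => simp only [map_add, Submodule.coe_add, hf, hg]
  | single i m =>
    rw [cOfFinsupp_single, chibar_toC1bar, Finsupp.mapRange.linearMap_apply,
      Finsupp.mapRange_single, gtOfFinsupp_single]
    rfl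

include hu

lemma gtOfFinsupp_surjective : Function.Surjective (gtOfFinsupp (F := F) M u) := by
  rw [← LinearMap.range_eq_top, eq_top_iff]
  rintro x -
  obtain ⟨x, rfl⟩ := Submodule.Quotient.mk_surjective _ x
  induction x using TensorProduct.induction_on with
  | zero => exact Submodule.zero_mem _
  | add x y hx hy => exact Submodule.add_mem _ hx hy
  | tmul a φ =>
    change gt1 F a φ ∈ _
    induction a using hu.induction with
    | torsion t ht => rw [gt1_torsion ht]; exact Submodule.zero_mem _
    | smul q i => rw [gt1_smul, ← gtOfFinsupp_single]; exact ⟨_, rfl⟩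
    | add a b ha hb =>
      rw [gt1, TensorProduct.add_tmul]
      exact Submodule.add_mem _ ha hb

lemma cOfFinsupp_surjective : Function.Surjective (cOfFinsupp (F := F) M u) := by
  rw [← LinearMap.range_eq_top, eq_top_iff]
  rintro x -
  obtain ⟨x, rfl⟩ := toC1bar_surjective F A M x
  obtain ⟨x, rfl⟩ := Submodule.Quotient.mk_surjective _ x
  induction x using TensorProduct.induction_on with
  | zero => exact (map_zero (toC1bar F A M)).symm ▸ Submodule.zero_mem _
  | add x y hx hy =>
    rw [Submodule.Quotient.mk_add, map_add]
    exact Submodule.add_mem _ hx hy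
  | tmul a m =>
    change toC1bar F A M (c1 F a m) ∈ _
    induction a using hu.induction with
    | torsion t ht => rw [toC1bar_torsion ht]; exact Submodule.zero_mem _
    | smul q i => rw [c1_smul, ← cOfFinsupp_single]; exact ⟨_, rfl⟩
    | add a b ha hb =>
      rw [c1, TensorProduct.add_tmul, Submodule.Quotient.mk_add, map_add]
      exact Submodule.add_mem _ ha hb

/-- The left inverse sends `a ⊗ φ` to the family `qᵢ(-λ*)φ`, where the `qᵢ` are the coordinates of
`a`; it respects the relations because `∂` multiplies each `qᵢ` by `X`. -/
lemma gtOfFinsupp_injective : Function.Injective (gtOfFinsupp (F := F) M u) := by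
  let T : HomL F M →ₗ[F] F[X] →ₗ[F] HomL F M :=
    (Polynomial.aeval (-lamStar F M)).toLinearMap.flip
  let Φ : A ⊗[F] HomL F M →ₗ[F] I →₀ HomL F M := TensorProduct.lift <| LinearMap.mk₂ F
    (fun a φ => Finsupp.mapRange.linearMap (T φ) (pr a))
    (fun a b φ => by rw [map_add, map_add])
    (fun c a φ => by
      rw [← map_smul, ← LinearMap.map_smul_of_tower pr])
    (fun a φ ψ => by ext i : 1; simp)
    (fun c a φ => by ext i : 1; simp)
  have hΦ : relGt1 F A M ≤ LinearMap.ker Φ := by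
    rintro _ ⟨x, rfl⟩
    rw [LinearMap.mem_ker]
    induction x using TensorProduct.induction_on with
    | zero => simp
    | add x y hx hy => rw [map_add, map_add, hx, hy, add_zero]
    | tmul a φ =>
      rw [LinearMap.add_apply, LinearMap.rTensor_tmul, LinearMap.lTensor_tmul, map_add]
      have h : pr (D F A a) = (Polynomial.X : F[X]) • pr a := map_smul pr _ _
      ext i : 1
      simp only [Φ, T, TensorProduct.lift.tmul, LinearMap.mk₂_apply, h]
      simp only [Finsupp.add_apply, Finsupp.mapRange.linearMap_apply, Finsupp.mapRange_apply,
        Finsupp.smul_apply, smul_eq_mul, LinearMap.flip_apply, AlgHom.toLinearMap_apply]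
      rw [mul_comm, map_mul, Polynomial.aeval_X, Module.End.mul_apply, LinearMap.neg_apply,
        map_neg, neg_add_cancel]
      rfl
  refine Function.LeftInverse.injective (g := (relGt1 F A M).liftQ Φ hΦ) fun z => ?_
  induction z using Finsupp.induction_linear with
  | zero => simp
  | add f g hf hg => rw [map_add, map_add, hf, hg]
  | single i φ =>
    rw [gtOfFinsupp_single]
    change Finsupp.mapRange.linearMap (T φ) (pr (u i)) = _
    rw [hu.pr_u, Finsupp.mapRange.linearMap_apply, Finsupp.mapRange_single]
    simp [T]

/-- In coordinates `χ̄₁` is `m ↦ e_m` on each copy of `M`. It is injective since `e_m(1) = m`. A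
chain killed by `∂` has coordinates killed by `∂ - λ*`, and these are of the form `e_m`. -/
lemma chibar_bijective : Function.Bijective (chibar F A M) := by
  constructor
  · rw [injective_iff_map_eq_zero]
    intro y hy
    obtain ⟨z, rfl⟩ := cOfFinsupp_surjective hu y
    have h := congrArg Subtype.val hy
    rw [chibar_cOfFinsupp] at h
    have h0 := gtOfFinsupp_injective hu (h.trans (map_zero _).symm)
    have : z = 0 := by
      ext i
      have := congrArg (fun f => f i 1) h0
      simpa [expD_one] using this
    rw [this, map_zero]
  · rintro ⟨g, hg⟩
    obtain ⟨z, rfl⟩ := gtOfFinsupp_surjective hu g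
    replace hg : delGt1 F A M (gtOfFinsupp M u z) = 0 := hg
    rw [delGt1_gtOfFinsupp] at hg
    have h0 := gtOfFinsupp_injective hu (hg.trans (map_zero _).symm)
    refine ⟨cOfFinsupp M u (Finsupp.mapRange.linearMap (LinearMap.applyₗ 1) z), Subtype.ext ?_⟩
    rw [chibar_cOfFinsupp]
    congr 1
    ext i : 1
    have := congrArg (fun f => f i) h0
    simp only [Finsupp.mapRange.linearMap_apply, Finsupp.mapRange_apply, Finsupp.coe_zero,
      Pi.zero_apply, LinearMap.sub_apply, sub_eq_zero] at this
    simp only [Finsupp.mapRange.linearMap_apply, Finsupp.mapRange_apply]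
    exact (eq_expD this).symm

end FreeBasis

/-! ### Bijectivity of `ψ^•` -/

section PsiInjective

variable {F : Type u} [Field F] [CharZero F]
  {A : Type v} [AddCommGroup A] [Module F A] [Module F[X] A] [IsScalarTower F F[X] A]
  {M : Type w} [NonUnitalCommRing M] [Module F M] [IsScalarTower F M M] [SMulCommClass F M M]
  [Module F[X] M] [IsScalarTower F F[X] M]

lemma mem_Gt_zero (γ : Mult F A M 0) : γ ∈ Gt F A M 0 := by
  refine ⟨fun a i => i.elim0, fun σ a => ?_⟩
  rw [Subsingleton.elim σ 1, Equiv.Perm.sign_one, Units.val_one, one_smul]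
  exact ren_id (γ a)

lemma thM_injective (k : ℕ) : Function.Injective (thM F A M (k + 1)) := fun γ γ' h => by
  ext a
  exact ThP_injective k (congrArg (fun f => f a) h)

/-- The defects of sesquilinearity and of skew-symmetry commute with `∂ + λ₁ + ⋯ + λₖ`, which is
injective for `k ≥ 1`. In degree `0` there is no condition. -/
lemma mem_Gt_of_thM : ∀ {k : ℕ} {θ : Mult F A M k}, thM F A M k θ ∈ Gt F A M k → θ ∈ Gt F A M k
  | 0, θ, _ => mem_Gt_zero θ
  | k + 1, θ, h => by
    obtain ⟨h1, h2⟩ := mem_Gt.1 h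
    refine mem_Gt.2 ⟨fun l => ?_, fun σ => ?_⟩
    · have := h1 l
      rw [edel_thM] at this
      exact thM_injective k (this.trans (map_zero _).symm)
    · have := h2 σ
      rw [permM_thM, ← map_zsmul, ← map_sub] at this
      exact thM_injective k (this.trans (map_zero _).symm)

/-- A basic cochain with zero reduction is `(∂ + λ₁ + ⋯ + λₖ)θ`, and `θ` is again basic. No
condition on `A` enters. -/
lemma psiK_injective (k : ℕ) : Function.Injective (psiK F A M k) := by
  rw [injective_iff_map_eq_zero]
  intro x hx
  obtain ⟨γ, rfl⟩ := Submodule.Quotient.mk_surjective _ x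
  have h : toC F A M k ⟨γ.1, Gt_le γ.2⟩ = 0 := congrArg Subtype.val hx
  obtain ⟨θ, hθ⟩ := (toC_eq_zero_iff k _).1 h
  replace hθ : thM F A M k θ = γ.1 := hθ
  refine (Submodule.Quotient.mk_eq_zero _).2 (mem_delGt.2 ⟨⟨θ, mem_Gt_of_thM ?_⟩, hθ.symm⟩)
  rw [hθ]
  exact γ.2

end PsiInjective

/-! ### Surjectivity of `ψ^•` by extension from a basis. -/

section PsiSurjective

variable {F : Type u} [Field F] [CharZero F]
  {A : Type v} [AddCommGroup A] [Module F A] [Module F[X] A] [IsScalarTower F F[X] A]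
  {M : Type w} [NonUnitalCommRing M] [Module F M] [IsScalarTower F M M] [SMulCommClass F M M]
  [Module F[X] M] [IsScalarTower F F[X] M]
  {I : Type*} {u : I → A} {pr : A →ₗ[F[X]] I →₀ F[X]}

lemma map_smul_of_map_D {N : Type*} [AddCommGroup N] [Module F N] (g : A →ₗ[F] N)
    (T : Module.End F N) (h : ∀ a, g (D F A a) = T (g a)) (q : F[X]) (a : A) :
    g (q • a) = Polynomial.aeval T q (g a) := by
  induction q using Polynomial.induction_on' generalizing a with
  | add p q hp hq => rw [add_smul, map_add, hp, hq, map_add, LinearMap.add_apply]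
  | monomial n c =>
    induction n generalizing a with
    | zero =>
      rw [Polynomial.monomial_zero_left, Polynomial.aeval_C, ← Polynomial.algebraMap_eq,
        algebraMap_smul, map_smul, Module.algebraMap_end_apply]
    | succ n ih =>
      rw [← Polynomial.monomial_mul_X, mul_smul, ih, map_mul, Polynomial.aeval_X,
        Module.End.mul_apply, ← h]
      rfl

/-- A multilinear map that vanishes on torsion and on the basis elements and is sesquilinear is
zero. -/
lemma TorFree.multilinear_eq_zero (hu : TorFree u pr) {n : ℕ} {N : Type*} [AddCommGroup N]
    [Module F N] (e : MultilinearMap F (fun _ : Fin n => A) N) (T : Fin n → Module.End F N)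
    (hT : ∀ a l, e (Function.update a l (D F A (a l))) = T l (e a))
    (htor : ∀ a i, a i ∈ Submodule.torsion F[X] A → e a = 0) (h : ∀ p : Fin n → I, e (fun i => u (p i)) = 0) :
    e = 0 := by
  -- Arguments are freed one at a time: `s` contains the places where the argument need not be a
  -- basis element.
  suffices key : ∀ (s : Finset (Fin n)) a, (∀ i ∉ s, a i ∈ Set.range u) → e a = 0 by
    ext a
    exact key Finset.univ a fun i hi => absurd (Finset.mem_univ i) hi
  intro s
  induction s using Finset.induction_on with
  | empty =>
    intro a ha
    choose p hp using fun i => ha i (Finset.notMem_empty i)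
    rw [← h p]
    congr 1
    exact (funext hp).symm
  | insert l s _ ih =>
    intro a ha
    have hg : ∀ x, e.toLinearMap a l x = 0 := by
      intro x
      induction x using hu.induction with
      | torsion t ht =>
        refine htor _ l ?_
        rwa [Function.update_self]
      | add x y hx hy => rw [map_add, hx, hy, add_zero]
      | smul q i =>
        rw [map_smul_of_map_D (e.toLinearMap a l) (T l) (fun x => ?_),
          MultilinearMap.toLinearMap_apply, ih, map_zero]
        · intro j hj
          by_cases hjl : j = l
          · subst hjl
            rw [Function.update_self]
            exact ⟨i, rfl⟩
          · rw [Function.update_of_ne hjl]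
            exact ha j (by simp [hjl, hj])
        · have := hT (Function.update a l x) l
          rwa [Function.update_self, Function.update_idem] at this
    have := hg (a l)
    rwa [MultilinearMap.toLinearMap_apply, Function.update_eq_self] at this

variable (pr) in
/-- The coordinates, evaluated at `∂ = -λⱼ`. -/
def coordL (k : ℕ) (j : Fin k) : A →ₗ[F] Π₀ _ : I, MvPolynomial (Fin k) F := by
  classical
  exact Finsupp.lsum F (fun i => (DFinsupp.lsingle i : _ →ₗ[F] Π₀ _ : I, MvPolynomial (Fin k) F) ∘ₗ
    (Polynomial.aeval (-(MvPolynomial.X j : MvPolynomial (Fin k) F))).toLinearMap) ∘ₗ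
      pr.restrictScalars F

lemma coordL_D {k : ℕ} (j : Fin k) (a : A) : coordL pr k j (D F A a) =
    -((MvPolynomial.X j : MvPolynomial (Fin k) F) • coordL pr k j a) := by
  classical
  have h : pr (D F A a) = (Polynomial.X : F[X]) • pr a := map_smul pr _ _
  rw [coordL, LinearMap.comp_apply, LinearMap.comp_apply, LinearMap.restrictScalars_apply,
    LinearMap.restrictScalars_apply, h]
  induction pr a using Finsupp.induction_linear with
  | zero => simp
  | add f g hf hg => rw [smul_add, map_add, map_add, hf, hg, smul_add, neg_add]
  | single i q =>
    rw [Finsupp.smul_single]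
    simp only [Finsupp.lsum_single, LinearMap.comp_apply, AlgHom.toLinearMap_apply, smul_eq_mul,
      map_mul, Polynomial.aeval_X, DFinsupp.lsingle_apply]
    rw [← DFinsupp.single_smul, smul_eq_mul, ← DFinsupp.single_neg, neg_mul]

/-- A sesquilinear cochain with given values on the basis elements. -/
lemma TorFree.exists_sesq (hu : TorFree u pr) {k : ℕ} (f : (Fin k → I) → P F k M) :
    ∃ γ : Mult F A M k, (∀ l, edel l γ = 0) ∧
      ∀ p, γ (fun i => u (p i)) = f p := by
  classical
  -- The values on the basis are extended multilinearly over `F[λ₁, …, λₖ]`; sesquilinearity comes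
  -- from evaluating the coordinates of the `j`-th argument at `∂ = -λⱼ`.
  let G : MultilinearMap (MvPolynomial (Fin k) F)
      (fun _ : Fin k => Π₀ _ : I, MvPolynomial (Fin k) F) (P F k M) :=
    MultilinearMap.fromDFinsuppEquiv (fun _ : Fin k => I) (MvPolynomial (Fin k) F)
      (M := fun _ _ => MvPolynomial (Fin k) F)
      fun p => MultilinearMap.mkPiRing (MvPolynomial (Fin k) F) (Fin k) (f p)
  refine ⟨(G.restrictScalars F).compLinearMap (coordL pr k), fun l => ?_, fun p => ?_⟩
  · ext a
    rw [edel_apply, MultilinearMap.compLinearMap_apply, MultilinearMap.compLinearMap_apply]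
    have h : (fun i => coordL pr k i (Function.update a l (D F A (a l)) i)) =
        Function.update (fun i => coordL pr k i (a i)) l
          (-(MvPolynomial.X l : MvPolynomial (Fin k) F) • coordL pr k l (a l)) := by
      funext i
      by_cases hi : i = l
      · subst hi
        rw [Function.update_self, Function.update_self, coordL_D, neg_smul]
      · rw [Function.update_of_ne hi, Function.update_of_ne hi]
    rw [h]
    change G _ + _ • G _ = 0
    rw [G.map_update_smul, Function.update_eq_self, neg_smul, neg_add_cancel]
  · rw [MultilinearMap.compLinearMap_apply]
    have h : ∀ i, coordL pr k i (u (p i)) = DFinsupp.single (p i) 1 := by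
      intro i
      rw [coordL, LinearMap.comp_apply, LinearMap.restrictScalars_apply, hu.pr_u]
      simp
    simp only [h]
    change G _ = _
    rw [MultilinearMap.fromDFinsuppEquiv_single]
    simp

lemma edel_alt {k : ℕ} {γ : Mult F A M k} (h : ∀ l, edel l γ = 0) (l : Fin k) :
    edel l (alt γ) = 0 := by
  rw [alt, map_smul, map_sum, Finset.sum_eq_zero, smul_zero]
  intro σ _
  have : edel l (permM σ γ) = 0 := by
    rw [← σ.apply_symm_apply l, edel_permM, h, map_zero]
  rw [map_zsmul, this, smul_zero]

/-- A sesquilinear cochain is built from the values of `c` on the basis. Its reduction agrees with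
`c` on the basis, hence everywhere by sesquilinearity and vanishing on torsion. It is then
skew-symmetric modulo the kernel of the reduction, so its skew-symmetrization is a basic cochain
with the same reduction. -/
lemma psiK_surjective (hu : TorFree u pr) : ∀ k, Function.Surjective (psiK F A M k)
  | 0 => fun c => by
    obtain ⟨z, hz⟩ := toC_surjective 0 c.1
    exact ⟨(delGt F A M 0).mkQ ⟨z.1, mem_Gt_zero z.1⟩, Subtype.ext hz⟩
  | k + 1 => fun c => by
    let c' : LamBr F A M k := c.1
    have hc : ∀ a i, a i ∈ Submodule.torsion F[X] A → c'.1 a = 0 := c.2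
    obtain ⟨γ, hγ, hf⟩ := hu.exists_sesq (M := M) fun p : Fin (k + 1) → I =>
      ren F Fin.castSucc (c'.1 fun i => u (p i))
    -- In the `l`-th argument both terms turn `∂` into `-λₗ`, with `λ†` for the last variable, so
    -- the difference satisfies the hypotheses of `TorFree.multilinear_eq_zero`.
    have h1 : redM F A M k γ - c'.1 = 0 := by
      refine hu.multilinear_eq_zero _ (fun l => -dact F M k (lamDag F k l)) (fun a l => ?_)
        (fun a i hi => ?_) (fun p => ?_)
      · have e1 := redM_edel l γ a
        rw [hγ, map_zero] at e1
        have e2 := redM_edel l (liftM F A M k c'.1) a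
        rw [redM_eq_zero_iff.2 ((liftM_mem c').1 l), redM_liftM] at e2
        rw [sub_apply, sub_apply, map_sub, LinearMap.neg_apply, LinearMap.neg_apply,
          eq_neg_of_add_eq_zero_left e1.symm, eq_neg_of_add_eq_zero_left e2.symm]
      · have : γ a = 0 := by
          have := torsion_vanish i (γ.toLinearMap a i) (fun b => by
            have := congrArg (fun f => f (Function.update a i b)) (hγ i)
            rw [edel_apply] at this
            have := eq_neg_of_add_eq_zero_left this
            simpa using this) hi
          simpa using this
        rw [sub_apply, hc a i hi, redM_apply, this, map_zero, sub_zero]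
      · rw [sub_apply, redM_apply, hf, red_lift, sub_self]
    have h2 : γ ∈ Zmod (LinearMap.range (thM F A M (k + 1))) := by
      rw [← mem_LamBr, sub_eq_zero.1 h1]
      exact c'.2
    have h3 := redM_eq_zero_iff.2 (alt_sub_mem h2.2)
    rw [map_sub, sub_eq_zero, sub_eq_zero.1 h1] at h3
    have h4 : alt γ ∈ Gt F A M (k + 1) := mem_Gt.2
      ⟨fun l => (Submodule.mem_bot F).2 (edel_alt hγ l),
        fun σ => (Submodule.mem_bot F).2 (sub_eq_zero.2 (alt_skew γ σ))⟩
    exact ⟨(delGt F A M (k + 1)).mkQ ⟨alt γ, h4⟩, Subtype.ext (Subtype.ext h3.symm)⟩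

end PsiSurjective

/-! ### The composite morphism and the isomorphism of complexes. -/

section Assembly

variable {F : Type*} [Field F] [CharZero F]
  {A : Type*} [AddCommGroup A] [Module F A] [Module F[X] A] [IsScalarTower F F[X] A]
  {M : Type*} [NonUnitalCommRing M] [Module F M] [IsScalarTower F M M] [SMulCommClass F M M]
  [Module F[X] M] [IsScalarTower F F[X] M]
  {L : LieConformalAlgebra F A} {V : LieConformalModule L M}

lemma isGMorphism_incl_psi (hV : V.ByDerivations) :
    IsGMorphism ((reducedCplx hV).toG.pullback (chi1 F A M) (chi1_br hV)) (polyCplx hV).toG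
      LinearMap.id (incl F A M ∘ₗ psi F A M) :=
  isGMorphism_of _ _ _ _ (fun _ _ => rfl)
    (fun k b hb => (isGMorphism_incl hV).map_deg k _ ((isGMorphism_psi hV).map_deg k b hb))
    (fun b => by
      rw [LinearMap.comp_apply, LinearMap.comp_apply, (isGMorphism_psi hV).map_d,
        (isGMorphism_incl hV).map_d])
    (fun x b => by
      rw [LinearMap.comp_apply, LinearMap.comp_apply, (isGMorphism_psi hV).map_ι,
        (isGMorphism_incl hV).map_ι]
      rfl)

lemma exists_isomorphism (hV : V.ByDerivations)
    (h : ∃ U : Submodule F[X] A, IsCompl (Submodule.torsion F[X] A) U ∧ Module.Free F[X] U) :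
    ∃ (e : G1 F A M ≃ₗ[F] C1bar F A M)
      (Ψ : (⨁ k, Gam F A M k) ≃ₗ[F] (⨁ k, Cbar F A M k)),
      (∀ x, e.symm x = chibar F A M x) ∧ (∀ γ, Ψ γ = psi F A M γ) ∧
      IsGMorphism (reducedCplx hV).toG (barCplx hV).toG e.toLinearMap Ψ.toLinearMap := by
  obtain ⟨U, hU, hfree⟩ := h
  obtain ⟨u, pr, hu⟩ := exists_torFree hU
  let e := LinearEquiv.ofBijective (chibar F A M) (chibar_bijective hu)
  let Ψ := LinearEquiv.ofBijective (psi F A M)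
    ⟨(DirectSum.lmap_injective _).2 psiK_injective, (DirectSum.lmap_surjective _).2 (psiK_surjective hu)⟩
  have he : ∀ x, e.symm (chibar F A M x) = x := e.symm_apply_apply
  refine ⟨e.symm, Ψ, fun _ => rfl, fun _ => rfl, isGMorphism_of _ _ _ _ (fun x y => ?_)
    (isGMorphism_psi hV).map_deg (isGMorphism_psi hV).map_d fun x b => ?_⟩
  · obtain ⟨x, rfl⟩ := (chibar_bijective hu).2 x
    obtain ⟨y, rfl⟩ := (chibar_bijective hu).2 y
    rw [← chibar_br]
    exact (he _).trans (by rw [LinearEquiv.coe_coe, he, he])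
  · obtain ⟨x, rfl⟩ := (chibar_bijective hu).2 x
    -- Every element of `Γ₁` is now `χ₁` of a chain in `C₁`, so the compatibility over `C₁`
    -- suffices.
    obtain ⟨x, rfl⟩ := toC1bar_surjective F A M x
    rw [LinearEquiv.coe_coe e.symm, he, chibar_toC1bar]
    exact (isGMorphism_psi hV).map_ι x b

end Assembly

end LieConf

end

open LieConf in
theorem mainTheorem8 {F A M : Type*} [Field F] [CharZero F]
    [AddCommGroup A] [Module F A] [Module F[X] A] [IsScalarTower F F[X] A]
    [NonUnitalCommRing M] [Module F M] [IsScalarTower F M M] [SMulCommClass F M M]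
    [Module F[X] M] [IsScalarTower F F[X] M]
    (L : LieConformalAlgebra F A) (V : LieConformalModule L M) (hV : V.ByDerivations) :
    ∃ (lieGt : LieStr F (Gt1 F A M)) (lieG : LieStr F (G1 F A M))
      (lieC : LieStr F (C1 F A M)) (lieCb : LieStr F (C1bar F A M))
      (SGt : GStructure lieGt (fun k => Gt F A M k)) (SG : GStructure lieG (Gam F A M))
      (SC : GStructure lieC (C F A M)) (SCb : GStructure lieCb (fun k => Cbar F A M k))
      (ψ : (⨁ k, Gam F A M k) →ₗ[F] (⨁ k, Cbar F A M k))
      (χbar : C1bar F A M →ₗ[F] G1 F A M)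
      (hχ : ∀ x y, chi1 F A M (lieC.br x y) = lieG.br (chi1 F A M x) (chi1 F A M y))
      (hq : ∀ x y, toC1bar F A M (lieC.br x y) = lieCb.br (toC1bar F A M x) (toC1bar F A M y)),
      IsBasicComplex V SGt ∧ IsReducedComplex SGt SG ∧ IsPolyComplex V SC ∧ IsPsi ψ ∧
      IsGMorphism (SCb.pullback (toC1bar F A M) hq) SC LinearMap.id (incl F A M) ∧
      IsGMorphism (SG.pullback (chi1 F A M) hχ) (SCb.pullback (toC1bar F A M) hq)
        LinearMap.id ψ ∧
      IsGMorphism (SG.pullback (chi1 F A M) hχ) SC LinearMap.id (incl F A M ∘ₗ ψ) ∧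
      (∀ x, χbar (toC1bar F A M x) = chi1 F A M x) ∧
      ((∃ U : Submodule F[X] A, IsCompl (Submodule.torsion F[X] A) U ∧ Module.Free F[X] U) →
        ∃ (e : G1 F A M ≃ₗ[F] C1bar F A M)
          (Ψ : (⨁ k, Gam F A M k) ≃ₗ[F] (⨁ k, Cbar F A M k)),
          (∀ x, e.symm x = χbar x) ∧ (∀ γ, Ψ γ = ψ γ) ∧
          IsGMorphism SG SCb e.toLinearMap Ψ.toLinearMap) := by
  exact ⟨lieGt1 hV, lieG1 hV, lieC1 hV, lieC1bar hV, (basicCplx hV).toG, (reducedCplx hV).toG,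
    (polyCplx hV).toG, (barCplx hV).toG, psi F A M, chibar F A M, chi1_br hV, toC1bar_lie hV,
    isBasicComplex hV, isReducedComplex hV, isPolyComplex hV, isPsi_psi, isGMorphism_incl hV,
    isGMorphism_psi hV, isGMorphism_incl_psi hV, chibar_toC1bar, exists_isomorphism hV⟩
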